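/- **Setting.** Let $k\in(1/3,1)$, $\zeta>0$, $0<\gamma<2$, $\mu<1/4$, $\bar c>0$, $\bar R>0$. For $\varepsilon>0$ let $\mathcal A_\varepsilon$ be the set of $u:\varepsilon\mathbb Z^2\to\{-1,0,1\}$ with finite $Z_u=\{u=0\}$, let $I_u=\{u=1\}$, and let $A_I$ be the union of the closed $\varepsilon$-squares centred at the points of $I\subset\varepsilon\mathbb Z^2$. Put $$\mathcal E_\varepsilon(u)=\sum_{\{p,q\}:\,|p-q|=\varepsilon}\varepsilon\bigl(1-u(p)u(q)-k(1-(u(p)u(q))^2)\bigr),$$ $$\mathcal F_\varepsilon(u,w)=\mathcal E_\varepsilon(u)+\frac1{\zeta\varepsilon}\Bigl(\sum_{p\in I_u\triangle I_w}\varepsilon^2d_1(p,\partial I_w)+\varepsilon^\gamma\bigl|\#Z_u-\#Z_w\bigr|\Bigr),$$ where $d_1(p,\partial I)$ is the $\ell^1$-distance of $p$ from $I$ if $p\notin I$, and from $\varepsilon\mathbb Z^2\setminus I$ if $p\in I$. Let $\partial^+I$ be the set of points outside $I$ with a nearest neighbour in $I$, and $\mathbb O_I\subset\partial^+I$ the set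 of those with exactly two nearest neighbours in $I$. A *staircase set* is a connected (through nearest neighbours), horizontally and vertically convex subset of $\varepsilon\mathbb Z^2$; its external slices $\mathscr P_1,\dots,\mathscr P_4$ are its lowest row, leftmost column, highest row and rightmost column. A (possibly degenerate) *octagon* is a nonempty set $A\cap\varepsilon\mathbb Z^2$ with $A$ a (possibly degenerate) convex octagon with sides parallel to $e_1,e_2,e_1\pm e_2$. A *quasi-octagon* is a staircase set $I$ that either is an octagon, or is of the form $I=\tilde I\cup\bigcup_i\mathscr P_i$ with $\tilde I$ an octagon and each external slice $\mathscr P_i$ of $I$ contained in the outward translate by one lattice step of the $i$-th external slice of $\tilde I$ deprived of its two endpoints. Let $P_i(I)$ and $D_i(I)$, $i=1,\dots,4$, be the lengths of the sides, parallel to the axes and diagonal respectively, of the smallest such real octagon containing $A_I$ (clockwise, starting from the lowest and from the lower left side). For two sets $I,I'$ let $a_i$ and $b_i$ be the distances between the lines containing the corresponding $i$-th axis-parallel and diagonal sides, and put $\alpha_i=a_i/\varepsilon$, $\beta_i=\sqrt2\,b_i/\varepsilon$. **Hypotheses.** Let $u_j\in\mathcal A_\varepsilon$, let $u_{j+1}$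 be a minimizer of $\mathcal F_\varepsilon(\cdot,u_j)$ on $\mathcal A_\varepsilon$, and write $I_j=I_{u_j}$, $Z_j=Z_{u_j}$, $\mathbb O_j=\mathbb O_{I_j}$, $A_j=A_{I_j}$, $P_{j,i}=P_i(I_j)$, $D_{j,i}=D_i(I_j)$, and similarly for $j+1$; let $\alpha_{j,i},\beta_{j,i}$ be the displacements from $I_j$ to $I_{j+1}$. Put $C_\varepsilon=\#Z_j$ and $c_\alpha=\lfloor 4\zeta/\min_iP_{j,i}\rfloor+2$. Suppose that $I_j$ is an octagon and a staircase set, contained in a ball of radius $\bar R$, with $\#\mathscr P_i\ge\bar c/\varepsilon$ for each of its external slices, that $\#\partial^+I_j-8\varepsilon^{\mu-1}>C_\varepsilon$, and that $$C_\varepsilon\le\sum_{i=1}^4\frac{D_{j,i}}{\sqrt2\,\varepsilon}<C_\varepsilon+8c_\alpha+2.$$ **Claim.** There is $\bar\varepsilon>0$, depending only on $k,\zeta,\gamma,\mu,\bar c,\bar R$ (and, in (iii), on $(\ell_\varepsilon)$), such that for all $\varepsilon\le\bar\varepsilon$ the set $I_{j+1}$ is a quasi-octagon contained in $I_j$, and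 the following hold. (i) For every $i$, $\beta_{j,i}\le2\sum_{l=1}^4\alpha_{j,l}\le8c_\alpha$; moreover the Hausdorff distance satisfies $d_{\mathcal H}(\partial A_j,\partial A_{j+1})\le c\,\varepsilon$ with $c$ depending only on $c_\alpha$. (ii) If $D_{j,\bar\imath}\le\frac12\frac{\sqrt2\,\zeta(1+k)}{8c_\alpha+1}$ for some $\bar\imath$, then $I_{j+1}$ is a (possibly degenerate) octagon with $Z_{j+1}\subset\mathbb O_{j+1}$. (iii) Let $\ell_\varepsilon\to0$ as $\varepsilon\to0$, with $\ell_\varepsilon\ge\sqrt2(8c_\alpha+2)\varepsilon$, and suppose that $D_{j,\bar\imath}\le\ell_\varepsilon$ for some $\bar\imath$. Then $I_{j+1}$ is a (possibly degenerate) octagon with $Z_{j+1}\subset\mathbb O_{j+1}$; $\beta_{j,i}=0$ for every $i$ such that $D_{j,i}\ge16c_\alpha\ell_\varepsilon$; and, for every $i$, $$\alpha_{j,i}=\Bigl\lfloor\frac{4\zeta}{P_{j,i}}\Bigr\rfloor\ \text{ if }\operatorname{dist}\Bigl(\frac{4\zeta}{P_{j,i}},\{1,2,\dots\}\Bigr)\ge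 c\,\ell_\varepsilon,\qquad \alpha_{j,i}\in\Bigl\{\Bigl[\frac{4\zeta}{P_{j,i}}\Bigr],\Bigl[\frac{4\zeta}{P_{j,i}}\Bigr]-1\Bigr\}\ \text{ otherwise,}$$ where $[x]$ is the integer closest to $x$ and $c>0$ depends only on $\zeta$ and $\bar c$. -/

import Mathlib

open Filter Topology
open scoped ENNReal

namespace BEG

/-- Lattice sites: the index `p : ℤ × ℤ` stands for the point `ε • p` of the lattice `ε ℤ²`. -/
abbrev Site := ℤ × ℤ

/-- The Euclidean plane. -/
abbrev Plane := EuclideanSpace ℝ (Fin 2)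

/-- Spin configurations `u : ε ℤ² → {-1, 0, 1}`. -/
abbrev Config := Site → SignType

/-- The point of `ε ℤ²` with index `p`. -/
noncomputable def point (ε : ℝ) (p : Site) : Plane := !₂[ε * (p.1 : ℝ), ε * (p.2 : ℝ)]

/-- The phase `I_u = {u = 1}`. -/
def plus (u : Config) : Set Site := {p | u p = 1}

/-- The surfactant phase `Z_u = {u = 0}`. -/
def surf (u : Config) : Set Site := {p | u p = 0}

/-- Membership in the class of configurations with finitely many surfactant sites. -/
def IsAdmissible (u : Config) : Prop := (surf u).Finite

/-- The union `A_I` of the closed `ε`-cells centred at the points of `I`. -/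
def cells (ε : ℝ) (I : Set Site) : Set Plane :=
  {x | ∃ p ∈ I, ∀ a : Fin 2, |x a - point ε p a| ≤ ε / 2}

/-! ### Energy and dissipation -/

/-- The interaction of two neighbouring spins. It is nonnegative for `k ≤ 1`. -/
def bond (k : ℝ) (a b : SignType) : ℝ :=
  1 - (a : ℝ) * (b : ℝ) - k * (1 - ((a : ℝ) * (b : ℝ)) ^ 2)

/-- The rescaled Blume-Emery-Griffiths energy. Every unordered pair of nearest neighbours is counted
once, through the bonds joining each site to its right and to its upper neighbour. -/
noncomputable def energy (k ε : ℝ) (u : Config) : ℝ≥0∞ :=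
  ∑' p : Site,
    ENNReal.ofReal (ε * (bond k (u p) (u (p + (1, 0))) + bond k (u p) (u (p + (0, 1)))))

/-- The `ℓ¹` distance in `ε ℤ²`. -/
noncomputable def dist1 (ε : ℝ) (p q : Site) : ℝ≥0∞ :=
  ENNReal.ofReal (ε * (|(p.1 : ℝ) - (q.1 : ℝ)| + |(p.2 : ℝ) - (q.2 : ℝ)|))

open Classical in
/-- The discrete `ℓ¹` distance of a site from the boundary of `I`. -/
noncomputable def distBdry (ε : ℝ) (p : Site) (I : Set Site) : ℝ≥0∞ :=
  if p ∈ I then ⨅ q ∈ Iᶜ, dist1 ε p q else ⨅ q ∈ I, dist1 ε p q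

/-- The Almgren-Taylor-Wang type dissipation. -/
noncomputable def diss1 (ε : ℝ) (I J : Set Site) : ℝ≥0∞ :=
  ∑' p : ↥(symmDiff I J), ENNReal.ofReal (ε ^ 2) * distBdry ε p J

/-- The dissipation due to the variation of the number of surfactant sites. -/
noncomputable def diss0 (Z W : Set Site) : ℝ≥0∞ :=
  ENNReal.ofReal |(Z.ncard : ℝ) - (W.ncard : ℝ)|

/-- The total energy `E_ε(u) + (1/τ) (D¹_ε(u, w) + ε^γ D⁰_ε(u, w))`. -/
noncomputable def total (k γ τ ε : ℝ) (u w : Config) : ℝ≥0∞ :=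
  energy k ε u + ENNReal.ofReal (1 / τ) *
    (diss1 ε (plus u) (plus w) + ENNReal.ofReal (ε ^ γ) * diss0 (surf u) (surf w))

/-- `v` minimizes the total energy relative to `w` in the admissible class. -/
def IsMinimizer (k γ τ ε : ℝ) (v w : Config) : Prop :=
  IsAdmissible v ∧ ∀ v' : Config, IsAdmissible v' → total k γ τ ε v w ≤ total k γ τ ε v' w

/-! ### Discrete sets -/

/-- The four nearest neighbours of a site. -/
def nbrs (p : Site) : Set Site := {p + (1, 0), p - (1, 0), p + (0, 1), p - (0, 1)}

/-- The exterior boundary `∂⁺ I`. -/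
def extBdry (I : Set Site) : Set Site := {p | p ∉ I ∧ (nbrs p ∩ I).Nonempty}

/-- The set `𝕆_I` of sites of the exterior boundary with exactly two neighbours in `I`. -/
def corners (I : Set Site) : Set Site := {p | p ∈ extBdry I ∧ (nbrs p ∩ I).ncard = 2}

/-- A staircase set: connected through nearest neighbours, horizontally and vertically convex. -/
def IsStaircase (I : Set Site) : Prop :=
  (∀ p ∈ I, ∀ q ∈ I, Relation.ReflTransGen (fun a b : Site => b ∈ nbrs a ∧ b ∈ I) p q) ∧
  (∀ x x' x'' y : ℤ, x ≤ x' → x' ≤ x'' → (x, y) ∈ I → (x'', y) ∈ I → (x', y) ∈ I) ∧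
  (∀ x y y' y'' : ℤ, y ≤ y' → y' ≤ y'' → (x, y) ∈ I → (x, y'') ∈ I → (x, y') ∈ I)

/-- Outer normals to the sides parallel to the axes, clockwise: bottom, left, top, right. -/
def axisDir : Fin 4 → Site := ![(0, -1), (-1, 0), (0, 1), (1, 0)]

/-- Outer normals (of length `√2`) to the diagonal sides, clockwise; the `i`-th diagonal side lies
between the `i`-th and the `(i+1)`-th side parallel to the axes, the first one is the lower left. -/
def diagDir (i : Fin 4) : Site := axisDir i + axisDir (i + 1)

/-- The scalar product of an integer vector with a point of the plane. -/
def along (n : Site) (x : Plane) : ℝ := (n.1 : ℝ) * x 0 + (n.2 : ℝ) * x 1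

/-- Possibly degenerate convex octagons with sides parallel to `e₁`, `e₂`, `e₁ + e₂`, `e₁ - e₂`. -/
def IsWulff (A : Set Plane) : Prop :=
  A.Nonempty ∧ ∃ a d : Fin 4 → ℝ,
    A = {x | ∀ i, along (axisDir i) x ≤ a i ∧ along (diagDir i) x ≤ d i}

/-- Discrete octagons `A ∩ ε ℤ²`, possibly degenerate. -/
def IsOctagon (ε : ℝ) (I : Set Site) : Prop :=
  I.Nonempty ∧ ∃ A : Set Plane, IsWulff A ∧ I = {p | point ε p ∈ A}

/-- The `i`-th external slice of `I`: the lowest row, the leftmost column, the highest row, the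
rightmost column. -/
def slice (I : Set Site) (i : Fin 4) : Set Site :=
  {p | p ∈ I ∧ ∀ q ∈ I,
    (axisDir i).1 * q.1 + (axisDir i).2 * q.2 ≤ (axisDir i).1 * p.1 + (axisDir i).2 * p.2}

/-- Quasi-octagons: staircase sets which are octagons, or are obtained from an octagon `J` by adding
four external slices, the `i`-th one being contained in the outward translate by one lattice step of
the `i`-th external slice of `J` deprived of its two endpoints. -/
def IsQuasiOctagon (ε : ℝ) (I : Set Site) : Prop :=
  IsStaircase I ∧ (IsOctagon ε I ∨
    ∃ J : Set Site, IsOctagon ε J ∧ I = J ∪ ⋃ i, slice I i ∧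
      ∀ i, ∀ p ∈ slice I i,
        p - axisDir i + axisDir (i + 1) ∈ slice J i ∧ p - axisDir i - axisDir (i + 1) ∈ slice J i)

/-! ### Side lengths and displacements -/

/-- The support value of `A_I` in direction `n`. The smallest octagon containing `A_I` is
`{x | along n x ≤ supp ε I n for the eight directions n}`. -/
noncomputable def supp (ε : ℝ) (I : Set Site) (n : Site) : ℝ := sSup (along n '' cells ε I)

/-- The length `P_i` of the `i`-th side, parallel to an axis, of the smallest octagon containing
`A_I`. For instance the lowest side lies on `x₂ = b`, between `x₁ + x₂ = s` and `x₁ - x₂ = d`, and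
it has length `d + b - (s - b)`, where `b = - supp (0,-1)`, `s = - supp (-1,-1)`,
`d = supp (1,-1)`. -/
noncomputable def lenP (ε : ℝ) (I : Set Site) (i : Fin 4) : ℝ :=
  supp ε I (diagDir i) + supp ε I (diagDir (i - 1)) - 2 * supp ε I (axisDir i)

/-- The length `D_i` of the `i`-th diagonal side of the smallest octagon containing `A_I`. For
instance the lower left one lies on `x₁ + x₂ = s`, between `x₁ = l` and `x₂ = b`, and it has length
`√2 (s - b - l)`. -/
noncomputable def lenD (ε : ℝ) (I : Set Site) (i : Fin 4) : ℝ :=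
  √2 * (supp ε I (axisDir i) + supp ε I (axisDir (i + 1)) - supp ε I (diagDir i))

/-- The displacement `α_i`: the distance, in units of `ε`, between the lines containing the `i`-th
sides parallel to an axis of the smallest octagons containing `A_I` and `A_J`. -/
noncomputable def dispP (ε : ℝ) (I J : Set Site) (i : Fin 4) : ℝ :=
  |supp ε I (axisDir i) - supp ε J (axisDir i)| / ε

/-- The displacement `β_i = √2 b_i / ε`, where `b_i` is the distance between the lines containing
the `i`-th diagonal sides of the smallest octagons containing `A_I` and `A_J`. -/
noncomputable def dispD (ε : ℝ) (I J : Set Site) (i : Fin 4) : ℝ :=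
  √2 * (|supp ε I (diagDir i) - supp ε J (diagDir i)| / √2) / ε

/-- The constant `c_α = ⌊4ζ / min_i P_i⌋ + 2`. -/
noncomputable def cAlpha (ζ ε : ℝ) (I : Set Site) : ℕ := ⌊4 * ζ / ⨅ i, lenP ε I i⌋₊ + 2

/-- The regularity assumption with constants `c` and `R`: a staircase set, contained in a ball of
radius `R`, with external slices of cardinality at least `c / ε`. -/
def IsRegular (c R ε : ℝ) (I : Set Site) : Prop :=
  IsStaircase I ∧ (∃ z : Plane, ∀ p ∈ I, point ε p ∈ Metric.ball z R) ∧
    ∀ i, c / ε ≤ ((slice I i).ncard : ℝ)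

/-- The hypotheses on the datum `u`: it is an admissible configuration, `I_u` is an octagon which
satisfies the regularity assumption, it is not surrounded by surfactant, and the surfactant sites
approximately cover its diagonal sides. -/
def IsDatum (ζ c R μ ε : ℝ) (u : Config) : Prop :=
  IsAdmissible u ∧ IsRegular c R ε (plus u) ∧ IsOctagon ε (plus u) ∧
  ((surf u).ncard : ℝ) < ((extBdry (plus u)).ncard : ℝ) - 8 * ε ^ (μ - 1) ∧
  ((surf u).ncard : ℝ) ≤ ∑ i, lenD ε (plus u) i / (√2 * ε) ∧
  ∑ i, lenD ε (plus u) i / (√2 * ε) < ((surf u).ncard : ℝ) + 8 * (cAlpha ζ ε (plus u) : ℝ) + 2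

/-- The positive integers, as a subset of `ℝ`. -/
def posNat : Set ℝ := {x | ∃ n : ℕ, 1 ≤ n ∧ x = n}

end BEG

/-! In units of `ε`, and once the number `C` of surfactant sites is known to be preserved, the
functional of a configuration with phases `P` and `Z` is, up to a constant, `cost k P Z + δ * Dis A
D P`, where `δ = ε / ζ` and `oct A D` is the datum. Preservation of `C` (`IsMinimizer.ncard_surf`)
comes from `γ < 2`: changing one site alters the energy by at most `12 ε`, less than the `ε ^ γ / (ζ
ε)` paid for changing the number by one.

The energy is bounded line by line. A row or column meeting `P` costs at least 4, and a surfactant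
site costs `1 + k` in each direction, except where it is the outer neighbour of an extreme site of
`P` on that line. A line on which `P` is not an interval, or which meets `Z` but not `P`, costs at
least `1 - k` more (`lineCost_lower`, `cost_lower`). A surfactant site is thus free only in a corner
of `P`, where it is an outer neighbour in both directions, and a connected set with support values
`a`, `d` has at most `∑ i, tS a d i` corners in its bounding box (`IsComp.card_corSet`). Octagons
with trimmed slices, with surfactant on the trimmed sites and in corners, match these bounds
(`cost_trim_le`). What remains is to minimize `4 ∑ a + (1 + k) excess + δ Dis` over octagons.

Rigidity: the lines of the datum have at least `n` sites with `δ n` bounded below, so losing a line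
away from the boundary dissipates a definite amount. Comparison with the datum bounds the missing
lines, the dissipation and the bad lines by constants (`Ctx.a_priori`); hence one component of `P`
is almost full (`exists_main_comp`). Against the octagonal hull of that component, `χ` defective
lines cost at least `(1 - k) χ`, while the stray sites lie at crossings of defective lines and save
at most `χ ^ 2` times a small dissipation. So `χ = 0` for small `δ`, and `P` is connected with
interval lines (`Ctx.rigid`).

Comparison with its own hull leaves two cases (`Ctx.subset_oct`). If the hull has at least `C`
corners, `P` is the hull and all surfactant is in corners. Otherwise the corners are all filled and
the surplus surfactant lies on long steps of the staircase. Filled corners allow long steps only at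
the ends of the staircase, so the slices of the hull lack at least as many sites of `P` as there are
surplus sites. Trimming exactly that many sites gives a competitor which contains `P` and is no more
expensive, and the dissipation forces equality (`Shape.eq_trim`): `P` is a quasi-octagon.

The displacements come from moving one or two sides by a step. A diagonal side with a corner moves
outwards for free while the hull has a corner to spare (`Shape.sum_beta_le`). An axis side moved
outwards costs 4 and saves about `δ` times its displacement times its length; moved inwards it
yields the reverse inequality (`Shape.alpha_upper`, `Shape.alpha_lower`). The inward move needs
cheap room for the lost corners, which a short diagonal side provides when cut; for the same reason
a short diagonal side excludes surplus surfactant (`Shape.cut_cost'`) and keeps the long ones fixed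
(`Shape.beta_eq_zero`). -/

namespace BEG

/-! ### One-dimensional configurations -/

/-- Number of bonds of a line joining a site of `P` to a site outside `P ∪ Z`. -/
def lineEdge (P Z : Finset ℤ) : ℕ :=
  (P.filter fun x => x + 1 ∉ P ∧ x + 1 ∉ Z).card + (P.filter fun x => x - 1 ∉ P ∧ x - 1 ∉ Z).card

/-- Number of bonds of a line joining two sites of `Z`. -/
def lineAdj (Z : Finset ℤ) : ℕ := (Z.filter fun x => x - 1 ∈ Z).card

/-- Number of sites of `Z` which are the outer neighbours of an extreme site of `P`. -/
def lineLead (P Z : Finset ℤ) : ℕ :=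
  (Z.filter fun z => z + 1 ∈ P ∧ ∀ p ∈ P, z < p).card +
    (Z.filter fun z => z - 1 ∈ P ∧ ∀ p ∈ P, p < z).card

/-- A bond between opposite spins costs 2 and a bond touching `Z` costs `1 - k`; there are `2 |Z| -
adj` of the latter. The term `2 k |Z|` is a normalization, harmless for a fixed amount of
surfactant, which makes the total `2 edge + 2 |Z| - (1 - k) adj`. -/
noncomputable def lineCost (k : ℝ) (P Z : Finset ℤ) : ℝ :=
  2 * (lineEdge P Z : ℝ) + (1 - k) * (2 * (Z.card : ℝ) - lineAdj Z) + 2 * k * Z.card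

/-- Order convexity of a finite set of integers. -/
def LineConvex (P : Finset ℤ) : Prop := ∀ a ∈ P, ∀ c ∈ P, ∀ b, a < b → b < c → b ∈ P

/-- The regular lines: `P` is an interval, and there is no site of `Z` if `P` is empty. -/
def LineGood (P Z : Finset ℤ) : Prop := LineConvex P ∧ (P = ∅ → Z = ∅)

theorem lineAdj_add_card (Z : Finset ℤ) :
    lineAdj Z + (Z.filter fun x => x - 1 ∉ Z).card = Z.card :=
  Finset.card_filter_add_card_filter_not _

/-- Each of the two extreme sites of `P` either has an exposed bond or is covered from outside by a
site of `Z`. -/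
theorem two_le_lineEdge_add_lineLead {P Z : Finset ℤ} (hP : P.Nonempty) :
    2 ≤ lineEdge P Z + lineLead P Z := by
  have h1 : 1 ≤ (P.filter fun x => x + 1 ∉ P ∧ x + 1 ∉ Z).card +
      (Z.filter fun z => z - 1 ∈ P ∧ ∀ p ∈ P, p < z).card := by
    have hm := P.max'_mem hP
    have hle : ∀ p ∈ P, p ≤ P.max' hP := fun p hp => P.le_max' p hp
    set r := P.max' hP
    by_cases hz : r + 1 ∈ Z
    · have : 0 < (Z.filter fun z => z - 1 ∈ P ∧ ∀ p ∈ P, p < z).card :=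
        Finset.card_pos.2 ⟨r + 1, by
          simp only [Finset.mem_filter]
          exact ⟨hz, by simpa using hm, fun p hp => by have := hle p hp; omega⟩⟩
      omega
    · have : 0 < (P.filter fun x => x + 1 ∉ P ∧ x + 1 ∉ Z).card :=
        Finset.card_pos.2 ⟨r, by
          simp only [Finset.mem_filter]
          exact ⟨hm, fun h => by have := hle _ h; omega, hz⟩⟩
      omega
  have h2 : 1 ≤ (P.filter fun x => x - 1 ∉ P ∧ x - 1 ∉ Z).card +
      (Z.filter fun z => z + 1 ∈ P ∧ ∀ p ∈ P, z < p).card := by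
    have hm := P.min'_mem hP
    have hle : ∀ p ∈ P, P.min' hP ≤ p := fun p hp => P.min'_le p hp
    set r := P.min' hP
    by_cases hz : r - 1 ∈ Z
    · have : 0 < (Z.filter fun z => z + 1 ∈ P ∧ ∀ p ∈ P, z < p).card :=
        Finset.card_pos.2 ⟨r - 1, by
          simp only [Finset.mem_filter]
          exact ⟨hz, by simpa using hm, fun p hp => by have := hle p hp; omega⟩⟩
      omega
    · have : 0 < (P.filter fun x => x - 1 ∉ P ∧ x - 1 ∉ Z).card :=
        Finset.card_pos.2 ⟨r, by
          simp only [Finset.mem_filter]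
          exact ⟨hm, fun h => by have := hle _ h; omega, hz⟩⟩
      omega
  unfold lineEdge lineLead
  omega

theorem card_left_lead_le_one (P Z : Finset ℤ) :
    (Z.filter fun z => z + 1 ∈ P ∧ ∀ p ∈ P, z < p).card ≤ 1 := by
  refine Finset.card_le_one.2 fun a ha b hb => ?_
  simp only [Finset.mem_filter] at ha hb
  have := ha.2.2 _ hb.2.1
  have := hb.2.2 _ ha.2.1
  omega

/-- The right-hand side counts the runs of `Z`, through their left ends. A right leading site is a
left end, because its left neighbour is in `P`. A left leading site is charged to the minimum of
`Z`. The sites of `S` lie between sites of `P`, so none of these coincide. -/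
theorem lineLead_add_le_of_subset {P Z : Finset ℤ} {S : Finset ℤ}
    (hS : S ⊆ Z.filter fun x => x - 1 ∉ Z) (hPZ : Disjoint P Z)
    (hl : ∀ s ∈ S, ∃ p ∈ P, p < s) (hr : ∀ s ∈ S, ∃ p ∈ P, s < p) :
    lineLead P Z + S.card ≤ (Z.filter fun x => x - 1 ∉ Z).card := by
  have hl1 := card_left_lead_le_one P Z
  have hdis := Finset.disjoint_left.1 hPZ
  set LE := Z.filter fun x => x - 1 ∉ Z with hLE
  set B := Z.filter fun z => z - 1 ∈ P ∧ ∀ p ∈ P, p < z with hB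
  have hdef : lineLead P Z = (Z.filter fun z => z + 1 ∈ P ∧ ∀ p ∈ P, z < p).card + B.card := rfl
  have hBLE : B ⊆ LE := by
    intro z hz
    simp only [hB, hLE, Finset.mem_filter] at hz ⊢
    exact ⟨hz.1, hdis hz.2.1⟩
  have hBS : Disjoint B S := by
    refine Finset.disjoint_left.2 fun z hz hs => ?_
    obtain ⟨p, hp, hlt⟩ := hr z hs
    simp only [hB, Finset.mem_filter] at hz
    have := hz.2.2 p hp
    omega
  rcases Nat.eq_zero_or_pos (Z.filter fun z => z + 1 ∈ P ∧ ∀ p ∈ P, z < p).card with h0 | h0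
  · have : (B ∪ S).card ≤ LE.card := Finset.card_le_card (Finset.union_subset hBLE hS)
    rw [Finset.card_union_of_disjoint hBS] at this
    omega
  · obtain ⟨w, hw⟩ := Finset.card_pos.1 h0
    simp only [Finset.mem_filter] at hw
    have hZ : Z.Nonempty := ⟨w, hw.1⟩
    have hm := Z.min'_mem hZ
    have hmw : Z.min' hZ ≤ w := Z.min'_le w hw.1
    have hmL : Z.min' hZ ∈ LE := by
      simp only [hLE, Finset.mem_filter]
      exact ⟨hm, fun h => by have := Z.min'_le _ h; omega⟩
    have hmn : Z.min' hZ ∉ B ∪ S := by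
      intro h
      rcases Finset.mem_union.1 h with h | h
      · simp only [hB, Finset.mem_filter] at h
        have := h.2.2 _ hw.2.1
        omega
      · obtain ⟨p, hp, hlt⟩ := hl _ h
        have := hw.2.2 p hp
        omega
    have : (insert (Z.min' hZ) (B ∪ S)).card ≤ LE.card :=
      Finset.card_le_card (Finset.insert_subset hmL (Finset.union_subset hBLE hS))
    rw [Finset.card_insert_of_notMem hmn, Finset.card_union_of_disjoint hBS] at this
    omega

/-- Just after the last site of `P` before a gap there is either an additional exposed bond or the
beginning of an additional run of `Z`, lying strictly between sites of `P`. -/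
theorem three_le_of_not_lineConvex {P Z : Finset ℤ} (hPZ : Disjoint P Z) (h : ¬ LineConvex P) :
    3 ≤ lineEdge P Z + lineLead P Z ∨ lineLead P Z + lineAdj Z + 1 ≤ Z.card := by
  unfold LineConvex at h
  push Not at h
  obtain ⟨a, ha, c, hc, b, hab, hbc, hb⟩ := h
  -- the last site of `P` before `b`
  have hne : (P.filter (· < b)).Nonempty := ⟨a, by simp [ha, hab]⟩
  set x := (P.filter (· < b)).max' hne with hx
  have hxm := Finset.max'_mem _ hne
  rw [← hx] at hxm
  simp only [Finset.mem_filter] at hxm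
  have hx1 : x + 1 ∉ P := by
    intro h
    by_cases h' : x + 1 < b
    · have := Finset.le_max' (P.filter (· < b)) (x + 1) (by simp [h, h'])
      omega
    · have : x + 1 = b := by omega
      exact hb (this ▸ h)
  by_cases hz : x + 1 ∈ Z
  · right
    have := lineLead_add_le_of_subset (P := P) (Z := Z) (S := {x + 1})
      (by
        intro y hy
        rw [Finset.mem_singleton] at hy
        subst hy
        simp only [Finset.mem_filter]
        exact ⟨hz, by simpa using Finset.disjoint_left.1 hPZ hxm.1⟩) hPZ
      (by intro s hs; rw [Finset.mem_singleton] at hs; subst hs; exact ⟨x, hxm.1, by omega⟩)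
      (by intro s hs; rw [Finset.mem_singleton] at hs; subst hs; exact ⟨c, hc, by omega⟩)
    have h2 := lineAdj_add_card Z
    simp at this
    omega
  · left
    have hP : P.Nonempty := ⟨a, ha⟩
    have hxin : x ∈ P.filter fun x => x + 1 ∉ P ∧ x + 1 ∉ Z := by
      simp only [Finset.mem_filter]; exact ⟨hxm.1, hx1, hz⟩
    -- remove the inner bond by adding an auxiliary site to `Z`
    have key := two_le_lineEdge_add_lineLead (P := P) (Z := insert (x + 1) Z) hP
    have e1 : (P.filter fun y => y + 1 ∉ P ∧ y + 1 ∉ insert (x + 1) Z) ⊆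
        (P.filter fun y => y + 1 ∉ P ∧ y + 1 ∉ Z).erase x := by
      intro y hy
      simp only [Finset.mem_filter, Finset.mem_insert, Finset.mem_erase] at hy ⊢
      refine ⟨fun h => hy.2.2 (by left; omega), hy.1, hy.2.1, fun h => hy.2.2 (Or.inr h)⟩
    have e1' := Finset.card_le_card e1
    rw [Finset.card_erase_of_mem hxin] at e1'
    have hpos := Finset.card_pos.2 ⟨x, hxin⟩
    have e2 : (P.filter fun y => y - 1 ∉ P ∧ y - 1 ∉ insert (x + 1) Z).card ≤
        (P.filter fun y => y - 1 ∉ P ∧ y - 1 ∉ Z).card := by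
      apply Finset.card_le_card
      intro y hy
      simp only [Finset.mem_filter, Finset.mem_insert] at hy ⊢
      exact ⟨hy.1, hy.2.1, fun h => hy.2.2 (Or.inr h)⟩
    have e3 : ((insert (x + 1) Z).filter fun z => z + 1 ∈ P ∧ ∀ p ∈ P, z < p) =
        Z.filter fun z => z + 1 ∈ P ∧ ∀ p ∈ P, z < p := by
      ext z
      simp only [Finset.mem_filter, Finset.mem_insert]
      refine ⟨fun h => ⟨h.1.resolve_left fun h' => ?_, h.2⟩, fun h => ⟨Or.inr h.1, h.2⟩⟩
      have := h.2.2 x hxm.1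
      omega
    have e4 : ((insert (x + 1) Z).filter fun z => z - 1 ∈ P ∧ ∀ p ∈ P, p < z) =
        Z.filter fun z => z - 1 ∈ P ∧ ∀ p ∈ P, p < z := by
      ext z
      simp only [Finset.mem_filter, Finset.mem_insert]
      refine ⟨fun h => ⟨h.1.resolve_left fun h' => ?_, h.2⟩, fun h => ⟨Or.inr h.1, h.2⟩⟩
      have := h.2.2 c hc
      omega
    unfold lineEdge lineLead at key ⊢
    rw [e3, e4] at key
    omega

/-- Adds `edge + lead ≥ 2` with weight 2 and `lead + adj ≤ |Z|` with weight `1 - k`. A bad line has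
one unit of slack in one of the two inequalities, worth at least `1 - k` since `1 - k < 2`. -/
theorem lineCost_lower {k : ℝ} (hk : -1 < k) (hk1 : k < 1) {P Z : Finset ℤ} (hPZ : Disjoint P Z) :
    (if P.Nonempty then (4 : ℝ) else 0) + (1 + k) * ((Z.card : ℝ) - lineLead P Z) ≤
      lineCost k P Z ∧
    (¬ LineGood P Z → (if P.Nonempty then (4 : ℝ) else 0) +
      (1 + k) * ((Z.card : ℝ) - lineLead P Z) + (1 - k) ≤ lineCost k P Z) := by
  have hk1' : 0 < 1 - k := by linarith
  have hB : lineLead P Z + lineAdj Z ≤ Z.card := by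
    have := lineLead_add_le_of_subset (P := P) (Z := Z) (S := ∅) (by simp) hPZ (by simp) (by simp)
    have h2 := lineAdj_add_card Z
    simp at this
    omega
  rcases P.eq_empty_or_nonempty with rfl | hP
  · have h1 : lineEdge ∅ Z = 0 := by simp [lineEdge]
    have h2 : lineLead ∅ Z = 0 := by simp [lineLead]
    rw [h2] at hB ⊢
    unfold lineCost
    rw [h1]
    have hB' : (lineAdj Z : ℝ) ≤ Z.card := by exact_mod_cast (by omega)
    constructor
    · simp
      nlinarith
    · intro hb
      have hZ : Z.Nonempty := by
        by_contra h
        rw [Finset.not_nonempty_iff_eq_empty] at h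
        exact hb ⟨fun a ha => by simp at ha, fun _ => h⟩
      have : lineAdj Z + 1 ≤ Z.card := by
        have h2 := lineAdj_add_card Z
        have : 0 < (Z.filter fun x => x - 1 ∉ Z).card := Finset.card_pos.2 ⟨Z.min' hZ, by
          simp only [Finset.mem_filter]
          exact ⟨Z.min'_mem hZ, fun h => by have := Z.min'_le _ h; omega⟩⟩
        omega
      have hB' : (lineAdj Z : ℝ) + 1 ≤ Z.card := by exact_mod_cast this
      simp
      nlinarith
  · have hA := two_le_lineEdge_add_lineLead (Z := Z) hP
    have hA' : (2 : ℝ) ≤ lineEdge P Z + lineLead P Z := by exact_mod_cast hA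
    have hB' : (lineLead P Z : ℝ) + lineAdj Z ≤ Z.card := by exact_mod_cast hB
    unfold lineCost
    simp only [hP, if_true]
    constructor
    · nlinarith
    · intro hb
      have hc : ¬ LineConvex P := fun h => hb ⟨h, fun h' => absurd h' hP.ne_empty⟩
      rcases three_le_of_not_lineConvex hPZ hc with h | h
      · have h' : (3 : ℝ) ≤ lineEdge P Z + lineLead P Z := by exact_mod_cast h
        nlinarith
      · have h' : (lineLead P Z : ℝ) + lineAdj Z + 1 ≤ Z.card := by exact_mod_cast h
        nlinarith

/-- Amounts to `edge + |Z| ≤ 2 + adj`, where `|Z| - adj` counts right ends of runs of `Z`. Those to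
the right of `P`, together with exposed right bonds of `P`, are right ends of the interval `P ∪ Z`,
hence at most one. One to the left of `P` must sit next to its first site, and then the left bond is
not exposed. -/
theorem lineCost_upper {k : ℝ} {P Z : Finset ℤ} (hP : P.Nonempty)
    (hPZ : Disjoint P Z) (h1 : LineConvex P) (h2 : LineConvex (P ∪ Z)) :
    lineCost k P Z ≤ 4 + (1 + k) * lineAdj Z := by
  have hdis := Finset.disjoint_left.1 hPZ
  -- right ends of `P ∪ Z`, left ends of `P`
  have hadj : lineAdj Z = (Z.filter fun x => x + 1 ∈ Z).card := by
    unfold lineAdj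
    refine Finset.card_bij (fun x _ => x - 1) ?_ ?_ ?_
    · intro a ha; simp only [Finset.mem_filter] at ha ⊢; exact ⟨ha.2, by simpa using ha.1⟩
    · intro a _ b _ h; simpa using h
    · intro b hb
      simp only [Finset.mem_filter] at hb
      exact ⟨b + 1, by simp only [Finset.mem_filter]; exact ⟨hb.2, by simpa using hb.1⟩, by simp⟩
  have hcard : lineAdj Z + (Z.filter fun x => x + 1 ∉ Z).card = Z.card := by
    rw [hadj]; exact Finset.card_filter_add_card_filter_not _
  set ℓ := P.min' hP with hℓ
  have hℓm : ℓ ∈ P := P.min'_mem hP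
  have hle : ∀ p ∈ P, ℓ ≤ p := fun p hp => P.min'_le p hp
  have hsplit : (Z.filter fun x => x + 1 ∉ Z).card =
      (Z.filter fun x => x + 1 ∉ Z ∧ x < ℓ).card + (Z.filter fun x => x + 1 ∉ Z ∧ ¬ x < ℓ).card := by
    rw [← Finset.filter_filter, ← Finset.filter_filter, Finset.card_filter_add_card_filter_not]
  have hA : (P.filter fun x => x + 1 ∉ P ∧ x + 1 ∉ Z).card +
      (Z.filter fun x => x + 1 ∉ Z ∧ ¬ x < ℓ).card ≤ 1 := by
    rw [← Finset.card_union_of_disjoint]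
    · refine Finset.card_le_one.2 ?_
      have hend : ∀ a ∈ (P.filter fun x => x + 1 ∉ P ∧ x + 1 ∉ Z) ∪
          (Z.filter fun x => x + 1 ∉ Z ∧ ¬ x < ℓ), a ∈ P ∪ Z ∧ a + 1 ∉ P ∪ Z := by
        intro a ha
        simp only [Finset.mem_union, Finset.mem_filter] at ha ⊢
        rcases ha with ha | ha
        · exact ⟨Or.inl ha.1, by tauto⟩
        · refine ⟨Or.inr ha.1, fun h => h.elim (fun h => ?_) ha.2.1⟩
          rcases eq_or_lt_of_le (not_lt.1 ha.2.2) with h' | h'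
          · exact hdis hℓm (h' ▸ ha.1)
          · exact hdis (h1 ℓ hℓm _ h a h' (by omega)) ha.1
      intro a ha b hb
      have ha' := hend a ha
      have hb' := hend b hb
      by_contra hne
      rcases lt_or_gt_of_ne hne with h | h
      · rcases eq_or_lt_of_le (show a + 1 ≤ b by omega) with h' | h'
        · exact ha'.2 (h' ▸ hb'.1)
        · exact ha'.2 (h2 a ha'.1 b hb'.1 _ (by omega) h')
      · rcases eq_or_lt_of_le (show b + 1 ≤ a by omega) with h' | h'
        · exact hb'.2 (h' ▸ ha'.1)
        · exact hb'.2 (h2 b hb'.1 a ha'.1 _ (by omega) h')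
    · refine Finset.disjoint_left.2 fun a ha hb => ?_
      simp only [Finset.mem_filter] at ha hb
      exact hdis ha.1 hb.1
  have hB : (P.filter fun x => x - 1 ∉ P ∧ x - 1 ∉ Z).card +
      (Z.filter fun x => x + 1 ∉ Z ∧ x < ℓ).card ≤ 1 := by
    have e1 : ∀ a ∈ P.filter fun x => x - 1 ∉ P ∧ x - 1 ∉ Z, a = ℓ ∧ ℓ - 1 ∉ Z := by
      intro a ha
      simp only [Finset.mem_filter] at ha
      have : a = ℓ := by
        by_contra hne
        have := hle a ha.1
        rcases eq_or_lt_of_le (show ℓ ≤ a - 1 by omega) with h' | h'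
        · exact ha.2.1 (h' ▸ hℓm)
        · exact ha.2.1 (h1 ℓ hℓm a ha.1 _ h' (by omega))
      exact ⟨this, this ▸ ha.2.2⟩
    have e2 : ∀ a ∈ Z.filter fun x => x + 1 ∉ Z ∧ x < ℓ, a = ℓ - 1 ∧ ℓ - 1 ∈ Z := by
      intro a ha
      simp only [Finset.mem_filter] at ha
      have : a = ℓ - 1 := by
        by_contra hne
        have : a + 1 ∈ P ∪ Z := h2 a (by simp [ha.1]) ℓ (by simp [hℓm]) _ (by omega) (by omega)
        rcases Finset.mem_union.1 this with h | h
        · have := hle _ h; omega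
        · exact ha.2.1 h
      exact ⟨this, this ▸ ha.1⟩
    by_cases hz : ℓ - 1 ∈ Z
    · have : (P.filter fun x => x - 1 ∉ P ∧ x - 1 ∉ Z) = ∅ :=
        Finset.eq_empty_of_forall_notMem fun a ha => (e1 a ha).2 hz
      rw [this, Finset.card_empty, zero_add]
      exact Finset.card_le_one.2 fun a ha b hb => by rw [(e2 a ha).1, (e2 b hb).1]
    · have : (Z.filter fun x => x + 1 ∉ Z ∧ x < ℓ) = ∅ :=
        Finset.eq_empty_of_forall_notMem fun a ha => hz (e2 a ha).2
      rw [this, Finset.card_empty, add_zero]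
      exact Finset.card_le_one.2 fun a ha b hb => by rw [(e1 a ha).1, (e1 b hb).1]
  have hfin : lineEdge P Z + Z.card ≤ 2 + lineAdj Z := by
    unfold lineEdge; omega
  have hfin' : (lineEdge P Z : ℝ) + Z.card ≤ 2 + lineAdj Z := by exact_mod_cast hfin
  unfold lineCost
  nlinarith

/-! ### Rows, columns, and the cost of a configuration -/

/-- The coordinate in the `i`-th outer axis direction. -/
def ax (i : Fin 4) (p : Site) : ℤ := (axisDir i).1 * p.1 + (axisDir i).2 * p.2

/-- The coordinate in the `i`-th outer diagonal direction. -/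
def dg (i : Fin 4) (p : Site) : ℤ := ax i p + ax (i + 1) p

@[simp] theorem ax_zero (p : Site) : ax 0 p = -p.2 := by simp [ax, axisDir]
@[simp] theorem ax_one (p : Site) : ax 1 p = -p.1 := by simp [ax, axisDir]
@[simp] theorem ax_two (p : Site) : ax 2 p = p.2 := by simp [ax, axisDir]
@[simp] theorem ax_three (p : Site) : ax 3 p = p.1 := by simp [ax, axisDir]
@[simp] theorem dg_zero (p : Site) : dg 0 p = -p.2 - p.1 := by simp [dg]; ring
@[simp] theorem dg_one (p : Site) : dg 1 p = -p.1 + p.2 := by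
  rw [dg, show (1 + 1 : Fin 4) = 2 from rfl]; simp
@[simp] theorem dg_two (p : Site) : dg 2 p = p.2 + p.1 := by
  rw [dg, show (2 + 1 : Fin 4) = 3 from rfl]; simp
@[simp] theorem dg_three (p : Site) : dg 3 p = p.1 - p.2 := by
  rw [dg, show (3 + 1 : Fin 4) = 0 from rfl]; simp; ring

@[simp] theorem axisDir_zero : axisDir 0 = (0, -1) := rfl
@[simp] theorem axisDir_one : axisDir 1 = (-1, 0) := rfl
@[simp] theorem axisDir_two : axisDir 2 = (0, 1) := rfl
@[simp] theorem axisDir_three : axisDir 3 = (1, 0) := rfl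

theorem forall_fin4 {p : Fin 4 → Prop} : (∀ i, p i) ↔ p 0 ∧ p 1 ∧ p 2 ∧ p 3 := by
  constructor
  · intro h; exact ⟨h 0, h 1, h 2, h 3⟩
  · rintro ⟨h0, h1, h2, h3⟩ i
    fin_cases i <;> assumption

def rowOf (S : Finset Site) (y : ℤ) : Finset ℤ := (S.filter (fun p => p.2 = y)).image Prod.fst
def colOf (S : Finset Site) (x : ℤ) : Finset ℤ := (S.filter (fun p => p.1 = x)).image Prod.snd

@[simp] theorem mem_rowOf {S : Finset Site} {x y : ℤ} : x ∈ rowOf S y ↔ (x, y) ∈ S := by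
  simp [rowOf]

@[simp] theorem mem_colOf {S : Finset Site} {x y : ℤ} : y ∈ colOf S x ↔ (x, y) ∈ S := by
  simp [colOf]

theorem card_eq_sum_rowOf {S : Finset Site} {T : Finset ℤ} (h : ∀ p ∈ S, p.2 ∈ T) :
    S.card = ∑ y ∈ T, (rowOf S y).card := by
  rw [Finset.card_eq_sum_card_fiberwise (f := Prod.snd) (t := T) (fun p hp => h p hp)]
  refine Finset.sum_congr rfl fun y _ => ?_
  rw [rowOf, Finset.card_image_of_injOn]
  intro a ha b hb hab
  simp at ha hb
  exact Prod.ext hab (ha.2.trans hb.2.symm)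

theorem card_eq_sum_colOf {S : Finset Site} {T : Finset ℤ} (h : ∀ p ∈ S, p.1 ∈ T) :
    S.card = ∑ x ∈ T, (colOf S x).card := by
  rw [Finset.card_eq_sum_card_fiberwise (f := Prod.fst) (t := T) (fun p hp => h p hp)]
  refine Finset.sum_congr rfl fun y _ => ?_
  rw [colOf, Finset.card_image_of_injOn]
  intro a ha b hb hab
  simp at ha hb
  exact Prod.ext (ha.2.trans hb.2.symm) hab

/-- Number of bonds in direction `e` joining a site of `P` to a site outside `P ∪ Z`. -/
def edgeE (e : Site) (P Z : Finset Site) : ℕ :=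
  (P.filter fun p => p + e ∉ P ∧ p + e ∉ Z).card + (P.filter fun p => p - e ∉ P ∧ p - e ∉ Z).card

/-- Number of bonds in direction `e` joining two sites of `Z`. -/
def adjE (e : Site) (Z : Finset Site) : ℕ := (Z.filter fun z => z - e ∈ Z).card

noncomputable def dirCost (k : ℝ) (e : Site) (P Z : Finset Site) : ℝ :=
  2 * (edgeE e P Z : ℝ) + (1 - k) * (2 * (Z.card : ℝ) - adjE e Z) + 2 * k * Z.card

/-- The energy of a configuration in units of `ε`, up to an additive constant depending on the
number of surfactant sites. -/
noncomputable def cost (k : ℝ) (P Z : Finset Site) : ℝ :=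
  dirCost k (1, 0) P Z + dirCost k (0, 1) P Z

theorem dirCost_row {k : ℝ} {P Z : Finset Site} {T : Finset ℤ} (hP : ∀ p ∈ P, p.2 ∈ T)
    (hZ : ∀ p ∈ Z, p.2 ∈ T) :
    dirCost k (1, 0) P Z = ∑ y ∈ T, lineCost k (rowOf P y) (rowOf Z y) := by
  have e1 : edgeE (1, 0) P Z = ∑ y ∈ T, lineEdge (rowOf P y) (rowOf Z y) := by
    unfold edgeE lineEdge
    rw [Finset.sum_add_distrib, card_eq_sum_rowOf (T := T) fun p hp => hP p (Finset.mem_filter.1 hp).1,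
      card_eq_sum_rowOf (T := T) fun p hp => hP p (Finset.mem_filter.1 hp).1]
    congr 1 <;>
    · refine Finset.sum_congr rfl fun y _ => ?_
      congr 1; ext x; simp
  have e2 : adjE (1, 0) Z = ∑ y ∈ T, lineAdj (rowOf Z y) := by
    unfold adjE lineAdj
    rw [card_eq_sum_rowOf (T := T) fun p hp => hZ p (Finset.mem_filter.1 hp).1]
    refine Finset.sum_congr rfl fun y _ => ?_
    congr 1; ext x; simp
  have e3 := card_eq_sum_rowOf hZ
  unfold dirCost lineCost
  rw [e1, e2, e3]
  push_cast
  rw [Finset.sum_add_distrib, Finset.sum_add_distrib, ← Finset.mul_sum, ← Finset.mul_sum,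
    ← Finset.mul_sum, Finset.sum_sub_distrib, ← Finset.mul_sum]

theorem dirCost_col {k : ℝ} {P Z : Finset Site} {T : Finset ℤ} (hP : ∀ p ∈ P, p.1 ∈ T)
    (hZ : ∀ p ∈ Z, p.1 ∈ T) :
    dirCost k (0, 1) P Z = ∑ x ∈ T, lineCost k (colOf P x) (colOf Z x) := by
  have e1 : edgeE (0, 1) P Z = ∑ y ∈ T, lineEdge (colOf P y) (colOf Z y) := by
    unfold edgeE lineEdge
    rw [Finset.sum_add_distrib, card_eq_sum_colOf (T := T) fun p hp => hP p (Finset.mem_filter.1 hp).1,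
      card_eq_sum_colOf (T := T) fun p hp => hP p (Finset.mem_filter.1 hp).1]
    congr 1 <;>
    · refine Finset.sum_congr rfl fun y _ => ?_
      congr 1; ext x; simp
  have e2 : adjE (0, 1) Z = ∑ y ∈ T, lineAdj (colOf Z y) := by
    unfold adjE lineAdj
    rw [card_eq_sum_colOf (T := T) fun p hp => hZ p (Finset.mem_filter.1 hp).1]
    refine Finset.sum_congr rfl fun y _ => ?_
    congr 1; ext x; simp
  have e3 := card_eq_sum_colOf hZ
  unfold dirCost lineCost
  rw [e1, e2, e3]
  push_cast
  rw [Finset.sum_add_distrib, Finset.sum_add_distrib, ← Finset.mul_sum, ← Finset.mul_sum,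
    ← Finset.mul_sum, Finset.sum_sub_distrib, ← Finset.mul_sum]

/-- Surfactant sites which are the `i`-th outer neighbour of an `i`-extreme site of `P`. -/
def leadSet (i : Fin 4) (P Z : Finset Site) : Finset Site :=
  Z.filter fun z => z - axisDir i ∈ P ∧ ∀ p ∈ P, ax (i + 1) p = ax (i + 1) z → ax i p < ax i z

theorem mem_leadSet {i : Fin 4} {P Z : Finset Site} {z : Site} : z ∈ leadSet i P Z ↔
    z ∈ Z ∧ z - axisDir i ∈ P ∧ ∀ p ∈ P, ax (i + 1) p = ax (i + 1) z → ax i p < ax i z := by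
  simp [leadSet]

theorem sum_lineLead_row {P Z : Finset Site} {T : Finset ℤ} (hZ : ∀ p ∈ Z, p.2 ∈ T) :
    ∑ y ∈ T, lineLead (rowOf P y) (rowOf Z y) = (leadSet 1 P Z).card + (leadSet 3 P Z).card := by
  unfold lineLead
  rw [Finset.sum_add_distrib,
    card_eq_sum_rowOf (T := T) fun p hp => hZ p (mem_leadSet.1 hp).1,
    card_eq_sum_rowOf (T := T) fun p hp => hZ p (mem_leadSet.1 hp).1]
  congr 1
  · refine Finset.sum_congr rfl fun y _ => ?_
    congr 1; ext x
    simp only [mem_rowOf, mem_leadSet, Finset.mem_filter, show (1 + 1 : Fin 4) = 2 from rfl]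
    simp only [ax_two, ax_one, axisDir_one, Prod.mk_sub_mk, sub_neg_eq_add, sub_zero]
    refine and_congr Iff.rfl (and_congr Iff.rfl ⟨fun h p hp h2 => ?_, fun h p hp => ?_⟩)
    · have := h p.1 (by rw [← h2]; exact hp)
      omega
    · have := h _ hp rfl
      simp at this; exact this
  · refine Finset.sum_congr rfl fun y _ => ?_
    congr 1; ext x
    simp only [mem_rowOf, mem_leadSet, Finset.mem_filter, show (3 + 1 : Fin 4) = 0 from rfl]
    simp only [ax_zero, ax_three, axisDir_three, Prod.mk_sub_mk, sub_zero]
    refine and_congr Iff.rfl (and_congr Iff.rfl ⟨fun h p hp h2 => ?_, fun h p hp => ?_⟩)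
    · have := h p.1 (by rw [show y = p.2 by omega]; exact hp)
      omega
    · have := h _ hp rfl
      simp at this; exact this

theorem sum_lineLead_col {P Z : Finset Site} {T : Finset ℤ} (hZ : ∀ p ∈ Z, p.1 ∈ T) :
    ∑ x ∈ T, lineLead (colOf P x) (colOf Z x) = (leadSet 0 P Z).card + (leadSet 2 P Z).card := by
  unfold lineLead
  rw [Finset.sum_add_distrib,
    card_eq_sum_colOf (T := T) fun p hp => hZ p (mem_leadSet.1 hp).1,
    card_eq_sum_colOf (T := T) fun p hp => hZ p (mem_leadSet.1 hp).1]
  congr 1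
  · refine Finset.sum_congr rfl fun x _ => ?_
    congr 1; ext y
    simp only [mem_colOf, mem_leadSet, Finset.mem_filter, show (0 + 1 : Fin 4) = 1 from rfl]
    simp only [ax_zero, ax_one, axisDir_zero, Prod.mk_sub_mk, sub_neg_eq_add, sub_zero]
    refine and_congr Iff.rfl (and_congr Iff.rfl ⟨fun h p hp h2 => ?_, fun h p hp => ?_⟩)
    · have := h p.2 (by rw [show x = p.1 by omega]; exact hp)
      omega
    · have := h _ hp rfl
      simp at this; exact this
  · refine Finset.sum_congr rfl fun x _ => ?_
    congr 1; ext y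
    simp only [mem_colOf, mem_leadSet, Finset.mem_filter, show (2 + 1 : Fin 4) = 3 from rfl]
    simp only [ax_two, ax_three, axisDir_two, Prod.mk_sub_mk, sub_zero]
    refine and_congr Iff.rfl (and_congr Iff.rfl ⟨fun h p hp h2 => ?_, fun h p hp => ?_⟩)
    · have := h p.2 (by rw [← h2]; exact hp)
      omega
    · have := h _ hp rfl
      simp at this; exact this

theorem sum_lines_lower {k : ℝ} (hk : -1 < k) (hk1 : k < 1) {T B : Finset ℤ} (hB : B ⊆ T)
    (p z : ℤ → Finset ℤ) (hpz : ∀ y, Disjoint (p y) (z y)) (hbad : ∀ y ∈ B, ¬ LineGood (p y) (z y)) :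
    4 * ((T.filter fun y => (p y).Nonempty).card : ℝ) +
      (1 + k) * ((∑ y ∈ T, (z y).card : ℕ) - (∑ y ∈ T, lineLead (p y) (z y) : ℕ)) +
      (1 - k) * B.card ≤ ∑ y ∈ T, lineCost k (p y) (z y) := by
  have h1 : ∀ y ∈ T, (if (p y).Nonempty then (4 : ℝ) else 0) +
      (1 + k) * (((z y).card : ℝ) - lineLead (p y) (z y)) + (if y ∈ B then 1 - k else 0) ≤
      lineCost k (p y) (z y) := by
    intro y _
    have := lineCost_lower hk hk1 (hpz y)
    split_ifs with h1 h2 h3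
    · have := this.2 (hbad y h2); simpa [h1] using this
    · have := this.1; simpa [h1] using this
    · have := this.2 (hbad y h3); simpa [h1] using this
    · have := this.1; simpa [h1] using this
  refine le_trans (le_of_eq ?_) (Finset.sum_le_sum h1)
  rw [Finset.sum_add_distrib, Finset.sum_add_distrib, ← Finset.mul_sum, Finset.sum_sub_distrib,
    ← Finset.sum_filter, ← Finset.sum_filter, Finset.sum_const, Finset.sum_const,
    Finset.filter_mem_eq_inter, Finset.inter_eq_right.2 hB]
  push_cast
  simp only [nsmul_eq_mul]
  ring

theorem cost_lower {k : ℝ} (hk : -1 < k) (hk1 : k < 1) {P Z : Finset Site} (hPZ : Disjoint P Z)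
    {BR BC : Finset ℤ} (hBR : ∀ y ∈ BR, ¬ LineGood (rowOf P y) (rowOf Z y))
    (hBC : ∀ x ∈ BC, ¬ LineGood (colOf P x) (colOf Z x)) :
    4 * (((P.image Prod.fst).card : ℝ) + (P.image Prod.snd).card) +
      (1 + k) * (2 * (Z.card : ℝ) - (∑ i, (leadSet i P Z).card : ℕ)) +
      (1 - k) * ((BR.card : ℝ) + BC.card) ≤ cost k P Z := by
  have hdis := Finset.disjoint_left.1 hPZ
  -- Adjoining `BR` dispenses with showing that bad lines meet `P ∪ Z`.
  set T := P.image Prod.snd ∪ Z.image Prod.snd ∪ BR with hT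
  set U := P.image Prod.fst ∪ Z.image Prod.fst ∪ BC with hU
  have hPT : ∀ p ∈ P, p.2 ∈ T := fun p hp => by
    simp only [hT, Finset.mem_union]; exact Or.inl (Or.inl (Finset.mem_image_of_mem _ hp))
  have hZT : ∀ p ∈ Z, p.2 ∈ T := fun p hp => by
    simp only [hT, Finset.mem_union]; exact Or.inl (Or.inr (Finset.mem_image_of_mem _ hp))
  have hPU : ∀ p ∈ P, p.1 ∈ U := fun p hp => by
    simp only [hU, Finset.mem_union]; exact Or.inl (Or.inl (Finset.mem_image_of_mem _ hp))
  have hZU : ∀ p ∈ Z, p.1 ∈ U := fun p hp => by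
    simp only [hU, Finset.mem_union]; exact Or.inl (Or.inr (Finset.mem_image_of_mem _ hp))
  have r := sum_lines_lower hk hk1 (T := T) (B := BR) (by intro y hy; simp [hT, hy]) (rowOf P) (rowOf Z)
    (fun y => Finset.disjoint_left.2 fun x hx hx' => hdis (mem_rowOf.1 hx) (mem_rowOf.1 hx')) hBR
  have c := sum_lines_lower hk hk1 (T := U) (B := BC) (by intro y hy; simp [hU, hy]) (colOf P) (colOf Z)
    (fun y => Finset.disjoint_left.2 fun x hx hx' => hdis (mem_colOf.1 hx) (mem_colOf.1 hx')) hBC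
  rw [← dirCost_row hPT hZT, ← card_eq_sum_rowOf hZT, sum_lineLead_row hZT] at r
  rw [← dirCost_col hPU hZU, ← card_eq_sum_colOf hZU, sum_lineLead_col hZU] at c
  have e1 : (T.filter fun y => (rowOf P y).Nonempty) = P.image Prod.snd := by
    ext y
    rw [Finset.mem_filter, Finset.mem_image]
    constructor
    · rintro ⟨-, x, hx⟩; exact ⟨_, mem_rowOf.1 hx, rfl⟩
    · rintro ⟨p, hp, rfl⟩; exact ⟨hPT p hp, p.1, mem_rowOf.2 hp⟩
  have e2 : (U.filter fun y => (colOf P y).Nonempty) = P.image Prod.fst := by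
    ext y
    rw [Finset.mem_filter, Finset.mem_image]
    constructor
    · rintro ⟨-, x, hx⟩; exact ⟨_, mem_colOf.1 hx, rfl⟩
    · rintro ⟨p, hp, rfl⟩; exact ⟨hPU p hp, p.2, mem_colOf.2 hp⟩
  rw [e1] at r
  rw [e2] at c
  rw [Fin.sum_univ_four]
  unfold cost
  push_cast at r c ⊢
  linarith

theorem cost_upper {k : ℝ} {P Z : Finset Site} (hPZ : Disjoint P Z)
    (hZr : ∀ z ∈ Z, z.2 ∈ P.image Prod.snd) (hZc : ∀ z ∈ Z, z.1 ∈ P.image Prod.fst)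
    (hr : ∀ y, LineConvex (rowOf P y)) (hc : ∀ x, LineConvex (colOf P x))
    (hr' : ∀ y, LineConvex (rowOf P y ∪ rowOf Z y)) (hc' : ∀ x, LineConvex (colOf P x ∪ colOf Z x)) :
    cost k P Z ≤ 4 * (((P.image Prod.fst).card : ℝ) + (P.image Prod.snd).card) +
      (1 + k) * ((adjE (1, 0) Z : ℝ) + adjE (0, 1) Z) := by
  have hdis := Finset.disjoint_left.1 hPZ
  have hPr : ∀ p ∈ P, p.2 ∈ P.image Prod.snd := fun p hp => Finset.mem_image_of_mem _ hp
  have hPc : ∀ p ∈ P, p.1 ∈ P.image Prod.fst := fun p hp => Finset.mem_image_of_mem _ hp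
  unfold cost
  rw [dirCost_row hPr hZr, dirCost_col hPc hZc]
  have e1 : adjE (1, 0) Z = ∑ y ∈ P.image Prod.snd, lineAdj (rowOf Z y) := by
    unfold adjE lineAdj
    rw [card_eq_sum_rowOf (T := P.image Prod.snd) fun p hp => hZr p (Finset.mem_filter.1 hp).1]
    refine Finset.sum_congr rfl fun y _ => ?_
    congr 1; ext x; simp
  have e2 : adjE (0, 1) Z = ∑ y ∈ P.image Prod.fst, lineAdj (colOf Z y) := by
    unfold adjE lineAdj
    rw [card_eq_sum_colOf (T := P.image Prod.fst) fun p hp => hZc p (Finset.mem_filter.1 hp).1]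
    refine Finset.sum_congr rfl fun y _ => ?_
    congr 1; ext x; simp
  rw [e1, e2]
  have r : ∑ y ∈ P.image Prod.snd, lineCost k (rowOf P y) (rowOf Z y) ≤
      ∑ y ∈ P.image Prod.snd, (4 + (1 + k) * (lineAdj (rowOf Z y) : ℝ)) := by
    refine Finset.sum_le_sum fun y hy => lineCost_upper ?_ ?_ (hr y) (hr' y)
    · obtain ⟨p, hp, rfl⟩ := Finset.mem_image.1 hy
      exact ⟨p.1, by simpa using hp⟩
    · exact Finset.disjoint_left.2 fun x hx hx' => hdis (mem_rowOf.1 hx) (mem_rowOf.1 hx')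
  have c : ∑ y ∈ P.image Prod.fst, lineCost k (colOf P y) (colOf Z y) ≤
      ∑ y ∈ P.image Prod.fst, (4 + (1 + k) * (lineAdj (colOf Z y) : ℝ)) := by
    refine Finset.sum_le_sum fun y hy => lineCost_upper ?_ ?_ (hc y) (hc' y)
    · obtain ⟨p, hp, rfl⟩ := Finset.mem_image.1 hy
      exact ⟨p.2, by simpa using hp⟩
    · exact Finset.disjoint_left.2 fun x hx hx' => hdis (mem_colOf.1 hx) (mem_colOf.1 hx')
  rw [Finset.sum_add_distrib, ← Finset.mul_sum, Finset.sum_const, nsmul_eq_mul] at r c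
  push_cast
  linarith

/-! ### Discrete octagons -/

/-- The discrete octagon with support values `a` (axis directions) and `d` (diagonal directions). -/
noncomputable def oct (a d : Fin 4 → ℤ) : Finset Site :=
  ((Finset.Icc (-a 1) (a 3)) ×ˢ (Finset.Icc (-a 0) (a 2))).filter fun p =>
    -p.2 - p.1 ≤ d 0 ∧ -p.1 + p.2 ≤ d 1 ∧ p.2 + p.1 ≤ d 2 ∧ p.1 - p.2 ≤ d 3

theorem mem_oct' {a d : Fin 4 → ℤ} {p : Site} : p ∈ oct a d ↔
    (-p.2 ≤ a 0 ∧ -p.1 ≤ a 1 ∧ p.2 ≤ a 2 ∧ p.1 ≤ a 3) ∧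
    -p.2 - p.1 ≤ d 0 ∧ -p.1 + p.2 ≤ d 1 ∧ p.2 + p.1 ≤ d 2 ∧ p.1 - p.2 ≤ d 3 := by
  simp only [oct, Finset.mem_filter, Finset.mem_product, Finset.mem_Icc]
  constructor <;> intro h <;> refine ⟨?_, h.2⟩ <;> omega

theorem mem_oct {a d : Fin 4 → ℤ} {p : Site} :
    p ∈ oct a d ↔ (∀ i, ax i p ≤ a i) ∧ ∀ i, dg i p ≤ d i := by
  rw [mem_oct', forall_fin4, forall_fin4]
  simp

theorem oct_subset_oct {a d a' d' : Fin 4 → ℤ} (ha : ∀ i, a i ≤ a' i) (hd : ∀ i, d i ≤ d' i) :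
    oct a d ⊆ oct a' d' := by
  intro p hp
  rw [mem_oct] at hp ⊢
  exact ⟨fun i => (hp.1 i).trans (ha i), fun i => (hp.2 i).trans (hd i)⟩

/-- Number of corner sites along the `i`-th diagonal side. -/
def tS (a d : Fin 4 → ℤ) (i : Fin 4) : ℤ := a i + a (i + 1) - d i

/-- Number of sites of the `i`-th external slice. -/
def pS (a d : Fin 4 → ℤ) (i : Fin 4) : ℤ := d i + d (i + 3) - 2 * a i + 1

theorem tS_zero (a d : Fin 4 → ℤ) : tS a d 0 = a 0 + a 1 - d 0 := rfl
theorem tS_one (a d : Fin 4 → ℤ) : tS a d 1 = a 1 + a 2 - d 1 := rfl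
theorem tS_two (a d : Fin 4 → ℤ) : tS a d 2 = a 2 + a 3 - d 2 := rfl
theorem tS_three (a d : Fin 4 → ℤ) : tS a d 3 = a 3 + a 0 - d 3 := rfl
theorem pS_zero (a d : Fin 4 → ℤ) : pS a d 0 = d 0 + d 3 - 2 * a 0 + 1 := rfl

/-- The constraints defining the octagon are sharp, and its external slices have at least `n`
sites. -/
def Tight (n : ℤ) (a d : Fin 4 → ℤ) : Prop := (∀ i, 0 ≤ tS a d i) ∧ ∀ i, n ≤ pS a d i

theorem Tight.expand {n : ℤ} {a d : Fin 4 → ℤ} (h : Tight n a d) :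
    ((0 ≤ a 0 + a 1 - d 0) ∧ (0 ≤ a 1 + a 2 - d 1) ∧ (0 ≤ a 2 + a 3 - d 2) ∧
      (0 ≤ a 3 + a 0 - d 3)) ∧
    (n ≤ d 0 + d 3 - 2 * a 0 + 1) ∧ (n ≤ d 1 + d 0 - 2 * a 1 + 1) ∧
      (n ≤ d 2 + d 1 - 2 * a 2 + 1) ∧ (n ≤ d 3 + d 2 - 2 * a 3 + 1) := by
  obtain ⟨h1, h2⟩ := h
  rw [forall_fin4] at h1 h2
  exact ⟨h1, h2⟩

theorem Tight.mono {n m : ℤ} {a d : Fin 4 → ℤ} (h : Tight n a d) (hm : m ≤ n) : Tight m a d :=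
  ⟨h.1, fun i => hm.trans (h.2 i)⟩

/-- The point with given coordinates in the `i`-th outer frame. -/
def pt (i : Fin 4) (u v : ℤ) : Site :=
  (u * (axisDir i).1 + v * (axisDir (i + 1)).1, u * (axisDir i).2 + v * (axisDir (i + 1)).2)

theorem pt_zero (u v : ℤ) : pt 0 u v = (-v, -u) := by simp [pt]
theorem pt_one (u v : ℤ) : pt 1 u v = (-u, v) := by
  simp [pt, show (1 + 1 : Fin 4) = 2 from rfl]
theorem pt_two (u v : ℤ) : pt 2 u v = (v, u) := by
  simp [pt, show (2 + 1 : Fin 4) = 3 from rfl]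
theorem pt_three (u v : ℤ) : pt 3 u v = (u, -v) := by
  simp [pt, show (3 + 1 : Fin 4) = 0 from rfl]

@[simp] theorem ax_pt (i : Fin 4) (u v : ℤ) : ax i (pt i u v) = u := by
  revert i; rw [forall_fin4]
  simp [pt_zero, pt_one, pt_two, pt_three]

@[simp] theorem ax_succ_pt (i : Fin 4) (u v : ℤ) : ax (i + 1) (pt i u v) = v := by
  revert i; rw [forall_fin4]
  refine ⟨?_, ?_, ?_, ?_⟩
  · rw [pt_zero, show (0 + 1 : Fin 4) = 1 from rfl]; simp
  · rw [pt_one, show (1 + 1 : Fin 4) = 2 from rfl]; simp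
  · rw [pt_two, show (2 + 1 : Fin 4) = 3 from rfl]; simp
  · rw [pt_three, show (3 + 1 : Fin 4) = 0 from rfl]; simp

theorem pt_ax (i : Fin 4) (p : Site) : pt i (ax i p) (ax (i + 1) p) = p := by
  revert i; rw [forall_fin4]
  refine ⟨?_, ?_, ?_, ?_⟩
  · rw [pt_zero, show (0 + 1 : Fin 4) = 1 from rfl]; simp
  · rw [pt_one, show (1 + 1 : Fin 4) = 2 from rfl]; simp
  · rw [pt_two, show (2 + 1 : Fin 4) = 3 from rfl]; simp
  · rw [pt_three, show (3 + 1 : Fin 4) = 0 from rfl]; simp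

theorem dg_pt (i : Fin 4) (u v : ℤ) : dg i (pt i u v) = u + v := by simp [dg]

theorem site_ext {i : Fin 4} {p q : Site} (h : ax i p = ax i q) (h' : ax (i + 1) p = ax (i + 1) q) :
    p = q := by
  rw [← pt_ax i p, ← pt_ax i q, h, h']

/-- The points of a box corner on a given diagonal line. -/
noncomputable def layer (a : Fin 4 → ℤ) (i : Fin 4) (s : ℤ) : Finset Site :=
  (Finset.Icc (s - a (i + 1)) (a i)).image fun u => pt i u (s - u)

theorem mem_layer {a : Fin 4 → ℤ} {i : Fin 4} {s : ℤ} {p : Site} :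
    p ∈ layer a i s ↔ dg i p = s ∧ ax i p ≤ a i ∧ ax (i + 1) p ≤ a (i + 1) := by
  simp only [layer, Finset.mem_image, Finset.mem_Icc]
  constructor
  · rintro ⟨u, hu, rfl⟩
    rw [dg_pt, ax_pt, ax_succ_pt]
    omega
  · rintro ⟨h1, h2, h3⟩
    have : ax (i + 1) p = s - ax i p := by unfold dg at h1; omega
    refine ⟨ax i p, by omega, ?_⟩
    rw [← this, pt_ax]

theorem card_layer (a : Fin 4 → ℤ) (i : Fin 4) (s : ℤ) :
    (layer a i s).card = (a i + a (i + 1) - s + 1).toNat := by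
  rw [layer, Finset.card_image_of_injective _ fun u v h => by
    have := congrArg (ax i) h; simpa using this, Int.card_Icc]
  congr 1; ring

/-- The octagon with its corner sites. -/
noncomputable def octPlus (a d : Fin 4 → ℤ) : Finset Site := oct a fun i => d i + 1

theorem mem_octPlus' {a d : Fin 4 → ℤ} {p : Site} : p ∈ octPlus a d ↔
    (-p.2 ≤ a 0 ∧ -p.1 ≤ a 1 ∧ p.2 ≤ a 2 ∧ p.1 ≤ a 3) ∧
    -p.2 - p.1 ≤ d 0 + 1 ∧ -p.1 + p.2 ≤ d 1 + 1 ∧ p.2 + p.1 ≤ d 2 + 1 ∧ p.1 - p.2 ≤ d 3 + 1 :=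
  mem_oct'

theorem oct_subset_octPlus (a d : Fin 4 → ℤ) : oct a d ⊆ octPlus a d :=
  oct_subset_oct (fun _ => le_rfl) fun _ => by omega

/-- Slices with at least three sites make a point just beyond one diagonal side satisfy all the
other constraints, so each of the four layers belongs entirely to the enlarged octagon. -/
theorem octPlus_sdiff_oct {a d : Fin 4 → ℤ} (h : Tight 3 a d) :
    octPlus a d \ oct a d = Finset.univ.biUnion fun i => layer a i (d i + 1) := by
  have := h.expand
  ext p
  simp only [Finset.mem_sdiff, Finset.mem_biUnion, Finset.mem_univ, true_and, mem_layer]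
  rw [mem_octPlus', mem_oct']
  constructor
  · intro hp
    have h4 : -p.2 - p.1 = d 0 + 1 ∨ -p.1 + p.2 = d 1 + 1 ∨ p.2 + p.1 = d 2 + 1 ∨
        p.1 - p.2 = d 3 + 1 := by omega
    rcases h4 with h4 | h4 | h4 | h4
    · exact ⟨0, by simp; omega⟩
    · exact ⟨1, by rw [show (1 + 1 : Fin 4) = 2 from rfl]; simp; omega⟩
    · exact ⟨2, by rw [show (2 + 1 : Fin 4) = 3 from rfl]; simp; omega⟩
    · exact ⟨3, by rw [show (3 + 1 : Fin 4) = 0 from rfl]; simp; omega⟩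
  · rintro ⟨i, hi⟩
    revert hi
    revert i
    rw [forall_fin4]
    refine ⟨?_, ?_, ?_, ?_⟩
    · simp; omega
    · rw [show (1 + 1 : Fin 4) = 2 from rfl]; simp; omega
    · rw [show (2 + 1 : Fin 4) = 3 from rfl]; simp; omega
    · rw [show (3 + 1 : Fin 4) = 0 from rfl]; simp; omega

theorem card_octPlus_sdiff {a d : Fin 4 → ℤ} (h : Tight 3 a d) :
    ((octPlus a d \ oct a d).card : ℤ) = ∑ i, tS a d i := by
  rw [octPlus_sdiff_oct h, Finset.card_biUnion]
  · push_cast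
    refine Finset.sum_congr rfl fun i _ => ?_
    have := h.1 i
    rw [card_layer]
    unfold tS at *
    omega
  · have := h.expand
    intro i _ j _ hij
    refine Finset.disjoint_left.2 fun p hi hj => ?_
    rw [mem_layer] at hi hj
    revert hi hj hij
    revert i j
    simp only [forall_fin4, show (1 + 1 : Fin 4) = 2 from rfl, show (2 + 1 : Fin 4) = 3 from rfl,
      show (3 + 1 : Fin 4) = 0 from rfl, show (0 + 1 : Fin 4) = 1 from rfl]
    simp
    omega

/-! ### Octagons with trimmed slices -/

/-- The free coordinate along the `i`-th slice is `ax (i + 1)`, hence the alternating signs. Lowest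
and highest slices are separated from the lateral ones because the adjacencies they create are
horizontal in one case and vertical in the other. -/
def TrimH (a lo hi : Fin 4 → ℤ) (p : Site) : Prop :=
  (-p.2 = a 0 → lo 0 ≤ -p.1 ∧ -p.1 ≤ hi 0) ∧ (p.2 = a 2 → lo 2 ≤ p.1 ∧ p.1 ≤ hi 2)

def TrimV (a lo hi : Fin 4 → ℤ) (p : Site) : Prop :=
  (-p.1 = a 1 → lo 1 ≤ p.2 ∧ p.2 ≤ hi 1) ∧ (p.1 = a 3 → lo 3 ≤ -p.2 ∧ -p.2 ≤ hi 3)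

open Classical in
/-- An octagon whose `i`-th slice is restricted to `lo i ≤ ax (i + 1) p ≤ hi i`. -/
noncomputable def trim (a d lo hi : Fin 4 → ℤ) : Finset Site :=
  (oct a d).filter fun p => TrimH a lo hi p ∧ TrimV a lo hi p

theorem mem_trim {a d lo hi : Fin 4 → ℤ} {p : Site} :
    p ∈ trim a d lo hi ↔ p ∈ oct a d ∧ TrimH a lo hi p ∧ TrimV a lo hi p := by
  classical
  simp [trim]

/-- Admissible trimming parameters. -/
structure TrimOK (a d lo hi : Fin 4 → ℤ) : Prop where
  tight : Tight 3 a d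
  lo_le : ∀ i, a i - d (i + 3) ≤ lo i
  le_hi : ∀ i, hi i ≤ d i - a i
  ne : ∀ i, lo i ≤ hi i
  -- Every slice keeps a site, so the bounding box is that of the octagon.
  mem : ∀ i, ∃ p ∈ trim a d lo hi, ax i p = a i
  -- No site is removed both from a row and from a column, so a removed site is charged for
  -- adjacencies in one direction only.
  once : ∀ p ∈ oct a d, TrimH a lo hi p ∨ TrimV a lo hi p

theorem oct_lineConvex_row (a d : Fin 4 → ℤ) (y : ℤ) : LineConvex (rowOf (oct a d) y) := by
  intro u hu w hw b h1 h2
  simp only [mem_rowOf, mem_oct'] at *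
  omega

theorem oct_lineConvex_col (a d : Fin 4 → ℤ) (y : ℤ) : LineConvex (colOf (oct a d) y) := by
  intro u hu w hw b h1 h2
  simp only [mem_colOf, mem_oct'] at *
  omega

theorem trim_lineConvex_row (a d lo hi : Fin 4 → ℤ) (y : ℤ) :
    LineConvex (rowOf (trim a d lo hi) y) := by
  intro u hu w hw b h1 h2
  simp only [mem_rowOf, mem_trim] at *
  refine ⟨mem_rowOf.1 (oct_lineConvex_row a d y u (mem_rowOf.2 hu.1) w (mem_rowOf.2 hw.1) b h1 h2), ?_⟩
  simp only [TrimH, TrimV, mem_oct'] at *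
  omega

theorem trim_lineConvex_col (a d lo hi : Fin 4 → ℤ) (y : ℤ) :
    LineConvex (colOf (trim a d lo hi) y) := by
  intro u hu w hw b h1 h2
  simp only [mem_colOf, mem_trim] at *
  refine ⟨mem_colOf.1 (oct_lineConvex_col a d y u (mem_colOf.2 hu.1) w (mem_colOf.2 hw.1) b h1 h2), ?_⟩
  simp only [TrimH, TrimV, mem_oct'] at *
  omega

theorem lineConvex_row_between {a d : Fin 4 → ℤ} {S : Finset Site} (h1 : oct a d ⊆ S)
    (h2 : S ⊆ octPlus a d) (y : ℤ) : LineConvex (rowOf S y) := by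
  intro u hu w hw b hub hbw
  simp only [mem_rowOf] at *
  have hu := h2 hu
  have hw := h2 hw
  apply h1
  simp only [mem_octPlus', mem_oct'] at *
  omega

theorem lineConvex_col_between {a d : Fin 4 → ℤ} {S : Finset Site} (h1 : oct a d ⊆ S)
    (h2 : S ⊆ octPlus a d) (y : ℤ) : LineConvex (colOf S y) := by
  intro u hu w hw b hub hbw
  simp only [mem_colOf] at *
  have hu := h2 hu
  have hw := h2 hw
  apply h1
  simp only [mem_octPlus', mem_oct'] at *
  omega

theorem exists_mem_trim_row {a d lo hi : Fin 4 → ℤ} (h : TrimOK a d lo hi) {y : ℤ} (h1 : -a 0 ≤ y)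
    (h2 : y ≤ a 2) : ∃ x, (x, y) ∈ trim a d lo hi := by
  rcases eq_or_lt_of_le h1 with h1 | h1
  · obtain ⟨p, hp, e⟩ := h.mem 0
    rw [ax_zero] at e
    exact ⟨p.1, by rw [← h1, ← e, neg_neg]; exact hp⟩
  rcases eq_or_lt_of_le h2 with h2 | h2
  · obtain ⟨p, hp, e⟩ := h.mem 2
    rw [ax_two] at e
    exact ⟨p.1, by rw [h2, ← e]; exact hp⟩
  have := h.tight.expand
  refine ⟨max (max (-a 1) (-d 0 - y)) (y - d 1) + 1, ?_⟩
  rw [mem_trim, mem_oct']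
  simp only [TrimH, TrimV]
  omega

theorem exists_mem_trim_col {a d lo hi : Fin 4 → ℤ} (h : TrimOK a d lo hi) {x : ℤ} (h1 : -a 1 ≤ x)
    (h2 : x ≤ a 3) : ∃ y, (x, y) ∈ trim a d lo hi := by
  rcases eq_or_lt_of_le h1 with h1 | h1
  · obtain ⟨p, hp, e⟩ := h.mem 1
    rw [ax_one] at e
    exact ⟨p.2, by rw [← h1, ← e, neg_neg]; exact hp⟩
  rcases eq_or_lt_of_le h2 with h2 | h2
  · obtain ⟨p, hp, e⟩ := h.mem 3
    rw [ax_three] at e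
    exact ⟨p.2, by rw [h2, ← e]; exact hp⟩
  have := h.tight.expand
  refine ⟨max (max (-a 0) (-d 0 - x)) (x - d 3) + 1, ?_⟩
  rw [mem_trim, mem_oct']
  simp only [TrimH, TrimV]
  omega

theorem image_fst_oct {a d : Fin 4 → ℤ} (S : Finset Site) (hS : S ⊆ oct a d) :
    S.image Prod.fst ⊆ Finset.Icc (-a 1) (a 3) := by
  intro x hx
  obtain ⟨p, hp, rfl⟩ := Finset.mem_image.1 hx
  have := mem_oct'.1 (hS hp)
  rw [Finset.mem_Icc]; omega

theorem image_snd_oct {a d : Fin 4 → ℤ} (S : Finset Site) (hS : S ⊆ oct a d) :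
    S.image Prod.snd ⊆ Finset.Icc (-a 0) (a 2) := by
  intro x hx
  obtain ⟨p, hp, rfl⟩ := Finset.mem_image.1 hx
  have := mem_oct'.1 (hS hp)
  rw [Finset.mem_Icc]; omega

theorem card_le_of_cover {A S T : Finset Site} {e : Site}
    (h : ∀ z ∈ A, z ∈ S ∨ z - e ∈ T) : A.card ≤ S.card + T.card := by
  have : A ⊆ S ∪ T.image (· + e) := by
    intro z hz
    rcases h z hz with h | h
    · exact Finset.mem_union_left _ h
    · exact Finset.mem_union_right _ (Finset.mem_image.2 ⟨z - e, h, by simp⟩)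
  exact (Finset.card_le_card this).trans
    ((Finset.card_union_le _ _).trans (Nat.add_le_add_left Finset.card_image_le _))

-- Horizontal adjacencies in `Z` occur only on the removed ends of the lowest and highest rows, each
-- possibly prolonged by one corner site. A pair is charged to its right member at a left end and to
-- its left member at a right end; the charged member is always a removed site.
open Classical in
theorem adjE_row_le {a d lo hi : Fin 4 → ℤ} (h : TrimOK a d lo hi) {Z : Finset Site}
    (hZ : Z ⊆ octPlus a d \ trim a d lo hi) :
    adjE (1, 0) Z ≤ ((oct a d).filter fun p => ¬ TrimH a lo hi p).card := by
  set R := (oct a d).filter fun p => ¬ TrimH a lo hi p with hR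
  set lf : Site → Prop := fun p => (-p.2 = a 0 ∧ hi 0 < -p.1) ∨ (p.2 = a 2 ∧ p.1 < lo 2) with hlf
  have hT := h.tight.expand
  have hc : R.card = (R.filter lf).card + (R.filter fun p => ¬ lf p).card :=
    (Finset.card_filter_add_card_filter_not _).symm
  rw [hc]
  refine card_le_of_cover (e := (1, 0)) fun z hz => ?_
  rw [Finset.mem_filter] at hz
  have h1 := hZ hz.1
  have h2 := hZ hz.2
  rw [Finset.mem_sdiff, mem_trim, mem_octPlus', mem_oct'] at h1 h2
  obtain ⟨h1, h1'⟩ := h1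
  obtain ⟨h2, h2'⟩ := h2
  simp only [hR, hlf, Finset.mem_filter, mem_oct']
  clear hZ hz hc hlf hR
  clear lf R
  simp only [Prod.fst_sub, Prod.snd_sub, sub_zero] at *
  by_cases hi1 : -z.2 = a 0
  · obtain ⟨p, hp, hpe⟩ := h.mem 0
    rw [mem_trim, mem_oct'] at hp
    have hne := h.ne 0
    have hlo := h.lo_le 0
    have hhi := h.le_hi 0
    rw [show (0 + 3 : Fin 4) = 3 from rfl] at hlo
    simp only [ax_zero] at hpe
    obtain ⟨hp, hpH, hpV⟩ := hp
    clear h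
    have hpH' := hpH
    simp only [TrimH] at hpH'
    by_cases hz : TrimH a lo hi z
    -- A site of `Z` that survives the trimming of its row is removed from the last column. Its left
    -- neighbour is then removed from the row, which leaves `z` as the only possible position of the
    -- retained site `p`.
    · exfalso
      have hz' := hz
      simp only [TrimH] at hz'
      have hzo : (-z.2 ≤ a 0 ∧ -z.1 ≤ a 1 ∧ z.2 ≤ a 2 ∧ z.1 ≤ a 3) ∧ -z.2 - z.1 ≤ d 0 ∧
          -z.1 + z.2 ≤ d 1 ∧ z.2 + z.1 ≤ d 2 ∧ z.1 - z.2 ≤ d 3 := by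
        clear h1' h2' hpV hz hpH hpH'
        refine ⟨h1.1, ?_⟩
        omega
      have hV' : ¬ TrimV a lo hi z := fun hV => h1' ⟨hzo, hz, hV⟩
      have hfar : z.1 = a 3 := by
        by_contra hf
        apply hV'
        simp only [TrimV]
        omega
      have hw : (-z.2 ≤ a 0 ∧ -(z.1 - 1) ≤ a 1 ∧ z.2 ≤ a 2 ∧ (z.1 - 1) ≤ a 3) ∧ -z.2 - (z.1 - 1) ≤ d 0 ∧
          -(z.1 - 1) + z.2 ≤ d 1 ∧ z.2 + (z.1 - 1) ≤ d 2 ∧ (z.1 - 1) - z.2 ≤ d 3 := by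
        clear h1' h2' hpV hz hpH hpH' hV'
        refine ⟨h2.1, ?_⟩
        omega
      have hV : TrimV a lo hi (z - (1, 0)) := by
        clear h1' h2' hpV hz hpH hpH' hV' hz'
        simp only [TrimV, Prod.fst_sub, Prod.snd_sub, sub_zero]
        omega
      have hH : ¬ TrimH a lo hi (z - (1, 0)) := fun hH => h2' ⟨hw, hH, hV⟩
      simp only [TrimH, Prod.fst_sub, Prod.snd_sub, sub_zero] at hH
      have e1 : z.1 = p.1 := by
        clear h1' h2' hpV hz hpH hV' hV
        omega
      have e2 : z.2 = p.2 := by omega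
      have e3 : z = p := Prod.ext (by omega) (by omega)
      exact hV' (e3 ▸ hpV)
    · by_cases hl : hi 0 < -z.1
      · left
        refine ⟨⟨⟨h1.1, ?_⟩, hz⟩, by omega⟩
        clear h1' h2' hpV hz hpH
        omega
      · right
        have hz' := hz
        simp only [TrimH] at hz'
        have hw : (-z.2 ≤ a 0 ∧ -(z.1 - 1) ≤ a 1 ∧ z.2 ≤ a 2 ∧ (z.1 - 1) ≤ a 3) ∧ -z.2 - (z.1 - 1) ≤ d 0 ∧
            -(z.1 - 1) + z.2 ≤ d 1 ∧ z.2 + (z.1 - 1) ≤ d 2 ∧ (z.1 - 1) - z.2 ≤ d 3 := by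
          clear h1' h2' hpV hz hpH
          refine ⟨h2.1, ?_⟩
          omega
        have hH : ¬ TrimH a lo hi (z - (1, 0)) := by
          intro hH
          have hV : ¬ TrimV a lo hi (z - (1, 0)) := fun hV => h2' ⟨hw, hH, hV⟩
          simp only [TrimH, Prod.fst_sub, Prod.snd_sub, sub_zero] at hH
          have hfar : -(z.1 - 1) = a 1 := by
            by_contra hf
            apply hV
            simp only [TrimV, Prod.fst_sub, Prod.snd_sub, sub_zero]
            clear h1' h2' hz hz' hH hV hpV hpH
            omega
          have e1 : z.1 - 1 = p.1 := by
            clear h1' h2' hV hpV hpH hz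
            omega
          have e2 : z.2 = p.2 := by omega
          have e3 : z - (1, 0) = p := Prod.ext (by simp only [Prod.fst_sub]; omega)
            (by simp only [Prod.snd_sub, sub_zero]; omega)
          exact hV (e3 ▸ hpV)
        refine ⟨⟨hw, hH⟩, ?_⟩
        clear h1' h2' hH hpV hpH hz
        omega
  by_cases hi2 : z.2 = a 2
  · obtain ⟨p, hp, hpe⟩ := h.mem 2
    rw [mem_trim, mem_oct'] at hp
    have hne := h.ne 2
    have hlo := h.lo_le 2
    have hhi := h.le_hi 2
    rw [show (2 + 3 : Fin 4) = 1 from rfl] at hlo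
    simp only [ax_two] at hpe
    obtain ⟨hp, hpH, hpV⟩ := hp
    clear h
    have hpH' := hpH
    simp only [TrimH] at hpH'
    by_cases hz : TrimH a lo hi z
    · exfalso
      have hz' := hz
      simp only [TrimH] at hz'
      have hzo : (-z.2 ≤ a 0 ∧ -z.1 ≤ a 1 ∧ z.2 ≤ a 2 ∧ z.1 ≤ a 3) ∧ -z.2 - z.1 ≤ d 0 ∧
          -z.1 + z.2 ≤ d 1 ∧ z.2 + z.1 ≤ d 2 ∧ z.1 - z.2 ≤ d 3 := by
        clear h1' h2' hpV hz hpH hpH'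
        refine ⟨h1.1, ?_⟩
        omega
      have hV' : ¬ TrimV a lo hi z := fun hV => h1' ⟨hzo, hz, hV⟩
      have hfar : z.1 = a 3 := by
        by_contra hf
        apply hV'
        simp only [TrimV]
        omega
      have hw : (-z.2 ≤ a 0 ∧ -(z.1 - 1) ≤ a 1 ∧ z.2 ≤ a 2 ∧ (z.1 - 1) ≤ a 3) ∧ -z.2 - (z.1 - 1) ≤ d 0 ∧
          -(z.1 - 1) + z.2 ≤ d 1 ∧ z.2 + (z.1 - 1) ≤ d 2 ∧ (z.1 - 1) - z.2 ≤ d 3 := by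
        clear h1' h2' hpV hz hpH hpH' hV'
        refine ⟨h2.1, ?_⟩
        omega
      have hV : TrimV a lo hi (z - (1, 0)) := by
        clear h1' h2' hpV hz hpH hpH' hV' hz'
        simp only [TrimV, Prod.fst_sub, Prod.snd_sub, sub_zero]
        omega
      have hH : ¬ TrimH a lo hi (z - (1, 0)) := fun hH => h2' ⟨hw, hH, hV⟩
      simp only [TrimH, Prod.fst_sub, Prod.snd_sub, sub_zero] at hH
      have e1 : z.1 = p.1 := by
        clear h1' h2' hpV hz hpH hV' hV
        omega
      have e2 : z.2 = p.2 := by omega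
      have e3 : z = p := Prod.ext (by omega) (by omega)
      exact hV' (e3 ▸ hpV)
    · by_cases hl : z.1 < lo 2
      · left
        refine ⟨⟨⟨h1.1, ?_⟩, hz⟩, by omega⟩
        clear h1' h2' hpV hz hpH
        omega
      · right
        have hz' := hz
        simp only [TrimH] at hz'
        have hw : (-z.2 ≤ a 0 ∧ -(z.1 - 1) ≤ a 1 ∧ z.2 ≤ a 2 ∧ (z.1 - 1) ≤ a 3) ∧ -z.2 - (z.1 - 1) ≤ d 0 ∧
            -(z.1 - 1) + z.2 ≤ d 1 ∧ z.2 + (z.1 - 1) ≤ d 2 ∧ (z.1 - 1) - z.2 ≤ d 3 := by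
          clear h1' h2' hpV hz hpH
          refine ⟨h2.1, ?_⟩
          omega
        have hH : ¬ TrimH a lo hi (z - (1, 0)) := by
          intro hH
          have hV : ¬ TrimV a lo hi (z - (1, 0)) := fun hV => h2' ⟨hw, hH, hV⟩
          simp only [TrimH, Prod.fst_sub, Prod.snd_sub, sub_zero] at hH
          have hfar : -(z.1 - 1) = a 1 := by
            by_contra hf
            apply hV
            simp only [TrimV, Prod.fst_sub, Prod.snd_sub, sub_zero]
            clear h1' h2' hz hz' hH hV hpV hpH
            omega
          have e1 : z.1 - 1 = p.1 := by
            clear h1' h2' hV hpV hpH hz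
            omega
          have e2 : z.2 = p.2 := by omega
          have e3 : z - (1, 0) = p := Prod.ext (by simp only [Prod.fst_sub]; omega)
            (by simp only [Prod.snd_sub, sub_zero]; omega)
          exact hV (e3 ▸ hpV)
        refine ⟨⟨hw, hH⟩, ?_⟩
        clear h1' h2' hH hpV hpH hz
        omega
  -- In the remaining rows at most one site at each end is outside `P`, either a corner site or one
  -- trimmed from a lateral column, so no two are adjacent.
  · exfalso
    clear h
    have k1 : TrimH a lo hi z := by simp only [TrimH]; omega
    have k2 : TrimH a lo hi (z - (1, 0)) := by
      simp only [TrimH, Prod.fst_sub, Prod.snd_sub]; omega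
    have k3 : -z.1 = a 1 ∨ z.1 = a 3 ∨ TrimV a lo hi z := by simp only [TrimV]; omega
    have k4 : -(z.1 - 1) = a 1 ∨ z.1 - 1 = a 3 ∨ TrimV a lo hi (z - (1, 0)) := by
      simp only [TrimV, Prod.fst_sub, Prod.snd_sub]; omega
    simp only [k1, k2, true_and] at h1' h2'
    rw [not_and_or] at h1' h2'
    rcases h1' with h1' | h1'
    · rcases h2' with h2' | h2'
      · omega
      · simp only [h2', or_false] at k4
        omega
    · simp only [h1', or_false] at k3
      rcases h2' with h2' | h2'
      · omega
      · simp only [h2', or_false] at k4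
        omega

open Classical in
theorem adjE_col_le {a d lo hi : Fin 4 → ℤ} (h : TrimOK a d lo hi) {Z : Finset Site}
    (hZ : Z ⊆ octPlus a d \ trim a d lo hi) :
    adjE (0, 1) Z ≤ ((oct a d).filter fun p => ¬ TrimV a lo hi p).card := by
  set R := (oct a d).filter fun p => ¬ TrimV a lo hi p with hR
  set lf : Site → Prop := fun p => (-p.1 = a 1 ∧ p.2 < lo 1) ∨ (p.1 = a 3 ∧ hi 3 < -p.2) with hlf
  have hT := h.tight.expand
  have hc : R.card = (R.filter lf).card + (R.filter fun p => ¬ lf p).card :=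
    (Finset.card_filter_add_card_filter_not _).symm
  rw [hc]
  refine card_le_of_cover (e := (0, 1)) fun z hz => ?_
  rw [Finset.mem_filter] at hz
  have h1 := hZ hz.1
  have h2 := hZ hz.2
  rw [Finset.mem_sdiff, mem_trim, mem_octPlus', mem_oct'] at h1 h2
  obtain ⟨h1, h1'⟩ := h1
  obtain ⟨h2, h2'⟩ := h2
  simp only [hR, hlf, Finset.mem_filter, mem_oct']
  clear hZ hz hc hlf hR
  clear lf R
  simp only [Prod.fst_sub, Prod.snd_sub, sub_zero] at *
  by_cases hi1 : -z.1 = a 1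
  · obtain ⟨p, hp, hpe⟩ := h.mem 1
    rw [mem_trim, mem_oct'] at hp
    have hne := h.ne 1
    have hlo := h.lo_le 1
    have hhi := h.le_hi 1
    rw [show (1 + 3 : Fin 4) = 0 from rfl] at hlo
    simp only [ax_one] at hpe
    obtain ⟨hp, hpV, hpH⟩ := hp
    clear h
    have hpH' := hpH
    simp only [TrimV] at hpH'
    by_cases hz : TrimV a lo hi z
    · exfalso
      have hz' := hz
      simp only [TrimV] at hz'
      have hzo : (-z.2 ≤ a 0 ∧ -z.1 ≤ a 1 ∧ z.2 ≤ a 2 ∧ z.1 ≤ a 3) ∧ -z.2 - z.1 ≤ d 0 ∧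
          -z.1 + z.2 ≤ d 1 ∧ z.2 + z.1 ≤ d 2 ∧ z.1 - z.2 ≤ d 3 := by
        clear h1' h2' hpV hz hpH hpH'
        refine ⟨h1.1, ?_⟩
        omega
      have hV' : ¬ TrimH a lo hi z := fun hV => h1' ⟨hzo, hV, hz⟩
      have hfar : z.2 = a 2 := by
        by_contra hf
        apply hV'
        simp only [TrimH]
        omega
      have hw : (-(z.2 - 1) ≤ a 0 ∧ -z.1 ≤ a 1 ∧ (z.2 - 1) ≤ a 2 ∧ z.1 ≤ a 3) ∧ -(z.2 - 1) - z.1 ≤ d 0 ∧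
          -z.1 + (z.2 - 1) ≤ d 1 ∧ (z.2 - 1) + z.1 ≤ d 2 ∧ z.1 - (z.2 - 1) ≤ d 3 := by
        clear h1' h2' hpV hz hpH hpH' hV'
        refine ⟨h2.1, ?_⟩
        omega
      have hV : TrimH a lo hi (z - (0, 1)) := by
        clear h1' h2' hpV hz hpH hpH' hV' hz'
        simp only [TrimH, Prod.fst_sub, Prod.snd_sub, sub_zero]
        omega
      have hH : ¬ TrimV a lo hi (z - (0, 1)) := fun hH => h2' ⟨hw, hV, hH⟩
      simp only [TrimV, Prod.fst_sub, Prod.snd_sub, sub_zero] at hH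
      have e1 : z.2 = p.2 := by
        clear h1' h2' hpV hz hpH hV' hV
        omega
      have e2 : z.1 = p.1 := by omega
      have e3 : z = p := Prod.ext (by omega) (by omega)
      exact hV' (e3 ▸ hpV)
    · by_cases hl : z.2 < lo 1
      · left
        refine ⟨⟨⟨h1.1, ?_⟩, hz⟩, by omega⟩
        clear h1' h2' hpV hz hpH
        omega
      · right
        have hz' := hz
        simp only [TrimV] at hz'
        have hw : (-(z.2 - 1) ≤ a 0 ∧ -z.1 ≤ a 1 ∧ (z.2 - 1) ≤ a 2 ∧ z.1 ≤ a 3) ∧ -(z.2 - 1) - z.1 ≤ d 0 ∧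
            -z.1 + (z.2 - 1) ≤ d 1 ∧ (z.2 - 1) + z.1 ≤ d 2 ∧ z.1 - (z.2 - 1) ≤ d 3 := by
          clear h1' h2' hpV hz hpH
          refine ⟨h2.1, ?_⟩
          omega
        have hH : ¬ TrimV a lo hi (z - (0, 1)) := by
          intro hH
          have hV : ¬ TrimH a lo hi (z - (0, 1)) := fun hV => h2' ⟨hw, hV, hH⟩
          simp only [TrimV, Prod.fst_sub, Prod.snd_sub, sub_zero] at hH
          have hfar : -(z.2 - 1) = a 0 := by
            by_contra hf
            apply hV
            simp only [TrimH, Prod.fst_sub, Prod.snd_sub, sub_zero]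
            clear h1' h2' hz hz' hH hV hpV hpH
            omega
          have e1 : z.2 - 1 = p.2 := by
            clear h1' h2' hV hpV hpH hz
            omega
          have e2 : z.1 = p.1 := by omega
          have e3 : z - (0, 1) = p := Prod.ext (by simp only [Prod.fst_sub, sub_zero]; omega)
            (by simp only [Prod.snd_sub]; omega)
          exact hV (e3 ▸ hpV)
        refine ⟨⟨hw, hH⟩, ?_⟩
        clear h1' h2' hH hpV hpH hz
        omega
  by_cases hi2 : z.1 = a 3
  · obtain ⟨p, hp, hpe⟩ := h.mem 3
    rw [mem_trim, mem_oct'] at hp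
    have hne := h.ne 3
    have hlo := h.lo_le 3
    have hhi := h.le_hi 3
    rw [show (3 + 3 : Fin 4) = 2 from rfl] at hlo
    simp only [ax_three] at hpe
    obtain ⟨hp, hpV, hpH⟩ := hp
    clear h
    have hpH' := hpH
    simp only [TrimV] at hpH'
    by_cases hz : TrimV a lo hi z
    · exfalso
      have hz' := hz
      simp only [TrimV] at hz'
      have hzo : (-z.2 ≤ a 0 ∧ -z.1 ≤ a 1 ∧ z.2 ≤ a 2 ∧ z.1 ≤ a 3) ∧ -z.2 - z.1 ≤ d 0 ∧
          -z.1 + z.2 ≤ d 1 ∧ z.2 + z.1 ≤ d 2 ∧ z.1 - z.2 ≤ d 3 := by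
        clear h1' h2' hpV hz hpH hpH'
        refine ⟨h1.1, ?_⟩
        omega
      have hV' : ¬ TrimH a lo hi z := fun hV => h1' ⟨hzo, hV, hz⟩
      have hfar : z.2 = a 2 := by
        by_contra hf
        apply hV'
        simp only [TrimH]
        omega
      have hw : (-(z.2 - 1) ≤ a 0 ∧ -z.1 ≤ a 1 ∧ (z.2 - 1) ≤ a 2 ∧ z.1 ≤ a 3) ∧ -(z.2 - 1) - z.1 ≤ d 0 ∧
          -z.1 + (z.2 - 1) ≤ d 1 ∧ (z.2 - 1) + z.1 ≤ d 2 ∧ z.1 - (z.2 - 1) ≤ d 3 := by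
        clear h1' h2' hpV hz hpH hpH' hV'
        refine ⟨h2.1, ?_⟩
        omega
      have hV : TrimH a lo hi (z - (0, 1)) := by
        clear h1' h2' hpV hz hpH hpH' hV' hz'
        simp only [TrimH, Prod.fst_sub, Prod.snd_sub, sub_zero]
        omega
      have hH : ¬ TrimV a lo hi (z - (0, 1)) := fun hH => h2' ⟨hw, hV, hH⟩
      simp only [TrimV, Prod.fst_sub, Prod.snd_sub, sub_zero] at hH
      have e1 : z.2 = p.2 := by
        clear h1' h2' hpV hz hpH hV' hV
        omega
      have e2 : z.1 = p.1 := by omega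
      have e3 : z = p := Prod.ext (by omega) (by omega)
      exact hV' (e3 ▸ hpV)
    · by_cases hl : hi 3 < -z.2
      · left
        refine ⟨⟨⟨h1.1, ?_⟩, hz⟩, by omega⟩
        clear h1' h2' hpV hz hpH
        omega
      · right
        have hz' := hz
        simp only [TrimV] at hz'
        have hw : (-(z.2 - 1) ≤ a 0 ∧ -z.1 ≤ a 1 ∧ (z.2 - 1) ≤ a 2 ∧ z.1 ≤ a 3) ∧ -(z.2 - 1) - z.1 ≤ d 0 ∧
            -z.1 + (z.2 - 1) ≤ d 1 ∧ (z.2 - 1) + z.1 ≤ d 2 ∧ z.1 - (z.2 - 1) ≤ d 3 := by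
          clear h1' h2' hpV hz hpH
          refine ⟨h2.1, ?_⟩
          omega
        have hH : ¬ TrimV a lo hi (z - (0, 1)) := by
          intro hH
          have hV : ¬ TrimH a lo hi (z - (0, 1)) := fun hV => h2' ⟨hw, hV, hH⟩
          simp only [TrimV, Prod.fst_sub, Prod.snd_sub, sub_zero] at hH
          have hfar : -(z.2 - 1) = a 0 := by
            by_contra hf
            apply hV
            simp only [TrimH, Prod.fst_sub, Prod.snd_sub, sub_zero]
            clear h1' h2' hz hz' hH hV hpV hpH
            omega
          have e1 : z.2 - 1 = p.2 := by
            clear h1' h2' hV hpV hpH hz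
            omega
          have e2 : z.1 = p.1 := by omega
          have e3 : z - (0, 1) = p := Prod.ext (by simp only [Prod.fst_sub, sub_zero]; omega)
            (by simp only [Prod.snd_sub]; omega)
          exact hV (e3 ▸ hpV)
        refine ⟨⟨hw, hH⟩, ?_⟩
        clear h1' h2' hH hpV hpH hz
        omega
  · exfalso
    clear h
    have k1 : TrimV a lo hi z := by simp only [TrimV]; omega
    have k2 : TrimV a lo hi (z - (0, 1)) := by
      simp only [TrimV, Prod.fst_sub, Prod.snd_sub]; omega
    have k3 : -z.2 = a 0 ∨ z.2 = a 2 ∨ TrimH a lo hi z := by simp only [TrimH]; omega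
    have k4 : -(z.2 - 1) = a 0 ∨ z.2 - 1 = a 2 ∨ TrimH a lo hi (z - (0, 1)) := by
      simp only [TrimH, Prod.fst_sub, Prod.snd_sub]; omega
    simp only [k1, k2, and_true] at h1' h2'
    rw [not_and_or] at h1' h2'
    rcases h1' with h1' | h1'
    · rcases h2' with h2' | h2'
      · omega
      · simp only [h2', or_false] at k4
        omega
    · simp only [h1', or_false] at k3
      rcases h2' with h2' | h2'
      · omega
      · simp only [h2', or_false] at k4
        omega

/-- All lines of the trimmed octagon and of its union with `Z` are intervals, so beyond 4 per line
only adjacencies in `Z` count. Corner sites have none among themselves: the total is at most the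
number of removed sites. -/
theorem cost_trim_le {k : ℝ} (hk : -1 < k) {a d lo hi : Fin 4 → ℤ} (h : TrimOK a d lo hi)
    {Z : Finset Site} (hZ : Z ⊆ octPlus a d \ trim a d lo hi) (hR : oct a d \ trim a d lo hi ⊆ Z) :
    cost k (trim a d lo hi) Z ≤
      4 * (∑ i, (a i : ℝ) + 2) + (1 + k) * ((oct a d \ trim a d lo hi).card : ℝ) := by
  classical
  have hsub : trim a d lo hi ⊆ oct a d := fun p hp => (mem_trim.1 hp).1
  have hdis : Disjoint (trim a d lo hi) Z :=
    Finset.disjoint_left.2 fun p hp hp' => (Finset.mem_sdiff.1 (hZ hp')).2 hp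
  have hZ1 : ∀ z ∈ Z, z ∈ octPlus a d := fun z hz => (Finset.mem_sdiff.1 (hZ hz)).1
  have u1 : oct a d ⊆ trim a d lo hi ∪ Z := by
    intro p hp
    by_cases hp' : p ∈ trim a d lo hi
    · exact Finset.mem_union_left _ hp'
    · exact Finset.mem_union_right _ (hR (Finset.mem_sdiff.2 ⟨hp, hp'⟩))
  have u2 : trim a d lo hi ∪ Z ⊆ octPlus a d :=
    Finset.union_subset (hsub.trans (oct_subset_octPlus a d)) hZ1
  have er : ∀ y, rowOf (trim a d lo hi) y ∪ rowOf Z y = rowOf (trim a d lo hi ∪ Z) y := by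
    intro y; ext x; simp
  have ec : ∀ y, colOf (trim a d lo hi) y ∪ colOf Z y = colOf (trim a d lo hi ∪ Z) y := by
    intro y; ext x; simp
  have key := cost_upper (k := k) hdis
    (fun z hz => by
      have := mem_octPlus'.1 (hZ1 z hz)
      obtain ⟨x, hx⟩ := exists_mem_trim_row h (y := z.2) (by omega) (by omega)
      exact Finset.mem_image.2 ⟨_, hx, rfl⟩)
    (fun z hz => by
      have := mem_octPlus'.1 (hZ1 z hz)
      obtain ⟨x, hx⟩ := exists_mem_trim_col h (x := z.1) (by omega) (by omega)
      exact Finset.mem_image.2 ⟨_, hx, rfl⟩)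
    (trim_lineConvex_row a d lo hi) (trim_lineConvex_col a d lo hi)
    (fun y => by rw [er]; exact lineConvex_row_between u1 u2 y)
    (fun y => by rw [ec]; exact lineConvex_col_between u1 u2 y)
  have hT := h.tight.expand
  have c1 := Finset.card_le_card (image_fst_oct _ hsub)
  have c2 := Finset.card_le_card (image_snd_oct _ hsub)
  rw [Int.card_Icc] at c1 c2
  have c1' : (((trim a d lo hi).image Prod.fst).card : ℝ) ≤ a 1 + a 3 + 1 := by
    have : (((trim a d lo hi).image Prod.fst).card : ℤ) ≤ a 1 + a 3 + 1 := by omega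
    exact_mod_cast this
  have c2' : (((trim a d lo hi).image Prod.snd).card : ℝ) ≤ a 0 + a 2 + 1 := by
    have : (((trim a d lo hi).image Prod.snd).card : ℤ) ≤ a 0 + a 2 + 1 := by omega
    exact_mod_cast this
  have hadj : adjE (1, 0) Z + adjE (0, 1) Z ≤ (oct a d \ trim a d lo hi).card := by
    refine (Nat.add_le_add (adjE_row_le h hZ) (adjE_col_le h hZ)).trans ?_
    rw [← Finset.card_union_of_disjoint]
    · apply Finset.card_le_card
      intro p hp
      rw [Finset.mem_sdiff, mem_trim]
      simp only [Finset.mem_union, Finset.mem_filter] at hp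
      tauto
    · refine Finset.disjoint_left.2 fun p hp hp' => ?_
      simp only [Finset.mem_filter] at hp hp'
      have := h.once p hp.1
      tauto
  have hadj' : (adjE (1, 0) Z : ℝ) + adjE (0, 1) Z ≤ (oct a d \ trim a d lo hi).card := by
    exact_mod_cast hadj
  rw [Fin.sum_univ_four]
  nlinarith

/-! ### The dissipation -/

/-- The `ℓ¹` distance of a site of `oct A D` from the complement. -/
noncomputable def dep (A D : Fin 4 → ℤ) (p : Site) : ℤ :=
  min (min (min (A 0 - ax 0 p) (A 1 - ax 1 p)) (min (A 2 - ax 2 p) (A 3 - ax 3 p)))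
    (min (min (D 0 - dg 0 p) (D 1 - dg 1 p)) (min (D 2 - dg 2 p) (D 3 - dg 3 p))) + 1

theorem le_dep {A D : Fin 4 → ℤ} {p : Site} {m : ℤ} :
    m ≤ dep A D p ↔ (∀ i, ax i p + m ≤ A i + 1) ∧ ∀ i, dg i p + m ≤ D i + 1 := by
  rw [forall_fin4, forall_fin4, dep]
  omega

theorem dep_le_ax (A D : Fin 4 → ℤ) (p : Site) (i : Fin 4) : dep A D p ≤ A i - ax i p + 1 := by
  have := (le_dep.1 (le_refl (dep A D p))).1 i
  omega

theorem dep_le_dg (A D : Fin 4 → ℤ) (p : Site) (i : Fin 4) : dep A D p ≤ D i - dg i p + 1 := by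
  have := (le_dep.1 (le_refl (dep A D p))).2 i
  omega

theorem one_le_dep {A D : Fin 4 → ℤ} {p : Site} : 1 ≤ dep A D p ↔ p ∈ oct A D := by
  rw [le_dep, mem_oct]
  simp

/-- The dissipation in units of `ε ^ 3`; outside of the octagon a lower bound is used. -/
noncomputable def Dis (A D : Fin 4 → ℤ) (P : Finset Site) : ℤ :=
  ∑ p ∈ oct A D \ P, dep A D p + ((P \ oct A D).card : ℤ)

theorem Dis_of_subset {A D : Fin 4 → ℤ} {P : Finset Site} (h : P ⊆ oct A D) :
    Dis A D P = ∑ p ∈ oct A D \ P, dep A D p := by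
  simp [Dis, Finset.sdiff_eq_empty_iff_subset.2 h]

theorem Dis_nonneg (A D : Fin 4 → ℤ) (P : Finset Site) : 0 ≤ Dis A D P := by
  unfold Dis
  have : 0 ≤ ∑ p ∈ oct A D \ P, dep A D p := Finset.sum_nonneg fun p hp => by
    have := one_le_dep.2 (Finset.mem_sdiff.1 hp).1
    omega
  omega

theorem Dis_add_sum {A D : Fin 4 → ℤ} {P Q : Finset Site} (hPQ : P ⊆ Q) (hQ : Q ⊆ oct A D) :
    Dis A D P = Dis A D Q + ∑ p ∈ Q \ P, dep A D p := by
  rw [Dis_of_subset hQ, Dis_of_subset (hPQ.trans hQ), ← Finset.sum_union]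
  · congr 1
    ext p
    simp only [Finset.mem_sdiff, Finset.mem_union]
    constructor
    · intro h; by_cases hp : p ∈ Q
      · exact Or.inr ⟨hp, h.2⟩
      · exact Or.inl ⟨h.1, hp⟩
    · rintro (h | h)
      · exact ⟨h.1, fun h' => h.2 (hPQ h')⟩
      · exact ⟨hQ h.1, h.2⟩
  · exact Finset.disjoint_left.2 fun p h h' => (Finset.mem_sdiff.1 h).2 (Finset.mem_sdiff.1 h').1

/-- A minimizer among the configurations with `C` surfactant sites, for the incremental problem with
datum an octagon. -/
structure Ctx (k δ : ℝ) (A D : Fin 4 → ℤ) (C : ℕ) (P Z : Finset Site) : Prop where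
  disj : Disjoint P Z
  card : Z.card = C
  le_sum : (C : ℤ) ≤ ∑ i, tS A D i
  hk : 0 < k
  hk1 : k < 1
  hδ : 0 < δ
  -- Competitors stay inside the datum, where `Dis` is the exact dissipation; for `P` itself it is
  -- only a lower bound.
  min : ∀ P' Z' : Finset Site, P' ⊆ oct A D → Disjoint P' Z' → Z'.card = C →
    cost k P Z + δ * Dis A D P ≤ cost k P' Z' + δ * Dis A D P'

section
variable {k δ : ℝ} {A D : Fin 4 → ℤ} {C : ℕ} {P Z : Finset Site}

theorem card_octPlus_sdiff_trim {a d lo hi : Fin 4 → ℤ} (hT : Tight 3 a d) :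
    ((octPlus a d \ trim a d lo hi).card : ℤ) =
      ∑ i, tS a d i + (oct a d \ trim a d lo hi).card := by
  rw [← card_octPlus_sdiff hT, ← Nat.cast_add, ← Finset.card_union_of_disjoint]
  · congr 2
    ext p
    have h1 : p ∈ trim a d lo hi → p ∈ oct a d := fun hp => (mem_trim.1 hp).1
    have h2 : p ∈ oct a d → p ∈ octPlus a d := fun hp => oct_subset_octPlus a d hp
    simp only [Finset.mem_sdiff, Finset.mem_union]
    tauto
  · exact Finset.disjoint_left.2 fun p h h' => (Finset.mem_sdiff.1 h).2 (Finset.mem_sdiff.1 h').1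

/-- Comparison with an octagon with trimmed slices. -/
theorem Ctx.le_trim (h : Ctx k δ A D C P Z) {a d lo hi : Fin 4 → ℤ} (hT : TrimOK a d lo hi)
    (ha : ∀ i, a i ≤ A i) (hd : ∀ i, d i ≤ D i) (hC1 : (oct a d \ trim a d lo hi).card ≤ C)
    (hC2 : (C : ℤ) ≤ ∑ i, tS a d i + (oct a d \ trim a d lo hi).card) :
    cost k P Z + δ * Dis A D P ≤ 4 * (∑ i, (a i : ℝ) + 2) +
      (1 + k) * ((oct a d \ trim a d lo hi).card : ℝ) + δ * Dis A D (trim a d lo hi) := by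
  have hsub : oct a d \ trim a d lo hi ⊆ octPlus a d \ trim a d lo hi :=
    Finset.sdiff_subset_sdiff (oct_subset_octPlus a d) le_rfl
  have hcard := card_octPlus_sdiff_trim (lo := lo) (hi := hi) hT.tight
  obtain ⟨Z', h1, h2, h3⟩ := Finset.exists_subsuperset_card_eq hsub hC1 (by omega)
  have := cost_trim_le (k := k) (by linarith [h.hk]) hT h2 h1
  have := h.min (trim a d lo hi) Z'
    (fun p hp => oct_subset_oct ha hd (mem_trim.1 hp).1)
    (Finset.disjoint_left.2 fun p hp hp' => (Finset.mem_sdiff.1 (h2 hp')).2 hp) h3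
  linarith

/-- Comparison with an octagon, where `s` surfactant sites replace one end of the lowest slice. -/
theorem Ctx.le_oct (h : Ctx k δ A D C P Z) {a d : Fin 4 → ℤ} (hT : Tight 3 a d)
    (ha : ∀ i, a i ≤ A i) (hd : ∀ i, d i ≤ D i) {s : ℕ} (hs : (s : ℤ) + 3 ≤ pS a d 0) (hsC : s ≤ C)
    (hC : (C : ℤ) ≤ ∑ i, tS a d i + s) :
    cost k P Z + δ * Dis A D P ≤ 4 * (∑ i, (a i : ℝ) + 2) + (1 + k) * (s : ℝ) +
      δ * (Dis A D (oct a d) + s * (A 0 - a 0 + 1) : ℤ) := by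
  set lo : Fin 4 → ℤ := fun i => a i - d (i + 3) with hlo
  set hi : Fin 4 → ℤ := fun i => d i - a i - if i = 0 then (s : ℤ) else 0 with hhi
  have e := hT.expand
  rw [pS_zero] at hs
  have lo0 : lo 0 = a 0 - d 3 := rfl
  have lo1 : lo 1 = a 1 - d 0 := rfl
  have lo2 : lo 2 = a 2 - d 1 := rfl
  have lo3 : lo 3 = a 3 - d 2 := rfl
  have hi0 : hi 0 = d 0 - a 0 - s := by simp [hhi]
  have hi1 : hi 1 = d 1 - a 1 := by simp [hhi]
  have hi2 : hi 2 = d 2 - a 2 := by simp [hhi]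
  have hi3 : hi 3 = d 3 - a 3 := by simp [hhi]
  have hR : oct a d \ trim a d lo hi =
      (Finset.Ioc (d 0 - a 0 - s) (d 0 - a 0)).image fun v => pt 0 (a 0) v := by
    ext p
    rw [Finset.mem_sdiff, mem_trim, Finset.mem_image]
    simp only [Finset.mem_Ioc]
    constructor
    · rintro ⟨h1, h2⟩
      rw [mem_oct'] at h1
      have hp2 : -p.2 = a 0 ∧ hi 0 < -p.1 := by
        by_contra hcon
        refine h2 ⟨mem_oct'.2 h1, ?_, ?_⟩
        · simp only [TrimH]; clear h2; omega
        · simp only [TrimV]; clear h2; omega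
      refine ⟨-p.1, ?_, ?_⟩
      · clear h2; omega
      · rw [pt_zero]; exact Prod.ext (by simp) (by simp; omega)
    · rintro ⟨v, hv, rfl⟩
      rw [pt_zero]
      refine ⟨mem_oct'.2 ?_, fun hh => ?_⟩
      · dsimp only; omega
      · have := hh.2.1.1
        dsimp only at this
        omega
  have hcard : (oct a d \ trim a d lo hi).card = s := by
    rw [hR, Finset.card_image_of_injective _ fun u v huv => by
      have := congrArg (ax (0 + 1)) huv; rwa [ax_succ_pt, ax_succ_pt] at this, Int.card_Ioc]
    omega
  have hOK : TrimOK a d lo hi := by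
    refine ⟨hT, fun i => le_rfl, forall_fin4.2 ?_, forall_fin4.2 ?_, forall_fin4.2 ⟨?_, ?_, ?_, ?_⟩, ?_⟩
    · omega
    · omega
    · refine ⟨(d 3 - a 0, -a 0), ?_, by simp⟩
      rw [mem_trim, mem_oct']; simp only [TrimH, TrimV]; omega
    · refine ⟨(-a 1, d 1 - a 1), ?_, by simp⟩
      rw [mem_trim, mem_oct']; simp only [TrimH, TrimV]; omega
    · refine ⟨(a 2 - d 1, a 2), ?_, by simp⟩
      rw [mem_trim, mem_oct']; simp only [TrimH, TrimV]; omega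
    · refine ⟨(a 3, d 2 - a 3), ?_, by simp⟩
      rw [mem_trim, mem_oct']; simp only [TrimH, TrimV]; omega
    · intro p hp
      right
      rw [mem_oct'] at hp
      simp only [TrimV]; omega
  have key := h.le_trim hOK ha hd (hcard.le.trans hsC) (by rw [hcard]; exact hC)
  rw [hcard] at key
  have hsub : trim a d lo hi ⊆ oct a d := fun p hp => (mem_trim.1 hp).1
  have hD := Dis_add_sum hsub (oct_subset_oct ha hd)
  have hsum : ∑ p ∈ oct a d \ trim a d lo hi, dep A D p ≤ s * (A 0 - a 0 + 1) := by
    rw [← hcard]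
    have := Finset.sum_le_card_nsmul (oct a d \ trim a d lo hi) (dep A D) (A 0 - a 0 + 1) ?_
    · simpa using this
    · intro p hp
      rw [hR] at hp
      obtain ⟨v, -, rfl⟩ := Finset.mem_image.1 hp
      have := dep_le_ax A D (pt 0 (a 0) v) 0
      rwa [ax_pt] at this
  have hfin : ((Dis A D (trim a d lo hi) : ℤ) : ℝ) ≤ (Dis A D (oct a d) + s * (A 0 - a 0 + 1) : ℤ) := by
    exact_mod_cast (by rw [hD]; omega)
  have := mul_le_mul_of_nonneg_left hfin h.hδ.le
  linarith
end

/-! ### Support values -/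

/-- The support value of a finite set of sites in the `i`-th axis direction. -/
noncomputable def sA (S : Finset Site) (i : Fin 4) : ℤ :=
  if h : S.Nonempty then S.sup' h (ax i) else 0

/-- The support value of a finite set of sites in the `i`-th diagonal direction. -/
noncomputable def sD (S : Finset Site) (i : Fin 4) : ℤ :=
  if h : S.Nonempty then S.sup' h (dg i) else 0

theorem le_sA {S : Finset Site} {p : Site} (hp : p ∈ S) (i : Fin 4) : ax i p ≤ sA S i := by
  rw [sA, dif_pos ⟨p, hp⟩]; exact Finset.le_sup' (ax i) hp

theorem le_sD {S : Finset Site} {p : Site} (hp : p ∈ S) (i : Fin 4) : dg i p ≤ sD S i := by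
  rw [sD, dif_pos ⟨p, hp⟩]; exact Finset.le_sup' (dg i) hp

theorem exists_sA {S : Finset Site} (h : S.Nonempty) (i : Fin 4) : ∃ p ∈ S, ax i p = sA S i := by
  obtain ⟨p, hp, e⟩ := Finset.exists_mem_eq_sup' h (ax i)
  exact ⟨p, hp, by rw [sA, dif_pos h, e]⟩

theorem exists_sD {S : Finset Site} (h : S.Nonempty) (i : Fin 4) : ∃ p ∈ S, dg i p = sD S i := by
  obtain ⟨p, hp, e⟩ := Finset.exists_mem_eq_sup' h (dg i)
  exact ⟨p, hp, by rw [sD, dif_pos h, e]⟩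

theorem sA_mono {S T : Finset Site} (hS : S.Nonempty) (h : S ⊆ T) (i : Fin 4) :
    sA S i ≤ sA T i := by
  obtain ⟨p, hp, e⟩ := exists_sA hS i
  rw [← e]; exact le_sA (h hp) i

theorem sD_mono {S T : Finset Site} (hS : S.Nonempty) (h : S ⊆ T) (i : Fin 4) :
    sD S i ≤ sD T i := by
  obtain ⟨p, hp, e⟩ := exists_sD hS i
  rw [← e]; exact le_sD (h hp) i

theorem subset_oct_sA (S : Finset Site) : S ⊆ oct (sA S) (sD S) := fun _ hp =>
  mem_oct.2 ⟨le_sA hp, le_sD hp⟩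

theorem tS_support_nonneg {S : Finset Site} (hS : S.Nonempty) (i : Fin 4) :
    0 ≤ tS (sA S) (sD S) i := by
  obtain ⟨p, hp, e⟩ := exists_sD hS i
  have h1 := le_sA hp i
  have h2 := le_sA hp (i + 1)
  unfold tS
  unfold dg at e
  omega

theorem ax_succ_succ (i : Fin 4) (p : Site) : ax (i + 1 + 1) p = -ax i p := by
  revert i; rw [forall_fin4]
  refine ⟨?_, ?_, ?_, ?_⟩
  · rw [show (0 + 1 + 1 : Fin 4) = 2 from rfl]; simp
  · rw [show (1 + 1 + 1 : Fin 4) = 3 from rfl]; simp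
  · rw [show (2 + 1 + 1 : Fin 4) = 0 from rfl]; simp
  · rw [show (3 + 1 + 1 : Fin 4) = 1 from rfl]; simp

theorem ax_add_three (i : Fin 4) (p : Site) : ax (i + 3) p = -ax (i + 1) p := by
  rw [← ax_succ_succ (i + 1), add_assoc, add_assoc]; rfl

theorem ax_sub (i : Fin 4) (p q : Site) : ax i (p - q) = ax i p - ax i q := by
  simp [ax]; ring

theorem ax_add (i : Fin 4) (p q : Site) : ax i (p + q) = ax i p + ax i q := by
  simp [ax]; ring

@[simp] theorem ax_axisDir (i : Fin 4) : ax i (axisDir i) = 1 := by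
  revert i; rw [forall_fin4]; simp

@[simp] theorem ax_succ_axisDir (i : Fin 4) : ax (i + 1) (axisDir i) = 0 := by
  revert i; rw [forall_fin4]
  refine ⟨?_, ?_, ?_, ?_⟩
  · rw [show (0 + 1 : Fin 4) = 1 from rfl]; simp
  · rw [show (1 + 1 : Fin 4) = 2 from rfl]; simp
  · rw [show (2 + 1 : Fin 4) = 3 from rfl]; simp
  · rw [show (3 + 1 : Fin 4) = 0 from rfl]; simp

@[simp] theorem ax_axisDir_succ (i : Fin 4) : ax i (axisDir (i + 1)) = 0 := by
  have := ax_succ_axisDir (i + 1)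
  rw [ax_succ_succ] at this
  omega

theorem mem_nbrs {a b : Site} : b ∈ nbrs a ↔
    (b.1 = a.1 + 1 ∧ b.2 = a.2) ∨ (b.1 = a.1 - 1 ∧ b.2 = a.2) ∨ (b.1 = a.1 ∧ b.2 = a.2 + 1) ∨
      (b.1 = a.1 ∧ b.2 = a.2 - 1) := by
  simp [nbrs, Prod.ext_iff]

theorem nbrs_ax {a b : Site} (h : b ∈ nbrs a) (i : Fin 4) :
    (ax i b = ax i a ∧ (ax (i + 1) b = ax (i + 1) a + 1 ∨ ax (i + 1) b = ax (i + 1) a - 1)) ∨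
    (ax (i + 1) b = ax (i + 1) a ∧ (ax i b = ax i a + 1 ∨ ax i b = ax i a - 1)) := by
  rw [mem_nbrs] at h
  revert i; rw [forall_fin4, show (0 + 1 : Fin 4) = 1 from rfl, show (1 + 1 : Fin 4) = 2 from rfl,
    show (2 + 1 : Fin 4) = 3 from rfl, show (3 + 1 : Fin 4) = 0 from rfl]
  simp only [ax_zero, ax_one, ax_two, ax_three]
  omega

/-! ### Connected components -/

/-- `M` is a connected component of `P`. -/
structure IsComp (P M : Finset Site) : Prop where
  sub : M ⊆ P
  ne : M.Nonempty
  conn : ∀ p ∈ M, ∀ q ∈ M, Relation.ReflTransGen (fun a b : Site => b ∈ nbrs a ∧ b ∈ M) p q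
  closed : ∀ p ∈ M, ∀ q ∈ P, q ∈ nbrs p → q ∈ M

theorem IsComp.of_step {P M : Finset Site} (h : IsComp P M) {S : Site → Prop}
    (hS : ∀ a ∈ M, ∀ b ∈ M, b ∈ nbrs a → S a → S b) {p q : Site} (hp : p ∈ M) (hq : q ∈ M)
    (hSp : S p) : S q := by
  have : ∀ r, Relation.ReflTransGen (fun a b : Site => b ∈ nbrs a ∧ b ∈ M) p r → r ∈ M ∧ S r := by
    intro r hr
    induction hr with
    | refl => exact ⟨hp, hSp⟩
    | tail _ hbc ih => exact ⟨hbc.2, hS _ ih.1 _ hbc.2 hbc.1 ih.2⟩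
  exact (this q (h.conn p hp q hq)).2

theorem nbrs_symm {a b : Site} (h : b ∈ nbrs a) : a ∈ nbrs b := by
  rw [mem_nbrs] at h ⊢; omega

open Classical in
theorem exists_isComp {P : Finset Site} {p : Site} (hp : p ∈ P) : ∃ M, IsComp P M ∧ p ∈ M ∧
    ∀ q, Relation.ReflTransGen (fun a b : Site => b ∈ nbrs a ∧ b ∈ P) p q → q ∈ M := by
  set R : Site → Site → Prop := fun a b => b ∈ nbrs a ∧ b ∈ P with hR
  set M := P.filter fun q => Relation.ReflTransGen R p q with hM
  have hMem : ∀ q, Relation.ReflTransGen R p q → q ∈ M := by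
    intro q hq
    rw [hM, Finset.mem_filter]
    refine ⟨?_, hq⟩
    cases hq with
    | refl => exact hp
    | tail _ h => exact h.2
  have fwd : ∀ q, Relation.ReflTransGen R p q →
      Relation.ReflTransGen (fun a b : Site => b ∈ nbrs a ∧ b ∈ M) p q := by
    intro q hq
    induction hq with
    | refl => exact .refl
    | tail h1 h2 ih => exact ih.tail ⟨h2.1, hMem _ (h1.tail h2)⟩
  have bwd : ∀ q, Relation.ReflTransGen R p q →
      Relation.ReflTransGen (fun a b : Site => b ∈ nbrs a ∧ b ∈ M) q p := by
    intro q hq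
    induction hq with
    | refl => exact .refl
    | tail h1 h2 ih => exact .head ⟨nbrs_symm h2.1, hMem _ h1⟩ ih
  refine ⟨M, ⟨Finset.filter_subset _ _, ⟨p, hMem p .refl⟩, ?_, ?_⟩, hMem p .refl, hMem⟩
  · intro a ha b hb
    exact (bwd a (Finset.mem_filter.1 ha).2).trans (fwd b (Finset.mem_filter.1 hb).2)
  · intro a ha b hb hab
    exact hMem b ((Finset.mem_filter.1 ha).2.tail ⟨hab, hb⟩)

/-- Discrete intermediate value property: a step between neighbours changes a coordinate by at most
one. -/
theorem IsComp.exists_ax_eq {P M : Finset Site} (h : IsComp P M) {i : Fin 4} {p q : Site}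
    (hp : p ∈ M) (hq : q ∈ M) {c : ℤ} (h1 : ax i p ≤ c) (h2 : c ≤ ax i q) : ∃ r ∈ M, ax i r = c := by
  by_contra hcon
  push Not at hcon
  have := h.of_step (S := fun r => ax i r < c) (fun a ha b hb hab hlt => by
    have h1 := hcon b hb
    have h2 := nbrs_ax hab i
    omega) hp hq (lt_of_le_of_ne h1 (hcon p hp))
  omega

theorem IsComp.image_fst {P M : Finset Site} (h : IsComp P M) :
    M.image Prod.fst = Finset.Icc (-sA M 1) (sA M 3) := by
  ext x
  rw [Finset.mem_image, Finset.mem_Icc]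
  constructor
  · rintro ⟨p, hp, rfl⟩
    have h1 := le_sA hp 1
    have h3 := le_sA hp 3
    simp only [ax_one, ax_three] at h1 h3
    omega
  · rintro ⟨h1, h2⟩
    obtain ⟨p, hp, ep⟩ := exists_sA h.ne 1
    obtain ⟨q, hq, eq⟩ := exists_sA h.ne 3
    simp only [ax_one] at ep
    obtain ⟨r, hr, er⟩ := h.exists_ax_eq (i := 3) hp hq (c := x) (by simp; omega) (by omega)
    exact ⟨r, hr, by simpa using er⟩

theorem IsComp.image_snd {P M : Finset Site} (h : IsComp P M) :
    M.image Prod.snd = Finset.Icc (-sA M 0) (sA M 2) := by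
  ext x
  rw [Finset.mem_image, Finset.mem_Icc]
  constructor
  · rintro ⟨p, hp, rfl⟩
    have h1 := le_sA hp 0
    have h3 := le_sA hp 2
    simp only [ax_zero, ax_two] at h1 h3
    omega
  · rintro ⟨h1, h2⟩
    obtain ⟨p, hp, ep⟩ := exists_sA h.ne 0
    obtain ⟨q, hq, eq⟩ := exists_sA h.ne 2
    simp only [ax_zero] at ep
    obtain ⟨r, hr, er⟩ := h.exists_ax_eq (i := 2) hp hq (c := x) (by simp; omega) (by omega)
    exact ⟨r, hr, by simpa using er⟩

/-! ### Corner sites -/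

/-- Surfactant sites in a corner of the `i`-th quadrant. -/
def corSet (i : Fin 4) (P Z : Finset Site) : Finset Site := leadSet i P Z ∩ leadSet (i + 1) P Z

theorem leadSet_inj {i : Fin 4} {P Z : Finset Site} {z w : Site} (hz : z ∈ leadSet i P Z)
    (hw : w ∈ leadSet i P Z) (h : ax (i + 1) z = ax (i + 1) w) : z = w := by
  rw [mem_leadSet] at hz hw
  have h1 := hz.2.2 _ hw.2.1 (by rw [ax_sub, ax_succ_axisDir]; omega)
  have h2 := hw.2.2 _ hz.2.1 (by rw [ax_sub, ax_succ_axisDir]; omega)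
  rw [ax_sub, ax_axisDir] at h1 h2
  exact site_ext (i := i) (by omega) h

theorem corSet_inj {i : Fin 4} {P Z : Finset Site} {z w : Site} (hz : z ∈ corSet i P Z)
    (hw : w ∈ corSet i P Z) (h : ax i z = ax i w) : z = w := by
  refine leadSet_inj (Finset.mem_inter.1 hz).2 (Finset.mem_inter.1 hw).2 ?_
  rw [ax_succ_succ, ax_succ_succ, h]

theorem corSet_inj' {i : Fin 4} {P Z : Finset Site} {z w : Site} (hz : z ∈ corSet i P Z)
    (hw : w ∈ corSet i P Z) (h : ax (i + 1) z = ax (i + 1) w) : z = w :=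
  leadSet_inj (Finset.mem_inter.1 hz).1 (Finset.mem_inter.1 hw).1 h

/-- A connected set does not cross the two half lines starting from a corner site. -/
theorem IsComp.not_beyond {P M : Finset Site} (h : IsComp P M) {i : Fin 4} {z : Site}
    (hz : ∀ p ∈ P, ax (i + 1) p = ax (i + 1) z → ax i p < ax i z)
    (hz' : ∀ p ∈ P, ax i p = ax i z → ax (i + 1) p < ax (i + 1) z)
    (hbox : -sA M (i + 1 + 1) ≤ ax i z) {q : Site} (hq : q ∈ M) :
    ax i q < ax i z ∨ ax (i + 1) q < ax (i + 1) z := by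
  by_contra hcon
  push Not at hcon
  have hq1 : ax i z < ax i q := by
    rcases eq_or_lt_of_le hcon.1 with h1 | h1
    · have := hz' q (h.sub hq) h1.symm; omega
    · exact h1
  have hq2 : ax (i + 1) z < ax (i + 1) q := by
    rcases eq_or_lt_of_le hcon.2 with h1 | h1
    · have := hz q (h.sub hq) h1.symm; omega
    · exact h1
  obtain ⟨p, hp, ep⟩ := exists_sA h.ne (i + 1 + 1)
  rw [ax_succ_succ] at ep
  -- A path in `M` cannot leave the open quadrant beyond `z` without meeting one of the two half
  -- lines. But `p`, extreme in the direction opposite to `i`, is outside this quadrant.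
  have := h.of_step (S := fun r => ax i z < ax i r ∧ ax (i + 1) z < ax (i + 1) r)
    (fun a ha b hb hab hS => by
      have h1 := nbrs_ax hab i
      have h2 := hz b (h.sub hb)
      have h3 := hz' b (h.sub hb)
      omega) hq hp ⟨hq1, hq2⟩
  omega

theorem corSet_rays {i : Fin 4} {P Z : Finset Site} {z : Site} (hz : z ∈ corSet i P Z) :
    (∀ p ∈ P, ax (i + 1) p = ax (i + 1) z → ax i p < ax i z) ∧
    (∀ p ∈ P, ax i p = ax i z → ax (i + 1) p < ax (i + 1) z) := by
  have h1 := mem_leadSet.1 (Finset.mem_inter.1 hz).1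
  have h2 := mem_leadSet.1 (Finset.mem_inter.1 hz).2
  refine ⟨h1.2.2, fun p hp e => h2.2.2 p hp ?_⟩
  rw [ax_succ_succ, ax_succ_succ, e]

-- Fix `q` in `M` of maximal diagonal coordinate. No corner has `q` beyond it, so each exceeds `q`
-- in one of the two coordinates, and either coordinate determines the corner. The available values
-- number `tS` in all; when the bound is attained, every value is taken.
open Classical in
theorem IsComp.card_corSet {P Z M : Finset Site} (h : IsComp P M) (i : Fin 4) :
    let B := (corSet i P Z).filter fun z => ∀ j, ax j z ≤ sA M j
    (B.card : ℤ) ≤ tS (sA M) (sD M) i ∧ (tS (sA M) (sD M) i ≤ B.card →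
      ∀ q ∈ M, dg i q = sD M i →
        (∀ u, ax i q < u → u ≤ sA M i → ∃ z ∈ corSet i P Z, ax i z = u) ∧
        (∀ v, ax (i + 1) q < v → v ≤ sA M (i + 1) → ∃ z ∈ corSet i P Z, ax (i + 1) z = v)) := by
  intro B
  have key : ∀ q ∈ M, dg i q = sD M i →
      (B.card : ℤ) ≤ tS (sA M) (sD M) i ∧ (tS (sA M) (sD M) i ≤ B.card →
        (∀ u, ax i q < u → u ≤ sA M i → ∃ z ∈ corSet i P Z, ax i z = u) ∧
        (∀ v, ax (i + 1) q < v → v ≤ sA M (i + 1) → ∃ z ∈ corSet i P Z, ax (i + 1) z = v)) := by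
    intro q hq eq
    set U := (B.filter fun z => ax i q < ax i z).image (ax i) with hU
    set V := (B.filter fun z => ax (i + 1) q < ax (i + 1) z).image (ax (i + 1)) with hV
    have hUc : U.card = (B.filter fun z => ax i q < ax i z).card :=
      Finset.card_image_of_injOn fun z hz w hw e => by
        simp only [B, Finset.coe_filter, Set.mem_ofPred_eq, Finset.mem_filter] at hz hw
        exact corSet_inj hz.1.1 hw.1.1 e
    have hVc : V.card = (B.filter fun z => ax (i + 1) q < ax (i + 1) z).card :=
      Finset.card_image_of_injOn fun z hz w hw e => by
        simp only [B, Finset.coe_filter, Set.mem_ofPred_eq, Finset.mem_filter] at hz hw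
        exact corSet_inj' hz.1.1 hw.1.1 e
    have hUs : U ⊆ Finset.Ioc (ax i q) (sA M i) := by
      intro u hu
      obtain ⟨z, hz, rfl⟩ := Finset.mem_image.1 hu
      simp only [B, Finset.mem_filter] at hz
      exact Finset.mem_Ioc.2 ⟨hz.2, hz.1.2 i⟩
    have hVs : V ⊆ Finset.Ioc (ax (i + 1) q) (sA M (i + 1)) := by
      intro u hu
      obtain ⟨z, hz, rfl⟩ := Finset.mem_image.1 hu
      simp only [B, Finset.mem_filter] at hz
      exact Finset.mem_Ioc.2 ⟨hz.2, hz.1.2 (i + 1)⟩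
    have hUl := Finset.card_le_card hUs
    have hVl := Finset.card_le_card hVs
    rw [Int.card_Ioc] at hUl hVl
    have hB : B.card ≤ (B.filter fun z => ax i q < ax i z).card +
        (B.filter fun z => ax (i + 1) q < ax (i + 1) z).card := by
      refine le_trans (Finset.card_le_card ?_) (Finset.card_union_le _ _)
      intro z hz
      have hz' := hz
      simp only [B, Finset.mem_filter] at hz
      obtain ⟨r1, r2⟩ := corSet_rays hz.1
      have h2 := hz.2 (i + 1 + 1)
      rw [ax_succ_succ] at h2
      rcases h.not_beyond r1 r2 (by omega) hq with h3 | h3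
      · exact Finset.mem_union_left _ (Finset.mem_filter.2 ⟨hz', h3⟩)
      · exact Finset.mem_union_right _ (Finset.mem_filter.2 ⟨hz', h3⟩)
    have h1 := le_sA hq i
    have h2 := le_sA hq (i + 1)
    have e : tS (sA M) (sD M) i = (sA M i - ax i q) + (sA M (i + 1) - ax (i + 1) q) := by
      unfold tS; rw [← eq]; unfold dg; ring
    refine ⟨by omega, fun hsat => ⟨fun u hu1 hu2 => ?_, fun u hu1 hu2 => ?_⟩⟩
    · have : U = Finset.Ioc (ax i q) (sA M i) :=
        Finset.eq_of_subset_of_card_le hUs (by rw [Int.card_Ioc]; omega)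
      have hu : u ∈ U := by rw [this, Finset.mem_Ioc]; exact ⟨hu1, hu2⟩
      obtain ⟨z, hz, rfl⟩ := Finset.mem_image.1 hu
      simp only [B, Finset.mem_filter] at hz
      exact ⟨z, hz.1.1, rfl⟩
    · have : V = Finset.Ioc (ax (i + 1) q) (sA M (i + 1)) :=
        Finset.eq_of_subset_of_card_le hVs (by rw [Int.card_Ioc]; omega)
      have hu : u ∈ V := by rw [this, Finset.mem_Ioc]; exact ⟨hu1, hu2⟩
      obtain ⟨z, hz, rfl⟩ := Finset.mem_image.1 hu
      simp only [B, Finset.mem_filter] at hz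
      exact ⟨z, hz.1.1, rfl⟩
  obtain ⟨q, hq, eq⟩ := exists_sD h.ne i
  exact ⟨(key q hq eq).1, fun hs q hq eq => (key q hq eq).2 hs⟩

/-! ### Lower bound of the cost -/

theorem disjoint_leadSet (i : Fin 4) (P Z : Finset Site) :
    Disjoint (leadSet i P Z) (leadSet (i + 1 + 1) P Z) := by
  refine Finset.disjoint_left.2 fun z h h' => ?_
  rw [mem_leadSet] at h h'
  have := h.2.2 _ h'.2.1 (by
    rw [ax_sub, ax_axisDir_succ]; omega)
  have e := ax_succ_succ i (axisDir (i + 1 + 1))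
  rw [ax_axisDir] at e
  rw [ax_sub] at this
  omega

/-- The surfactant sites in some corner. -/
def corAll (P Z : Finset Site) : Finset Site := Finset.univ.biUnion fun i => corSet i P Z

/-- The surfactant sites next to an extreme site of a line. -/
def leadAll (P Z : Finset Site) : Finset Site := Finset.univ.biUnion fun i => leadSet i P Z

theorem mem_corAll {P Z : Finset Site} {z : Site} : z ∈ corAll P Z ↔ ∃ i, z ∈ corSet i P Z := by
  simp [corAll]

theorem mem_leadAll {P Z : Finset Site} {z : Site} : z ∈ leadAll P Z ↔ ∃ i, z ∈ leadSet i P Z := by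
  simp [leadAll]

theorem leadAll_subset (P Z : Finset Site) : leadAll P Z ⊆ Z := fun z hz => by
  obtain ⟨i, hi⟩ := mem_leadAll.1 hz
  exact (mem_leadSet.1 hi).1

theorem corAll_subset (P Z : Finset Site) : corAll P Z ⊆ leadAll P Z := fun z hz => by
  obtain ⟨i, hi⟩ := mem_corAll.1 hz
  exact mem_leadAll.2 ⟨i, (Finset.mem_inter.1 hi).1⟩

/-- Opposite leading sets are disjoint, so a site is counted at most twice, and twice exactly when
it leads in two adjacent directions, that is, in a corner. -/
theorem sum_card_leadSet (P Z : Finset Site) :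
    ∑ i, (leadSet i P Z).card = (leadAll P Z).card + (corAll P Z).card := by
  have d0 : Disjoint (leadSet 0 P Z) (leadSet 2 P Z) := disjoint_leadSet 0 P Z
  have d1 : Disjoint (leadSet 1 P Z) (leadSet 3 P Z) := disjoint_leadSet 1 P Z
  have hG : leadAll P Z = (leadSet 0 P Z ∪ leadSet 2 P Z) ∪ (leadSet 1 P Z ∪ leadSet 3 P Z) := by
    ext z
    rw [mem_leadAll, Fin.exists_fin_succ, Fin.exists_fin_succ, Fin.exists_fin_succ,
      Fin.exists_fin_succ]
    simp only [Finset.mem_union]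
    simp
    tauto
  have hL : corAll P Z = (leadSet 0 P Z ∪ leadSet 2 P Z) ∩ (leadSet 1 P Z ∪ leadSet 3 P Z) := by
    ext z
    rw [mem_corAll, Fin.exists_fin_succ, Fin.exists_fin_succ, Fin.exists_fin_succ,
      Fin.exists_fin_succ]
    simp only [Finset.mem_union, Finset.mem_inter, corSet]
    simp
    tauto
  have := Finset.card_union_add_card_inter (leadSet 0 P Z ∪ leadSet 2 P Z)
    (leadSet 1 P Z ∪ leadSet 3 P Z)
  rw [Finset.card_union_of_disjoint d0, Finset.card_union_of_disjoint d1] at this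
  rw [hG, hL, this, Fin.sum_univ_four]
  ring

/-- A line carries at most one leading site on each of its two sides. -/
theorem card_filter_line_le {i : Fin 4} {P Z S : Finset Site} {E : Finset ℤ}
    (hS : S ⊆ leadSet i P Z ∪ leadSet (i + 1 + 1) P Z) (hE : ∀ z ∈ S, ax (i + 1) z ∈ E) :
    S.card ≤ 2 * E.card := by
  have h1 : (S ∩ leadSet i P Z).card ≤ E.card := by
    refine Finset.card_le_card_of_injOn (ax (i + 1)) (fun z hz => ?_) fun z hz w hw e => ?_
    · exact hE z (Finset.mem_inter.1 hz).1
    · exact leadSet_inj (Finset.mem_inter.1 (Finset.mem_coe.1 hz)).2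
        (Finset.mem_inter.1 (Finset.mem_coe.1 hw)).2 e
  have h2 : (S ∩ leadSet (i + 1 + 1) P Z).card ≤ E.card := by
    refine Finset.card_le_card_of_injOn (ax (i + 1)) (fun z hz => ?_) fun z hz w hw e => ?_
    · exact hE z (Finset.mem_inter.1 hz).1
    · refine leadSet_inj (Finset.mem_inter.1 (Finset.mem_coe.1 hz)).2
        (Finset.mem_inter.1 (Finset.mem_coe.1 hw)).2 ?_
      rw [ax_succ_succ, ax_succ_succ, e]
  have h3 : S ⊆ (S ∩ leadSet i P Z) ∪ (S ∩ leadSet (i + 1 + 1) P Z) := fun z hz => by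
    have := hS hz
    simp only [Finset.mem_union, Finset.mem_inter] at this ⊢
    tauto
  have := (Finset.card_le_card h3).trans (Finset.card_union_le _ _)
  omega

/-- The number of rows and columns which meet `P` but not `M`. -/
def extraLines (P M : Finset Site) : ℕ :=
  (P.image Prod.fst \ M.image Prod.fst).card + (P.image Prod.snd \ M.image Prod.snd).card

theorem IsComp.card_lines {P M : Finset Site} (h : IsComp P M) :
    (((P.image Prod.fst).card + (P.image Prod.snd).card : ℕ) : ℤ) =
      ∑ i, sA M i + 2 + extraLines P M := by
  have h1 := Finset.card_sdiff_add_card_eq_card (Finset.image_subset_image (f := Prod.fst) h.sub)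
  have h2 := Finset.card_sdiff_add_card_eq_card (Finset.image_subset_image (f := Prod.snd) h.sub)
  have h3 : (M.image Prod.fst).card = (sA M 3 - -sA M 1 + 1).toNat := by
    rw [h.image_fst, Int.card_Icc]; congr 1; ring
  have h4 : (M.image Prod.snd).card = (sA M 2 - -sA M 0 + 1).toNat := by
    rw [h.image_snd, Int.card_Icc]; congr 1; ring
  obtain ⟨p, hp⟩ := h.ne
  have l0 := le_sA hp 0
  have l1 := le_sA hp 1
  have l2 := le_sA hp 2
  have l3 := le_sA hp 3
  simp only [ax_zero, ax_one, ax_two, ax_three] at l0 l1 l2 l3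
  rw [Fin.sum_univ_four, extraLines]
  omega

-- Corners inside the bounding box of `M` are bounded quadrant by quadrant. Any other corner lies on
-- a line that meets `P` but not `M`, and such a line holds at most two.
open Classical in
theorem IsComp.card_corAll {P Z M : Finset Site} (h : IsComp P M) :
    ((corAll P Z).card : ℤ) ≤ ∑ i, tS (sA M) (sD M) i + 2 * extraLines P M ∧
    (extraLines P M = 0 → corAll P Z =
      Finset.univ.biUnion fun i => (corSet i P Z).filter fun z => ∀ j, ax j z ≤ sA M j) := by
  set B := Finset.univ.biUnion fun i => (corSet i P Z).filter fun z => ∀ j, ax j z ≤ sA M j with hB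
  set S1 := (corAll P Z).filter fun z => z.1 ∈ P.image Prod.fst \ M.image Prod.fst with hS1
  set S2 := (corAll P Z).filter fun z => z.2 ∈ P.image Prod.snd \ M.image Prod.snd with hS2
  have hsub : corAll P Z ⊆ B ∪ (S1 ∪ S2) := by
    intro z hz
    obtain ⟨i, hi⟩ := mem_corAll.1 hz
    have hx : z.1 ∈ P.image Prod.fst ∧ z.2 ∈ P.image Prod.snd := by
      have q1 := (mem_leadSet.1 (Finset.mem_inter.1 hi).1).2.1
      have q2 := (mem_leadSet.1 (Finset.mem_inter.1 hi).2).2.1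
      clear hi
      revert i; rw [forall_fin4, show (0 + 1 : Fin 4) = 1 from rfl, show (1 + 1 : Fin 4) = 2 from rfl,
        show (2 + 1 : Fin 4) = 3 from rfl, show (3 + 1 : Fin 4) = 0 from rfl]
      simp only [Finset.mem_image]
      refine ⟨fun q1 q2 => ⟨⟨_, q1, by simp⟩, ⟨_, q2, by simp⟩⟩,
        fun q1 q2 => ⟨⟨_, q2, by simp⟩, ⟨_, q1, by simp⟩⟩,
        fun q1 q2 => ⟨⟨_, q1, by simp⟩, ⟨_, q2, by simp⟩⟩,
        fun q1 q2 => ⟨⟨_, q2, by simp⟩, ⟨_, q1, by simp⟩⟩⟩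
    by_cases h1 : z.1 ∈ M.image Prod.fst
    · by_cases h2 : z.2 ∈ M.image Prod.snd
      · refine Finset.mem_union_left _ (Finset.mem_biUnion.2 ⟨i, Finset.mem_univ _,
          Finset.mem_filter.2 ⟨hi, ?_⟩⟩)
        rw [h.image_fst, Finset.mem_Icc] at h1
        rw [h.image_snd, Finset.mem_Icc] at h2
        rw [forall_fin4]
        simp only [ax_zero, ax_one, ax_two, ax_three]
        omega
      · exact Finset.mem_union_right _ (Finset.mem_union_right _
          (Finset.mem_filter.2 ⟨hz, Finset.mem_sdiff.2 ⟨hx.2, h2⟩⟩))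
    · exact Finset.mem_union_right _ (Finset.mem_union_left _
          (Finset.mem_filter.2 ⟨hz, Finset.mem_sdiff.2 ⟨hx.1, h1⟩⟩))
  have lead02 : corAll P Z ⊆ leadSet 0 P Z ∪ leadSet 2 P Z := by
    intro z hz
    obtain ⟨i, hi⟩ := mem_corAll.1 hz
    unfold corSet at hi
    revert i; rw [forall_fin4, show (0 + 1 : Fin 4) = 1 from rfl, show (1 + 1 : Fin 4) = 2 from rfl,
        show (2 + 1 : Fin 4) = 3 from rfl, show (3 + 1 : Fin 4) = 0 from rfl]
    simp only [Finset.mem_inter, Finset.mem_union]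
    tauto
  have lead13 : corAll P Z ⊆ leadSet 1 P Z ∪ leadSet 3 P Z := by
    intro z hz
    obtain ⟨i, hi⟩ := mem_corAll.1 hz
    unfold corSet at hi
    revert i; rw [forall_fin4, show (0 + 1 : Fin 4) = 1 from rfl, show (1 + 1 : Fin 4) = 2 from rfl,
        show (2 + 1 : Fin 4) = 3 from rfl, show (3 + 1 : Fin 4) = 0 from rfl]
    simp only [Finset.mem_inter, Finset.mem_union]
    tauto
  have hS1c : S1.card ≤ 2 * (P.image Prod.fst \ M.image Prod.fst).card := by
    have := card_filter_line_le (i := 0) (P := P) (Z := Z) (S := S1)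
      (E := (P.image Prod.fst \ M.image Prod.fst).image fun x => -x)
      ((Finset.filter_subset _ _).trans lead02) (fun z hz => by
        rw [show (0 + 1 : Fin 4) = 1 from rfl, ax_one]
        exact Finset.mem_image_of_mem _ (Finset.mem_filter.1 hz).2)
    rwa [Finset.card_image_of_injective _ neg_injective] at this
  have hS2c : S2.card ≤ 2 * (P.image Prod.snd \ M.image Prod.snd).card := by
    exact card_filter_line_le (i := 1) (P := P) (Z := Z) (S := S2)
      ((Finset.filter_subset _ _).trans lead13) (fun z hz => by
        rw [show (1 + 1 : Fin 4) = 2 from rfl, ax_two]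
        exact (Finset.mem_filter.1 hz).2)
  have hBc : (B.card : ℤ) ≤ ∑ i, tS (sA M) (sD M) i := by
    calc (B.card : ℤ) ≤ ((∑ i, ((corSet i P Z).filter fun z => ∀ j, ax j z ≤ sA M j).card : ℕ) : ℤ) := by
          exact_mod_cast Finset.card_biUnion_le
      _ ≤ _ := by
          push_cast
          exact Finset.sum_le_sum fun i _ => (h.card_corSet i).1
  have hcard := (Finset.card_le_card hsub).trans ((Finset.card_union_le _ _).trans
    (Nat.add_le_add_left (Finset.card_union_le _ _) _))
  refine ⟨?_, fun he => ?_⟩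
  · unfold extraLines; push_cast; omega
  · unfold extraLines at he
    have e1 : S1 = ∅ := Finset.card_eq_zero.1 (by omega)
    have e2 : S2 = ∅ := Finset.card_eq_zero.1 (by omega)
    rw [e1, e2, Finset.union_empty, Finset.union_empty] at hsub
    refine hsub.antisymm ?_
    intro z hz
    obtain ⟨i, -, hi⟩ := Finset.mem_biUnion.1 hz
    exact mem_corAll.2 ⟨i, (Finset.mem_filter.1 hi).1⟩

theorem IsComp.cost_lower {k : ℝ} (hk : -1 < k) (hk1 : k < 1) {P Z M : Finset Site}
    (hPZ : Disjoint P Z) (h : IsComp P M)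
    {BR BC : Finset ℤ} (hBR : ∀ y ∈ BR, ¬ LineGood (rowOf P y) (rowOf Z y))
    (hBC : ∀ x ∈ BC, ¬ LineGood (colOf P x) (colOf Z x)) :
    4 * (((∑ i, sA M i : ℤ) : ℝ) + 2 + extraLines P M) +
      (1 + k) * (((Z.card : ℝ) - (corAll P Z).card) + ((Z.card : ℝ) - (leadAll P Z).card)) +
      (1 - k) * ((BR.card : ℝ) + BC.card) ≤ cost k P Z := by
  have h1 := BEG.cost_lower hk hk1 hPZ hBR hBC
  have h2 : (((P.image Prod.fst).card : ℝ) + (P.image Prod.snd).card) =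
      ((∑ i, sA M i : ℤ) : ℝ) + 2 + extraLines P M := by
    have := h.card_lines
    exact_mod_cast this
  rw [h2, sum_card_leadSet] at h1
  push_cast at h1
  push_cast
  linarith

/-- The energy, up to a constant, of an octagon with `C` surfactant sites. -/
noncomputable def Phi (k : ℝ) (C : ℕ) (a d : Fin 4 → ℤ) : ℝ :=
  4 * (((∑ i, a i : ℤ) : ℝ) + 2) + (1 + k) * (((C - ∑ i, tS a d i : ℤ).toNat : ℕ) : ℝ)

/-- Passing from `M` to a subset `S`, each unit of axis support lost saves 4 and gives up at most
two corners, worth `2 (1 + k)`; the same balance holds for each line of `P` that misses `M`. The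
difference is the penalty `2 (1 - k)`. -/
theorem IsComp.Phi_le_cost {k : ℝ} (hk : -1 < k) (hk1 : k < 1) {P Z M S : Finset Site} {C : ℕ}
    (hC : Z.card = C) (hPZ : Disjoint P Z) (h : IsComp P M) (hS : S.Nonempty) (hSM : S ⊆ M)
    {BR BC : Finset ℤ} (hBR : ∀ y ∈ BR, ¬ LineGood (rowOf P y) (rowOf Z y))
    (hBC : ∀ x ∈ BC, ¬ LineGood (colOf P x) (colOf Z x)) :
    Phi k C (sA S) (sD S) + (1 - k) * (2 * ((∑ i, (sA M i - sA S i) : ℤ) : ℝ) +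
      2 * extraLines P M + BR.card + BC.card) ≤ cost k P Z := by
  have h1 := h.cost_lower hk hk1 hPZ hBR hBC
  have h2 := (h.card_corAll (Z := Z)).1
  have h3 := Finset.card_le_card (leadAll_subset P Z)
  have h4 : (corAll P Z).card ≤ Z.card :=
    (Finset.card_le_card (corAll_subset P Z)).trans h3
  have ht : ∑ i, tS (sA M) (sD M) i ≤ ∑ i, tS (sA S) (sD S) i + 2 * ∑ i, (sA M i - sA S i) := by
    have d := fun i => sD_mono hS hSM i
    have d0 := d 0
    have d1 := d 1
    have d2 := d 2
    have d3 := d 3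
    simp only [Fin.sum_univ_four, tS_zero, tS_one, tS_two, tS_three]
    omega
  have hm : 0 ≤ ∑ i, (sA M i - sA S i) := Finset.sum_nonneg fun i _ => by
    have := sA_mono hS hSM i
    omega
  set s := (C - ∑ i, tS (sA S) (sD S) i : ℤ).toNat with hs
  have h5 : s ≤ (Z.card : ℤ) - (corAll P Z).card + 2 * ∑ i, (sA M i - sA S i) +
      2 * extraLines P M := by
    omega
  have h6 : (s : ℝ) ≤ (Z.card : ℝ) - (corAll P Z).card + 2 * ((∑ i, (sA M i - sA S i) : ℤ) : ℝ) +
      2 * extraLines P M := by exact_mod_cast h5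
  have h7 : (0 : ℝ) ≤ (Z.card : ℝ) - (leadAll P Z).card := by
    have : ((leadAll P Z).card : ℝ) ≤ Z.card := by exact_mod_cast h3
    linarith
  have h8 : ((∑ i, sA S i : ℤ) : ℝ) = ((∑ i, sA M i : ℤ) : ℝ) - ((∑ i, (sA M i - sA S i) : ℤ) : ℝ) := by
    rw [Finset.sum_sub_distrib]; push_cast; ring
  have h9 := mul_le_mul_of_nonneg_left h6 (by linarith : (0:ℝ) ≤ 1 + k)
  have h10 := mul_nonneg (by linarith : (0:ℝ) ≤ 1 + k) h7
  unfold Phi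
  rw [← hs, h8]
  nlinarith

/-! ### Dissipation of missing lines -/

/-- The left and right ends of the rows of an octagon. -/
noncomputable def rowLo (A D : Fin 4 → ℤ) (y : ℤ) : ℤ := max (max (-A 1) (-D 0 - y)) (y - D 1)
noncomputable def rowHi (A D : Fin 4 → ℤ) (y : ℤ) : ℤ := min (min (A 3) (D 2 - y)) (y + D 3)

/-- The lower and upper ends of the columns of an octagon. -/
noncomputable def colLo (A D : Fin 4 → ℤ) (x : ℤ) : ℤ := max (max (-A 0) (-D 0 - x)) (x - D 3)
noncomputable def colHi (A D : Fin 4 → ℤ) (x : ℤ) : ℤ := min (min (A 2) (D 1 + x)) (D 2 - x)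

theorem le_dep_row {A D : Fin 4 → ℤ} {p : Site} {m : ℤ} : m ≤ dep A D p ↔
    m ≤ A 0 + p.2 + 1 ∧ m ≤ A 2 - p.2 + 1 ∧ rowLo A D p.2 + m - 1 ≤ p.1 ∧
      p.1 ≤ rowHi A D p.2 - m + 1 := by
  rw [le_dep, forall_fin4, forall_fin4, rowLo, rowHi]
  simp
  omega

theorem le_dep_col {A D : Fin 4 → ℤ} {p : Site} {m : ℤ} : m ≤ dep A D p ↔
    m ≤ A 1 + p.1 + 1 ∧ m ≤ A 3 - p.1 + 1 ∧ colLo A D p.1 + m - 1 ≤ p.2 ∧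
      p.2 ≤ colHi A D p.1 - m + 1 := by
  rw [le_dep, forall_fin4, forall_fin4, colLo, colHi]
  simp
  omega

theorem Tight.le_row {n : ℤ} {A D : Fin 4 → ℤ} (h : Tight n A D) {y : ℤ} (h1 : -A 0 ≤ y)
    (h2 : y ≤ A 2) (hn : 1 ≤ n) : n ≤ rowHi A D y - rowLo A D y + 1 := by
  have := h.expand
  rw [rowHi, rowLo]
  omega

theorem Tight.le_col {n : ℤ} {A D : Fin 4 → ℤ} (h : Tight n A D) {x : ℤ} (h1 : -A 1 ≤ x)
    (h2 : x ≤ A 3) (hn : 1 ≤ n) : n ≤ colHi A D x - colLo A D x + 1 := by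
  have := h.expand
  rw [colHi, colLo]
  omega

/-- All but `2 * M0` lines are far enough from the ends of the box. On such a line at most `2 * M0`
sites have depth less than `M0`, so at least `n / 4` of the missing ones are deep. The abstract
coordinates serve rows and columns alike. -/
theorem line_sum_le {dp f g : Site → ℤ} {U V n M0 : ℤ} {lo hi : ℤ → ℤ}
    (hinj : ∀ p q, f p = f q → g p = g q → p = q)
    (hdp : ∀ p m, m ≤ dp p ↔ m ≤ U + f p + 1 ∧ m ≤ V - f p + 1 ∧ lo (f p) + m - 1 ≤ g p ∧
      g p ≤ hi (f p) - m + 1) {W : Finset Site} (hW : ∀ p ∈ W, 1 ≤ dp p) {Y : Finset ℤ}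
    (hY : ∀ y ∈ Y, n ≤ 2 * (W.filter fun p => f p = y).card) (hM0 : 1 ≤ M0) (hn : 8 * M0 ≤ n) :
    ((Y.card : ℤ) - 2 * M0) * (M0 * n) ≤ 4 * ∑ p ∈ W, dp p := by
  set Y' := Y.filter fun y => M0 ≤ U + y + 1 ∧ M0 ≤ V - y + 1 with hY'
  have hcard : (Y.card : ℤ) ≤ Y'.card + 2 * M0 := by
    have hsub : Y ⊆ Y' ∪ (Finset.Ico (-U) (-U + M0 - 1) ∪ Finset.Ioc (V - M0 + 1) V) := by
      intro y hy
      have hne : (W.filter fun p => f p = y).Nonempty := Finset.card_pos.1 (by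
        have := hY y hy; omega)
      obtain ⟨p, hp⟩ := hne
      rw [Finset.mem_filter] at hp
      have h1 := (hdp p 1).1 (hW p hp.1)
      rw [hp.2] at h1
      simp only [hY', Finset.mem_union, Finset.mem_filter, Finset.mem_Ico, Finset.mem_Ioc]
      simp only [hy, true_and]
      omega
    have := (Finset.card_le_card hsub).trans ((Finset.card_union_le _ _).trans
      (Nat.add_le_add_left (Finset.card_union_le _ _) _))
    rw [Int.card_Ico, Int.card_Ioc] at this
    omega
  have hline : ∀ y ∈ Y', M0 * n ≤ 4 * ∑ p ∈ W.filter (fun p => f p = y), dp p := by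
    intro y hy
    rw [hY', Finset.mem_filter] at hy
    set Wy := W.filter fun p => f p = y with hWy
    set Wd := Wy.filter fun p => M0 ≤ dp p with hWd
    have hfew : (Wy \ Wd).card ≤ 2 * M0 := by
      have hsub : (Wy \ Wd).image g ⊆
          Finset.Ico (lo y) (lo y + M0 - 1) ∪ Finset.Ioc (hi y - M0 + 1) (hi y) := by
        intro x hx
        obtain ⟨p, hp, rfl⟩ := Finset.mem_image.1 hx
        rw [Finset.mem_sdiff] at hp
        have hp1 : ¬ M0 ≤ dp p := fun h' => hp.2 (Finset.mem_filter.2 ⟨hp.1, h'⟩)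
        have hp2 := Finset.mem_filter.1 hp.1
        have h1 := (hdp p 1).1 (hW p hp2.1)
        rw [hdp] at hp1
        rw [hp2.2] at hp1 h1
        rw [Finset.mem_union, Finset.mem_Ico, Finset.mem_Ioc]
        omega
      have h1 : ((Wy \ Wd).image g).card = (Wy \ Wd).card :=
        Finset.card_image_of_injOn fun p hp q hq e => by
          have h1 := (Finset.mem_filter.1 (Finset.mem_sdiff.1 (Finset.mem_coe.1 hp)).1).2
          have h2 := (Finset.mem_filter.1 (Finset.mem_sdiff.1 (Finset.mem_coe.1 hq)).1).2
          exact hinj p q (h1.trans h2.symm) e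
      have := (Finset.card_le_card hsub).trans (Finset.card_union_le _ _)
      rw [h1, Int.card_Ico, Int.card_Ioc] at this
      omega
    have h2 := Finset.card_sdiff_add_card_eq_card (Finset.filter_subset (fun p => M0 ≤ dp p) Wy)
    rw [← hWd] at h2
    have h3 := hY y hy.1
    rw [← hWy] at h3
    have h4 : M0 * Wd.card ≤ ∑ p ∈ Wy, dp p := by
      calc M0 * Wd.card = ∑ p ∈ Wd, M0 := by simp [mul_comm]
        _ ≤ ∑ p ∈ Wd, dp p := Finset.sum_le_sum fun p hp => (Finset.mem_filter.1 hp).2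
        _ ≤ _ := Finset.sum_le_sum_of_subset_of_nonneg (Finset.filter_subset _ _) fun p hp _ => by
          have := hW p (Finset.mem_filter.1 hp).1
          omega
    have h5 : n ≤ 4 * Wd.card := by omega
    nlinarith
  have hsum : ∑ y ∈ Y', ∑ p ∈ W.filter (fun p => f p = y), dp p ≤ ∑ p ∈ W, dp p := by
    rw [Finset.sum_fiberwise_eq_sum_filter]
    exact Finset.sum_le_sum_of_subset_of_nonneg (Finset.filter_subset _ _) fun p hp _ => by
      have := hW p hp
      omega
  have hsum2 : Y'.card * (M0 * n) ≤ 4 * ∑ y ∈ Y', ∑ p ∈ W.filter (fun p => f p = y), dp p := by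
    rw [Finset.mul_sum, ← nsmul_eq_mul, ← Finset.sum_const]
    exact Finset.sum_le_sum hline
  have : 0 ≤ M0 * n := mul_nonneg (by omega) (by omega)
  nlinarith

/-- Missing sites in many lines have a large dissipation. -/
theorem lines_sum_dep_le {A D : Fin 4 → ℤ} {n M0 : ℤ} {W : Finset Site} (hW : W ⊆ oct A D)
    {Y X : Finset ℤ} (hY : ∀ y ∈ Y, n ≤ 2 * (W.filter fun p => p.2 = y).card)
    (hX : ∀ x ∈ X, n ≤ 2 * (W.filter fun p => p.1 = x).card) (hM0 : 1 ≤ M0) (hn : 8 * M0 ≤ n) :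
    ((Y.card : ℤ) + X.card - 4 * M0) * (M0 * n) ≤ 8 * ∑ p ∈ W, dep A D p := by
  have h1 := line_sum_le (dp := dep A D) (f := Prod.snd) (g := Prod.fst)
    (fun p q h h' => Prod.ext h' h) (fun p m => le_dep_row) (fun p hp => one_le_dep.2 (hW hp))
    hY hM0 hn
  have h2 := line_sum_le (dp := dep A D) (f := Prod.fst) (g := Prod.snd)
    (fun p q h h' => Prod.ext h h') (fun p m => le_dep_col) (fun p hp => one_le_dep.2 (hW hp))
    hX hM0 hn
  linarith

theorem Tight.le_card_row {n : ℤ} {A D : Fin 4 → ℤ} (h : Tight n A D) {y : ℤ} (h1 : -A 0 ≤ y)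
    (h2 : y ≤ A 2) (hn : 1 ≤ n) : n ≤ ((oct A D).filter fun p => p.2 = y).card := by
  have hsub : (Finset.Icc (rowLo A D y) (rowHi A D y)).image (fun x => ((x, y) : Site)) ⊆
      (oct A D).filter fun p => p.2 = y := by
    intro p hp
    obtain ⟨x, hx, rfl⟩ := Finset.mem_image.1 hp
    rw [Finset.mem_Icc] at hx
    rw [Finset.mem_filter, ← one_le_dep, le_dep_row]
    dsimp only
    omega
  refine le_trans ?_ (Nat.cast_le.2 (Finset.card_le_card hsub))
  rw [Finset.card_image_of_injective _ fun a b hab => (Prod.ext_iff.1 hab).1, Int.card_Icc]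
  have := h.le_row h1 h2 hn
  omega

theorem Tight.le_card_col {n : ℤ} {A D : Fin 4 → ℤ} (h : Tight n A D) {x : ℤ} (h1 : -A 1 ≤ x)
    (h2 : x ≤ A 3) (hn : 1 ≤ n) : n ≤ ((oct A D).filter fun p => p.1 = x).card := by
  have hsub : (Finset.Icc (colLo A D x) (colHi A D x)).image (fun y => ((x, y) : Site)) ⊆
      (oct A D).filter fun p => p.1 = x := by
    intro p hp
    obtain ⟨y, hy, rfl⟩ := Finset.mem_image.1 hp
    rw [Finset.mem_Icc] at hy
    rw [Finset.mem_filter, ← one_le_dep, le_dep_col]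
    dsimp only
    omega
  refine le_trans ?_ (Nat.cast_le.2 (Finset.card_le_card hsub))
  rw [Finset.card_image_of_injective _ fun a b hab => (Prod.ext_iff.1 hab).2, Int.card_Icc]
  have := h.le_col h1 h2 hn
  omega

/-- The number of rows and columns of `P` outside of the bounding box of `oct A D`. -/
noncomputable def outLines (A : Fin 4 → ℤ) (P : Finset Site) : ℕ :=
  (P.image Prod.fst \ Finset.Icc (-A 1) (A 3)).card +
    (P.image Prod.snd \ Finset.Icc (-A 0) (A 2)).card

theorem Tight.width {n : ℤ} {A D : Fin 4 → ℤ} (h : Tight n A D) :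
    n ≤ A 1 + A 3 + 1 ∧ n ≤ A 0 + A 2 + 1 := by
  have := h.expand
  omega

/-- The competitor is the datum, which dissipates nothing and has corners for all `C` surfactant
sites. Against it each missing line saves 4, hence the bound `32 * M0` once at most `8 * M0` lines
can be missing. -/
theorem Ctx.a_priori {k δ lam : ℝ} {A D : Fin 4 → ℤ} {C : ℕ} {P Z : Finset Site}
    (h : Ctx k δ A D C P Z) {n M0 : ℤ} (hT : Tight n A D) (hM0 : 1 ≤ M0) (hn : 8 * M0 ≤ n)
    (hlam : lam ≤ δ * n) (hM : 64 ≤ lam * M0)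
    {BR BC : Finset ℤ} (hBR : ∀ y ∈ BR, ¬ LineGood (rowOf P y) (rowOf Z y))
    (hBC : ∀ x ∈ BC, ¬ LineGood (colOf P x) (colOf Z x)) :
    4 * (outLines A P : ℝ) + δ * Dis A D P + (1 - k) * ((BR.card : ℝ) + BC.card) ≤ 32 * M0 := by
  have hδ := h.hδ
  have hk1 := h.hk1
  set Y := Finset.Icc (-A 0) (A 2) \ P.image Prod.snd with hY
  set X := Finset.Icc (-A 1) (A 3) \ P.image Prod.fst with hX
  have hw := hT.width
  have hup := h.le_oct (hT.mono (by omega)) (fun _ => le_rfl) (fun _ => le_rfl) (s := 0)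
    (by have := hT.2 0; push_cast; omega) (by omega) (by have := h.le_sum; push_cast; omega)
  have hlow := BEG.cost_lower (by linarith [h.hk] : -1 < k) hk1 h.disj hBR hBC
  have hlead : ((∑ i, (leadSet i P Z).card : ℕ) : ℝ) ≤ 2 * Z.card := by
    have h1 := Finset.card_le_card (leadAll_subset P Z)
    have h2 := Finset.card_le_card (corAll_subset P Z)
    rw [sum_card_leadSet]
    exact_mod_cast (by omega : (leadAll P Z).card + (corAll P Z).card ≤ 2 * Z.card)
  have hzero : Dis A D (oct A D) = 0 := by simp [Dis]
  rw [hzero] at hup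
  simp only [Nat.cast_zero, mul_zero, zero_mul, add_zero, Int.cast_zero] at hup
  have c1 : ((P.image Prod.fst).card : ℤ) + X.card =
      A 1 + A 3 + 1 + (P.image Prod.fst \ Finset.Icc (-A 1) (A 3)).card := by
    have e1 := Finset.card_sdiff_add_card (Finset.Icc (-A 1) (A 3)) (P.image Prod.fst)
    have e2 := Finset.card_sdiff_add_card (P.image Prod.fst) (Finset.Icc (-A 1) (A 3))
    rw [Finset.union_comm, ← hX] at e1
    have e3 := Int.card_Icc (-A 1) (A 3)
    omega
  have c2 : ((P.image Prod.snd).card : ℤ) + Y.card =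
      A 0 + A 2 + 1 + (P.image Prod.snd \ Finset.Icc (-A 0) (A 2)).card := by
    have e1 := Finset.card_sdiff_add_card (Finset.Icc (-A 0) (A 2)) (P.image Prod.snd)
    have e2 := Finset.card_sdiff_add_card (P.image Prod.snd) (Finset.Icc (-A 0) (A 2))
    rw [Finset.union_comm, ← hY] at e1
    have e3 := Int.card_Icc (-A 0) (A 2)
    omega
  have c3 : ((P.image Prod.fst).card : ℝ) + (P.image Prod.snd).card + (Y.card + X.card) =
      ∑ i, (A i : ℝ) + 2 + outLines A P := by
    rw [Fin.sum_univ_four]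
    have : ((P.image Prod.fst).card : ℤ) + (P.image Prod.snd).card + (Y.card + X.card) =
        A 0 + A 1 + A 2 + A 3 + 2 + outLines A P := by unfold outLines; push_cast; omega
    exact_mod_cast this
  have hmain : 4 * (outLines A P : ℝ) + δ * Dis A D P + (1 - k) * ((BR.card : ℝ) + BC.card) ≤
      4 * (Y.card + X.card) := by
    have : 0 ≤ (1 + k) * (2 * (Z.card : ℝ) - (∑ i, (leadSet i P Z).card : ℕ)) :=
      mul_nonneg (by linarith [h.hk]) (by linarith)
    linarith
  have hdis := lines_sum_dep_le (A := A) (D := D) (W := oct A D \ P) Finset.sdiff_subset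
    (Y := Y) (X := X) (n := n) (M0 := M0) (fun y hy => by
      rw [hY, Finset.mem_sdiff, Finset.mem_Icc] at hy
      have h1 := hT.le_card_row hy.1.1 hy.1.2 (by omega)
      have h2 : (oct A D).filter (fun p => p.2 = y) ⊆ (oct A D \ P).filter fun p => p.2 = y := by
        intro p hp
        rw [Finset.mem_filter] at hp ⊢
        refine ⟨Finset.mem_sdiff.2 ⟨hp.1, fun hpP => hy.2 ?_⟩, hp.2⟩
        rw [← hp.2]; exact Finset.mem_image_of_mem _ hpP
      have := Finset.card_le_card h2
      omega) (fun y hy => by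
      rw [hX, Finset.mem_sdiff, Finset.mem_Icc] at hy
      have h1 := hT.le_card_col hy.1.1 hy.1.2 (by omega)
      have h2 : (oct A D).filter (fun p => p.1 = y) ⊆ (oct A D \ P).filter fun p => p.1 = y := by
        intro p hp
        rw [Finset.mem_filter] at hp ⊢
        refine ⟨Finset.mem_sdiff.2 ⟨hp.1, fun hpP => hy.2 ?_⟩, hp.2⟩
        rw [← hp.2]; exact Finset.mem_image_of_mem _ hpP
      have := Finset.card_le_card h2
      omega) hM0 hn
  have hdis2 : ((Y.card : ℤ) + X.card - 4 * M0) * (M0 * n) ≤ 8 * Dis A D P := by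
    unfold Dis; omega
  -- If `x` lines are missing, the dissipation estimate gives `64 (x - 4 M0) ≤ 8 δ Dis ≤ 32 x`, so
  -- `x ≤ 8 M0`. This is the purpose of the constant 64.
  have hr : (Y.card : ℝ) + X.card ≤ 8 * M0 := by
    by_contra hcon
    push Not at hcon
    have h1 : (((Y.card : ℝ) + X.card - 4 * M0) * (M0 * n)) ≤ 8 * Dis A D P := by
      exact_mod_cast hdis2
    have hM0' : (1 : ℝ) ≤ M0 := by exact_mod_cast hM0
    have h2 : 64 ≤ δ * n * M0 := hM.trans (mul_le_mul_of_nonneg_right hlam (by linarith))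
    have h3 : ((Y.card : ℝ) + X.card - 4 * M0) * 64 ≤
        ((Y.card : ℝ) + X.card - 4 * M0) * (δ * n * M0) :=
      mul_le_mul_of_nonneg_left h2 (by linarith)
    have h4 := mul_le_mul_of_nonneg_left h1 hδ.le
    have h5 : 0 ≤ (1 - k) * ((BR.card : ℝ) + BC.card) := mul_nonneg (by linarith) (by positivity)
    have h6 : (0 : ℝ) ≤ outLines A P := by positivity
    nlinarith
  linarith

/-! ### The main component -/

theorem IsComp.row_mem {P M : Finset Site} (h : IsComp P M) {x x' y : ℤ} (hx : (x, y) ∈ M)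
    (hP : ∀ t, min x x' ≤ t → t ≤ max x x' → (t, y) ∈ P) : (x', y) ∈ M := by
  have up : ∀ N : ℕ, x + N ≤ max x x' → (x + N, y) ∈ M := by
    intro N
    induction N with
    | zero => intro _; simpa using hx
    | succ N ih =>
      intro hN
      push_cast at hN ⊢
      refine h.closed _ (ih (by omega)) _ (hP _ (by omega) hN) (mem_nbrs.2 (Or.inl ?_))
      dsimp only; omega
  have down : ∀ N : ℕ, min x x' ≤ x - N → (x - N, y) ∈ M := by
    intro N
    induction N with
    | zero => intro _; simpa using hx
    | succ N ih =>
      intro hN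
      push_cast at hN ⊢
      refine h.closed _ (ih (by omega)) _ (hP _ hN (by omega)) (mem_nbrs.2 (Or.inr (Or.inl ?_)))
      dsimp only; omega
  rcases le_total x x' with hxx | hxx
  · have := up (x' - x).toNat (by omega)
    rwa [show x + ((x' - x).toNat : ℤ) = x' by omega] at this
  · have := down (x - x').toNat (by omega)
    rwa [show x - ((x - x').toNat : ℤ) = x' by omega] at this

theorem IsComp.col_mem {P M : Finset Site} (h : IsComp P M) {x y y' : ℤ} (hx : (x, y) ∈ M)
    (hP : ∀ t, min y y' ≤ t → t ≤ max y y' → (x, t) ∈ P) : (x, y') ∈ M := by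
  have up : ∀ N : ℕ, y + N ≤ max y y' → (x, y + N) ∈ M := by
    intro N
    induction N with
    | zero => intro _; simpa using hx
    | succ N ih =>
      intro hN
      push_cast at hN ⊢
      refine h.closed _ (ih (by omega)) _ (hP _ (by omega) hN)
        (mem_nbrs.2 (Or.inr (Or.inr (Or.inl ?_))))
      dsimp only; omega
  have down : ∀ N : ℕ, min y y' ≤ y - N → (x, y - N) ∈ M := by
    intro N
    induction N with
    | zero => intro _; simpa using hx
    | succ N ih =>
      intro hN
      push_cast at hN ⊢
      refine h.closed _ (ih (by omega)) _ (hP _ hN (by omega))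
        (mem_nbrs.2 (Or.inr (Or.inr (Or.inr ?_))))
      dsimp only; omega
  rcases le_total y y' with hxx | hxx
  · have := up (y' - y).toNat (by omega)
    rwa [show y + ((y' - y).toNat : ℤ) = y' by omega] at this
  · have := down (y - y').toNat (by omega)
    rwa [show y - ((y - y').toNat : ℤ) = y' by omega] at this

theorem exists_not_mem_of_card {X : Finset ℤ} {K : ℤ} (hX : X.card ≤ K) (c : ℤ) :
    ∃ x, c ≤ x ∧ x ≤ c + K ∧ x ∉ X := by
  by_contra hcon
  push Not at hcon
  have : Finset.Icc c (c + K) ⊆ X := fun x hx => by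
    rw [Finset.mem_Icc] at hx; exact hcon x hx.1 hx.2
  have := Finset.card_le_card this
  rw [Int.card_Icc] at this
  omega

/-- If few sites far from the boundary are missing, some component is almost full. -/
theorem exists_main_comp {A D : Fin 4 → ℤ} {P : Finset Site} {n m K : ℤ} (hT : Tight n A D)
    (hm : 1 ≤ m) (hK : (((oct A D \ P).filter fun p => m ≤ dep A D p).card : ℤ) ≤ K)
    (hn : 2 * m + 4 * K + 10 ≤ n) :
    ∃ M, IsComp P M ∧ ∀ q, m + K ≤ dep A D q →
      (∃ j, 0 ≤ j ∧ j ≤ K ∧ (q.1, q.2 - j) ∈ M ∩ oct A D) ∧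
      (∃ j, 0 ≤ j ∧ j ≤ K ∧ (q.1, q.2 + j) ∈ M ∩ oct A D) := by
  set X := (oct A D \ P).filter fun p => m ≤ dep A D p with hX
  have hK0 : 0 ≤ K := by omega
  have hin : ∀ p, m ≤ dep A D p → (p.1 ∉ X.image Prod.fst ∨ p.2 ∉ X.image Prod.snd) → p ∈ P := by
    intro p hp hor
    by_contra hpP
    have : p ∈ X := by
      rw [hX, Finset.mem_filter, Finset.mem_sdiff, ← one_le_dep]
      exact ⟨⟨by omega, hpP⟩, hp⟩
    rcases hor with h | h
    · exact h (Finset.mem_image_of_mem _ this)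
    · exact h (Finset.mem_image_of_mem _ this)
  have hXf : ((X.image Prod.fst).card : ℤ) ≤ K := by
    have := Finset.card_image_le (s := X) (f := Prod.fst); omega
  have hXs : ((X.image Prod.snd).card : ℤ) ≤ K := by
    have := Finset.card_image_le (s := X) (f := Prod.snd); omega
  have hw := hT.width.2
  -- A base row without missing deep sites: `K + 1` consecutive rows always contain one.
  obtain ⟨yb, hb1, hb2, hb3⟩ := exists_not_mem_of_card hXs (m - 1 - A 0)
  have hrow : ∀ y, m - 1 - A 0 ≤ y → y ≤ A 2 - m + 1 → n ≤ rowHi A D y - rowLo A D y + 1 :=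
    fun y h1 h2 => hT.le_row (by omega) (by omega) (by omega)
  have hb4 := hrow yb hb1 (by omega)
  have hp0 : (rowLo A D yb + m - 1, yb) ∈ P := by
    refine hin _ (le_dep_row.2 ?_) (Or.inr hb3)
    dsimp only; omega
  obtain ⟨M, hM, hpM, -⟩ := exists_isComp hp0
  have hfull : ∀ y, y ∉ X.image Prod.snd → ∀ x x', (x, y) ∈ M → m ≤ dep A D (x, y) →
      m ≤ dep A D (x', y) → (x', y) ∈ M := by
    intro y hy x x' hx hd hd'
    refine hM.row_mem hx fun t h1 h2 => hin _ ?_ (Or.inr hy)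
    rw [le_dep_row] at hd hd' ⊢
    dsimp only at *
    omega
  have link : ∀ y y', m - 1 - A 0 ≤ y → y ≤ A 2 - m + 1 → m - 1 - A 0 ≤ y' → y' ≤ A 2 - m + 1 →
      y ∉ X.image Prod.snd → y - y' ≤ K + 1 → y' - y ≤ K + 1 →
      (∀ x, m ≤ dep A D (x, y') → (x, y') ∈ M) → ∀ x, m ≤ dep A D (x, y) → (x, y) ∈ M := by
    intro y y' h1 h2 h3 h4 hy h5 h6 hM' x hx
    -- Two full rows are joined through a column without missing deep sites. It is taken `K + 1`
    -- sites further inside than depth `m` requires, since row ends move by at most one per row.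
    obtain ⟨c, hc1, hc2, hc3⟩ := exists_not_mem_of_card hXf (rowLo A D y + m + K)
    have hr := hrow y h1 h2
    have hdep : ∀ t, min y' y ≤ t → t ≤ max y' y → m ≤ dep A D (c, t) := by
      intro t ht1 ht2
      rw [le_dep_row]
      have e1 : rowLo A D t ≤ rowLo A D y + (K + 1) := by unfold rowLo; omega
      have e2 : rowHi A D y ≤ rowHi A D t + (K + 1) := by unfold rowHi; omega
      dsimp only
      omega
    have hcM : (c, y) ∈ M := hM.col_mem (hM' c (hdep y' (by omega) (by omega)))
      fun t ht1 ht2 => hin _ (hdep t ht1 ht2) (Or.inl hc3)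
    exact hfull y hy c x hcM (hdep y (by omega) (by omega)) hx
  have hbase : ∀ x, m ≤ dep A D (x, yb) → (x, yb) ∈ M := by
    intro x hx
    refine hfull yb hb3 _ x hpM (le_dep_row.2 ?_) hx
    dsimp only; omega
  -- Induction on the distance from the base row: some full row strictly closer to it is at most `K
  -- + 1` away.
  have hall : ∀ N : ℕ, ∀ y, (y - yb).natAbs ≤ N → m - 1 - A 0 ≤ y → y ≤ A 2 - m + 1 →
      y ∉ X.image Prod.snd → ∀ x, m ≤ dep A D (x, y) → (x, y) ∈ M := by
    intro N
    induction N with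
    | zero =>
      intro y hy _ _ _
      rw [show y = yb by omega]; exact hbase
    | succ N ih =>
      intro y hy h1 h2 h3
      by_cases hclose : y - yb ≤ K + 1 ∧ yb - y ≤ K + 1
      · exact link y yb h1 h2 hb1 (by omega) h3 hclose.1 hclose.2 hbase
      · rcases lt_or_ge yb y with hlt | hlt
        · obtain ⟨y', e1, e2, e3⟩ := exists_not_mem_of_card hXs (y - K - 1)
          exact link y y' h1 h2 (by omega) (by omega) h3 (by omega) (by omega)
            (ih y' (by omega) (by omega) (by omega) e3)
        · obtain ⟨y', e1, e2, e3⟩ := exists_not_mem_of_card hXs (y + 1)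
          exact link y y' h1 h2 (by omega) (by omega) h3 (by omega) (by omega)
            (ih y' (by omega) (by omega) (by omega) e3)
  have hmem : ∀ q : Site, m + K ≤ dep A D q → ∀ y, q.2 - K ≤ y → y ≤ q.2 + K →
      y ∉ X.image Prod.snd → (q.1, y) ∈ M ∩ oct A D := by
    intro q hq y h1 h2 h3
    rw [le_dep_row] at hq
    have hd : m ≤ dep A D (q.1, y) := by
      rw [le_dep_row]
      have e1 : rowLo A D y ≤ rowLo A D q.2 + K := by unfold rowLo; omega
      have e2 : rowHi A D q.2 ≤ rowHi A D y + K := by unfold rowHi; omega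
      dsimp only
      omega
    exact Finset.mem_inter.2 ⟨hall _ y le_rfl (by omega) (by omega) h3 _ hd,
      one_le_dep.1 (by omega)⟩
  refine ⟨M, hM, fun q hq => ⟨?_, ?_⟩⟩
  · obtain ⟨y', e1, e2, e3⟩ := exists_not_mem_of_card hXs (q.2 - K)
    refine ⟨q.2 - y', by omega, by omega, ?_⟩
    rw [sub_sub_cancel]
    exact hmem q hq y' (by omega) (by omega) e3
  · obtain ⟨y', e1, e2, e3⟩ := exists_not_mem_of_card hXs q.2
    refine ⟨y' - q.2, by omega, by omega, ?_⟩
    rw [add_sub_cancel]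
    exact hmem q hq y' (by omega) (by omega) e3

theorem Tight.exists_corner {n m : ℤ} {A D : Fin 4 → ℤ} (h : Tight n A D) (hm : 1 ≤ m)
    (hn : 4 * m ≤ n) (i : Fin 4) :
    ∃ q, m ≤ dep A D q ∧ ax i q = A i - m + 1 ∧ dg i q = D i - 2 * m + 2 := by
  refine ⟨pt i (A i - m + 1) (D i - A i - m + 1), ?_, by simp, by rw [dg_pt]; ring⟩
  have e := h.expand
  rw [le_dep, forall_fin4, forall_fin4]
  revert i; rw [forall_fin4]
  refine ⟨?_, ?_, ?_, ?_⟩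
  · rw [pt_zero]; simp; omega
  · rw [pt_one]; simp; omega
  · rw [pt_two]; simp; omega
  · rw [pt_three]; simp; omega

/-- The inner octagon of an almost full set. -/
theorem support_of_dominated {A D : Fin 4 → ℤ} {S : Finset Site} {n m : ℤ} (hT : Tight n A D)
    (hm : 1 ≤ m) (hn : 4 * m ≤ n) (hS : S ⊆ oct A D)
    (hdom : ∀ q, m ≤ dep A D q →
      (∃ j, 0 ≤ j ∧ (q.1, q.2 - j) ∈ S) ∧ (∃ j, 0 ≤ j ∧ (q.1, q.2 + j) ∈ S)) :
    S.Nonempty ∧ (∀ i, sA S i ≤ A i ∧ A i - m + 1 ≤ sA S i) ∧ (∀ i, sD S i ≤ D i) ∧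
      Tight (n - 4 * m) (sA S) (sD S) ∧ ∀ q, m ≤ dep A D q → q ∈ oct (sA S) (sD S) := by
  have hq : ∀ q, m ≤ dep A D q → q ∈ oct (sA S) (sD S) := by
    intro q hq
    obtain ⟨⟨j, hj, hjS⟩, ⟨j', hj', hjS'⟩⟩ := hdom q hq
    have a0 := le_sA hjS 0
    have a1 := le_sA hjS 1
    have a3 := le_sA hjS 3
    have a2 := le_sA hjS' 2
    have d0 := le_sD hjS 0
    have d3 := le_sD hjS 3
    have d1 := le_sD hjS' 1
    have d2 := le_sD hjS' 2
    rw [mem_oct']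
    simp only [ax_zero, ax_one, ax_two, ax_three, dg_zero, dg_one, dg_two, dg_three] at *
    omega
  have hne : S.Nonempty := by
    obtain ⟨q, h1, -⟩ := hT.exists_corner hm hn 0
    obtain ⟨⟨j, hj, hjS⟩, -⟩ := hdom q h1
    exact ⟨_, hjS⟩
  have hA : ∀ i, sA S i ≤ A i := fun i => by
    obtain ⟨p, hp, e⟩ := exists_sA hne i
    rw [← e]; exact (mem_oct.1 (hS hp)).1 i
  have hD : ∀ i, sD S i ≤ D i := fun i => by
    obtain ⟨p, hp, e⟩ := exists_sD hne i
    rw [← e]; exact (mem_oct.1 (hS hp)).2 i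
  -- Sites of depth `m` near the vertices bound the loss of support by `m - 1` on the axes and `2 *
  -- m - 2` on the diagonals; a slice therefore loses fewer than `4 * m` sites.
  have hcor : ∀ i, A i - m + 1 ≤ sA S i ∧ D i - 2 * m + 2 ≤ sD S i := fun i => by
    obtain ⟨q, h1, h2, h3⟩ := hT.exists_corner hm hn i
    have := mem_oct.1 (hq q h1)
    have h4 := this.1 i
    have h5 := this.2 i
    omega
  refine ⟨hne, fun i => ⟨hA i, (hcor i).1⟩, hD, ⟨fun i => tS_support_nonneg hne i, fun i => ?_⟩, hq⟩
  have h1 := hT.2 i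
  have h2 := (hcor i).2
  have h3 := (hcor (i + 3)).2
  have h4 := hA i
  unfold pS at *
  omega

/-! ### Rigidity -/

/-- A site of `P` outside of the connected component `M` lies in a bad row or in a row not meeting
`M`. -/
theorem IsComp.row_of_not_mem {P Z M : Finset Site} (hM : IsComp P M) {p : Site} (hp : p ∈ P)
    (hpM : p ∉ M) (hg : LineGood (rowOf P p.2) (rowOf Z p.2)) : p.2 ∉ M.image Prod.snd := by
  intro hpx
  refine hpM ?_
  obtain ⟨q, hq, e⟩ := Finset.mem_image.1 hpx
  have hqe : (q.1, p.2) ∈ M := by rw [← e]; exact hq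
  refine hM.row_mem hqe fun t ht1 ht2 => ?_
  have hqP : q.1 ∈ rowOf P p.2 := mem_rowOf.2 (hM.sub hqe)
  have hpP' : p.1 ∈ rowOf P p.2 := mem_rowOf.2 hp
  rw [← mem_rowOf]
  by_cases e1 : t = q.1
  · rwa [e1]
  by_cases e2 : t = p.1
  · rwa [e2]
  rcases lt_or_ge q.1 p.1 with hlt | hlt
  · exact hg.1 _ hqP _ hpP' t (by omega) (by omega)
  · exact hg.1 _ hpP' _ hqP t (by omega) (by omega)

theorem IsComp.col_of_not_mem {P Z M : Finset Site} (hM : IsComp P M) {p : Site} (hp : p ∈ P)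
    (hpM : p ∉ M) (hg : LineGood (colOf P p.1) (colOf Z p.1)) : p.1 ∉ M.image Prod.fst := by
  intro hpx
  refine hpM ?_
  obtain ⟨q, hq, e⟩ := Finset.mem_image.1 hpx
  have hqe : (p.1, q.2) ∈ M := by rw [← e]; exact hq
  refine hM.col_mem hqe fun t ht1 ht2 => ?_
  have hqP : q.2 ∈ colOf P p.1 := mem_colOf.2 (hM.sub hqe)
  have hpP' : p.2 ∈ colOf P p.1 := mem_colOf.2 hp
  rw [← mem_colOf]
  by_cases e1 : t = q.2
  · rwa [e1]
  by_cases e2 : t = p.2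
  · rwa [e2]
  rcases lt_or_ge q.2 p.2 with hlt | hlt
  · exact hg.1 _ hqP _ hpP' t (by omega) (by omega)
  · exact hg.1 _ hpP' _ hqP t (by omega) (by omega)

-- In a row missing `S`, the sites of `P` are outside `M`, so each lies in a bad column or in a
-- column missing `M`. The former are at most `K`, the latter are within `m - 1` of the lateral
-- sides, and together they fill less than half of the row.
open Classical in
theorem card_stray_row {P Z M : Finset Site} (hM : IsComp P M) {A D : Fin 4 → ℤ} {n m K : ℤ}
    (hT : Tight n A D) (hA : ∀ i, A i - m + 1 ≤ sA (M ∩ oct A D) i) (hne : (M ∩ oct A D).Nonempty)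
    (hm : 1 ≤ m) (hn : 4 * m + 2 * K ≤ n) {BC : Finset ℤ} (hBC : (BC.card : ℤ) ≤ K)
    (hbad : ∀ x, ¬ LineGood (colOf P x) (colOf Z x) → x ∈ BC) {y : ℤ} (h1 : -A 0 ≤ y) (h2 : y ≤ A 2)
    (hy : y ∉ Finset.Icc (-sA (M ∩ oct A D) 0) (sA (M ∩ oct A D) 2)) :
    n ≤ 2 * ((oct A D \ P).filter fun p => p.2 = y).card := by
  have hrow := hT.le_card_row h1 h2 (by omega)
  set F := (oct A D).filter fun p => p.2 = y with hF
  have hs := Finset.card_sdiff_add_card_inter F P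
  have hsub : (F ∩ P).image Prod.fst ⊆
      (Finset.Ico (-A 1) (-A 1 + m - 1) ∪ Finset.Ioc (A 3 - m + 1) (A 3)) ∪ BC := by
    intro x hx
    obtain ⟨p, hp, rfl⟩ := Finset.mem_image.1 hx
    obtain ⟨hpF, hpP⟩ := Finset.mem_inter.1 hp
    obtain ⟨hpo, hpy⟩ := Finset.mem_filter.1 hpF
    have hpM : p ∉ M := fun hpM => hy (by
      have := Finset.mem_inter.2 ⟨hpM, hpo⟩
      have l0 := le_sA this 0
      have l2 := le_sA this 2
      rw [ax_zero] at l0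
      rw [ax_two] at l2
      rw [Finset.mem_Icc]; omega)
    have hpo' := mem_oct'.1 hpo
    by_cases hpx : p.1 ∈ M.image Prod.fst
    · exact Finset.mem_union_right _ (hbad _ fun hg => hM.col_of_not_mem hpP hpM hg hpx)
    · rw [hM.image_fst, Finset.mem_Icc] at hpx
      have m1 := sA_mono hne Finset.inter_subset_left 1
      have m3 := sA_mono hne Finset.inter_subset_left 3
      have a1 := hA 1
      have a3 := hA 3
      refine Finset.mem_union_left _ ?_
      rw [Finset.mem_union, Finset.mem_Ico, Finset.mem_Ioc]
      omega
  have hc := (Finset.card_le_card hsub).trans ((Finset.card_union_le _ _).trans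
    (Nat.add_le_add_right (Finset.card_union_le _ _) _))
  rw [Finset.card_image_of_injOn, Int.card_Ico, Int.card_Ioc] at hc
  · have hsub2 : F \ P ⊆ (oct A D \ P).filter fun p => p.2 = y := by
      intro p hp
      rw [Finset.mem_sdiff, hF, Finset.mem_filter] at hp
      exact Finset.mem_filter.2 ⟨Finset.mem_sdiff.2 ⟨hp.1.1, hp.2⟩, hp.1.2⟩
    have := Finset.card_le_card hsub2
    omega
  · intro p hp q hq e
    have h1 := (Finset.mem_filter.1 (Finset.mem_inter.1 (Finset.mem_coe.1 hp)).1).2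
    have h2 := (Finset.mem_filter.1 (Finset.mem_inter.1 (Finset.mem_coe.1 hq)).1).2
    exact Prod.ext e (h1.trans h2.symm)

open Classical in
theorem card_stray_col {P Z M : Finset Site} (hM : IsComp P M) {A D : Fin 4 → ℤ} {n m K : ℤ}
    (hT : Tight n A D) (hA : ∀ i, A i - m + 1 ≤ sA (M ∩ oct A D) i) (hne : (M ∩ oct A D).Nonempty)
    (hm : 1 ≤ m) (hn : 4 * m + 2 * K ≤ n) {BR : Finset ℤ} (hBR : (BR.card : ℤ) ≤ K)
    (hbad : ∀ y, ¬ LineGood (rowOf P y) (rowOf Z y) → y ∈ BR) {x : ℤ} (h1 : -A 1 ≤ x) (h2 : x ≤ A 3)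
    (hy : x ∉ Finset.Icc (-sA (M ∩ oct A D) 1) (sA (M ∩ oct A D) 3)) :
    n ≤ 2 * ((oct A D \ P).filter fun p => p.1 = x).card := by
  have hrow := hT.le_card_col h1 h2 (by omega)
  set F := (oct A D).filter fun p => p.1 = x with hF
  have hs := Finset.card_sdiff_add_card_inter F P
  have hsub : (F ∩ P).image Prod.snd ⊆
      (Finset.Ico (-A 0) (-A 0 + m - 1) ∪ Finset.Ioc (A 2 - m + 1) (A 2)) ∪ BR := by
    intro x hx
    obtain ⟨p, hp, rfl⟩ := Finset.mem_image.1 hx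
    obtain ⟨hpF, hpP⟩ := Finset.mem_inter.1 hp
    obtain ⟨hpo, hpy⟩ := Finset.mem_filter.1 hpF
    have hpM : p ∉ M := fun hpM => hy (by
      have := Finset.mem_inter.2 ⟨hpM, hpo⟩
      have l0 := le_sA this 1
      have l2 := le_sA this 3
      rw [ax_one] at l0
      rw [ax_three] at l2
      rw [Finset.mem_Icc]; omega)
    have hpo' := mem_oct'.1 hpo
    by_cases hpx : p.2 ∈ M.image Prod.snd
    · exact Finset.mem_union_right _ (hbad _ fun hg => hM.row_of_not_mem hpP hpM hg hpx)
    · rw [hM.image_snd, Finset.mem_Icc] at hpx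
      have m1 := sA_mono hne Finset.inter_subset_left 0
      have m3 := sA_mono hne Finset.inter_subset_left 2
      have a1 := hA 0
      have a3 := hA 2
      refine Finset.mem_union_left _ ?_
      rw [Finset.mem_union, Finset.mem_Ico, Finset.mem_Ioc]
      omega
  have hc := (Finset.card_le_card hsub).trans ((Finset.card_union_le _ _).trans
    (Nat.add_le_add_right (Finset.card_union_le _ _) _))
  rw [Finset.card_image_of_injOn, Int.card_Ico, Int.card_Ioc] at hc
  · have hsub2 : F \ P ⊆ (oct A D \ P).filter fun p => p.1 = x := by
      intro p hp
      rw [Finset.mem_sdiff, hF, Finset.mem_filter] at hp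
      exact Finset.mem_filter.2 ⟨Finset.mem_sdiff.2 ⟨hp.1.1, hp.2⟩, hp.1.2⟩
    have := Finset.card_le_card hsub2
    omega
  · intro p hp q hq e
    have h1 := (Finset.mem_filter.1 (Finset.mem_inter.1 (Finset.mem_coe.1 hp)).1).2
    have h2 := (Finset.mem_filter.1 (Finset.mem_inter.1 (Finset.mem_coe.1 hq)).1).2
    exact Prod.ext (h1.trans h2.symm) e

/-- Because `χ ≤ B`, the quadratic gain absorbs at most half of the linear penalty in `χ`. What is
left bounds the nonnegative integer `4 μ + χ` strictly by one. -/
theorem eq_zero_of_penalty_le {k T B e : ℝ} {χ μ : ℤ} (hk1 : k < 1) (hχ : 0 ≤ χ) (hμ : 0 ≤ μ)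
    (hT : 0 ≤ T) (hχB : (χ : ℝ) ≤ B) (h1 : 2 * (B * (e * T)) ≤ 1 - k) {E : ℝ}
    (h2 : 2 * (e * E) < 1 - k)
    (h : (1 - k) * (2 * (μ : ℝ) + χ) ≤ e * (χ * χ * T) + e * E) (he : 0 ≤ e) : χ = 0 ∧ μ = 0 := by
  have hχ' : (0 : ℝ) ≤ χ := by exact_mod_cast hχ
  have hμ' : (0 : ℝ) ≤ μ := by exact_mod_cast hμ
  have h3 : 2 * (χ * (e * T)) ≤ 1 - k :=
    le_trans (mul_le_mul_of_nonneg_left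
      (mul_le_mul_of_nonneg_right hχB (mul_nonneg he hT)) (by norm_num)) h1
  have h4 := mul_le_mul_of_nonneg_left h3 hχ'
  have h5 : (1 - k) * (4 * (μ : ℝ) + χ) < (1 - k) * 1 := by linarith
  have h6 := lt_of_mul_lt_mul_left h5 (by linarith)
  have h7 : 4 * μ + χ < 1 := by exact_mod_cast h6
  omega

set_option maxHeartbeats 1000000 in
/-- For small parameters the minimizer is connected and its lines are intervals. -/
theorem Ctx.rigid {k δ lam : ℝ} {A D : Fin 4 → ℤ} {C : ℕ} {P Z : Finset Site}
    (h : Ctx k δ A D C P Z) {n M0 m K Kb : ℤ} (hT : Tight n A D) (hM0 : 1 ≤ M0)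
    (hlam : lam ≤ δ * n) (hM : 64 ≤ lam * M0) (hm : 1 ≤ m) (hK0 : 0 ≤ K) (hK : 32 * M0 ≤ δ * m * K)
    (hKb : 32 * M0 ≤ (1 - k) * Kb) (hn : 40 * M0 + 8 * (m + K) + 4 * Kb + 20 ≤ n)
    (hδ1 : 2 * ((Kb + 16 * M0) * (δ * (m + K))) ≤ 1 - k)
    (hδ2 : 2 * (δ * (16 * M0 * (8 * M0 + 1))) < 1 - k) :
    IsComp P P ∧ (∀ y, LineGood (rowOf P y) (rowOf Z y)) ∧
      (∀ x, LineGood (colOf P x) (colOf Z x)) ∧ (P ∩ oct A D).Nonempty ∧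
      (∀ i, sA P i = sA (P ∩ oct A D) i) ∧ (∀ i, sA P i ≤ A i) ∧
      (∀ i, sD (P ∩ oct A D) i ≤ D i) ∧
      Tight (n - 4 * (m + K)) (sA P) (sD (P ∩ oct A D)) ∧ ∑ i, (A i - sA P i) ≤ 8 * M0 := by
  classical
  have hδ := h.hδ
  have hk := h.hk
  have hk1 := h.hk1
  have hM0' : (1 : ℝ) ≤ M0 := by exact_mod_cast hM0
  have hm' : (1 : ℝ) ≤ m := by exact_mod_cast hm
  have hK0' : (0 : ℝ) ≤ K := by exact_mod_cast hK0
  have hKb0 : 0 ≤ Kb := by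
    by_contra hcon
    have : (Kb : ℝ) ≤ -1 := by exact_mod_cast (by omega : Kb ≤ -1)
    nlinarith
  set BR := (P.image Prod.snd ∪ Z.image Prod.snd).filter
    fun y => ¬ LineGood (rowOf P y) (rowOf Z y) with hBRdef
  set BC := (P.image Prod.fst ∪ Z.image Prod.fst).filter
    fun x => ¬ LineGood (colOf P x) (colOf Z x) with hBCdef
  have hBR : ∀ y ∈ BR, ¬ LineGood (rowOf P y) (rowOf Z y) := fun y hy => (Finset.mem_filter.1 hy).2
  have hBC : ∀ y ∈ BC, ¬ LineGood (colOf P y) (colOf Z y) := fun y hy => (Finset.mem_filter.1 hy).2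
  have hBR' : ∀ y, ¬ LineGood (rowOf P y) (rowOf Z y) → y ∈ BR := by
    intro y hy
    refine Finset.mem_filter.2 ⟨?_, hy⟩
    by_contra hcon
    rw [Finset.mem_union, not_or] at hcon
    refine hy ⟨fun a ha => absurd (Finset.mem_image_of_mem Prod.snd (mem_rowOf.1 ha)) hcon.1, fun _ => ?_⟩
    exact Finset.eq_empty_of_forall_notMem fun x hx =>
      hcon.2 (Finset.mem_image_of_mem Prod.snd (mem_rowOf.1 hx))
  have hBC' : ∀ y, ¬ LineGood (colOf P y) (colOf Z y) → y ∈ BC := by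
    intro y hy
    refine Finset.mem_filter.2 ⟨?_, hy⟩
    by_contra hcon
    rw [Finset.mem_union, not_or] at hcon
    refine hy ⟨fun a ha => absurd (Finset.mem_image_of_mem Prod.fst (mem_colOf.1 ha)) hcon.1, fun _ => ?_⟩
    exact Finset.eq_empty_of_forall_notMem fun x hx =>
      hcon.2 (Finset.mem_image_of_mem Prod.fst (mem_colOf.1 hx))
  have hap := h.a_priori hT hM0 (by omega) hlam hM hBR hBC
  have hDis0 : (0 : ℝ) ≤ Dis A D P := by exact_mod_cast Dis_nonneg A D P
  have hout0 : (0 : ℝ) ≤ outLines A P := by positivity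
  have hbadnn : 0 ≤ (1 - k) * ((BR.card : ℝ) + BC.card) := mul_nonneg (by linarith) (by positivity)
  have hδD : δ * Dis A D P ≤ 32 * M0 := by linarith
  have hbadc : (BR.card : ℤ) + BC.card ≤ Kb := by
    have h1 : (1 - k) * ((BR.card : ℝ) + BC.card) ≤ (1 - k) * Kb := by nlinarith
    have h2 := le_of_mul_le_mul_left h1 (by linarith)
    exact_mod_cast h2
  have hout : (outLines A P : ℤ) ≤ 8 * M0 := by
    have : (outLines A P : ℝ) ≤ 8 * M0 := by nlinarith
    exact_mod_cast this
  -- Each such site dissipates at least `δ * m`, out of a budget of `32 * M0 ≤ δ * m * K`.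
  have hX : (((oct A D \ P).filter fun p => m ≤ dep A D p).card : ℤ) ≤ K := by
    have h1 : m * ((oct A D \ P).filter fun p => m ≤ dep A D p).card ≤ Dis A D P := by
      calc m * ((oct A D \ P).filter fun p => m ≤ dep A D p).card
          = ∑ p ∈ (oct A D \ P).filter fun p => m ≤ dep A D p, m := by simp [mul_comm]
        _ ≤ ∑ p ∈ (oct A D \ P).filter fun p => m ≤ dep A D p, dep A D p :=
          Finset.sum_le_sum fun p hp => (Finset.mem_filter.1 hp).2
        _ ≤ ∑ p ∈ oct A D \ P, dep A D p :=
          Finset.sum_le_sum_of_subset_of_nonneg (Finset.filter_subset _ _) fun p hp _ => by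
            have := one_le_dep.2 (Finset.mem_sdiff.1 hp).1
            omega
        _ ≤ Dis A D P := by unfold Dis; omega
    have h2 : (m : ℝ) * ((oct A D \ P).filter fun p => m ≤ dep A D p).card ≤ Dis A D P := by
      exact_mod_cast h1
    have h3 : (δ * m) * (((oct A D \ P).filter fun p => m ≤ dep A D p).card : ℝ) ≤ (δ * m) * K := by
      have := mul_le_mul_of_nonneg_left h2 hδ.le
      nlinarith
    have h4 := le_of_mul_le_mul_left h3 (by positivity)
    exact_mod_cast h4
  obtain ⟨M, hMc, hdom⟩ := exists_main_comp hT hm hX (by omega)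
  set S := M ∩ oct A D with hS
  have hSM : S ⊆ M := Finset.inter_subset_left
  obtain ⟨hSne, hSA, hSD, hST, hSq⟩ := support_of_dominated (S := S) hT (m := m + K) (by omega)
    (by omega) Finset.inter_subset_right (fun q hq => by
      obtain ⟨⟨j, h1, -, h2⟩, ⟨j', h3, -, h4⟩⟩ := hdom q hq
      exact ⟨⟨j, h1, h2⟩, ⟨j', h3, h4⟩⟩)
  -- lines outside of the box of `S`
  have hSbox0 : -sA S 0 ≤ sA S 2 := by
    obtain ⟨p, hp⟩ := hSne
    have h0 := le_sA hp 0
    have h2 := le_sA hp 2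
    simp only [ax_zero, ax_two] at h0 h2
    omega
  have hSbox1 : -sA S 1 ≤ sA S 3 := by
    obtain ⟨p, hp⟩ := hSne
    have h0 := le_sA hp 1
    have h2 := le_sA hp 3
    simp only [ax_one, ax_three] at h0 h2
    omega
  -- The a priori argument applies again to the lines of the datum that miss the box of `S`: at
  -- least half of each is absent from `P`, which is all that the dissipation estimate requires.
  have hα : ∑ i, (A i - sA S i) ≤ 8 * M0 := by
    have hl := lines_sum_dep_le (A := A) (D := D) (W := oct A D \ P) Finset.sdiff_subset
      (Y := Finset.Icc (-A 0) (A 2) \ Finset.Icc (-sA S 0) (sA S 2))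
      (X := Finset.Icc (-A 1) (A 3) \ Finset.Icc (-sA S 1) (sA S 3)) (n := n) (M0 := M0)
      (fun y hy => by
        rw [Finset.mem_sdiff, Finset.mem_Icc] at hy
        exact card_stray_row hMc hT (fun i => (hSA i).2) hSne (by omega) (K := Kb) (by omega)
          (by omega) hBC' hy.1.1 hy.1.2 hy.2)
      (fun y hy => by
        rw [Finset.mem_sdiff, Finset.mem_Icc] at hy
        exact card_stray_col hMc hT (fun i => (hSA i).2) hSne (by omega) (K := Kb) (by omega)
          (by omega) hBR' hy.1.1 hy.1.2 hy.2) hM0 (by omega)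
    have a0 := (hSA 0).1
    have a1 := (hSA 1).1
    have a2 := (hSA 2).1
    have a3 := (hSA 3).1
    rw [Finset.card_sdiff_of_subset (Finset.Icc_subset_Icc (by omega) (by omega)),
      Finset.card_sdiff_of_subset (Finset.Icc_subset_Icc (by omega) (by omega)),
      Int.card_Icc, Int.card_Icc, Int.card_Icc, Int.card_Icc] at hl
    set r := ∑ i, (A i - sA S i) with hr
    have hr' : r = (A 0 - sA S 0) + (A 1 - sA S 1) + (A 2 - sA S 2) + (A 3 - sA S 3) := by
      rw [hr, Fin.sum_univ_four]
    have hl2 : (r - 4 * M0) * (M0 * n) ≤ 8 * Dis A D P := by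
      refine le_trans (le_of_eq ?_) (hl.trans ?_)
      · congr 1; omega
      · unfold Dis; omega
    by_contra hcon
    push Not at hcon
    have hr8 : (8 * M0 : ℝ) < r := by exact_mod_cast hcon
    have h1 : ((r : ℝ) - 4 * M0) * (M0 * n) ≤ 8 * Dis A D P := by exact_mod_cast hl2
    have h2 : 64 ≤ δ * n * M0 := hM.trans (mul_le_mul_of_nonneg_right hlam (by linarith))
    have h3 := mul_le_mul_of_nonneg_left h2 (by linarith : (0 : ℝ) ≤ r - 4 * M0)
    have h4 := mul_le_mul_of_nonneg_left h1 hδ.le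
    nlinarith
  -- lines of `P` not meeting `M`
  set EX := P.image Prod.fst \ M.image Prod.fst with hEX
  set EY := P.image Prod.snd \ M.image Prod.snd with hEY
  have he : (extraLines P M : ℤ) = EX.card + EY.card := by simp [extraLines, hEX, hEY]
  have heb : (EX.card : ℤ) + EY.card ≤ 16 * M0 := by
    have mono := fun i => sA_mono hSne hSM i
    have m0 := mono 0
    have m1 := mono 1
    have m2 := mono 2
    have m3 := mono 3
    have a0 := (hSA 0).1
    have a1 := (hSA 1).1
    have a2 := (hSA 2).1
    have a3 := (hSA 3).1
    have s1 : EX ⊆ (P.image Prod.fst \ Finset.Icc (-A 1) (A 3)) ∪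
        (Finset.Icc (-A 1) (A 3) \ Finset.Icc (-sA S 1) (sA S 3)) := by
      intro x hx
      rw [hEX, Finset.mem_sdiff, hMc.image_fst, Finset.mem_Icc] at hx
      simp only [Finset.mem_union, Finset.mem_sdiff, Finset.mem_Icc, hx.1, true_and]
      omega
    have s2 : EY ⊆ (P.image Prod.snd \ Finset.Icc (-A 0) (A 2)) ∪
        (Finset.Icc (-A 0) (A 2) \ Finset.Icc (-sA S 0) (sA S 2)) := by
      intro x hx
      rw [hEY, Finset.mem_sdiff, hMc.image_snd, Finset.mem_Icc] at hx
      simp only [Finset.mem_union, Finset.mem_sdiff, Finset.mem_Icc, hx.1, true_and]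
      omega
    have c1 := (Finset.card_le_card s1).trans (Finset.card_union_le _ _)
    have c2 := (Finset.card_le_card s2).trans (Finset.card_union_le _ _)
    rw [Finset.card_sdiff_of_subset (Finset.Icc_subset_Icc (by omega) (by omega) :
      Finset.Icc (-sA S 1) (sA S 3) ⊆ _), Int.card_Icc, Int.card_Icc] at c1
    rw [Finset.card_sdiff_of_subset (Finset.Icc_subset_Icc (by omega) (by omega) :
      Finset.Icc (-sA S 0) (sA S 2) ⊆ _), Int.card_Icc, Int.card_Icc] at c2
    rw [Fin.sum_univ_four] at hα
    unfold outLines at hout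
    omega
  -- The number of defective lines: bad ones and those disjoint from `M`. Rigidity is the assertion
  -- that it vanishes.
  set χ : ℤ := BR.card + BC.card + (EX.card + EY.card) with hχ
  have hχ0 : 0 ≤ χ := by omega
  -- comparison with the octagon generated by `S`
  set H := oct (sA S) (sD S) with hH
  set s := ((C : ℤ) - ∑ i, tS (sA S) (sD S) i).toNat with hs
  -- An axis displacement by one destroys at most two corners, and diagonal displacements only
  -- create them.
  have hsb : (s : ℤ) ≤ 16 * M0 := by
    have hle := h.le_sum
    have d0 := hSD 0
    have d1 := hSD 1
    have d2 := hSD 2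
    have d3 := hSD 3
    simp only [Fin.sum_univ_four, tS_zero, tS_one, tS_two, tS_three] at hle hα hs
    omega
  have hsC : s ≤ C := by
    have : 0 ≤ ∑ i, tS (sA S) (sD S) i := Finset.sum_nonneg fun i _ => hST.1 i
    omega
  have hcmp := h.le_oct (hST.mono (by omega)) (fun i => (hSA i).1) hSD (s := s)
    (by have := hST.2 0; omega) hsC (by omega)
  have hlow := hMc.Phi_le_cost (by linarith) hk1 h.card h.disj hSne hSM hBR hBC
  have hα0 : A 0 - sA S 0 ≤ 8 * M0 := by
    have a1 := (hSA 1).1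
    have a2 := (hSA 2).1
    have a3 := (hSA 3).1
    rw [Fin.sum_univ_four] at hα
    omega
  -- stray sites
  set Q := (P ∩ oct A D) \ H with hQ
  have hQM : ∀ p ∈ P \ M, p.2 ∈ EY ∪ BR ∧ p.1 ∈ EX ∪ BC := by
    intro p hp
    rw [Finset.mem_sdiff] at hp
    constructor
    · by_cases hg : LineGood (rowOf P p.2) (rowOf Z p.2)
      · exact Finset.mem_union_left _ (Finset.mem_sdiff.2
          ⟨Finset.mem_image_of_mem _ hp.1, hMc.row_of_not_mem hp.1 hp.2 hg⟩)
      · exact Finset.mem_union_right _ (hBR' _ hg)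
    · by_cases hg : LineGood (colOf P p.1) (colOf Z p.1)
      · exact Finset.mem_union_left _ (Finset.mem_sdiff.2
          ⟨Finset.mem_image_of_mem _ hp.1, hMc.col_of_not_mem hp.1 hp.2 hg⟩)
      · exact Finset.mem_union_right _ (hBC' _ hg)
  have hQsub : Q ⊆ P \ M := by
    intro p hp
    rw [hQ, Finset.mem_sdiff, Finset.mem_inter] at hp
    refine Finset.mem_sdiff.2 ⟨hp.1.1, fun hpM => hp.2 ?_⟩
    exact subset_oct_sA S (Finset.mem_inter.2 ⟨hpM, hp.1.2⟩)
  -- A stray site lies in a defective row and in a defective column, hence at one of their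
  -- crossings.
  have hQcard : (Q.card : ℤ) ≤ χ * χ := by
    have hsub : Q ⊆ (EX ∪ BC) ×ˢ (EY ∪ BR) := fun p hp =>
      Finset.mem_product.2 ⟨(hQM p (hQsub hp)).2, (hQM p (hQsub hp)).1⟩
    have h1 := Finset.card_le_card hsub
    rw [Finset.card_product] at h1
    have h2 : ((EX ∪ BC).card : ℤ) ≤ χ := by
      have := Finset.card_union_le EX BC; omega
    have h3 : ((EY ∪ BR).card : ℤ) ≤ χ := by
      have := Finset.card_union_le EY BR; omega
    calc (Q.card : ℤ) ≤ ((EX ∪ BC).card : ℤ) * (EY ∪ BR).card := by exact_mod_cast h1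
      _ ≤ χ * χ := mul_le_mul h2 h3 (by positivity) hχ0
  have hHD : Dis A D H ≤ Dis A D P + χ * χ * (m + K) := by
    have hHsub : H ⊆ oct A D := oct_subset_oct (fun i => (hSA i).1) hSD
    rw [Dis_of_subset hHsub]
    have h1 : oct A D \ H ⊆ (oct A D \ P) ∪ Q := by
      intro p hp
      rw [Finset.mem_sdiff] at hp
      by_cases hpP : p ∈ P
      · exact Finset.mem_union_right _ (Finset.mem_sdiff.2 ⟨Finset.mem_inter.2 ⟨hpP, hp.1⟩, hp.2⟩)
      · exact Finset.mem_union_left _ (Finset.mem_sdiff.2 ⟨hp.1, hpP⟩)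
    have hnn : ∀ p ∈ (oct A D \ P) ∪ Q, 0 ≤ dep A D p := by
      intro p hp
      have : p ∈ oct A D := by
        rw [Finset.mem_union] at hp
        rcases hp with hp | hp
        · exact (Finset.mem_sdiff.1 hp).1
        · exact (Finset.mem_inter.1 (Finset.mem_sdiff.1 hp).1).2
      have := one_le_dep.2 this
      omega
    have h2 : ∑ p ∈ oct A D \ H, dep A D p ≤ ∑ p ∈ (oct A D \ P) ∪ Q, dep A D p :=
      Finset.sum_le_sum_of_subset_of_nonneg h1 fun p hp _ => hnn p hp
    have h3 : ∑ p ∈ (oct A D \ P) ∪ Q, dep A D p = ∑ p ∈ oct A D \ P, dep A D p +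
        ∑ p ∈ Q, dep A D p := Finset.sum_union (Finset.disjoint_left.2 fun p h1 h2 =>
          (Finset.mem_sdiff.1 h1).2 (Finset.mem_inter.1 (Finset.mem_sdiff.1 h2).1).1)
    have h4 : ∑ p ∈ Q, dep A D p ≤ Q.card * (m + K) := by
      have := Finset.sum_le_card_nsmul Q (dep A D) (m + K) fun p hp => by
        by_contra hcon
        exact (Finset.mem_sdiff.1 hp).2 (hSq p (by omega))
      simpa using this
    have h5 : (Q.card : ℤ) * (m + K) ≤ χ * χ * (m + K) :=
      mul_le_mul_of_nonneg_right hQcard (by omega)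
    unfold Dis
    omega
  -- The energy penalty of the defects is paid for by what `P` can save in dissipation: `χ * χ`
  -- stray sites of depth at most `m + K`, and the slice end which the competitor gives to its
  -- excess surfactant.
  have hmain : (1 - k) * (2 * ((∑ i, (sA M i - sA S i) : ℤ) : ℝ) + χ) ≤
      δ * (χ * χ * (m + K)) + δ * (16 * M0 * (8 * M0 + 1)) := by
    have h1 : ((Dis A D H + s * (A 0 - sA S 0 + 1) : ℤ) : ℝ) ≤
        Dis A D P + χ * χ * (m + K) + 16 * M0 * (8 * M0 + 1) := by
      have h2 : (s : ℤ) * (A 0 - sA S 0 + 1) ≤ 16 * M0 * (8 * M0 + 1) :=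
        mul_le_mul hsb (by omega) (by have := (hSA 0).1; omega) (by omega)
      have : (Dis A D H + s * (A 0 - sA S 0 + 1) : ℤ) ≤
        Dis A D P + χ * χ * (m + K) + 16 * M0 * (8 * M0 + 1) := by omega
      exact_mod_cast this
    have h2 := mul_le_mul_of_nonneg_left h1 hδ.le
    have h3 : (1 - k) * (2 * ((∑ i, (sA M i - sA S i) : ℤ) : ℝ) + χ) ≤
        (1 - k) * (2 * ((∑ i, (sA M i - sA S i) : ℤ) : ℝ) +
      2 * extraLines P M + BR.card + BC.card) := by
      refine mul_le_mul_of_nonneg_left ?_ (by linarith)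
      have e1 : (χ : ℝ) = BR.card + BC.card + extraLines P M := by
        rw [hχ, ← he]; push_cast; ring
      have : (0 : ℝ) ≤ extraLines P M := by positivity
      linarith
    have hPhi : Phi k C (sA S) (sD S) = 4 * (∑ i, (sA S i : ℝ) + 2) + (1 + k) * (s : ℝ) := by
      unfold Phi; rw [← hs]; push_cast; rfl
    rw [hPhi] at hlow
    linarith
  have hmnn : ∀ i, 0 ≤ sA M i - sA S i := fun i => by
    have := sA_mono hSne hSM i; omega
  have hms : 0 ≤ ∑ i, (sA M i - sA S i) := Finset.sum_nonneg fun i _ => hmnn i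
  have hχb : (χ : ℝ) ≤ Kb + 16 * M0 := by
    have : χ ≤ Kb + 16 * M0 := by omega
    exact_mod_cast this
  have hzero : χ = 0 ∧ ∑ i, (sA M i - sA S i) = 0 :=
    eq_zero_of_penalty_le hk1 hχ0 hms (by positivity) hχb hδ1 hδ2 hmain hδ.le
  obtain ⟨hz1, hz2⟩ := hzero
  have hBRe : BR = ∅ := Finset.card_eq_zero.1 (by omega)
  have hBCe : BC = ∅ := Finset.card_eq_zero.1 (by omega)
  have hEYe : EY = ∅ := Finset.card_eq_zero.1 (by omega)
  have hPM : M = P := by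
    refine hMc.sub.antisymm fun p hp => ?_
    by_contra hpM
    have := (hQM p (Finset.mem_sdiff.2 ⟨hp, hpM⟩)).1
    rw [hEYe, hBRe] at this
    simp at this
  have hsA : ∀ i, sA M i = sA S i := fun i => by
    have := (Finset.sum_eq_zero_iff_of_nonneg fun i _ => hmnn i).1 hz2 i (Finset.mem_univ _)
    omega
  have hsA' : sA M = sA S := funext hsA
  rw [hPM] at hS hMc
  rw [← hS, show sA P = sA S by rw [← hPM]; exact hsA']
  refine ⟨hMc, fun y => ?_, fun x => ?_, hSne, fun _ => rfl, fun i => (hSA i).1, hSD, hST, hα⟩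
  · by_contra hcon
    have := hBR' y hcon
    rw [hBRe] at this
    simp at this
  · by_contra hcon
    have := hBC' x hcon
    rw [hBCe] at this
    simp at this

/-! ### The shape of the minimizer -/

/-- A saturated staircase cannot have long steps before its last one. -/
theorem stair_end {Q : ℤ → ℤ → Prop} {u v a b uq vq : ℤ} (hb : ∀ x y, Q x y → y ≤ b)
    (h1 : Q (u - 1) v) (h2 : ∀ x, Q x v → x < u) (h3 : ∀ y, Q u y → y < v) (h4 : ¬ Q u (v - 1))
    (satU : ∀ x, uq < x → x ≤ a →
      ∃ y, Q (x - 1) y ∧ ∀ y', Q x y' → y' < y)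
    (satV : ∀ y, vq < y → y ≤ b →
      ∃ x, Q (x - 1) y ∧ Q x (y - 1) ∧ ∀ x', Q x' y → x' < x)
    (hnb : uq < u ∨ vq < v) :
    ∀ N : ℕ, u + N ≤ a → ∀ y, Q (u + N) y → y + N + 2 ≤ v := by
  -- Otherwise `vq < v`, and saturation at height `v` places a corner at `(u, v)`, whose lower
  -- neighbour would belong to the set, against `h4`.
  have hu : uq < u := by
    by_contra hcon
    obtain ⟨x, e1, e2, e3⟩ := satV v (by omega) (hb _ _ h1)
    have := h2 _ e1
    have := e3 _ h1
    rw [show x = u by omega] at e2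
    exact h4 e2
  intro N
  induction N with
  | zero =>
    intro _ y hy
    rw [Nat.cast_zero, add_zero] at *
    have := h3 y hy
    by_contra hcon
    exact h4 (by rwa [show v - 1 = y by omega])
  | succ N ih =>
    intro hN y hy
    push_cast at *
    obtain ⟨y', e1, e2⟩ := satU (u + (N + 1)) (by omega) hN
    rw [show u + ((N : ℤ) + 1) - 1 = u + N by ring] at e1
    have := ih (by omega) _ e1
    have := e2 y hy
    omega

/-- All lines of `P` are intervals, and all lines meeting `Z` meet `P`. -/
structure GoodLines (P Z : Finset Site) : Prop where
  conv : ∀ i : Fin 4, ∀ p ∈ P, ∀ q ∈ P, ∀ r, ax i p = ax i r → ax i q = ax i r →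
    ax (i + 1) p ≤ ax (i + 1) r → ax (i + 1) r ≤ ax (i + 1) q → r ∈ P
  ne : ∀ i : Fin 4, ∀ z ∈ Z, ∃ p ∈ P, ax i p = ax i z

theorem LineConvex.mem {S : Finset ℤ} (h : LineConvex S) {a b c : ℤ} (ha : a ∈ S) (hc : c ∈ S)
    (h1 : a ≤ b) (h2 : b ≤ c) : b ∈ S := by
  rcases eq_or_lt_of_le h1 with e1 | e1
  · rwa [← e1]
  rcases eq_or_lt_of_le h2 with e2 | e2
  · rwa [e2]
  exact h a ha c hc b e1 e2

theorem GoodLines.of_lines {P Z : Finset Site} (hr : ∀ y, LineGood (rowOf P y) (rowOf Z y))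
    (hc : ∀ x, LineGood (colOf P x) (colOf Z x)) : GoodLines P Z := by
  have row : ∀ p ∈ P, ∀ q ∈ P, ∀ r : Site, p.2 = r.2 → q.2 = r.2 → p.1 ≤ r.1 → r.1 ≤ q.1 →
      r ∈ P := by
    intro p hp q hq r h1 h2 h3 h4
    have h5 : p.1 ∈ rowOf P r.2 := mem_rowOf.2 (by rw [← h1]; exact hp)
    have h6 : q.1 ∈ rowOf P r.2 := mem_rowOf.2 (by rw [← h2]; exact hq)
    exact mem_rowOf.1 ((hr r.2).1.mem h5 h6 h3 h4)
  have col : ∀ p ∈ P, ∀ q ∈ P, ∀ r : Site, p.1 = r.1 → q.1 = r.1 → p.2 ≤ r.2 → r.2 ≤ q.2 →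
      r ∈ P := by
    intro p hp q hq r h1 h2 h3 h4
    have h5 : p.2 ∈ colOf P r.1 := mem_colOf.2 (by rw [← h1]; exact hp)
    have h6 : q.2 ∈ colOf P r.1 := mem_colOf.2 (by rw [← h2]; exact hq)
    exact mem_colOf.1 ((hc r.1).1.mem h5 h6 h3 h4)
  have rowne : ∀ z ∈ Z, ∃ p ∈ P, p.2 = z.2 := by
    intro z hz
    by_contra hcon
    push Not at hcon
    have h1 : rowOf P z.2 = ∅ := Finset.eq_empty_of_forall_notMem fun x hx =>
      hcon _ (mem_rowOf.1 hx) rfl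
    have h2 : z.1 ∈ rowOf Z z.2 := mem_rowOf.2 hz
    rw [(hr z.2).2 h1] at h2
    simp at h2
  have colne : ∀ z ∈ Z, ∃ p ∈ P, p.1 = z.1 := by
    intro z hz
    by_contra hcon
    push Not at hcon
    have h1 : colOf P z.1 = ∅ := Finset.eq_empty_of_forall_notMem fun x hx =>
      hcon _ (mem_colOf.1 hx) rfl
    have h2 : z.2 ∈ colOf Z z.1 := mem_colOf.2 hz
    rw [(hc z.1).2 h1] at h2
    simp at h2
  constructor
  · rw [forall_fin4, show (0 + 1 : Fin 4) = 1 from rfl, show (1 + 1 : Fin 4) = 2 from rfl,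
        show (2 + 1 : Fin 4) = 3 from rfl, show (3 + 1 : Fin 4) = 0 from rfl]
    simp only [ax_zero, ax_one, ax_two, ax_three]
    refine ⟨fun p hp q hq r h1 h2 h3 h4 => row q hq p hp r ?_ ?_ ?_ ?_,
      fun p hp q hq r h1 h2 h3 h4 => col p hp q hq r ?_ ?_ ?_ ?_,
      fun p hp q hq r h1 h2 h3 h4 => row p hp q hq r ?_ ?_ ?_ ?_,
      fun p hp q hq r h1 h2 h3 h4 => col q hq p hp r ?_ ?_ ?_ ?_⟩ <;> omega
  · rw [forall_fin4]
    simp only [ax_zero, ax_one, ax_two, ax_three, neg_inj]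
    exact ⟨rowne, colne, rowne, colne⟩

/-! ### Surplus surfactant sites on the long steps of a staircase -/

/-- Surfactant sites on a long step of the staircase, seen from the `i`-th direction. -/
def stepP (i : Fin 4) (P Z : Finset Site) : Finset Site :=
  (leadSet i P Z \ corAll P Z).filter fun z =>
    ∀ p ∈ P, ax i p = ax i z → ax (i + 1) p < ax (i + 1) z

/-- Surfactant sites on a long step of the staircase, seen from the `(i + 1)`-th direction. -/
def stepN (i : Fin 4) (P Z : Finset Site) : Finset Site :=
  (leadSet (i + 1) P Z \ corAll P Z).filter fun z =>
    ∀ p ∈ P, ax (i + 1) p = ax (i + 1) z → ax i p < ax i z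

/-- The transverse line through `z` meets `P` in an interval that avoids `z`, so `P` lies on one
side of `z`. That side decides whether the step belongs to quadrant `i` or to quadrant `i + 3`,
which is `i - 1` modulo 4. -/
theorem GoodLines.cover {P Z : Finset Site} (h : GoodLines P Z) (hPZ : Disjoint P Z) {z : Site}
    (hz : z ∈ leadAll P Z) (hz' : z ∉ corAll P Z) : ∃ i, z ∈ stepP i P Z ∪ stepN i P Z := by
  obtain ⟨i, hi⟩ := mem_leadAll.1 hz
  have hzZ := (mem_leadSet.1 hi).1
  obtain ⟨p, hp, e⟩ := h.ne i z hzZ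
  have hzP : z ∉ P := fun h' => Finset.disjoint_left.1 hPZ h' hzZ
  have hne : ∀ q ∈ P, ax i q = ax i z → ax (i + 1) q ≠ ax (i + 1) z := fun q hq e1 e2 =>
    hzP (by rwa [← site_ext e1 e2])
  by_cases hlt : ax (i + 1) p < ax (i + 1) z
  · refine ⟨i, Finset.mem_union_left _ (Finset.mem_filter.2 ⟨Finset.mem_sdiff.2 ⟨hi, hz'⟩,
      fun q hq eq => ?_⟩)⟩
    by_contra hcon
    exact hzP (h.conv i p hp q hq z e eq hlt.le (by omega))
  · have e3 : i + 3 + 1 = i := by rw [add_assoc]; exact add_zero i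
    refine ⟨i + 3, Finset.mem_union_right _ (Finset.mem_filter.2 ⟨Finset.mem_sdiff.2 ⟨?_, hz'⟩,
      fun q hq eq => ?_⟩)⟩
    · rwa [e3]
    · rw [e3] at eq
      rw [ax_add_three, ax_add_three]
      have h1 := hne q hq eq
      have h2 := hne p hp e
      by_contra hcon
      exact hzP (h.conv i q hq p hp z eq e (by omega) (by omega))

section
variable {P Z : Finset Site} {i : Fin 4}

/-- All corners of the `i`-th quadrant are filled. -/
def Saturated (i : Fin 4) (P Z : Finset Site) : Prop :=
  ∀ q ∈ P, dg i q = sD P i →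
        (∀ u, ax i q < u → u ≤ sA P i → ∃ z ∈ corSet i P Z, ax i z = u) ∧
        (∀ v, ax (i + 1) q < v → v ≤ sA P (i + 1) → ∃ z ∈ corSet i P Z, ax (i + 1) z = v)

/-- This is `stair_end` in the `i`-th frame: past a long step the staircase must descend at every
column, so the diagonal coordinate stays at least two below that of `z`. -/
theorem stepP_bound (hP : IsComp P P) (hs : Saturated i P Z) {z : Site}
    (hz : z ∈ stepP i P Z) : dg i z ≤ sD P i + 1 ∧ ∀ p ∈ P, ax i z ≤ ax i p →
      dg i p + 2 ≤ dg i z := by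
  rw [stepP, Finset.mem_filter, Finset.mem_sdiff] at hz
  obtain ⟨⟨hz1, hz2⟩, hz3⟩ := hz
  obtain ⟨hzZ, hzP, hl⟩ := mem_leadSet.1 hz1
  have hzd := le_sD hzP i
  have hpz : pt i (ax i z - 1) (ax (i + 1) z) = z - axisDir i :=
    site_ext (i := i) (by rw [ax_pt, ax_sub, ax_axisDir]) (by
      rw [ax_succ_pt, ax_sub, ax_succ_axisDir, sub_zero])
  obtain ⟨q, hq, eq⟩ := exists_sD hP.ne i
  obtain ⟨s1, s2⟩ := hs q hq eq
  refine ⟨?_, fun p hp hup => ?_⟩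
  · unfold dg at hzd ⊢
    rw [ax_sub, ax_sub, ax_axisDir, ax_succ_axisDir] at hzd
    omega
  have hpa := le_sA hp i
  have key := stair_end (Q := fun x y => pt i x y ∈ P) (u := ax i z) (v := ax (i + 1) z)
    (a := sA P i) (b := sA P (i + 1)) (uq := ax i q) (vq := ax (i + 1) q)
    (fun x y h => by have := le_sA h (i + 1); rwa [ax_succ_pt] at this)
    (by rw [hpz]; exact hzP)
    (fun x hx => by have := hl _ hx (by rw [ax_succ_pt]); rwa [ax_pt] at this)
    (fun y hy => by have := hz3 _ hy (by rw [ax_pt]); rwa [ax_succ_pt] at this)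
    (fun hc => hz2 (mem_corAll.2 ⟨i, Finset.mem_inter.2 ⟨hz1, mem_leadSet.2 ⟨hzZ, ?_, fun p hp e => ?_⟩⟩⟩))
    (fun x hx hxa => ?_) (fun y hy hyb => ?_)
    (hP.not_beyond hl hz3 (by
      have := le_sA hzP (i + 1 + 1)
      rw [ax_succ_succ, ax_sub, ax_axisDir] at this
      omega) hq) (ax i p - ax i z).toNat (by omega) (ax (i + 1) p) (by
      rw [show ax i z + ((ax i p - ax i z).toNat : ℤ) = ax i p by omega, pt_ax]; exact hp)
  · unfold dg; omega
  · rwa [← show pt i (ax i z) (ax (i + 1) z - 1) = z - axisDir (i + 1) from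
      site_ext (i := i) (by rw [ax_pt, ax_sub, ax_axisDir_succ, sub_zero]) (by
      rw [ax_succ_pt, ax_sub, ax_axisDir])]
  · rw [ax_succ_succ, ax_succ_succ] at e
    exact hz3 p hp (by omega)
  · obtain ⟨w, hw, ew⟩ := s1 x hx hxa
    obtain ⟨r1, r2⟩ := corSet_rays hw
    refine ⟨ax (i + 1) w, ?_, fun y' hy' => ?_⟩
    · have := (mem_leadSet.1 (Finset.mem_inter.1 hw).1).2.1
      rwa [← show pt i (x - 1) (ax (i + 1) w) = w - axisDir i from
        site_ext (i := i) (by rw [ax_pt, ax_sub, ax_axisDir, ew]) (by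
        rw [ax_succ_pt, ax_sub, ax_succ_axisDir, sub_zero])] at this
    · have := r2 _ hy' (by rw [ax_pt, ew])
      rwa [ax_succ_pt] at this
  · obtain ⟨w, hw, ew⟩ := s2 y hy hyb
    obtain ⟨r1, r2⟩ := corSet_rays hw
    refine ⟨ax i w, ?_, ?_, fun x' hx' => ?_⟩
    · have := (mem_leadSet.1 (Finset.mem_inter.1 hw).1).2.1
      rwa [← show pt i (ax i w - 1) y = w - axisDir i from
        site_ext (i := i) (by rw [ax_pt, ax_sub, ax_axisDir]) (by
        rw [ax_succ_pt, ax_sub, ax_succ_axisDir, sub_zero, ew])] at this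
    · have := (mem_leadSet.1 (Finset.mem_inter.1 hw).2).2.1
      rwa [← show pt i (ax i w) (y - 1) = w - axisDir (i + 1) from
        site_ext (i := i) (by rw [ax_pt, ax_sub, ax_axisDir_succ, sub_zero]) (by
        rw [ax_succ_pt, ax_sub, ax_axisDir, ew])] at this
    · have := r1 _ hx' (by rw [ax_succ_pt, ew])
      rwa [ax_pt] at this

theorem stepN_bound (hP : IsComp P P) (hs : Saturated i P Z) {z : Site}
    (hz : z ∈ stepN i P Z) : dg i z ≤ sD P i + 1 ∧ ∀ p ∈ P, ax (i + 1) z ≤ ax (i + 1) p →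
      dg i p + 2 ≤ dg i z := by
  rw [stepN, Finset.mem_filter, Finset.mem_sdiff] at hz
  obtain ⟨⟨hz1, hz2⟩, hz3⟩ := hz
  obtain ⟨hzZ, hzP, hl⟩ := mem_leadSet.1 hz1
  have hl' : ∀ p ∈ P, ax i p = ax i z → ax (i + 1) p < ax (i + 1) z := fun p hp e =>
    hl p hp (by rw [ax_succ_succ, ax_succ_succ, e])
  have hzd := le_sD hzP i
  have hpz : pt i (ax i z) (ax (i + 1) z - 1) = z - axisDir (i + 1) :=
    site_ext (i := i) (by rw [ax_pt, ax_sub, ax_axisDir_succ, sub_zero]) (by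
      rw [ax_succ_pt, ax_sub, ax_axisDir])
  obtain ⟨q, hq, eq⟩ := exists_sD hP.ne i
  obtain ⟨s1, s2⟩ := hs q hq eq
  refine ⟨?_, fun p hp hup => ?_⟩
  · unfold dg at hzd ⊢
    rw [ax_sub, ax_sub, ax_axisDir, ax_axisDir_succ] at hzd
    omega
  have hpa := le_sA hp (i + 1)
  have key := stair_end (Q := fun x y => pt i y x ∈ P) (u := ax (i + 1) z) (v := ax i z)
    (a := sA P (i + 1)) (b := sA P i) (uq := ax (i + 1) q) (vq := ax i q)
    (fun x y h => by have := le_sA h i; rwa [ax_pt] at this)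
    (by rw [hpz]; exact hzP)
    (fun x hx => by have := hl' _ hx (by rw [ax_pt]); rwa [ax_succ_pt] at this)
    (fun y hy => by have := hz3 _ hy (by rw [ax_succ_pt]); rwa [ax_pt] at this)
    (fun hc => hz2 (mem_corAll.2 ⟨i, Finset.mem_inter.2 ⟨mem_leadSet.2 ⟨hzZ, ?_, hz3⟩, hz1⟩⟩))
    (fun x hx hxa => ?_) (fun y hy hyb => ?_)
    (Or.symm (hP.not_beyond hz3 hl' (by
      have := le_sA hzP (i + 1 + 1)
      rw [ax_succ_succ, ax_sub, ax_axisDir_succ] at this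
      omega) hq)) (ax (i + 1) p - ax (i + 1) z).toNat (by omega) (ax i p) (by
      rw [show ax (i + 1) z + ((ax (i + 1) p - ax (i + 1) z).toNat : ℤ) = ax (i + 1) p by omega,
        pt_ax]; exact hp)
  · unfold dg; omega
  · rwa [← show pt i (ax i z - 1) (ax (i + 1) z) = z - axisDir i from
      site_ext (i := i) (by rw [ax_pt, ax_sub, ax_axisDir]) (by
      rw [ax_succ_pt, ax_sub, ax_succ_axisDir, sub_zero])]
  · obtain ⟨w, hw, ew⟩ := s2 x hx hxa
    obtain ⟨r1, r2⟩ := corSet_rays hw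
    refine ⟨ax i w, ?_, fun y' hy' => ?_⟩
    · have := (mem_leadSet.1 (Finset.mem_inter.1 hw).2).2.1
      rwa [← show pt i (ax i w) (x - 1) = w - axisDir (i + 1) from
        site_ext (i := i) (by rw [ax_pt, ax_sub, ax_axisDir_succ, sub_zero]) (by
        rw [ax_succ_pt, ax_sub, ax_axisDir, ew])] at this
    · have := r1 _ hy' (by rw [ax_succ_pt, ew])
      rwa [ax_pt] at this
  · obtain ⟨w, hw, ew⟩ := s1 y hy hyb
    obtain ⟨r1, r2⟩ := corSet_rays hw
    refine ⟨ax (i + 1) w, ?_, ?_, fun x' hx' => ?_⟩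
    · have := (mem_leadSet.1 (Finset.mem_inter.1 hw).2).2.1
      rwa [← show pt i y (ax (i + 1) w - 1) = w - axisDir (i + 1) from
        site_ext (i := i) (by rw [ax_pt, ax_sub, ax_axisDir_succ, sub_zero, ew]) (by
        rw [ax_succ_pt, ax_sub, ax_axisDir])] at this
    · have := (mem_leadSet.1 (Finset.mem_inter.1 hw).1).2.1
      rwa [← show pt i (y - 1) (ax (i + 1) w) = w - axisDir i from
        site_ext (i := i) (by rw [ax_pt, ax_sub, ax_axisDir, ew]) (by
        rw [ax_succ_pt, ax_sub, ax_succ_axisDir, sub_zero])] at this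
    · have := r2 _ hx' (by rw [ax_pt, ew])
      rwa [ax_succ_pt] at this

/-- If `z` and `w` have the same diagonal coordinate and `f z < f w`, the inner neighbour of `w` is
past `z` and only one below it diagonally, which violates the gap of two. -/
theorem dg_inj_of_bound {S : Finset Site} {f g : Site → ℤ} (hfg : ∀ p, dg i p = f p + g p)
    (hinj : ∀ p q, f p = f q → g p = g q → p = q)
    (hb : ∀ z ∈ S, ∀ p ∈ P, f z ≤ f p → dg i p + 2 ≤ dg i z)
    (hp : ∀ z ∈ S, ∃ p ∈ P, f p = f z - 1 ∧ dg i p = dg i z - 1) : Set.InjOn (dg i) S := by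
  have hlt : ∀ z ∈ S, ∀ w ∈ S, dg i z = dg i w → ¬ f z < f w := by
    intro z hz w hw e hlt
    obtain ⟨p, hp, e1, e2⟩ := hp w hw
    have := hb z hz p hp (by omega)
    omega
  intro z hz w hw e
  have h1 := hlt z hz w hw e
  have h2 := hlt w hw z hz e.symm
  have h3 := hfg z
  have h4 := hfg w
  exact hinj _ _ (by omega) (by omega)

/-- The diagonal coordinates of step sites are distinct and range from `dg i h + 2` to `sD P i + 1`.
As `h` is on the `i`-th slice, the bound is the number of sites of the hull slice beyond `h`. -/
theorem card_stepP (hP : IsComp P P) (hg : GoodLines P Z) (hs : Saturated i P Z) {h : Site}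
    (hh : h ∈ P) (hha : ax i h = sA P i) :
    ((stepP i P Z).card : ℤ) ≤ sD P i - dg i h := by
  have hinj : Set.InjOn (dg i) (stepP i P Z) := by
    refine dg_inj_of_bound (P := P) (f := ax i) (g := ax (i + 1)) (fun p => rfl)
      (fun p q => site_ext) (fun z hz => (stepP_bound hP hs hz).2) fun z hz => ?_
    rw [stepP, Finset.mem_filter, Finset.mem_sdiff] at hz
    refine ⟨_, (mem_leadSet.1 hz.1.1).2.1, by rw [ax_sub, ax_axisDir], ?_⟩
    unfold dg; rw [ax_sub, ax_sub, ax_axisDir, ax_succ_axisDir]; ring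
  have hsub : (stepP i P Z).image (dg i) ⊆ Finset.Icc (dg i h + 2) (sD P i + 1) := by
    intro x hx
    obtain ⟨z, hz, rfl⟩ := Finset.mem_image.1 hx
    have h1 := stepP_bound hP hs hz
    refine Finset.mem_Icc.2 ⟨h1.2 h hh ?_, h1.1⟩
    rw [stepP, Finset.mem_filter, Finset.mem_sdiff] at hz
    obtain ⟨p, hp, e⟩ := hg.ne i z (mem_leadSet.1 hz.1.1).1
    rw [hha, ← e]; exact le_sA hp i
  have := Finset.card_le_card hsub
  rw [Finset.card_image_of_injOn hinj, Int.card_Icc] at this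
  have := le_sD hh i
  omega

theorem card_stepN (hP : IsComp P P) (hg : GoodLines P Z) (hs : Saturated i P Z) {h : Site}
    (hh : h ∈ P) (hha : ax (i + 1) h = sA P (i + 1)) :
    ((stepN i P Z).card : ℤ) ≤ sD P i - dg i h := by
  have hinj : Set.InjOn (dg i) (stepN i P Z) := by
    refine dg_inj_of_bound (P := P) (f := ax (i + 1)) (g := ax i) (fun p => add_comm _ _)
      (fun p q h h' => site_ext h' h) (fun z hz => (stepN_bound hP hs hz).2) fun z hz => ?_
    rw [stepN, Finset.mem_filter, Finset.mem_sdiff] at hz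
    refine ⟨_, (mem_leadSet.1 hz.1.1).2.1, by rw [ax_sub, ax_axisDir], ?_⟩
    unfold dg; rw [ax_sub, ax_sub, ax_axisDir, ax_axisDir_succ]; ring
  have hsub : (stepN i P Z).image (dg i) ⊆ Finset.Icc (dg i h + 2) (sD P i + 1) := by
    intro x hx
    obtain ⟨z, hz, rfl⟩ := Finset.mem_image.1 hx
    have h1 := stepN_bound hP hs hz
    refine Finset.mem_Icc.2 ⟨h1.2 h hh ?_, h1.1⟩
    rw [stepN, Finset.mem_filter, Finset.mem_sdiff] at hz
    obtain ⟨p, hp, e⟩ := hg.ne (i + 1) z (mem_leadSet.1 hz.1.1).1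
    rw [hha, ← e]; exact le_sA hp (i + 1)
  have := Finset.card_le_card hsub
  rw [Finset.card_image_of_injOn hinj, Int.card_Icc] at this
  have := le_sD hh i
  omega
end

theorem exists_fin4 {p : Fin 4 → Prop} : (∃ i, p i) ↔ p 0 ∨ p 1 ∨ p 2 ∨ p 3 := by
  rw [Fin.exists_fin_succ, Fin.exists_fin_succ, Fin.exists_fin_succ, Fin.exists_fin_succ]
  simp

/-- Distributes a total among slots of limited capacity, filling each greedily. It decides how many
sites are trimmed at each end of each slice. -/
theorem exists_le_sum_eq {ι : Type*} [DecidableEq ι] (T : Finset ι) (m : ι → ℕ) :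
    ∀ s ≤ ∑ i ∈ T, m i, ∃ e : ι → ℕ, (∀ i ∈ T, e i ≤ m i) ∧ ∑ i ∈ T, e i = s := by
  induction T using Finset.induction_on with
  | empty => intro s hs; exact ⟨fun _ => 0, by simp, by simp at hs; simp [hs]⟩
  | insert a T ha ih =>
    intro s hs
    rw [Finset.sum_insert ha] at hs
    obtain ⟨e, he1, he2⟩ := ih (s - min s (m a)) (by omega)
    refine ⟨fun i => if i = a then min s (m a) else e i, fun i hi => ?_, ?_⟩
    · dsimp only
      split_ifs with h
      · rw [h]; omega
      · exact he1 i (Finset.mem_of_mem_insert_of_ne hi h)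
    · rw [Finset.sum_insert ha, if_pos rfl, Finset.sum_congr rfl fun i hi =>
        if_neg (fun h : i = a => ha (h ▸ hi)), he2]
      omega

/-- The sites removed by trimming. -/
theorem card_oct_sdiff_trim {a d lo hi : Fin 4 → ℤ} (hT : Tight 3 a d) (ht : ∀ i, 1 ≤ tS a d i)
    (h1 : ∀ i, a i - d (i + 3) ≤ lo i) (h2 : ∀ i, hi i ≤ d i - a i) (h3 : ∀ i, lo i ≤ hi i) :
    ((oct a d \ trim a d lo hi).card : ℤ) =
      ∑ i, (lo i - (a i - d (i + 3)) + (d i - a i - hi i)) := by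
  have e := hT.expand
  have h1' := h1
  have h2' := h2
  have h3' := h3
  rw [forall_fin4] at h1 h2 h3 ht
  rw [tS_zero, tS_one, tS_two, tS_three] at ht
  have q1 : (0 + 3 : Fin 4) = 3 := rfl
  have q2 : (1 + 3 : Fin 4) = 0 := rfl
  have q3 : (2 + 3 : Fin 4) = 1 := rfl
  have q4 : (3 + 3 : Fin 4) = 2 := rfl
  rw [q1, q2, q3, q4] at h1
  have hR : oct a d \ trim a d lo hi = Finset.univ.biUnion fun i : Fin 4 =>
      (Finset.Ico (a i - d (i + 3)) (lo i) ∪ Finset.Ioc (hi i) (d i - a i)).image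
        fun v => pt i (a i) v := by
    ext p
    have hcase : p ∈ (Finset.univ.biUnion fun i : Fin 4 =>
      (Finset.Ico (a i - d (i + 3)) (lo i) ∪ Finset.Ioc (hi i) (d i - a i)).image
        fun v => pt i (a i) v) ↔ ∃ i : Fin 4, ax i p = a i ∧
          ((a i - d (i + 3) ≤ ax (i + 1) p ∧ ax (i + 1) p < lo i) ∨
            (hi i < ax (i + 1) p ∧ ax (i + 1) p ≤ d i - a i)) := by
      simp only [Finset.mem_biUnion, Finset.mem_univ, true_and, Finset.mem_image, Finset.mem_union,
        Finset.mem_Ico, Finset.mem_Ioc]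
      refine exists_congr fun i => ⟨?_, fun hh => ⟨ax (i + 1) p, hh.2, by rw [← hh.1, pt_ax]⟩⟩
      rintro ⟨v, hv, rfl⟩
      rw [ax_pt, ax_succ_pt]
      exact ⟨rfl, hv⟩
    rw [hcase, exists_fin4, q1, q2, q3, q4, show (0 + 1 : Fin 4) = 1 from rfl,
      show (1 + 1 : Fin 4) = 2 from rfl, show (2 + 1 : Fin 4) = 3 from rfl,
      show (3 + 1 : Fin 4) = 0 from rfl]
    simp only [Finset.mem_sdiff, mem_trim, mem_oct', TrimH, TrimV, ax_zero, ax_one, ax_two, ax_three]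
    omega
  have hcard : ∀ i, (((Finset.Ico (a i - d (i + 3)) (lo i) ∪ Finset.Ioc (hi i) (d i - a i)).image
        fun v => pt i (a i) v).card : ℤ) = lo i - (a i - d (i + 3)) + (d i - a i - hi i) := by
    intro i
    rw [Finset.card_image_of_injective _ fun u v huv => by
      have := congrArg (ax (i + 1)) huv; rwa [ax_succ_pt, ax_succ_pt] at this,
      Finset.card_union_of_disjoint, Int.card_Ico, Int.card_Ioc]
    · have := h1' i
      have := h2' i
      push_cast
      omega
    · refine Finset.disjoint_left.2 fun x hx hx' => ?_
      rw [Finset.mem_Ico] at hx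
      rw [Finset.mem_Ioc] at hx'
      have := h3' i
      omega
  rw [hR, Finset.card_biUnion]
  · push_cast
    exact Finset.sum_congr rfl fun i _ => hcard i
  -- Since every diagonal side has a corner, `ht`, adjacent slices share no vertex and no removed
  -- site is counted twice.
  · have hd : ∀ i : Fin 4, ∀ p ∈ (Finset.Ico (a i - d (i + 3)) (lo i) ∪
        Finset.Ioc (hi i) (d i - a i)).image fun v => pt i (a i) v,
        ax i p = a i ∧ a i - d (i + 3) ≤ ax (i + 1) p ∧ ax (i + 1) p ≤ d i - a i := by
      intro i p hp
      obtain ⟨v, hv, rfl⟩ := Finset.mem_image.1 hp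
      rw [Finset.mem_union, Finset.mem_Ico, Finset.mem_Ioc] at hv
      have := h1' i
      have := h2' i
      have := h3' i
      rw [ax_pt, ax_succ_pt]
      omega
    intro i hi' j hj' hij
    refine Finset.disjoint_left.2 fun p hp hp' => ?_
    have f1 := hd i p hp
    have f2 := hd j p hp'
    clear hp hp' hR hcard hd h1' h2' h3' hi' hj'
    revert i j
    simp only [forall_fin4, q1, q2, q3, q4, show (0 + 1 : Fin 4) = 1 from rfl,
      show (1 + 1 : Fin 4) = 2 from rfl, show (2 + 1 : Fin 4) = 3 from rfl,
      show (3 + 1 : Fin 4) = 0 from rfl, ax_zero, ax_one, ax_two, ax_three]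
    refine ⟨⟨?_, ?_, ?_, ?_⟩, ⟨?_, ?_, ?_, ?_⟩, ⟨?_, ?_, ?_, ?_⟩, ⟨?_, ?_, ?_, ?_⟩⟩ <;>
      intro hne f1 f2 <;> first | exact absurd rfl hne | omega

/-! ### Comparison of the minimizer with its octagonal hull -/

theorem Dis_eq_add {A D : Fin 4 → ℤ} {P H : Finset Site} (hH : H ⊆ oct A D)
    (hP : P ∩ oct A D ⊆ H) :
    Dis A D P = Dis A D H + ∑ p ∈ H \ P, dep A D p + ((P \ oct A D).card : ℤ) := by
  rw [Dis_of_subset hH, Dis, ← Finset.sum_union]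
  · congr 2
    ext p
    simp only [Finset.mem_sdiff, Finset.mem_union]
    have := @hP p
    have := @hH p
    rw [Finset.mem_inter] at *
    tauto
  · exact Finset.disjoint_left.2 fun p h h' => (Finset.mem_sdiff.1 h).2 (Finset.mem_sdiff.1 h').1

theorem card_le_sum_dep {A D : Fin 4 → ℤ} {S : Finset Site} (hS : S ⊆ oct A D) :
    (S.card : ℤ) ≤ ∑ p ∈ S, dep A D p := by
  have := Finset.card_nsmul_le_sum S (dep A D) 1 fun p hp => one_le_dep.2 (hS hp)
  simpa using this

/-- Every site of `H` absent from `P`, and every site of `P` outside the datum, adds at least one to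
the dissipation. -/
theorem eq_of_Dis_le {A D : Fin 4 → ℤ} {P H : Finset Site} (hH : H ⊆ oct A D)
    (hP : P ∩ oct A D ⊆ H) (h : Dis A D P ≤ Dis A D H) : P = H := by
  rw [Dis_eq_add hH hP] at h
  have h1 := card_le_sum_dep (Finset.sdiff_subset.trans hH : H \ P ⊆ oct A D)
  have h2 : H \ P = ∅ := Finset.card_eq_zero.1 (by omega)
  have h3 : P \ oct A D = ∅ := Finset.card_eq_zero.1 (by omega)
  rw [Finset.sdiff_eq_empty_iff_subset] at h2 h3
  exact Finset.Subset.antisymm (fun p hp => hP (Finset.mem_inter.2 ⟨hp, h3 hp⟩)) h2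

theorem extraLines_self (P : Finset Site) : extraLines P P = 0 := by simp [extraLines]

/-- The excess of surfactant sites with respect to the corners of an octagon. -/
def excess (C : ℕ) (a d : Fin 4 → ℤ) : ℕ := ((C : ℤ) - ∑ i, tS a d i).toNat

theorem excess_le {A D a d : Fin 4 → ℤ} {C : ℕ} {M : ℤ} (hC : (C : ℤ) ≤ ∑ i, tS A D i)
    (hd : ∀ i, d i ≤ D i) (hα : ∑ i, (A i - a i) ≤ M) (hM : 0 ≤ M) :
    (excess C a d : ℤ) ≤ 2 * M := by
  have d0 := hd 0
  have d1 := hd 1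
  have d2 := hd 2
  have d3 := hd 3
  simp only [excess, Fin.sum_univ_four, tS_zero, tS_one, tS_two, tS_three] at *
  omega

/-- Comparison with the octagon generated by `P ∩ oct A D`. Without excess, all surfactant must be
in corners and the dissipation forces `P` to fill the octagon. With excess, the corner count must
reach its maximum, and all other surfactant sites must lead in one direction. -/
theorem Ctx.subset_oct {k δ : ℝ} {A D : Fin 4 → ℤ} {C : ℕ} {P Z : Finset Site}
    (h : Ctx k δ A D C P Z) {N M0 : ℤ} (hM0 : 1 ≤ M0) (hN : 16 * M0 + 3 ≤ N) (hc : IsComp P P)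
    (hne : (P ∩ oct A D).Nonempty) (ha : ∀ i, sA P i = sA (P ∩ oct A D) i) (hA : ∀ i, sA P i ≤ A i)
    (hD : ∀ i, sD (P ∩ oct A D) i ≤ D i) (hT : Tight N (sA P) (sD (P ∩ oct A D)))
    (hα : ∑ i, (A i - sA P i) ≤ 8 * M0) (hδ : δ * (16 * M0 * (8 * M0 + 1)) < 1) :
    P ⊆ oct A D ∧ (4 * (∑ i, (sA P i : ℝ) + 2) + (1 + k) * (excess C (sA P) (sD P) : ℝ) ≤ cost k P Z) ∧
      ((C : ℤ) ≤ ∑ i, tS (sA P) (sD P) i → P = oct (sA P) (sD P) ∧ corAll P Z = Z) ∧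
      (∑ i, tS (sA P) (sD P) i < C → ((corAll P Z).card : ℤ) = ∑ i, tS (sA P) (sD P) i ∧
        leadAll P Z = Z) := by
  have hk := h.hk
  set S := P ∩ oct A D with hS
  have haS : sA S = sA P := funext fun i => (ha i).symm
  have hSP : S ⊆ P := Finset.inter_subset_left
  have hDS := fun i => sD_mono hne hSP i
  set s := excess C (sA P) (sD S) with hs
  have hs' : s = ((C : ℤ) - ∑ i, tS (sA P) (sD S) i).toNat := rfl
  have hsb : (s : ℤ) ≤ 16 * M0 := by
    have := excess_le h.le_sum hD hα (by omega); omega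
  have hκ0 : 0 ≤ ∑ i, tS (sA P) (sD S) i := Finset.sum_nonneg fun i _ => hT.1 i
  have hcmp := h.le_oct (hT.mono (by omega)) hA hD (s := s) (by have := hT.2 0; omega)
    (by omega) (by omega)
  have hlow := hc.cost_lower (BR := ∅) (BC := ∅) (by linarith : -1 < k) h.hk1 h.disj (by simp)
    (by simp)
  simp only [extraLines_self, Finset.card_empty, Nat.cast_zero, add_zero, mul_zero] at hlow
  push_cast at hlow
  have hL := (hc.card_corAll (Z := Z)).1
  rw [extraLines_self, Nat.cast_zero, mul_zero, add_zero] at hL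
  have hLG := Finset.card_le_card (corAll_subset P Z)
  have hGZ := Finset.card_le_card (leadAll_subset P Z)
  rw [h.card] at hGZ hlow
  have hκκ : ∑ i, tS (sA P) (sD P) i ≤ ∑ i, tS (sA P) (sD S) i :=
    Finset.sum_le_sum fun i _ => by unfold tS; have := hDS i; omega
  have hH : oct (sA P) (sD S) ⊆ oct A D := oct_subset_oct hA hD
  have hSH : P ∩ oct A D ⊆ oct (sA P) (sD S) := by
    rw [← haS]; exact subset_oct_sA S
  have hDis := Dis_eq_add hH hSH
  have hDis' := card_le_sum_dep (Finset.sdiff_subset.trans hH : oct (sA P) (sD S) \ P ⊆ oct A D)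
  have hα0 : A 0 - sA P 0 ≤ 8 * M0 := by
    have a1 := hA 1
    have a2 := hA 2
    have a3 := hA 3
    rw [Fin.sum_univ_four] at hα
    omega
  -- Both energies are `1 + k` times integers apart from a common term. The dissipation of the
  -- excess is less than one, so the comparison holds between the integers.
  have hkey : ((C : ℤ) - (corAll P Z).card) + (C - (leadAll P Z).card) ≤ s := by
    have h1 : ((Dis A D (oct (sA P) (sD S)) + s * (A 0 - sA P 0 + 1) : ℤ) : ℝ) ≤
        Dis A D P + 16 * M0 * (8 * M0 + 1) := by
      have h2 : (s : ℤ) * (A 0 - sA P 0 + 1) ≤ 16 * M0 * (8 * M0 + 1) :=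
        mul_le_mul hsb (by omega) (by have := hA 0; omega) (by omega)
      have : (Dis A D (oct (sA P) (sD S)) + s * (A 0 - sA P 0 + 1) : ℤ) ≤
        Dis A D P + 16 * M0 * (8 * M0 + 1) := by omega
      exact_mod_cast this
    have h2 := mul_le_mul_of_nonneg_left h1 h.hδ.le
    have h3 : (1 + k) * (((C : ℝ) - (corAll P Z).card) + (C - (leadAll P Z).card) - s) <
        (1 + k) * 1 := by linarith
    have h4 := lt_of_mul_lt_mul_left h3 (by linarith)
    have h5 : ((C : ℤ) - (corAll P Z).card) + (C - (leadAll P Z).card) - s < 1 := by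
      exact_mod_cast h4
    omega
  by_cases hC : (C : ℤ) ≤ ∑ i, tS (sA P) (sD S) i
  · have hs0 : s = 0 := by omega
    have hLZ : corAll P Z = Z := Finset.eq_of_subset_of_card_le
      ((corAll_subset P Z).trans (leadAll_subset P Z)) (by rw [h.card]; omega)
    have hPH : P = oct (sA P) (sD S) := by
      refine eq_of_Dis_le hH hSH ?_
      rw [hs0] at hcmp
      simp only [Nat.cast_zero, mul_zero, zero_mul, add_zero] at hcmp
      have h1 : 0 ≤ (1 + k) * (((C : ℝ) - (corAll P Z).card) + (C - (leadAll P Z).card)) := by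
        refine mul_nonneg (by linarith) ?_
        have h1 : ((corAll P Z).card : ℝ) ≤ C := by exact_mod_cast hLG.trans hGZ
        have h2 : ((leadAll P Z).card : ℝ) ≤ C := by exact_mod_cast hGZ
        linarith
      have h2 : δ * (Dis A D P : ℝ) ≤ δ * Dis A D (oct (sA P) (sD S)) := by linarith
      exact_mod_cast le_of_mul_le_mul_left h2 h.hδ
    have hPS : P = S := (Finset.inter_eq_left.2 (by rw [hPH]; exact hH)).symm
    have hsub : P ⊆ oct A D := by rw [hPH]; exact hH
    rw [← hPS] at hPH hs hC
    refine ⟨hsub, ?_, fun _ => ⟨hPH, hLZ⟩, fun hlt => by omega⟩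
    rw [← hs, hs0]
    rw [hLZ, h.card] at hlow
    have h2 : ((leadAll P Z).card : ℝ) ≤ C := by exact_mod_cast hGZ
    have h3 := mul_nonneg (by linarith : 0 ≤ 1 + k) (by linarith : (0 : ℝ) ≤ C - C + (C - (leadAll P Z).card))
    simp only [Nat.cast_zero, mul_zero, add_zero]
    linarith
  · have hG : leadAll P Z = Z := Finset.eq_of_subset_of_card_le (leadAll_subset P Z)
      (by rw [h.card]; omega)
    -- The corners number at most `∑ tS` for the support values of `P`, hence for those of `S`, and
    -- at least the latter sum by `hkey`. All three agree, which identifies the diagonal supports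
    -- and puts `P` inside the datum.
    have hdd : sD P = sD S := by
      have hsum : ∑ i, (sD P i - sD S i) = 0 := by
        have : ∑ i, tS (sA P) (sD S) i - ∑ i, tS (sA P) (sD P) i = ∑ i, (sD P i - sD S i) := by
          rw [← Finset.sum_sub_distrib]
          exact Finset.sum_congr rfl fun i _ => by unfold tS; ring
        have h0 : 0 ≤ ∑ i, (sD P i - sD S i) := Finset.sum_nonneg fun i _ => by
          have := hDS i; omega
        omega
      funext i
      have := (Finset.sum_eq_zero_iff_of_nonneg fun i _ => by have := hDS i; omega).1 hsum i
        (Finset.mem_univ _)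
      omega
    have hsub : P ⊆ oct A D := by
      refine (subset_oct_sA P).trans ?_
      rw [hdd]; exact hH
    rw [← hdd] at hs' hC hs hκκ
    refine ⟨hsub, ?_, fun hle => absurd hle hC, fun _ => ⟨by omega, hG⟩⟩
    rw [← hs]
    have h1 : (s : ℝ) ≤ (C : ℝ) - (corAll P Z).card := by
      have : (s : ℤ) ≤ (C : ℤ) - (corAll P Z).card := by omega
      exact_mod_cast this
    rw [hG, h.card] at hlow
    have h3 := mul_le_mul_of_nonneg_left h1 (by linarith : 0 ≤ 1 + k)
    linarith

/-- The first structural information on a minimizer. -/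
structure Shape (k δ : ℝ) (A D : Fin 4 → ℤ) (C : ℕ) (P Z : Finset Site) (N M0 : ℤ) : Prop where
  ctx : Ctx k δ A D C P Z
  comp : IsComp P P
  good : GoodLines P Z
  sub : P ⊆ oct A D
  tight : Tight N (sA P) (sD P)
  alpha : ∑ i, (A i - sA P i) ≤ 8 * M0
  low : 4 * (∑ i, (sA P i : ℝ) + 2) + (1 + k) * (excess C (sA P) (sD P) : ℝ) ≤ cost k P Z
  small : (C : ℤ) ≤ ∑ i, tS (sA P) (sD P) i → P = oct (sA P) (sD P) ∧ corAll P Z = Z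
  large : ∑ i, tS (sA P) (sD P) i < C → ((corAll P Z).card : ℤ) = ∑ i, tS (sA P) (sD P) i ∧
        leadAll P Z = Z
  tAD : ∀ i, 0 ≤ tS A D i
  hM0 : 1 ≤ M0
  hN : 16 * M0 + 10 ≤ N

/-- Moving the `i`-th diagonal side inwards. -/
def cutD (d : Fin 4 → ℤ) (i : Fin 4) : Fin 4 → ℤ := fun j => d j - if j = i then 1 else 0

theorem tS_cutD (a d : Fin 4 → ℤ) (i j : Fin 4) :
    tS a (cutD d i) j = tS a d j + if j = i then 1 else 0 := by
  unfold tS cutD; ring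

theorem sum_tS_cutD (a d : Fin 4 → ℤ) (i : Fin 4) :
    ∑ j, tS a (cutD d i) j = ∑ j, tS a d j + 1 := by
  simp [tS_cutD, Finset.sum_add_distrib]

theorem cutD_le (d : Fin 4 → ℤ) (i j : Fin 4) : cutD d i j ≤ d j := by
  unfold cutD; split_ifs <;> omega

theorem Tight.cutD {N : ℤ} {a d : Fin 4 → ℤ} (h : Tight N a d) (i : Fin 4) :
    Tight (N - 2) a (cutD d i) := by
  refine ⟨fun j => ?_, fun j => ?_⟩
  · rw [tS_cutD]; have := h.1 j; split_ifs <;> omega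
  · have := h.2 j
    unfold pS at *
    unfold BEG.cutD
    split_ifs <;> omega

theorem oct_sdiff_cutD (a d : Fin 4 → ℤ) (i : Fin 4) :
    oct a d \ oct a (cutD d i) ⊆ layer a i (d i) := by
  intro p hp
  rw [Finset.mem_sdiff, mem_oct, mem_oct] at hp
  obtain ⟨⟨h1, h2⟩, h3⟩ := hp
  rw [mem_layer]
  refine ⟨?_, h1 i, h1 (i + 1)⟩
  by_contra hcon
  refine h3 ⟨h1, fun j => ?_⟩
  unfold cutD
  split_ifs with hj
  · rw [hj]; have := h2 i; omega
  · have := h2 j; omega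

theorem Dis_cutD_le {A D a d : Fin 4 → ℤ} (ha : ∀ i, a i ≤ A i) (hd : ∀ i, d i ≤ D i) (i : Fin 4)
    {B : ℤ} (hB : ∀ p ∈ layer a i (d i), dep A D p ≤ B) (hB0 : 0 ≤ B) (ht : 0 ≤ tS a d i) :
    Dis A D (oct a (cutD d i)) ≤ Dis A D (oct a d) + (tS a d i + 1) * B := by
  rw [Dis_add_sum (oct_subset_oct (fun _ => le_rfl) (cutD_le d i)) (oct_subset_oct ha hd)]
  have h1 : ∑ p ∈ oct a d \ oct a (cutD d i), dep A D p ≤ _ :=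
    Finset.sum_le_card_nsmul _ _ B fun p hp => hB p (oct_sdiff_cutD a d i hp)
  have h2 := Finset.card_le_card (oct_sdiff_cutD a d i)
  rw [card_layer] at h2
  rw [nsmul_eq_mul] at h1
  have h3 : ((oct a d \ oct a (cutD d i)).card : ℤ) ≤ tS a d i + 1 := by unfold tS at *; omega
  have := mul_le_mul_of_nonneg_right h3 hB0
  omega

section
variable {k δ : ℝ} {A D : Fin 4 → ℤ} {C : ℕ} {P Z : Finset Site} {N M0 : ℤ}

theorem Shape.sA_le (h : Shape k δ A D C P Z N M0) (i : Fin 4) : sA P i ≤ A i := by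
  obtain ⟨p, hp, e⟩ := exists_sA h.comp.ne i
  rw [← e]; exact (mem_oct.1 (h.sub hp)).1 i

theorem Shape.sD_le (h : Shape k δ A D C P Z N M0) (i : Fin 4) : sD P i ≤ D i := by
  obtain ⟨p, hp, e⟩ := exists_sD h.comp.ne i
  rw [← e]; exact (mem_oct.1 (h.sub hp)).2 i

theorem Shape.alpha_le (h : Shape k δ A D C P Z N M0) (i : Fin 4) : A i - sA P i ≤ 8 * M0 :=
  (Finset.single_le_sum (fun i _ => by have := h.sA_le i; omega) (Finset.mem_univ i)).trans h.alpha

theorem Shape.excess_le (h : Shape k δ A D C P Z N M0) :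
    (excess C (sA P) (sD P) : ℤ) ≤ 16 * M0 := by
  have := BEG.excess_le h.ctx.le_sum h.sD_le h.alpha (by have := h.hM0; omega)
  omega

/-- The octagon generated by the minimizer is optimal. -/
theorem Shape.opt (h : Shape k δ A D C P Z N M0) {a d : Fin 4 → ℤ} (hT : Tight 3 a d)
    (ha : ∀ i, a i ≤ A i) (hd : ∀ i, d i ≤ D i) (hs : (excess C a d : ℤ) + 3 ≤ pS a d 0) :
    4 * ∑ i, (sA P i : ℝ) + (1 + k) * (excess C (sA P) (sD P) : ℝ) +
        δ * Dis A D (oct (sA P) (sD P)) ≤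
      4 * ∑ i, (a i : ℝ) + (1 + k) * (excess C a d : ℝ) +
        δ * (Dis A D (oct a d) + excess C a d * (A 0 - a 0 + 1) : ℤ) := by
  have h1 := h.ctx.le_oct hT ha hd hs (by
    have : 0 ≤ ∑ i, tS a d i := Finset.sum_nonneg fun i _ => hT.1 i
    unfold excess; omega) (by unfold excess; omega)
  have h2 := h.low
  have h3 : Dis A D (oct (sA P) (sD P)) ≤ Dis A D P := by
    rw [Dis_eq_add (oct_subset_oct h.sA_le h.sD_le)
      (Finset.inter_subset_left.trans (subset_oct_sA P))]
    have := card_le_sum_dep (Finset.sdiff_subset.trans (oct_subset_oct h.sA_le h.sD_le) :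
      oct (sA P) (sD P) \ P ⊆ oct A D)
    omega
  have h4 : (Dis A D (oct (sA P) (sD P)) : ℝ) ≤ Dis A D P := by exact_mod_cast h3
  have h5 := mul_le_mul_of_nonneg_left h4 h.ctx.hδ.le
  linarith

/-- Cutting a diagonal side yields room for one more surfactant site. -/
theorem Shape.cut_cost (h : Shape k δ A D C P Z N M0) (hC : ∑ i, tS (sA P) (sD P) i < C)
    (i : Fin 4) {B : ℤ} (hB : ∀ p ∈ layer (sA P) i (sD P i), dep A D p ≤ B) (hB0 : 0 ≤ B) :
    1 + k ≤ δ * ((tS (sA P) (sD P) i + 1) * B + 16 * M0 * (8 * M0 + 1)) := by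
  have hM0 := h.hM0
  have hN := h.hN
  have hδ := h.ctx.hδ
  have hex : (excess C (sA P) (cutD (sD P) i) : ℤ) + 1 = excess C (sA P) (sD P) := by
    unfold excess; rw [sum_tS_cutD]; omega
  have hT' := h.tight.cutD i
  have hsb := h.excess_le
  have hα := h.alpha_le 0
  have hopt := h.opt (hT'.mono (by omega)) h.sA_le (fun j => (cutD_le _ i j).trans (h.sD_le j))
    (by have := hT'.2 0; omega)
  have hD := Dis_cutD_le h.sA_le h.sD_le i hB hB0 (h.tight.1 i)
  have h2 : (excess C (sA P) (cutD (sD P) i) : ℤ) * (A 0 - sA P 0 + 1) ≤ 16 * M0 * (8 * M0 + 1) :=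
    mul_le_mul (by omega) (by omega) (by have := h.sA_le 0; omega) (by omega)
  have h3 : ((Dis A D (oct (sA P) (cutD (sD P) i)) +
      excess C (sA P) (cutD (sD P) i) * (A 0 - sA P 0 + 1) : ℤ) : ℝ) ≤
      Dis A D (oct (sA P) (sD P)) + ((tS (sA P) (sD P) i + 1) * B + 16 * M0 * (8 * M0 + 1)) := by
    have : (Dis A D (oct (sA P) (cutD (sD P) i)) +
      excess C (sA P) (cutD (sD P) i) * (A 0 - sA P 0 + 1) : ℤ) ≤
      Dis A D (oct (sA P) (sD P)) + ((tS (sA P) (sD P) i + 1) * B + 16 * M0 * (8 * M0 + 1)) := by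
      omega
    exact_mod_cast this
  have h4 := mul_le_mul_of_nonneg_left h3 hδ.le
  have h5 : (excess C (sA P) (cutD (sD P) i) : ℝ) + 1 = excess C (sA P) (sD P) := by
    exact_mod_cast hex
  rw [← h5] at hopt
  linarith

/-- A diagonal side with at most one corner consists of at most two sites near a vertex of the box,
at depth bounded by `8 * M0 + 2`. Cutting them would cost less than the `1 + k` gained from one more
corner. -/
theorem Shape.two_le_tS (h : Shape k δ A D C P Z N M0)
    (hδ : δ * (2 * (8 * M0 + 2) + 16 * M0 * (8 * M0 + 1)) < 1)
    (hC : ∑ i, tS (sA P) (sD P) i < C) (i : Fin 4) : 2 ≤ tS (sA P) (sD P) i := by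
  by_contra hcon
  have hM0 := h.hM0
  have hα := h.alpha_le i
  have h1 := h.cut_cost hC i (B := 8 * M0 + 2) (fun p hp => by
    rw [mem_layer] at hp
    have := dep_le_ax A D p i
    have h0 : ax i p + ax (i + 1) p = sD P i := hp.1
    unfold tS at hcon
    omega) (by omega)
  have h2 : (tS (sA P) (sD P) i + 1) * (8 * M0 + 2) ≤ 2 * (8 * M0 + 2) :=
    mul_le_mul_of_nonneg_right (by omega) (by omega)
  have h3 : (((tS (sA P) (sD P) i + 1) * (8 * M0 + 2) : ℤ) : ℝ) ≤ 2 * (8 * M0 + 2) := by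
    exact_mod_cast h2
  push_cast at h1 h3
  have h4 := mul_le_mul_of_nonneg_left
    (add_le_add_left h3 ((16 : ℝ) * M0 * (8 * M0 + 1))) h.ctx.hδ.le
  have := h.ctx.hk
  linarith

-- The corners total `∑ tS` while each quadrant holds at most its own `tS`, so equality holds in
-- every quadrant and all slots are filled.
open Classical in
theorem Shape.saturated (h : Shape k δ A D C P Z N M0) (hC : ∑ i, tS (sA P) (sD P) i < C)
    (i : Fin 4) : Saturated i P Z := by
  have h1 := (h.comp.card_corAll (Z := Z)).2 (extraLines_self P)
  have h2 := (h.large hC).1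
  set B := fun i => (corSet i P Z).filter fun z => ∀ j, ax j z ≤ sA P j with hB
  have h3 : ((corAll P Z).card : ℤ) ≤ ∑ i, ((B i).card : ℤ) := by
    rw [h1]; exact_mod_cast Finset.card_biUnion_le
  have h4 : ∀ i, 0 ≤ tS (sA P) (sD P) i - (B i).card := fun i => by
    have := (h.comp.card_corSet (Z := Z) i).1
    rw [sub_nonneg]; exact this
  have h5 : ∑ i, (tS (sA P) (sD P) i - (B i).card) = 0 := by
    have := Finset.sum_nonneg fun i (_ : i ∈ Finset.univ) => h4 i
    rw [Finset.sum_sub_distrib] at *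
    omega
  have h6 := (Finset.sum_eq_zero_iff_of_nonneg fun i _ => h4 i).1 h5 i (Finset.mem_univ _)
  refine (h.comp.card_corSet (Z := Z) i).2 ?_
  show tS (sA P) (sD P) i ≤ ((B i).card : ℤ)
  omega

theorem exists_slice_max {P : Finset Site} (hP : P.Nonempty) (i j : Fin 4) :
    ∃ h ∈ P, ax i h = sA P i ∧ ∀ q ∈ P, ax i q = sA P i → ax j q ≤ ax j h := by
  have hne : (P.filter fun p => ax i p = sA P i).Nonempty := by
    obtain ⟨p, hp, e⟩ := exists_sA hP i
    exact ⟨p, Finset.mem_filter.2 ⟨hp, e⟩⟩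
  obtain ⟨h, hh, hmax⟩ := Finset.exists_max_image _ (ax j) hne
  rw [Finset.mem_filter] at hh
  exact ⟨h, hh.1, hh.2, fun q hq e => hmax q (Finset.mem_filter.2 ⟨hq, e⟩)⟩

/-- If there are more surfactant sites than corners, then the minimizer is an octagon with trimmed
slices. -/
theorem Shape.eq_trim (h : Shape k δ A D C P Z N M0)
    (hδ : δ * (2 * (8 * M0 + 2) + 16 * M0 * (8 * M0 + 1)) < 1)
    (hC : ∑ i, tS (sA P) (sD P) i < C) :
    ∃ lo hi, TrimOK (sA P) (sD P) lo hi ∧ P = trim (sA P) (sD P) lo hi := by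
  have hM0 := h.hM0
  have hN := h.hN
  have ht := h.two_le_tS hδ hC
  have hsat := h.saturated hC
  have e3 : ∀ i : Fin 4, i + 1 + 3 = i := fun i => by rw [add_assoc]; exact add_zero i
  choose H hH1 hH2 hH3 using fun i => exists_slice_max h.comp.ne i (i + 1)
  choose L hL1 hL2 hL3 using fun i => exists_slice_max h.comp.ne i (i + 3)
  have hL3' : ∀ i, ∀ q ∈ P, ax i q = sA P i → ax (i + 1) (L i) ≤ ax (i + 1) q := fun i q hq e => by
    have := hL3 i q hq e
    rw [ax_add_three, ax_add_three] at this
    omega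
  -- Capacities: the numbers of sites of the `i`-th hull slice beyond the last site `H i` and before
  -- the first site `L i` of `P`.
  set m : Fin 4 ⊕ Fin 4 → ℕ := Sum.elim (fun i => (sD P i - sA P i - ax (i + 1) (H i)).toNat)
    (fun i => (ax (i + 1) (L i) - (sA P i - sD P (i + 3))).toNat) with hm
  have hHb : ∀ i, 0 ≤ sD P i - sA P i - ax (i + 1) (H i) := fun i => by
    have := le_sD (hH1 i) i
    unfold dg at this
    rw [hH2] at this
    omega
  have hLb : ∀ i, 0 ≤ ax (i + 1) (L i) - (sA P i - sD P (i + 3)) := fun i => by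
    have := le_sD (hL1 i) (i + 3)
    unfold dg at this
    rw [ax_add_three, show i + 3 + 1 = i by rw [add_assoc]; exact add_zero i, hL2] at this
    omega
  have hP : ∀ i, (stepP i P Z).card ≤ m (Sum.inl i) := fun i => by
    have := card_stepP h.comp h.good (hsat i) (hH1 i) (hH2 i)
    unfold dg at this
    rw [hH2] at this
    simp only [hm, Sum.elim_inl]
    omega
  have hNn : ∀ i, (stepN i P Z).card ≤ m (Sum.inr (i + 1)) := fun i => by
    have := card_stepN h.comp h.good (hsat i) (hL1 (i + 1)) (hL2 (i + 1))
    unfold dg at this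
    rw [hL2] at this
    simp only [hm, Sum.elim_inr, e3]
    rw [ax_succ_succ]
    omega
  obtain ⟨hL, hG⟩ := h.large hC
  have hLZ : corAll P Z ⊆ Z := (corAll_subset P Z).trans (leadAll_subset P Z)
  have hcard := Finset.card_sdiff_add_card_eq_card hLZ
  rw [h.ctx.card] at hcard
  have hsum : (Z \ corAll P Z).card ≤ ∑ j, m j := by
    have hsub : Z \ corAll P Z ⊆ Finset.univ.biUnion fun i => stepP i P Z ∪ stepN i P Z := by
      intro z hz
      rw [Finset.mem_sdiff] at hz
      obtain ⟨i, hi⟩ := h.good.cover h.ctx.disj (by rw [hG]; exact hz.1) hz.2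
      exact Finset.mem_biUnion.2 ⟨i, Finset.mem_univ _, hi⟩
    have h1 := (Finset.card_le_card hsub).trans (Finset.card_biUnion_le.trans
      (Finset.sum_le_sum fun i _ => Finset.card_union_le _ _))
    have h2 : ∑ i, ((stepP i P Z).card + (stepN i P Z).card) ≤
        ∑ i, (m (Sum.inl i) + m (Sum.inr (i + 1))) :=
      Finset.sum_le_sum fun i _ => add_le_add (hP i) (hNn i)
    have h3 : ∑ i, (m (Sum.inl i) + m (Sum.inr (i + 1))) = ∑ j, m j := by
      rw [Fintype.sum_sum_type, Finset.sum_add_distrib]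
      congr 1
      exact Equiv.sum_comp (Equiv.addRight (1 : Fin 4)) fun i => m (Sum.inr i)
    omega
  -- Trim as many sites as there are surplus surfactant sites, and never one of `P`. The trimmed
  -- octagon then contains `P` and is an admissible competitor.
  obtain ⟨e, he1, he2⟩ := exists_le_sum_eq Finset.univ m _ hsum
  rw [Fintype.sum_sum_type] at he2
  have heH : ∀ i, (e (Sum.inl i) : ℤ) ≤ sD P i - sA P i - ax (i + 1) (H i) := fun i => by
    have h1 := he1 (Sum.inl i) (Finset.mem_univ _)
    have h2 := hHb i
    simp only [hm, Sum.elim_inl] at h1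
    omega
  have heL : ∀ i, (e (Sum.inr i) : ℤ) ≤ ax (i + 1) (L i) - (sA P i - sD P (i + 3)) := fun i => by
    have h1 := he1 (Sum.inr i) (Finset.mem_univ _)
    have h2 := hLb i
    simp only [hm, Sum.elim_inr] at h1
    omega
  set lo : Fin 4 → ℤ := fun i => sA P i - sD P (i + 3) + e (Sum.inr i) with hlo
  set hi : Fin 4 → ℤ := fun i => sD P i - sA P i - e (Sum.inl i) with hhi
  have hT3 : Tight 3 (sA P) (sD P) := h.tight.mono (by omega)
  have hlohi : ∀ i, ∀ q ∈ P, ax i q = sA P i → lo i ≤ ax (i + 1) q ∧ ax (i + 1) q ≤ hi i := by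
    intro i q hq eq
    have h1 := hH3 i q hq eq
    have h2 := hL3' i q hq eq
    have h3 := heH i
    have h4 := heL i
    simp only [hlo, hhi]
    omega
  have hsub : P ⊆ trim (sA P) (sD P) lo hi := by
    intro p hp
    have hall := fun i => hlohi i p hp
    rw [forall_fin4] at hall
    simp only [ax_zero, ax_one, ax_two, ax_three, show (0 + 1 : Fin 4) = 1 from rfl,
      show (1 + 1 : Fin 4) = 2 from rfl, show (2 + 1 : Fin 4) = 3 from rfl,
      show (3 + 1 : Fin 4) = 0 from rfl] at hall
    exact mem_trim.2 ⟨subset_oct_sA P hp, ⟨hall.1, hall.2.2.1⟩, ⟨hall.2.1, hall.2.2.2⟩⟩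
  have hlo1 : ∀ i, sA P i - sD P (i + 3) ≤ lo i := fun i => by simp only [hlo]; omega
  have hhi1 : ∀ i, hi i ≤ sD P i - sA P i := fun i => by simp only [hhi]; omega
  have hle : ∀ i, lo i ≤ hi i := fun i => by
    have := hlohi i _ (hH1 i) (hH2 i)
    omega
  have hOK : TrimOK (sA P) (sD P) lo hi := by
    refine ⟨hT3, hlo1, hhi1, hle, fun i => ⟨H i, hsub (hH1 i), hH2 i⟩, fun p hp => ?_⟩
    have ht' := ht
    rw [forall_fin4, tS_zero, tS_one, tS_two, tS_three] at ht'
    rw [mem_oct'] at hp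
    simp only [TrimH, TrimV]
    omega
  have hRcard := card_oct_sdiff_trim hT3 (fun i => by have := ht i; omega) hlo1 hhi1 hle
  have hRs : (oct (sA P) (sD P) \ trim (sA P) (sD P) lo hi).card = (Z \ corAll P Z).card := by
    have : ∑ i, (lo i - (sA P i - sD P (i + 3)) + (sD P i - sA P i - hi i)) =
        ((Z \ corAll P Z).card : ℤ) := by
      rw [← he2]
      push_cast
      rw [← Finset.sum_add_distrib]
      exact Finset.sum_congr rfl fun i _ => by simp only [hlo, hhi]; ring
    omega
  have hex : excess C (sA P) (sD P) = (Z \ corAll P Z).card := by unfold excess; omega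
  have hcmp := h.ctx.le_trim hOK h.sA_le h.sD_le (by omega) (by omega)
  rw [hRs, ← hex] at hcmp
  have hlow := h.low
  -- The lower bound for `P` and the upper bound for the competitor have the same energy part, so
  -- only the dissipations are compared.
  refine ⟨lo, hi, hOK, eq_of_Dis_le
    (fun p hp => oct_subset_oct h.sA_le h.sD_le (mem_trim.1 hp).1) (Finset.inter_subset_left.trans hsub) ?_⟩
  have h2 : δ * (Dis A D P : ℝ) ≤ δ * Dis A D (trim (sA P) (sD P) lo hi) := by linarith
  exact_mod_cast le_of_mul_le_mul_left h2 h.ctx.hδ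
end

/-! ### Displacements -/

/-- Increasing the `i`-th value by one. -/
def bump (f : Fin 4 → ℤ) (i : Fin 4) : Fin 4 → ℤ := fun j => f j + if j = i then 1 else 0

theorem bump_le {f g : Fin 4 → ℤ} (h : ∀ j, f j ≤ g j) {i : Fin 4} (hi : f i + 1 ≤ g i) (j : Fin 4) :
    bump f i j ≤ g j := by
  unfold bump
  split_ifs with hj
  · rw [hj]; exact hi
  · have := h j; omega

theorem le_bump (f : Fin 4 → ℤ) (i j : Fin 4) : f j ≤ bump f i j := by
  unfold bump; split_ifs <;> omega

theorem tS_bumpD (a d : Fin 4 → ℤ) (i j : Fin 4) :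
    tS a (bump d i) j = tS a d j - if j = i then 1 else 0 := by
  unfold tS bump; ring

theorem sum_tS_bumpD (a d : Fin 4 → ℤ) (i : Fin 4) :
    ∑ j, tS a (bump d i) j = ∑ j, tS a d j - 1 := by
  simp [tS_bumpD, Finset.sum_sub_distrib]

theorem Tight.bumpD {N : ℤ} {a d : Fin 4 → ℤ} (h : Tight N a d) {i : Fin 4} (hi : 1 ≤ tS a d i) :
    Tight N a (bump d i) := by
  refine ⟨fun j => ?_, fun j => ?_⟩
  · rw [tS_bumpD]; have := h.1 j
    split_ifs with hj
    · rw [hj]; omega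
    · omega
  · have := h.2 j
    unfold pS at *
    unfold bump
    split_ifs <;> omega

theorem layer_subset_bumpD {N : ℤ} {a d : Fin 4 → ℤ} (hN : 3 ≤ N) (h : Tight N a d) {i : Fin 4} :
    layer a i (d i + 1) ⊆ oct a (bump d i) \ oct a d := by
  have e := h.expand
  intro p hp
  rw [mem_layer] at hp
  rw [Finset.mem_sdiff]
  constructor
  · rw [mem_oct']
    revert i
    rw [forall_fin4]
    simp only [bump, show (0 + 1 : Fin 4) = 1 from rfl,
      show (1 + 1 : Fin 4) = 2 from rfl, show (2 + 1 : Fin 4) = 3 from rfl,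
      show (3 + 1 : Fin 4) = 0 from rfl, ax_zero, ax_one, ax_two, ax_three, dg_zero, dg_one, dg_two,
      dg_three]
    refine ⟨?_, ?_, ?_, ?_⟩ <;> intro hp <;> simp <;> omega
  · intro h'
    have := (mem_oct.1 h').2 i
    omega

/-- Filling the corner sites of a diagonal side decreases the dissipation. -/
theorem Dis_bumpD_le {N : ℤ} {A D a d : Fin 4 → ℤ} (hN : 3 ≤ N) (h : Tight N a d)
    (ha : ∀ j, a j ≤ A j) (hd : ∀ j, d j ≤ D j) {i : Fin 4} (hi : d i + 1 ≤ D i) :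
    Dis A D (oct a (bump d i)) + tS a d i ≤ Dis A D (oct a d) := by
  have hsub : oct a (bump d i) ⊆ oct A D := oct_subset_oct ha (bump_le hd hi)
  rw [Dis_add_sum (oct_subset_oct (fun _ => le_rfl) (le_bump d i)) hsub]
  have h1 := card_le_sum_dep (A := A) (D := D) (S := oct a (bump d i) \ oct a d)
    (Finset.sdiff_subset.trans hsub)
  have h2 := Finset.card_le_card (layer_subset_bumpD hN h (i := i))
  rw [card_layer] at h2
  have := h.1 i
  unfold tS at *
  omega

theorem tS_bumpA (a d : Fin 4 → ℤ) (i j : Fin 4) :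
    tS (bump a i) d j = tS a d j + (if j = i then 1 else 0) + (if j + 1 = i then 1 else 0) := by
  unfold tS bump; ring

theorem Tight.bumpA {N : ℤ} {a d : Fin 4 → ℤ} (h : Tight N a d) (i : Fin 4) :
    Tight (N - 2) (bump a i) d := by
  refine ⟨fun j => ?_, fun j => ?_⟩
  · rw [tS_bumpA]; have := h.1 j
    split_ifs <;> omega
  · have := h.2 j
    unfold pS at *
    unfold bump
    split_ifs <;> omega

theorem excess_mono {C : ℕ} {a d a' d' : Fin 4 → ℤ} (h : ∑ i, tS a d i ≤ ∑ i, tS a' d' i) :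
    excess C a' d' ≤ excess C a d := by
  unfold excess; omega

theorem excess_eq_zero {C : ℕ} {a d : Fin 4 → ℤ} (h : (C : ℤ) ≤ ∑ i, tS a d i) :
    excess C a d = 0 := by
  unfold excess; omega

/-- Adding an external slice decreases the dissipation. -/
theorem Dis_bumpA_le {N : ℤ} {A D a d : Fin 4 → ℤ} (h : Tight N a d)
    (ha : ∀ j, a j ≤ A j) (hd : ∀ j, d j ≤ D j) {i : Fin 4} (hi : a i + 1 ≤ A i)
    (hN : A i - a i + 3 ≤ N) :
    Dis A D (oct (bump a i) d) + (A i - a i) * (pS a d i - 2 * (A i - a i)) ≤ Dis A D (oct a d) := by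
  have e := h.expand
  have hsub : oct (bump a i) d ⊆ oct A D := oct_subset_oct (bump_le ha hi) hd
  rw [Dis_add_sum (oct_subset_oct (le_bump a i) (fun _ => le_rfl)) hsub]
  set α := A i - a i with hα
  -- The middle part of the new slice. Discarding `α` sites at each end keeps it at depth at least
  -- `α`, the distance to the `i`-th side.
  set S := (Finset.Icc (a i - d (i + 3) + α) (d i - a i - α)).image fun v => pt i (a i + 1) v with hS
  have hcard : pS a d i - 2 * α ≤ S.card := by
    rw [hS, Finset.card_image_of_injective _ fun u v huv => by
      have := congrArg (ax (i + 1)) huv; rwa [ax_succ_pt, ax_succ_pt] at this, Int.card_Icc]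
    unfold pS
    omega
  have hmem : ∀ p ∈ S, α ≤ dep A D p ∧ p ∈ oct (bump a i) d \ oct a d := by
    intro p hp
    obtain ⟨v, hv, rfl⟩ := Finset.mem_image.1 hp
    rw [Finset.mem_Icc] at hv
    have ha' := forall_fin4.1 ha
    have hd' := forall_fin4.1 hd
    refine ⟨?_, Finset.mem_sdiff.2 ⟨?_, fun h' => ?_⟩⟩
    · rw [le_dep, forall_fin4, forall_fin4]
      clear hcard hp hS S hsub
      revert i
      rw [forall_fin4, show (0 + 3 : Fin 4) = 3 from rfl, show (1 + 3 : Fin 4) = 0 from rfl,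
        show (2 + 3 : Fin 4) = 1 from rfl, show (3 + 3 : Fin 4) = 2 from rfl]
      simp only [pt_zero, pt_one, pt_two, pt_three, ax_zero, ax_one, ax_two, ax_three, dg_zero, dg_one,
        dg_two, dg_three]
      refine ⟨?_, ?_, ?_, ?_⟩ <;> intros <;> omega
    · rw [mem_oct']
      clear hcard hp hS S hsub
      revert i
      rw [forall_fin4, show (0 + 3 : Fin 4) = 3 from rfl, show (1 + 3 : Fin 4) = 0 from rfl,
        show (2 + 3 : Fin 4) = 1 from rfl, show (3 + 3 : Fin 4) = 2 from rfl]
      simp only [pt_zero, pt_one, pt_two, pt_three, bump]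
      refine ⟨?_, ?_, ?_, ?_⟩ <;> intros <;> simp <;> omega
    · have := (mem_oct.1 h').1 i
      rw [ax_pt] at this
      omega
  have h1 : (S.card : ℤ) * α ≤ ∑ p ∈ S, dep A D p := by
    have := Finset.card_nsmul_le_sum S (dep A D) α fun p hp => (hmem p hp).1
    simpa using this
  have h2 : ∑ p ∈ S, dep A D p ≤ ∑ p ∈ oct (bump a i) d \ oct a d, dep A D p :=
    Finset.sum_le_sum_of_subset_of_nonneg (fun p hp => (hmem p hp).2) fun p hp _ => by
      have := one_le_dep.2 (hsub (Finset.mem_sdiff.1 hp).1)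
      omega
  have h3 := mul_le_mul_of_nonneg_left hcard (by omega : 0 ≤ α)
  nlinarith

section
variable {k δ : ℝ} {A D : Fin 4 → ℤ} {C : ℕ} {P Z : Finset Site} {N M0 : ℤ}

theorem sum_tS_eq (A D a d : Fin 4 → ℤ) : ∑ i, tS a d i =
    ∑ i, tS A D i - 2 * ∑ i, (A i - a i) + ∑ i, (D i - d i) := by
  simp only [Fin.sum_univ_four, tS_zero, tS_one, tS_two, tS_three]
  ring

/-- The diagonal sides move less than the sides parallel to the axes. -/
theorem Shape.sum_beta_le (h : Shape k δ A D C P Z N M0) :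
    ∑ i, (D i - sD P i) ≤ 2 * ∑ i, (A i - sA P i) := by
  by_contra hcon
  push Not at hcon
  have hN := h.hN
  have hM0 := h.hM0
  have hle := h.ctx.le_sum
  have hκ := sum_tS_eq A D (sA P) (sD P)
  have hex : excess C (sA P) (sD P) = 0 := excess_eq_zero (by omega)
  -- By `sum_tS_eq` a violation leaves a corner to spare. A displaced diagonal side that has a
  -- corner can then move outwards without any cost in energy, with less dissipation.
  by_cases hi : ∃ i, sD P i + 1 ≤ D i ∧ 1 ≤ tS (sA P) (sD P) i
  · obtain ⟨i, h1, h2⟩ := hi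
    have hT := h.tight.bumpD h2
    have hex' : excess C (sA P) (bump (sD P) i) = 0 := excess_eq_zero (by rw [sum_tS_bumpD]; omega)
    have hopt := h.opt (hT.mono (by omega)) h.sA_le (bump_le h.sD_le h1)
      (by have := hT.2 0; omega)
    have hD := Dis_bumpD_le (by omega) h.tight h.sA_le h.sD_le h1
    rw [hex, hex'] at hopt
    simp only [Nat.cast_zero, mul_zero, zero_mul, add_zero] at hopt
    have h3 : δ * (Dis A D (oct (sA P) (sD P)) : ℝ) ≤ δ * Dis A D (oct (sA P) (bump (sD P) i)) := by
      linarith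
    have h4 := le_of_mul_le_mul_left h3 h.ctx.hδ
    have h5 : Dis A D (oct (sA P) (sD P)) ≤ Dis A D (oct (sA P) (bump (sD P) i)) := by
      exact_mod_cast h4
    omega
  -- Here every displaced diagonal side has degenerated to a vertex of the box, so its displacement
  -- is at most that of the two adjacent axis sides; each axis side is adjacent to two diagonals.
  · push Not at hi
    have hT : ∀ i, D i - sD P i ≤ (A i - sA P i) + (A (i + 1) - sA P (i + 1)) := by
      intro i
      have h1 := hi i
      have h2 := h.tAD i
      have h3 := h.sA_le i
      have h4 := h.sA_le (i + 1)
      unfold tS at *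
      omega
    rw [forall_fin4] at hT
    simp only [Fin.sum_univ_four, show (0 + 1 : Fin 4) = 1 from rfl,
      show (1 + 1 : Fin 4) = 2 from rfl, show (2 + 1 : Fin 4) = 3 from rfl,
      show (3 + 1 : Fin 4) = 0 from rfl] at *
    omega

theorem Shape.beta_le (h : Shape k δ A D C P Z N M0) (i : Fin 4) :
    D i - sD P i ≤ 2 * ∑ i, (A i - sA P i) :=
  (Finset.single_le_sum (fun i _ => by have := h.sD_le i; omega) (Finset.mem_univ i)).trans
    h.sum_beta_le

/-- Upper bound of the displacement of the sides parallel to the axes. -/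
theorem Shape.alpha_upper (h : Shape k δ A D C P Z N M0) (i : Fin 4) :
    δ * ((A i - sA P i) * pS A D i : ℤ) ≤
      4 + δ * (16 * M0 * (8 * M0 + 1) + 8 * M0 * (32 * M0) : ℤ) := by
  have hM0 := h.hM0
  have hN := h.hN
  have hδ := h.ctx.hδ
  rcases eq_or_lt_of_le (h.sA_le i) with he | hlt
  · rw [he, sub_self, zero_mul, Int.cast_zero, mul_zero]
    have : (0 : ℝ) ≤ (16 * M0 * (8 * M0 + 1) + 8 * M0 * (32 * M0) : ℤ) := by
      have : 0 ≤ 16 * M0 * (8 * M0 + 1) + 8 * M0 * (32 * M0) := by positivity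
      exact_mod_cast this
    have := mul_nonneg hδ.le this
    linarith
  · have hα := h.alpha_le i
    have hT := h.tight.bumpA i
    have hle := bump_le h.sA_le (i := i) (by omega)
    have hmono : excess C (bump (sA P) i) (sD P) ≤ excess C (sA P) (sD P) :=
      excess_mono (Finset.sum_le_sum fun j _ => by rw [tS_bumpA]; split_ifs <;> omega)
    have hsb := h.excess_le
    have hopt := h.opt (hT.mono (by omega)) hle h.sD_le (by have := hT.2 0; omega)
    have hD := Dis_bumpA_le h.tight h.sA_le h.sD_le (i := i) (by omega) (by omega)
    have hsum : ∑ j, (bump (sA P) i j : ℝ) = ∑ j, (sA P j : ℝ) + 1 := by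
      simp [bump, Finset.sum_add_distrib]
    rw [hsum] at hopt
    have hα0 := h.alpha_le 0
    have hA0 := hle 0
    have hb0 := le_bump (sA P) i 0
    have h2 : (excess C (bump (sA P) i) (sD P) : ℤ) * (A 0 - bump (sA P) i 0 + 1) ≤
        16 * M0 * (8 * M0 + 1) := mul_le_mul (by omega) (by omega) (by omega) (by omega)
    have hβ1 := h.beta_le i
    have hβ2 := h.beta_le (i + 3)
    have hαs := h.alpha
    -- The inward motion of the side lengthens its slice by `2 α`, which cancels; only the two
    -- adjacent diagonal displacements, at most `16 * M0` each, shorten it.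
    have hp : pS (sA P) (sD P) i - 2 * (A i - sA P i) ≥ pS A D i - 32 * M0 := by
      unfold pS; omega
    have h3 : (A i - sA P i) * (pS A D i - 32 * M0) ≤
        (A i - sA P i) * (pS (sA P) (sD P) i - 2 * (A i - sA P i)) :=
      mul_le_mul_of_nonneg_left hp (by omega)
    have h4 : (A i - sA P i) * (32 * M0) ≤ 8 * M0 * (32 * M0) :=
      mul_le_mul_of_nonneg_right hα (by omega)
    have h5 : (A i - sA P i) * pS A D i +
        (Dis A D (oct (bump (sA P) i) (sD P)) +
          excess C (bump (sA P) i) (sD P) * (A 0 - bump (sA P) i 0 + 1)) ≤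
        Dis A D (oct (sA P) (sD P)) + (16 * M0 * (8 * M0 + 1) + 8 * M0 * (32 * M0)) := by
      have : (A i - sA P i) * (pS A D i - 32 * M0) =
        (A i - sA P i) * pS A D i - (A i - sA P i) * (32 * M0) := by ring
      omega
    have h6 : (((A i - sA P i) * pS A D i : ℤ) : ℝ) +
        ((Dis A D (oct (bump (sA P) i) (sD P)) +
          excess C (bump (sA P) i) (sD P) * (A 0 - bump (sA P) i 0 + 1) : ℤ) : ℝ) ≤
        (Dis A D (oct (sA P) (sD P)) : ℝ) +
          ((16 * M0 * (8 * M0 + 1) + 8 * M0 * (32 * M0) : ℤ) : ℝ) := by exact_mod_cast h5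
    have h7 := mul_le_mul_of_nonneg_left h6 hδ.le
    have h8 : (excess C (bump (sA P) i) (sD P) : ℝ) ≤ excess C (sA P) (sD P) := by
      exact_mod_cast hmono
    have h9 := mul_le_mul_of_nonneg_left h8 (by linarith [h.ctx.hk] : 0 ≤ 1 + k)
    linarith

theorem dep_le_of_layer {A D a : Fin 4 → ℤ} {i : Fin 4} {s : ℤ} {p : Site}
    (hp : p ∈ layer a i s) : dep A D p ≤ D i - s + 1 := by
  rw [mem_layer] at hp
  have := dep_le_dg A D p i
  omega

/-- Few surfactant sites fit next to a short diagonal side only if it is long enough. -/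
theorem Shape.cut_cost' (h : Shape k δ A D C P Z N M0) (hC : ∑ i, tS (sA P) (sD P) i < C)
    (i : Fin 4) {B : ℤ} (hB : 2 * ∑ i, (A i - sA P i) ≤ B) :
    1 + k ≤ δ * ((tS A D i + B + 1) * (B + 1) + 16 * M0 * (8 * M0 + 1) : ℤ) := by
  have h1 := h.cut_cost hC i (B := D i - sD P i + 1) (fun p hp => dep_le_of_layer hp)
    (by have := h.sD_le i; omega)
  refine h1.trans (mul_le_mul_of_nonneg_left ?_ h.ctx.hδ.le)
  have h2 := h.beta_le i
  have h3 : (tS (sA P) (sD P) i + 1) * (D i - sD P i + 1) ≤ (tS A D i + B + 1) * (B + 1) := by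
    refine mul_le_mul ?_ (by omega) (by have := h.sD_le i; omega) ?_
    · have := h.sA_le i
      have := h.sA_le (i + 1)
      unfold tS
      omega
    · have := h.tAD i
      have : 0 ≤ ∑ i, (A i - sA P i) := Finset.sum_nonneg fun i _ => by have := h.sA_le i; omega
      omega
  exact_mod_cast add_le_add_left h3 _

/-- Long diagonal sides do not move, in presence of a short one. -/
theorem Shape.beta_eq_zero (h : Shape k δ A D C P Z N M0)
    (hC : (C : ℤ) ≤ ∑ i, tS (sA P) (sD P) i) {i j : Fin 4} (hij : i ≠ j) {cα : ℤ} (hcα : 1 ≤ cα)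
    (hα : ∀ i, A i - sA P i ≤ cα - 1)
    (hbig : (8 * cα - 7) * (tS A D j + 8 * cα - 7) + 2 * cα < tS A D i + 3) : sD P i = D i := by
  by_contra hcon
  have hM0 := h.hM0
  have hN := h.hN
  have hi := h.sD_le i
  have hj := h.sD_le j
  have hα4 := forall_fin4.1 hα
  have hs : ∑ i, (A i - sA P i) ≤ 4 * (cα - 1) := by rw [Fin.sum_univ_four]; omega
  have hβj := h.beta_le j
  have a1 := hα i
  have a2 := hα (i + 1)
  have a3 := h.sA_le j
  have a4 := h.sA_le (j + 1)
  have htj := h.tAD j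
  have htj' := h.tight.1 j
  have hnn : 0 ≤ (8 * cα - 7) * (tS A D j + 8 * cα - 7) := mul_nonneg (by omega) (by omega)
  have hti : tS A D i - 2 * cα + 3 ≤ tS (sA P) (sD P) i := by unfold tS; omega
  -- The competitor moves the long side `i` outwards and the short side `j` inwards, which preserves
  -- the total number of corners. It gains the whole length of side `i` and loses at most the cut
  -- layer of side `j` times its depth, which is at most `8 * cα - 7`.
  have hT1 := h.tight.bumpD (i := i) (by omega)
  have hle1 := bump_le h.sD_le (i := i) (by omega)
  have hT2 := hT1.cutD j
  have hex : excess C (sA P) (sD P) = 0 := excess_eq_zero hC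
  have hex' : excess C (sA P) (cutD (bump (sD P) i) j) = 0 :=
    excess_eq_zero (by rw [sum_tS_cutD, sum_tS_bumpD]; omega)
  have hopt := h.opt (hT2.mono (by omega)) h.sA_le (fun l => (cutD_le _ j l).trans (hle1 l))
    (by have := hT2.2 0; omega)
  rw [hex, hex'] at hopt
  simp only [Nat.cast_zero, mul_zero, zero_mul, add_zero] at hopt
  have h3 : δ * (Dis A D (oct (sA P) (sD P)) : ℝ) ≤
      δ * Dis A D (oct (sA P) (cutD (bump (sD P) i) j)) := by linarith
  have h4 : Dis A D (oct (sA P) (sD P)) ≤ Dis A D (oct (sA P) (cutD (bump (sD P) i) j)) := by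
    exact_mod_cast le_of_mul_le_mul_left h3 h.ctx.hδ
  have hD1 := Dis_bumpD_le (by omega) h.tight h.sA_le h.sD_le (i := i) (by omega)
  have ebj : bump (sD P) i j = sD P j := by simp [bump, hij.symm]
  have etj : tS (sA P) (bump (sD P) i) j = tS (sA P) (sD P) j := by
    rw [tS_bumpD, if_neg hij.symm, sub_zero]
  have hD2 := Dis_cutD_le h.sA_le hle1 j (B := D j - sD P j + 1)
    (fun p hp => by have := dep_le_of_layer (A := A) (D := D) hp; rwa [ebj] at this) (by omega)
    (hT1.1 j)
  rw [etj] at hD2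
  have h5 : (tS (sA P) (sD P) j + 1) * (D j - sD P j + 1) ≤
      (tS A D j + 8 * cα - 7) * (8 * cα - 7) := by
    refine mul_le_mul ?_ (by omega) (by omega) (by omega)
    unfold tS at *
    omega
  have h6 : (tS A D j + 8 * cα - 7) * (8 * cα - 7) = (8 * cα - 7) * (tS A D j + 8 * cα - 7) := by
    ring
  omega

/-- Moving a side parallel to the axes inwards, keeping enough room for the surfactant by cutting
the `j`-th diagonal side. -/
def retractD (a d : Fin 4 → ℤ) (i j : Fin 4) : Fin 4 → ℤ := fun l =>
  if l = j then d l - 2 else if (l = i ∨ l + 1 = i) ∧ tS a d l = 0 then d l - 1 else d l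

def retractA (a : Fin 4 → ℤ) (i : Fin 4) : Fin 4 → ℤ := fun l => a l - if l = i then 1 else 0

theorem Tight.retract {a d : Fin 4 → ℤ} (h : Tight N a d) (i j : Fin 4) :
    Tight (N - 6) (retractA a i) (retractD a d i j) := by
  refine ⟨fun l => ?_, fun l => ?_⟩
  · have := h.1 l
    unfold tS at *
    unfold retractA retractD tS
    split_ifs <;> omega
  · have h1 := h.2 l
    have h2 : d l - 2 ≤ retractD a d i j l := by unfold retractD; split_ifs <;> omega
    have h3 : d (l + 3) - 2 ≤ retractD a d i j (l + 3) := by unfold retractD; split_ifs <;> omega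
    have h4 : retractA a i l ≤ a l := by unfold retractA; split_ifs <;> omega
    unfold pS at *
    omega

/-- Retracting the `i`-th side removes at most one corner from each of the two adjacent diagonals,
and moving the `j`-th diagonal inwards by two restores two. -/
theorem sum_tS_retract {a d : Fin 4 → ℤ} (h : ∀ i, 0 ≤ tS a d i) (i j : Fin 4) :
    ∑ l, tS a d l ≤ ∑ l, tS (retractA a i) (retractD a d i j) l := by
  have h1 : ∑ l, (tS a d l + (if l = j then 2 else 0) - (if l = i then 1 else 0) -
      (if l + 1 = i then 1 else 0)) ≤ ∑ l, tS (retractA a i) (retractD a d i j) l := by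
    refine Finset.sum_le_sum fun l _ => ?_
    have := h l
    unfold tS at *
    unfold retractA retractD tS
    split_ifs <;> omega
  have h2 : ∀ i : Fin 4, ∑ l : Fin 4, (if l + 1 = i then (1 : ℤ) else 0) = 1 := by decide
  rw [Finset.sum_sub_distrib, Finset.sum_sub_distrib, Finset.sum_add_distrib, h2] at h1
  simp at h1
  omega

theorem sum_dep_union_le {S T : Finset Site} (hT : S ∩ T ⊆ oct A D) :
    ∑ p ∈ S ∪ T, dep A D p ≤ ∑ p ∈ S, dep A D p + ∑ p ∈ T, dep A D p := by
  rw [← Finset.sum_union_inter]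
  have : 0 ≤ ∑ p ∈ S ∩ T, dep A D p := Finset.sum_nonneg fun p hp => by
    have := one_le_dep.2 (hT hp); omega
  omega

/-- A diagonal side without corners adjacent to side `i` reduces to a vertex on the `i`-th slice, so
moving it along with that slice removes nothing more. -/
theorem oct_sdiff_retract {a d : Fin 4 → ℤ} (i j : Fin 4) :
    oct a d \ oct (retractA a i) (retractD a d i j) ⊆
      ((oct a d).filter fun p => ax i p = a i) ∪
        ((oct a d ∩ layer a j (d j)) ∪ (oct a d ∩ layer a j (d j - 1))) := by
  intro p hp
  rw [Finset.mem_sdiff] at hp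
  obtain ⟨hp, hp'⟩ := hp
  obtain ⟨h1, h2⟩ := mem_oct.1 hp
  simp only [Finset.mem_union, Finset.mem_filter, Finset.mem_inter, mem_layer, hp, true_and]
  by_contra hcon
  rw [not_or, not_or] at hcon
  obtain ⟨c1, c2, c3⟩ := hcon
  refine hp' (mem_oct.2 ⟨fun l => ?_, fun l => ?_⟩)
  · have := h1 l
    unfold retractA
    split_ifs with hl
    · rw [hl] at this ⊢; omega
    · omega
  · have e1 := h1 l
    have e2 := h1 (l + 1)
    have e3 := h2 l
    unfold retractD
    split_ifs with hl hl2
    · rw [hl] at e1 e2 e3 ⊢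
      have c2' : dg j p ≠ d j := fun e => c2 ⟨e, e1, e2⟩
      have c3' : dg j p ≠ d j - 1 := fun e => c3 ⟨e, e1, e2⟩
      omega
    · obtain ⟨hl3, hl4⟩ := hl2
      unfold tS at hl4
      unfold dg at *
      rcases hl3 with hl3 | hl3
      · subst hl3
        omega
      · rw [← hl3] at c1
        omega
    · omega

theorem card_slice_le {N : ℤ} (hN : 1 ≤ N) {a d : Fin 4 → ℤ} (h : Tight N a d) (i : Fin 4) :
    (((oct a d).filter fun p => ax i p = a i).card : ℤ) ≤ pS a d i := by
  have hsub : (oct a d).filter (fun p => ax i p = a i) ⊆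
      (Finset.Icc (a i - d (i + 3)) (d i - a i)).image fun v => pt i (a i) v := by
    intro p hp
    obtain ⟨h1, h2⟩ := Finset.mem_filter.1 hp
    refine Finset.mem_image.2 ⟨ax (i + 1) p, ?_, by rw [← h2, pt_ax]⟩
    have h3 := (mem_oct.1 h1).2 i
    have h4 := (mem_oct.1 h1).2 (i + 3)
    unfold dg at h3 h4
    rw [ax_add_three, show i + 3 + 1 = i by rw [add_assoc]; exact add_zero i] at h4
    rw [Finset.mem_Icc]
    omega
  refine (Nat.cast_le.2 ((Finset.card_le_card hsub).trans Finset.card_image_le)).trans ?_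
  rw [Int.card_Icc]
  have := h.2 i
  unfold pS at *
  omega

theorem sum_dep_le {S : Finset Site} {n B : ℤ} (hn : (S.card : ℤ) ≤ n) (hB : ∀ p ∈ S, dep A D p ≤ B)
    (hB0 : 0 ≤ B) : ∑ p ∈ S, dep A D p ≤ n * B := by
  have h1 : ∑ p ∈ S, dep A D p ≤ _ := Finset.sum_le_card_nsmul _ _ B hB
  rw [nsmul_eq_mul] at h1
  have := mul_le_mul_of_nonneg_right hn hB0
  omega

theorem sum_dep_layer_le {a : Fin 4 → ℤ} {S : Finset Site} {j : Fin 4} {s n B : ℤ}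
    (hn : a j + a (j + 1) - s + 1 ≤ n) (hn0 : 0 ≤ n) (hB : D j - s + 1 ≤ B) (hB0 : 0 ≤ B) :
    ∑ p ∈ S ∩ layer a j s, dep A D p ≤ n * B := by
  have h1 := Finset.card_le_card (Finset.inter_subset_right (s₁ := S) (s₂ := layer a j s))
  rw [card_layer] at h1
  exact sum_dep_le (by omega) (fun p hp =>
    (dep_le_of_layer (Finset.mem_inter.1 hp).2).trans hB) hB0

set_option maxHeartbeats 800000 in
/-- Lower bound of the displacement of the sides parallel to the axes. -/
theorem Shape.alpha_lower (h : Shape k δ A D C P Z N M0)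
    (hC : (C : ℤ) ≤ ∑ i, tS (sA P) (sD P) i) (i j : Fin 4) :
    4 ≤ δ * ((pS A D i + 16 * M0) * (A i - sA P i + 1) +
      (2 * tS A D j + 32 * M0 + 3) * (16 * M0 + 2) : ℤ) := by
  have hM0 := h.hM0
  have hN := h.hN
  have hδ := h.ctx.hδ
  have hT := h.tight.retract i j
  have hle1 : ∀ l, retractA (sA P) i l ≤ sA P l := fun l => by
    unfold retractA; split_ifs <;> omega
  have hle2 : ∀ l, retractD (sA P) (sD P) i j l ≤ sD P l := fun l => by
    unfold retractD; split_ifs <;> omega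
  have hex : excess C (sA P) (sD P) = 0 := excess_eq_zero hC
  have hex' : excess C (retractA (sA P) i) (retractD (sA P) (sD P) i j) = 0 :=
    excess_eq_zero (hC.trans (sum_tS_retract h.tight.1 i j))
  have hopt := h.opt (hT.mono (by omega)) (fun l => (hle1 l).trans (h.sA_le l))
    (fun l => (hle2 l).trans (h.sD_le l)) (by have := hT.2 0; omega)
  have hsum : ∑ l, (retractA (sA P) i l : ℝ) = ∑ l, (sA P l : ℝ) - 1 := by
    simp [retractA, Finset.sum_sub_distrib]
  rw [hex, hex', hsum] at hopt
  simp only [Nat.cast_zero, mul_zero, zero_mul, add_zero] at hopt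
  have hsub := oct_subset_oct h.sA_le h.sD_le
  have hα := h.alpha_le i
  have hα1 := h.alpha
  have hβj := h.beta_le j
  have hβi := h.sD_le i
  have hβi3 := h.sD_le (i + 3)
  have hαi := h.sA_le i
  have hj := h.sD_le j
  have htj' := h.tight.1 j
  have a3 := h.sA_le j
  have a4 := h.sA_le (j + 1)
  have htj1 : sA P j + sA P (j + 1) - sD P j + 1 ≤ tS A D j + 16 * M0 + 1 := by unfold tS; omega
  have htj2 := h.tAD j
  -- The two terms are the `i`-th slice, at depth at most one more than its displacement, and two
  -- layers of the `j`-th diagonal side. The second is small only if that side is short.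
  have hD : Dis A D (oct (retractA (sA P) i) (retractD (sA P) (sD P) i j)) ≤
      Dis A D (oct (sA P) (sD P)) + ((pS A D i + 16 * M0) * (A i - sA P i + 1) +
      (2 * tS A D j + 32 * M0 + 3) * (16 * M0 + 2)) := by
    rw [Dis_add_sum (oct_subset_oct hle1 hle2) hsub]
    have h1 : ∑ p ∈ oct (sA P) (sD P) \ oct (retractA (sA P) i) (retractD (sA P) (sD P) i j),
        dep A D p ≤ _ :=
      Finset.sum_le_sum_of_subset_of_nonneg (oct_sdiff_retract i j) fun p hp _ => by
        have : p ∈ oct (sA P) (sD P) := by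
          simp only [Finset.mem_union, Finset.mem_filter, Finset.mem_inter] at hp
          tauto
        have := one_le_dep.2 (hsub this)
        omega
    have h2 := sum_dep_union_le (A := A) (D := D)
      (S := (oct (sA P) (sD P)).filter fun p => ax i p = sA P i)
      (T := (oct (sA P) (sD P) ∩ layer (sA P) j (sD P j)) ∪
        (oct (sA P) (sD P) ∩ layer (sA P) j (sD P j - 1)))
      ((Finset.inter_subset_left.trans (Finset.filter_subset _ _)).trans hsub)
    have h3 := sum_dep_union_le (A := A) (D := D)
      (S := oct (sA P) (sD P) ∩ layer (sA P) j (sD P j))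
      (T := oct (sA P) (sD P) ∩ layer (sA P) j (sD P j - 1))
      ((Finset.inter_subset_left.trans Finset.inter_subset_left).trans hsub)
    have h4 : ∑ p ∈ (oct (sA P) (sD P)).filter (fun p => ax i p = sA P i), dep A D p ≤
        (pS A D i + 16 * M0) * (A i - sA P i + 1) := by
      refine sum_dep_le ((card_slice_le (by omega) h.tight i).trans ?_) (fun p hp => ?_) (by omega)
      · unfold pS; omega
      · have := dep_le_ax A D p i
        rw [(Finset.mem_filter.1 hp).2] at this
        exact this
    have h5 : ∑ p ∈ oct (sA P) (sD P) ∩ layer (sA P) j (sD P j), dep A D p ≤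
        (tS A D j + 16 * M0 + 1) * (16 * M0 + 2) :=
      sum_dep_layer_le htj1 (by omega) (by omega) (by omega)
    have h6 : ∑ p ∈ oct (sA P) (sD P) ∩ layer (sA P) j (sD P j - 1), dep A D p ≤
        (tS A D j + 16 * M0 + 2) * (16 * M0 + 2) :=
      sum_dep_layer_le (by omega) (by omega) (by omega) (by omega)
    have h7 : (2 * tS A D j + 32 * M0 + 3) * (16 * M0 + 2) =
      (tS A D j + 16 * M0 + 1) * (16 * M0 + 2) + (tS A D j + 16 * M0 + 2) * (16 * M0 + 2) := by ring
    omega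
  have hD' : (Dis A D (oct (retractA (sA P) i) (retractD (sA P) (sD P) i j)) : ℝ) ≤
      Dis A D (oct (sA P) (sD P)) + ((pS A D i + 16 * M0) * (A i - sA P i + 1) +
      (2 * tS A D j + 32 * M0 + 3) * (16 * M0 + 2) : ℤ) := by exact_mod_cast hD
  have := mul_le_mul_of_nonneg_left hD' hδ.le
  linarith
end

/-! ### Choice of the auxiliary constants as `δ` tends to zero -/

/-- For small parameters the minimizers have the expected shape. -/
theorem exists_shape {k lam : ℝ} (hk : k < 1) (hlam0 : 0 < lam) {M0 : ℤ} (hM0 : 1 ≤ M0)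
    (hM : 64 ≤ lam * M0) : ∃ δ0 : ℝ, 0 < δ0 ∧ ∀ (δ : ℝ) (A D : Fin 4 → ℤ) (C : ℕ)
      (P Z : Finset Site) (n : ℤ), δ ≤ δ0 → Ctx k δ A D C P Z → Tight n A D → lam ≤ δ * n →
      ∃ N, Shape k δ A D C P Z N M0 ∧ (∑ i, tS (sA P) (sD P) i < C →
        (∀ i, 2 ≤ tS (sA P) (sD P) i) ∧
        ∃ lo hi, TrimOK (sA P) (sD P) lo hi ∧ P = trim (sA P) (sD P) lo hi) := by
  have hk' : 0 < 1 - k := by linarith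
  have hM0' : (1 : ℝ) ≤ M0 := by exact_mod_cast hM0
  obtain ⟨Kb, hKb⟩ : ∃ Kb : ℤ, 32 * (M0 : ℝ) ≤ (1 - k) * Kb := by
    obtain ⟨x, hx⟩ := exists_int_gt (32 * (M0 : ℝ) / (1 - k))
    refine ⟨x, ?_⟩
    rw [div_lt_iff₀ hk'] at hx
    linarith
  have hKb0 : (0 : ℝ) ≤ Kb := by
    by_contra hcon
    push Not at hcon
    nlinarith
  have hB0 : (0 : ℝ) < Kb + 16 * M0 := by linarith
  -- The depth `m` will be of order `θ / δ`, so that `δ * m` is close to `θ` while `K` and `Kb` do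
  -- not depend on `δ`. The first bound makes `8 * (m + K)` a fraction of `n`; the second makes the
  -- gain from stray sites smaller than the penalty.
  set θ : ℝ := min (lam / 64) ((1 - k) / (8 * (Kb + 16 * M0))) with hθ
  have hθ0 : 0 < θ := lt_min (by positivity) (by positivity)
  have hθ1 : θ ≤ lam / 64 := min_le_left _ _
  have hθ2 : (Kb + 16 * M0) * θ ≤ (1 - k) / 8 := by
    have h1 : θ ≤ (1 - k) / (8 * (Kb + 16 * M0)) := min_le_right _ _
    rw [le_div_iff₀ (by positivity)] at h1
    linarith
  obtain ⟨K, hK⟩ : ∃ K : ℤ, 32 * (M0 : ℝ) ≤ θ * K := by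
    obtain ⟨x, hx⟩ := exists_int_gt (32 * (M0 : ℝ) / θ)
    refine ⟨x, ?_⟩
    rw [div_lt_iff₀ hθ0] at hx
    linarith
  have hK0 : (0 : ℝ) ≤ K := by
    by_contra hcon
    push Not at hcon
    nlinarith
  have hK0' : 0 ≤ K := by exact_mod_cast hK0
  set E1 : ℝ := 40 * M0 + 4 * Kb + 20 with hE1
  set E2 : ℝ := 2 * (8 * M0 + 2) + 16 * M0 * (8 * M0 + 1) with hE2
  have hE1p : 0 < E1 := by positivity
  have hE2p : 0 < E2 := by positivity
  refine ⟨min (θ / (1 + K)) (min (lam / (4 * E1)) ((1 - k) / (4 * E2))), by positivity, ?_⟩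
  intro δ A D C P Z n hδ hctx hT hlam
  have hδ0 := hctx.hδ
  have hd1 : δ * (1 + K) ≤ θ := by
    rw [← le_div_iff₀ (by positivity)]; exact hδ.trans (min_le_left _ _)
  have hd2 : δ * (4 * E1) ≤ lam := by
    rw [← le_div_iff₀ (by positivity)]
    exact hδ.trans ((min_le_right _ _).trans (min_le_left _ _))
  have hd3 : δ * (4 * E2) ≤ 1 - k := by
    rw [← le_div_iff₀ (by positivity)]
    exact hδ.trans ((min_le_right _ _).trans (min_le_right _ _))
  set m : ℤ := ⌈θ / δ⌉ with hm
  have hm1 : 1 ≤ m := Int.one_le_ceil_iff.2 (by positivity)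
  have hm2 : θ ≤ δ * m := by
    have := Int.le_ceil (θ / δ)
    rw [div_le_iff₀ hδ0] at this
    linarith
  have hm3 : δ * m ≤ θ + δ := by
    have := Int.ceil_lt_add_one (θ / δ)
    have h2 := mul_lt_mul_of_pos_left this hδ0
    rw [mul_add, mul_div_cancel₀ _ hδ0.ne', mul_one] at h2
    exact h2.le
  have hmK : δ * (m + K) ≤ 2 * θ := by linarith
  have hn : 40 * M0 + 8 * (m + K) + 4 * Kb + 20 ≤ n := by
    have : δ * (40 * M0 + 8 * (m + K) + 4 * Kb + 20) ≤ δ * n := by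
      have : δ * (40 * M0 + 8 * (m + K) + 4 * Kb + 20) = δ * E1 + 8 * (δ * (m + K)) := by
        rw [hE1]; ring
      linarith
    have := le_of_mul_le_mul_left this hδ0
    exact_mod_cast this
  have hδ2 : 2 * (δ * (16 * M0 * (8 * M0 + 1))) < 1 - k := by
    have : δ * (2 * (8 * M0 + 2)) ≥ 0 := by positivity
    rw [hE2] at hd3
    linarith
  have hδ3 : δ * (2 * (8 * M0 + 2) + 16 * M0 * (8 * M0 + 1)) < 1 := by
    have := hctx.hk
    rw [← hE2]
    linarith
  obtain ⟨hc, hr, hcol, hne, hsA, hA, hD, hTS, hα⟩ := hctx.rigid hT hM0 hlam hM hm1 hK0'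
    (hK.trans (mul_le_mul_of_nonneg_right hm2 hK0)) hKb hn
    (by
      have := mul_le_mul_of_nonneg_left hmK hB0.le
      linarith) hδ2
  have hKbi : 0 ≤ Kb := by exact_mod_cast hKb0
  obtain ⟨hsub, hlow, hsmall, hlarge⟩ := hctx.subset_oct hM0 (N := n - 4 * (m + K)) (by omega) hc hne
    hsA hA hD hTS hα (by linarith [hctx.hk])
  have hPS : P ∩ oct A D = P := Finset.inter_eq_left.2 hsub
  rw [hPS] at hTS
  have hS : Shape k δ A D C P Z (n - 4 * (m + K)) M0 :=
    { ctx := hctx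
      comp := hc
      good := GoodLines.of_lines hr hcol
      sub := hsub
      tight := hTS
      alpha := hα
      low := hlow
      small := hsmall
      large := hlarge
      tAD := hT.1
      hM0 := hM0
      hN := by omega }
  exact ⟨_, hS, fun hC => ⟨hS.two_le_tS hδ3 hC, hS.eq_trim hδ3 hC⟩⟩

/-! ### Staircase sets and octagons -/

theorem mem_slice {I : Set Site} {i : Fin 4} {p : Site} :
    p ∈ slice I i ↔ p ∈ I ∧ ∀ q ∈ I, ax i q ≤ ax i p := Iff.rfl

theorem isStaircase_of {P Z : Finset Site} (h : IsComp P P) (hg : GoodLines P Z) :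
    IsStaircase (P : Set Site) := by
  refine ⟨fun p hp q hq => h.conn p hp q hq, fun x x' x'' y h1 h2 h3 h4 => ?_,
    fun x y y' y'' h1 h2 h3 h4 => ?_⟩
  · exact hg.conv 2 _ h3 _ h4 (x', y) (by simp) (by simp) (by
      rw [show (2 + 1 : Fin 4) = 3 from rfl]; simpa using h1) (by
      rw [show (2 + 1 : Fin 4) = 3 from rfl]; simpa using h2)
  · exact hg.conv 1 _ h3 _ h4 (x, y') (by simp) (by simp) (by
      rw [show (1 + 1 : Fin 4) = 2 from rfl]; simpa using h1) (by
      rw [show (1 + 1 : Fin 4) = 2 from rfl]; simpa using h2)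

theorem along_point (ε : ℝ) (i : Fin 4) (p : Site) :
    along (axisDir i) (point ε p) = ε * ax i p ∧ along (diagDir i) (point ε p) = ε * dg i p := by
  unfold along diagDir dg ax point
  simp
  constructor <;> ring

theorem isOctagon_oct {ε : ℝ} (hε : 0 < ε) {a d : Fin 4 → ℤ} (h : (oct a d).Nonempty) :
    IsOctagon ε (oct a d : Set Site) := by
  have key : ∀ p : Site, p ∈ oct a d ↔ point ε p ∈ {x : Plane | ∀ i, along (axisDir i) x ≤ ε * a i ∧
      along (diagDir i) x ≤ ε * d i} := by
    intro p
    rw [mem_oct, Set.mem_ofPred_eq, ← forall_and]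
    refine forall_congr' fun i => ?_
    rw [(along_point ε i p).1, (along_point ε i p).2, mul_le_mul_iff_right₀ hε,
      mul_le_mul_iff_right₀ hε, Int.cast_le, Int.cast_le]
  refine ⟨h, {x | ∀ i, along (axisDir i) x ≤ ε * a i ∧ along (diagDir i) x ≤ ε * d i},
    ⟨?_, fun i => ε * a i, fun i => ε * d i, rfl⟩, ?_⟩
  · obtain ⟨p, hp⟩ := h
    exact ⟨point ε p, (key p).1 hp⟩
  · ext p
    exact key p

section
variable {k δ : ℝ} {A D : Fin 4 → ℤ} {C : ℕ} {P Z : Finset Site} {N M0 : ℤ}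

/-- A corner site has its two inner neighbours in `P`, and the half lines free of `P` exclude the
two outer ones. -/
theorem Shape.isOctagon (h : Shape k δ A D C P Z N M0) {ε : ℝ} (hε : 0 < ε)
    (hC : (C : ℤ) ≤ ∑ i, tS (sA P) (sD P) i) :
    IsOctagon ε (P : Set Site) ∧ (Z : Set Site) ⊆ corners (P : Set Site) := by
  obtain ⟨h1, h2⟩ := h.small hC
  refine ⟨?_, fun z hz => ?_⟩
  · rw [h1]
    exact isOctagon_oct hε (h1 ▸ h.comp.ne)
  · rw [Finset.mem_coe, ← h2] at hz
    obtain ⟨i, hi⟩ := mem_corAll.1 hz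
    obtain ⟨r1, r2⟩ := corSet_rays hi
    have m1 := (mem_leadSet.1 (Finset.mem_inter.1 hi).1).2.1
    have m2 := (mem_leadSet.1 (Finset.mem_inter.1 hi).2).2.1
    have hzZ := (mem_leadSet.1 (Finset.mem_inter.1 hi).1).1
    have hzP : z ∉ P := fun hp => Finset.disjoint_left.1 h.ctx.disj hp hzZ
    have hn : nbrs z = {z - axisDir i, z - axisDir (i + 1), z + axisDir i, z + axisDir (i + 1)} := by
      clear r1 r2 m1 m2 hi
      ext q
      revert i
      rw [forall_fin4, show (0 + 1 : Fin 4) = 1 from rfl, show (1 + 1 : Fin 4) = 2 from rfl,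
        show (2 + 1 : Fin 4) = 3 from rfl, show (3 + 1 : Fin 4) = 0 from rfl]
      simp only [mem_nbrs, Set.mem_insert_iff, Set.mem_singleton_iff, Prod.ext_iff, axisDir_zero,
        axisDir_one, axisDir_two, axisDir_three, Prod.fst_sub, Prod.snd_sub, Prod.fst_add,
        Prod.snd_add]
      omega
    have e1 : z + axisDir i ∉ P := fun hp => by
      have := r1 _ hp (by rw [ax_add, ax_succ_axisDir, add_zero])
      rw [ax_add, ax_axisDir] at this
      omega
    have e2 : z + axisDir (i + 1) ∉ P := fun hp => by
      have := r2 _ hp (by rw [ax_add, ax_axisDir_succ, add_zero])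
      rw [ax_add, ax_axisDir] at this
      omega
    have hcap : nbrs z ∩ (P : Set Site) = {z - axisDir i, z - axisDir (i + 1)} := by
      ext q
      rw [hn]
      simp only [Set.mem_inter_iff, Set.mem_insert_iff, Set.mem_singleton_iff, Finset.mem_coe]
      constructor
      · rintro ⟨rfl | rfl | rfl | rfl, hq⟩
        · exact Or.inl rfl
        · exact Or.inr rfl
        · exact absurd hq e1
        · exact absurd hq e2
      · rintro (rfl | rfl)
        · exact ⟨Or.inl rfl, m1⟩
        · exact ⟨Or.inr (Or.inl rfl), m2⟩
    have hne : z - axisDir i ≠ z - axisDir (i + 1) := fun he => by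
      have := congrArg (ax i) he
      rw [ax_sub, ax_sub, ax_axisDir, ax_axisDir_succ] at this
      omega
    refine ⟨⟨hzP, ?_⟩, ?_⟩
    · rw [hcap]; exact ⟨_, Or.inl rfl⟩
    · rw [hcap, Set.ncard_pair hne]

/-- The inner octagon has all four axis sides moved inwards by one and the same diagonals. Its
slices extend one site beyond the original ones at both ends, which provides the two excluded
endpoints. -/
theorem isQuasiOctagon_trim {ε : ℝ} (hε : 0 < ε) {a d lo hi : Fin 4 → ℤ} (h : TrimOK a d lo hi)
    (hN : Tight 6 a d) (ht : ∀ i, 2 ≤ tS a d i)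
    (hs : IsStaircase (trim a d lo hi : Set Site)) :
    IsQuasiOctagon ε (trim a d lo hi : Set Site) := by
  have e := hN.expand
  have ht' := forall_fin4.1 ht
  rw [tS_zero, tS_one, tS_two, tS_three] at ht'
  set a' : Fin 4 → ℤ := fun i => a i - 1 with ha'
  have hlo := h.lo_le
  have hhi := h.le_hi
  have hmax : ∀ i, ∀ p ∈ slice (trim a d lo hi : Set Site) i, ax i p = a i ∧
      lo i ≤ ax (i + 1) p ∧ ax (i + 1) p ≤ hi i := by
    intro i p hp
    rw [mem_slice] at hp
    obtain ⟨q, hq, e⟩ := h.mem i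
    have h1 := hp.2 q hq
    obtain ⟨h2, h3, h4⟩ := mem_trim.1 (Finset.mem_coe.1 hp.1)
    have h5 := (mem_oct.1 h2).1 i
    have h6 : ax i p = a i := by omega
    refine ⟨h6, ?_⟩
    clear hp h1 h2 h5 e hq
    revert i
    rw [forall_fin4, show (0 + 1 : Fin 4) = 1 from rfl, show (1 + 1 : Fin 4) = 2 from rfl,
        show (2 + 1 : Fin 4) = 3 from rfl, show (3 + 1 : Fin 4) = 0 from rfl]
    simp only [ax_zero, ax_one, ax_two, ax_three, TrimH, TrimV] at *
    exact ⟨h3.1, h4.1, h3.2, h4.2⟩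
  have hslJ : ∀ i, ∀ p : Site, ax i p = a i - 1 → a i - d (i + 3) - 1 ≤ ax (i + 1) p →
      ax (i + 1) p ≤ d i - a i + 1 → p ∈ slice (oct a' d : Set Site) i := by
    intro i p h1 h2 h3
    refine mem_slice.2 ⟨?_, fun q hq => by rw [h1]; exact (mem_oct.1 (Finset.mem_coe.1 hq)).1 i⟩
    rw [Finset.mem_coe, mem_oct']
    simp only [ha']
    clear hmax hlo hhi
    revert i
    rw [forall_fin4, show (0 + 1 : Fin 4) = 1 from rfl, show (1 + 1 : Fin 4) = 2 from rfl,
        show (2 + 1 : Fin 4) = 3 from rfl, show (3 + 1 : Fin 4) = 0 from rfl,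
        show (0 + 3 : Fin 4) = 3 from rfl, show (1 + 3 : Fin 4) = 0 from rfl,
        show (2 + 3 : Fin 4) = 1 from rfl, show (3 + 3 : Fin 4) = 2 from rfl]
    simp only [ax_zero, ax_one, ax_two, ax_three]
    omega
  refine ⟨hs, Or.inr ⟨oct a' d, isOctagon_oct hε ?_, ?_, fun i p hp => ?_⟩⟩
  · refine ⟨_, Finset.mem_coe.1 (mem_slice.1 (hslJ 0 (pt 0 (a 0 - 1) (d 0 - a 0 + 1)) (by simp) ?_
      (by rw [ax_succ_pt]))).1⟩
    rw [ax_succ_pt, show (0 + 3 : Fin 4) = 3 from rfl]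
    omega
  · ext p
    rw [Set.mem_union, Set.mem_iUnion, Finset.mem_coe, Finset.mem_coe]
    constructor
    · intro hp
      obtain ⟨h1, h2, h3⟩ := mem_trim.1 hp
      obtain ⟨h4, h5⟩ := mem_oct.1 h1
      by_cases hc : ∃ i, ax i p = a i
      · obtain ⟨i, hi⟩ := hc
        exact Or.inr ⟨i, mem_slice.2 ⟨hp, fun q hq => by
          rw [hi]; exact (mem_oct.1 (mem_trim.1 (Finset.mem_coe.1 hq)).1).1 i⟩⟩
      · push Not at hc
        refine Or.inl (mem_oct.2 ⟨fun i => ?_, h5⟩)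
        have := hc i
        have := h4 i
        simp only [ha']
        omega
    · rintro (hp | ⟨i, hp⟩)
      · obtain ⟨h1, h2⟩ := mem_oct.1 hp
        have h3 := forall_fin4.1 h1
        simp only [ha', ax_zero, ax_one, ax_two, ax_three] at h3
        refine mem_trim.2 ⟨mem_oct.2 ⟨fun i => ?_, h2⟩, ?_, ?_⟩
        · have := h1 i
          simp only [ha'] at this
          omega
        · simp only [TrimH]; omega
        · simp only [TrimV]; omega
      · exact Finset.mem_coe.1 (mem_slice.1 hp).1
  · obtain ⟨h1, h2, h3⟩ := hmax i p hp
    have h4 := hlo i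
    have h5 := hhi i
    constructor
    · refine hslJ i _ ?_ ?_ ?_
      · rw [ax_add, ax_sub, ax_axisDir, ax_axisDir_succ]; omega
      · rw [ax_add, ax_sub, ax_succ_axisDir, ax_axisDir]; omega
      · rw [ax_add, ax_sub, ax_succ_axisDir, ax_axisDir]; omega
    · refine hslJ i _ ?_ ?_ ?_
      · rw [ax_sub, ax_sub, ax_axisDir, ax_axisDir_succ]; omega
      · rw [ax_sub, ax_sub, ax_succ_axisDir, ax_axisDir]; omega
      · rw [ax_sub, ax_sub, ax_succ_axisDir, ax_axisDir]; omega

theorem Shape.isQuasiOctagon (h : Shape k δ A D C P Z N M0) {ε : ℝ} (hε : 0 < ε)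
    (hlarge : ∑ i, tS (sA P) (sD P) i < C → (∀ i, 2 ≤ tS (sA P) (sD P) i) ∧
        ∃ lo hi, TrimOK (sA P) (sD P) lo hi ∧ P = trim (sA P) (sD P) lo hi) :
    IsQuasiOctagon ε (P : Set Site) := by
  have hs := isStaircase_of h.comp h.good
  by_cases hC : (C : ℤ) ≤ ∑ i, tS (sA P) (sD P) i
  · exact ⟨hs, Or.inl (h.isOctagon hε hC).1⟩
  · obtain ⟨ht, lo, hi, hOK, he⟩ := hlarge (by omega)
    have hN := h.hN
    have hM0 := h.hM0
    have := isQuasiOctagon_trim hε hOK (h.tight.mono (by omega)) ht (by rw [← he]; exact hs)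
    rwa [← he] at this
end

/-! ### Energy and dissipation of configurations with finite phases -/

theorem bond_nonneg {k : ℝ} (hk : k ≤ 1) (a b : SignType) : 0 ≤ bond k a b := by
  unfold bond
  rcases a with _ | _ | _ <;> rcases b with _ | _ | _ <;> norm_num [SignType.cast] <;> linarith

theorem bond_le_two {k : ℝ} (hk : -1 ≤ k) (a b : SignType) : bond k a b ≤ 2 := by
  unfold bond
  rcases a with _ | _ | _ <;> rcases b with _ | _ | _ <;> norm_num [SignType.cast] <;> linarith

theorem hasSum_indicator_finset (S : Finset Site) :
    HasSum (fun p : Site => if p ∈ S then (1 : ℝ) else 0) S.card := by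
  have h : HasSum (fun p : Site => if p ∈ S then (1 : ℝ) else 0)
      (∑ p ∈ S, if p ∈ S then (1 : ℝ) else 0) :=
    hasSum_sum_of_ne_finset_zero fun p hp => if_neg hp
  simpa using h

theorem hasSum_indicator_add (S : Finset Site) (e : Site) :
    HasSum (fun p : Site => if p + e ∈ S then (1 : ℝ) else 0) S.card := by
  have h := (Equiv.addRight e).hasSum_iff.2 (hasSum_indicator_finset S)
  exact h

/-- Pointwise, a bond is a combination of indicators: exposed on either side of `P`, first or second
endpoint in `Z`, both in `Z`. Each has a finite sum after a translation by `e`. -/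
theorem hasSum_bond {k : ℝ} {w : Config} {P Z : Finset Site} (hP : plus w = P) (hZ : surf w = Z)
    (e : Site) : HasSum (fun p => bond k (w p) (w (p + e))) (dirCost k e P Z - 2 * k * Z.card) := by
  have hPw : ∀ p, p ∈ P ↔ w p = 1 := fun p => by
    rw [← Finset.mem_coe, ← hP]; rfl
  have hZw : ∀ p, p ∈ Z ↔ w p = 0 := fun p => by
    rw [← Finset.mem_coe, ← hZ]; rfl
  have h1 := hasSum_indicator_finset (P.filter fun p => p + e ∉ P ∧ p + e ∉ Z)
  have h2 := hasSum_indicator_add (P.filter fun p => p - e ∉ P ∧ p - e ∉ Z) e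
  have h3 := hasSum_indicator_finset Z
  have h4 := hasSum_indicator_add Z e
  have h5 := hasSum_indicator_add (Z.filter fun z => z - e ∈ Z) e
  have h := ((h1.add h2).mul_left 2).add (((h3.add h4).sub h5).mul_left (1 - k))
  refine (congrArg₂ (fun f v => HasSum f v (SummationFilter.unconditional Site))
    (funext fun p => ?_) ?_).mpr h
  · simp only [Finset.mem_filter, add_sub_cancel_right, hPw, hZw, bond]
    rcases w p with _ | _ | _ <;> rcases w (p + e) with _ | _ | _ <;>
      norm_num [SignType.cast]
  · unfold dirCost edgeE adjE
    push_cast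
    ring

theorem hasSum_energy {k : ℝ} (ε : ℝ) {w : Config} {P Z : Finset Site}
    (hP : plus w = P) (hZ : surf w = Z) :
    HasSum (fun p => ε * (bond k (w p) (w (p + (1, 0))) + bond k (w p) (w (p + (0, 1)))))
      (ε * (cost k P Z - 4 * k * Z.card)) := by
  have h := ((hasSum_bond (k := k) hP hZ (1, 0)).add (hasSum_bond (k := k) hP hZ (0, 1))).mul_left ε
  have e : ε * (cost k P Z - 4 * k * Z.card) = ε * (dirCost k (1, 0) P Z - 2 * k * Z.card +
      (dirCost k (0, 1) P Z - 2 * k * Z.card)) := by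
    unfold cost; ring
  rw [e]
  exact h

theorem energy_nonneg' {k ε : ℝ} (hε : 0 ≤ ε) (hk : k ≤ 1) (w : Config) (p : Site) :
    0 ≤ ε * (bond k (w p) (w (p + (1, 0))) + bond k (w p) (w (p + (0, 1)))) :=
  mul_nonneg hε (add_nonneg (bond_nonneg hk _ _) (bond_nonneg hk _ _))

theorem energy_eq {k ε : ℝ} (hε : 0 ≤ ε) (hk : k ≤ 1) {w : Config} {P Z : Finset Site}
    (hP : plus w = P) (hZ : surf w = Z) :
    energy k ε w = ENNReal.ofReal (ε * (cost k P Z - 4 * k * Z.card)) ∧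
      0 ≤ ε * (cost k P Z - 4 * k * Z.card) := by
  have h := hasSum_energy (k := k) ε hP hZ
  refine ⟨?_, h.nonneg (energy_nonneg' hε hk w)⟩
  rw [← h.tsum_eq, ENNReal.ofReal_tsum_of_nonneg (energy_nonneg' hε hk w) h.summable]
  rfl

/-- Changing the value at one site changes the energy by a bounded multiple of `ε`. -/
theorem energy_update_le {k ε : ℝ} (hε : 0 ≤ ε) (hk : -1 ≤ k) (w : Config) (z : Site)
    (s : SignType) : energy k ε (Function.update w z s) ≤ energy k ε w + ENNReal.ofReal (12 * ε) := by
  -- Only the terms at these three sites involve `z`, and each term is at most `4 ε`.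
  set S : Finset Site := {z, z - (1, 0), z - (0, 1)} with hS
  have hc : S.card ≤ 3 := Finset.card_le_three
  have h1 : energy k ε (Function.update w z s) ≤ energy k ε w +
      ∑' p : Site, if p ∈ S then ENNReal.ofReal (4 * ε) else 0 := by
    unfold energy
    rw [← ENNReal.tsum_add]
    refine ENNReal.tsum_le_tsum fun p => ?_
    by_cases hp : p ∈ S
    · rw [if_pos hp]
      refine le_add_left (ENNReal.ofReal_le_ofReal ?_)
      have b1 := bond_le_two hk (Function.update w z s p) (Function.update w z s (p + (1, 0)))
      have b2 := bond_le_two hk (Function.update w z s p) (Function.update w z s (p + (0, 1)))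
      nlinarith
    · rw [if_neg hp, add_zero]
      simp only [hS, Finset.mem_insert, Finset.mem_singleton, not_or, eq_sub_iff_add_eq] at hp
      rw [Function.update_of_ne hp.1, Function.update_of_ne hp.2.1, Function.update_of_ne hp.2.2]
  refine h1.trans (add_le_add le_rfl ?_)
  rw [tsum_eq_sum (s := S) fun p hp => if_neg hp, Finset.sum_congr rfl fun p hp => if_pos hp,
    Finset.sum_const, nsmul_eq_mul]
  calc (S.card : ℝ≥0∞) * ENNReal.ofReal (4 * ε) ≤ 3 * ENNReal.ofReal (4 * ε) := by
        gcongr; exact_mod_cast hc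
    _ = ENNReal.ofReal (12 * ε) := by
        rw [show (3 : ℝ≥0∞) = ENNReal.ofReal 3 by simp, ← ENNReal.ofReal_mul (by norm_num)]
        ring_nf

theorem dist1_eq (ε : ℝ) (p q : Site) :
    dist1 ε p q = ENNReal.ofReal (ε * ((|p.1 - q.1| + |p.2 - q.2| : ℤ) : ℝ)) := by
  unfold dist1; push_cast; rfl

theorem ofReal_le_distBdry {ε : ℝ} (hε : 0 ≤ ε) (p : Site) (I : Set Site) :
    ENNReal.ofReal ε ≤ distBdry ε p I := by
  have key : ∀ q : Site, p ≠ q → ENNReal.ofReal ε ≤ dist1 ε p q := by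
    intro q hq
    rw [dist1_eq]
    refine ENNReal.ofReal_le_ofReal (le_mul_of_one_le_right hε ?_)
    have : (1 : ℤ) ≤ |p.1 - q.1| + |p.2 - q.2| := by
      by_contra hcon
      refine hq (Prod.ext ?_ ?_) <;> grind
    exact_mod_cast this
  unfold distBdry
  split_ifs with h
  · exact le_iInf₂ fun q hq => key q fun e => hq (e ▸ h)
  · exact le_iInf₂ fun q hq => key q fun e => h (e ▸ hq)

/-- The distance of a site of an octagon from the complement is at most its depth. -/
theorem exists_notMem_oct {A D : Fin 4 → ℤ} {p : Site} (hp : p ∈ oct A D) :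
    ∃ q ∉ oct A D, |p.1 - q.1| + |p.2 - q.2| ≤ dep A D p := by
  have h1 := one_le_dep.2 hp
  have key : ∀ i : Fin 4, |p.1 - (p + (dep A D p) • axisDir i).1| +
      |p.2 - (p + (dep A D p) • axisDir i).2| ≤ dep A D p := by
    rw [forall_fin4]
    simp only [axisDir_zero, axisDir_one, axisDir_two, axisDir_three, Prod.fst_add, Prod.snd_add,
      Prod.smul_mk, smul_eq_mul, mul_zero, mul_neg, mul_one, add_zero, sub_self, abs_zero,
      zero_add, sub_add_cancel_left, neg_neg, abs_neg, abs_of_nonneg (zero_le_one.trans h1),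
      le_refl, and_self]
  have hn : ¬ (dep A D p + 1 ≤ dep A D p) := by omega
  rw [le_dep, not_and_or, not_forall, not_forall] at hn
  -- An axis step raises both `ax i` and `dg i` by one, so the same straight path exits through a
  -- binding constraint of either kind.
  have hax : ∀ i, ax i (dep A D p • axisDir i) = dep A D p ∧
      dg i (dep A D p • axisDir i) = dep A D p := by
    rw [forall_fin4]; simp
  have hdg : ∀ i (q r : Site), dg i (q + r) = dg i q + dg i r := by
    intro i q r; unfold dg; rw [ax_add, ax_add]; ring
  rcases hn with ⟨i, hi⟩ | ⟨i, hi⟩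
  · refine ⟨_, fun hm => ?_, key i⟩
    have := (mem_oct.1 hm).1 i
    rw [ax_add, (hax i).1] at this
    omega
  · refine ⟨_, fun hm => ?_, key i⟩
    have := (mem_oct.1 hm).2 i
    rw [hdg, (hax i).2] at this
    omega

theorem distBdry_oct {ε : ℝ} (hε : 0 ≤ ε) {A D : Fin 4 → ℤ} {p : Site} (hp : p ∈ oct A D) :
    distBdry ε p (oct A D : Set Site) = ENNReal.ofReal (ε * (dep A D p : ℝ)) := by
  unfold distBdry
  rw [if_pos (Finset.mem_coe.2 hp)]
  apply le_antisymm
  · obtain ⟨q, hq, h⟩ := exists_notMem_oct hp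
    refine (iInf₂_le (f := fun q (_ : q ∈ (oct A D : Set Site)ᶜ) => dist1 ε p q) q hq).trans ?_
    rw [dist1_eq]
    exact ENNReal.ofReal_le_ofReal (mul_le_mul_of_nonneg_left (Int.cast_le.2 h) hε)
  · refine le_iInf₂ fun q hq => ?_
    rw [dist1_eq]
    refine ENNReal.ofReal_le_ofReal (mul_le_mul_of_nonneg_left (Int.cast_le.2 ?_) hε)
    by_contra hcon
    refine hq (Finset.mem_coe.2 (mem_oct'.2 ?_))
    obtain ⟨h2, h3⟩ := le_dep.1 (le_refl (dep A D p))
    rw [forall_fin4] at h2 h3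
    simp only [ax_zero, ax_one, ax_two, ax_three, dg_zero, dg_one, dg_two, dg_three] at h2 h3
    grind

theorem diss1_coe (ε : ℝ) (P Q : Finset Site) : diss1 ε (P : Set Site) (Q : Set Site) =
    ∑ p ∈ symmDiff P Q, ENNReal.ofReal (ε ^ 2) * distBdry ε p Q := by
  unfold diss1
  rw [← Finset.coe_symmDiff]
  exact Finset.tsum_subtype (symmDiff P Q) fun p => ENNReal.ofReal (ε ^ 2) * distBdry ε p Q

theorem diss1_eq {ε : ℝ} (hε : 0 ≤ ε) {A D : Fin 4 → ℤ} {P : Finset Site} (hP : P ⊆ oct A D) :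
    diss1 ε (P : Set Site) (oct A D : Set Site) = ENNReal.ofReal (ε ^ 3 * (Dis A D P : ℝ)) := by
  rw [diss1_coe, Dis_of_subset hP, symmDiff_def, Finset.sup_eq_union, Finset.sdiff_eq_empty_iff_subset.2 hP,
    Finset.empty_union]
  push_cast
  rw [Finset.mul_sum, ENNReal.ofReal_sum_of_nonneg]
  · refine Finset.sum_congr rfl fun p hp => ?_
    rw [distBdry_oct hε (Finset.mem_sdiff.1 hp).1, ← ENNReal.ofReal_mul (by positivity)]
    ring_nf
  · intro p hp
    have := one_le_dep.2 (Finset.mem_sdiff.1 hp).1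
    have : (0 : ℝ) ≤ dep A D p := by exact_mod_cast (by omega : (0 : ℤ) ≤ dep A D p)
    positivity

theorem ofReal_Dis_le_diss1 {ε : ℝ} (hε : 0 ≤ ε) (A D : Fin 4 → ℤ) (P : Finset Site) :
    ENNReal.ofReal (ε ^ 3 * (Dis A D P : ℝ)) ≤ diss1 ε (P : Set Site) (oct A D : Set Site) := by
  have hdep : ∀ p ∈ oct A D \ P, (0 : ℝ) ≤ dep A D p := fun p hp => by
    have := one_le_dep.2 (Finset.mem_sdiff.1 hp).1
    exact_mod_cast (by omega : (0 : ℤ) ≤ dep A D p)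
  rw [diss1_coe, symmDiff_def, Finset.sup_eq_union, Finset.union_comm, Finset.sum_union
    (Finset.disjoint_left.2 fun p h h' => (Finset.mem_sdiff.1 h).2 (Finset.mem_sdiff.1 h').1), Dis]
  push_cast
  rw [mul_add, ENNReal.ofReal_add (mul_nonneg (by positivity) (Finset.sum_nonneg hdep))
    (by positivity), Finset.mul_sum,
    ENNReal.ofReal_sum_of_nonneg fun p hp => mul_nonneg (by positivity) (hdep p hp)]
  refine add_le_add (Finset.sum_le_sum fun p hp => ?_) ?_
  · rw [distBdry_oct hε (Finset.mem_sdiff.1 hp).1, ← ENNReal.ofReal_mul (by positivity)]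
    refine le_of_eq ?_
    ring_nf
  · refine le_trans ?_ (Finset.card_nsmul_le_sum _ _ (ENNReal.ofReal (ε ^ 3)) fun p hp => ?_)
    · rw [nsmul_eq_mul, mul_comm, ENNReal.ofReal_mul (by positivity), ENNReal.ofReal_natCast]
    · rw [show ε ^ 3 = ε ^ 2 * ε by ring, ENNReal.ofReal_mul (by positivity)]
      gcongr
      exact ofReal_le_distBdry hε p _

/-- A set at finite dissipation from a finite set is finite. -/
theorem finite_of_diss1 {ε : ℝ} (hε : 0 < ε) {I J : Set Site} (hJ : J.Finite)
    (h : diss1 ε I J ≠ ∞) : I.Finite := by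
  have hc : ENNReal.ofReal (ε ^ 2) * ENNReal.ofReal ε ≠ 0 := by
    simp [hε, hε.ne']
  have h1 := ENNReal.finite_const_le_of_tsum_ne_top h hc
  have h2 : (Set.univ : Set ↥(symmDiff I J)).Finite := by
    refine h1.subset fun p _ => ?_
    exact mul_le_mul_right (ofReal_le_distBdry hε.le _ _) _
  have h3 : (symmDiff I J).Finite := Set.finite_univ_iff.1 h2
  exact (h3.union hJ).subset fun p hp => by
    by_cases hj : p ∈ J
    · exact Or.inr hj
    · exact Or.inl (Or.inl ⟨hp, hj⟩)

section
variable {k γ ζ ε : ℝ} {A D : Fin 4 → ℤ} {C : ℕ}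

theorem diss0_self {Z W : Set Site} (h : Z.ncard = W.ncard) : diss0 Z W = 0 := by
  simp [diss0, h]

/-- Distances and areas give `ε ^ 3` in the dissipation; divided by `ζ ε` and by the overall factor
`ε`, this leaves the coefficient `ε / ζ`. The term `4 k C` undoes the normalization of `cost`. -/
theorem total_eq (hε : 0 < ε) (hζ : 0 < ζ) (hk : k ≤ 1) {u w : Config} {P Z : Finset Site}
    (hu : plus u = oct A D) (hC : (surf u).ncard = C) (hP : plus w = P) (hZ : surf w = Z)
    (hPA : P ⊆ oct A D) (hZC : Z.card = C) :
    total k γ (ζ * ε) ε w u =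
      ENNReal.ofReal (ε * (cost k P Z + ε / ζ * Dis A D P - 4 * k * C)) ∧
    0 ≤ ε * (cost k P Z + ε / ζ * Dis A D P - 4 * k * C) := by
  obtain ⟨h1, h2⟩ := energy_eq hε.le hk hP hZ
  have h3 : (0 : ℝ) ≤ Dis A D P := by exact_mod_cast Dis_nonneg A D P
  have e : ε * (cost k P Z + ε / ζ * Dis A D P - 4 * k * C) =
      ε * (cost k P Z - 4 * k * Z.card) + 1 / (ζ * ε) * (ε ^ 3 * Dis A D P) := by
    rw [hZC]
    field_simp
    ring
  rw [e]
  refine ⟨?_, by positivity⟩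
  unfold total
  rw [h1, hP, hu, hZ, diss1_eq hε.le hPA, diss0_self (by rw [hC, Set.ncard_coe_finset, hZC]),
    mul_zero, add_zero, ← ENNReal.ofReal_mul (by positivity), ← ENNReal.ofReal_add h2 (by positivity)]

theorem le_total (hε : 0 < ε) (hζ : 0 < ζ) (hk : k ≤ 1) {u w : Config} {P Z : Finset Site}
    (hu : plus u = oct A D) (hP : plus w = P) (hZ : surf w = Z) (hZC : Z.card = C) :
    ENNReal.ofReal (ε * (cost k P Z + ε / ζ * Dis A D P - 4 * k * C)) ≤
      total k γ (ζ * ε) ε w u := by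
  obtain ⟨h1, h2⟩ := energy_eq hε.le hk hP hZ
  have h3 : (0 : ℝ) ≤ Dis A D P := by exact_mod_cast Dis_nonneg A D P
  have e : ε * (cost k P Z + ε / ζ * Dis A D P - 4 * k * C) =
      ε * (cost k P Z - 4 * k * Z.card) + 1 / (ζ * ε) * (ε ^ 3 * Dis A D P) := by
    rw [hZC]
    field_simp
    ring
  rw [e]
  unfold total
  rw [h1, hP, hu, ENNReal.ofReal_add h2 (by positivity), ENNReal.ofReal_mul (p := 1 / (ζ * ε))
    (by positivity)]
  gcongr
  exact le_add_right (ofReal_Dis_le_diss1 hε.le A D P)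

/-- The configuration with given phases. -/
def ofPhases (P Z : Finset Site) : Config := fun p => if p ∈ P then 1 else if p ∈ Z then 0 else -1

theorem plus_ofPhases (P Z : Finset Site) : plus (ofPhases P Z) = P := by
  ext p
  simp only [plus, ofPhases, Set.mem_ofPred_eq, Finset.mem_coe]
  split_ifs <;> simp_all

theorem surf_ofPhases {P Z : Finset Site} (h : Disjoint P Z) : surf (ofPhases P Z) = Z := by
  ext p
  have : p ∈ P → p ∉ Z := fun hp => Finset.disjoint_left.1 h hp
  simp only [surf, ofPhases, Set.mem_ofPred_eq, Finset.mem_coe]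
  split_ifs <;> simp_all

/-- The minimizers do not change the number of surfactant sites. -/
theorem IsMinimizer.ncard_surf (hε : 0 < ε) (hζ : 0 < ζ) (hk : -1 ≤ k)
    (hsmall : 12 * ε < 1 / (ζ * ε) * ε ^ γ) {u v : Config} (hv : IsMinimizer k γ (ζ * ε) ε v u)
    (hP : (plus v).Finite) (hfin : total k γ (ζ * ε) ε v u ≠ ∞) :
    (surf v).ncard = (surf u).ncard := by
  have hpos : 0 < ε ^ γ := Real.rpow_pos_of_pos hε γ
  -- A change at one site that keeps the plus phase and brings the number of surfactant sites closer
  -- to that of `u` saves `ε ^ γ / (ζ ε)` and costs at most `12 ε`. It turns a `-1` into `0` or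
  -- conversely.
  have key : ∀ (z : Site) (s : SignType), plus (Function.update v z s) = plus v →
      (surf (Function.update v z s)).Finite →
      |((surf v).ncard : ℝ) - (surf u).ncard| =
        |((surf (Function.update v z s)).ncard : ℝ) - (surf u).ncard| + 1 → False := by
    intro z s h1 h2 h3
    have h4 := hv.2 _ h2
    set B := energy k ε v + ENNReal.ofReal (1 / (ζ * ε)) * (diss1 ε (plus v) (plus u) +
      ENNReal.ofReal (ε ^ γ) * diss0 (surf (Function.update v z s)) (surf u)) with hB
    have h5 : total k γ (ζ * ε) ε v u = B + ENNReal.ofReal (1 / (ζ * ε) * ε ^ γ) := by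
      have : diss0 (surf v) (surf u) = diss0 (surf (Function.update v z s)) (surf u) + 1 := by
        unfold diss0
        rw [h3, ENNReal.ofReal_add (abs_nonneg _) zero_le_one, ENNReal.ofReal_one]
      rw [hB, total, this, ENNReal.ofReal_mul (p := 1 / (ζ * ε)) (by positivity)]
      ring
    have h6 : total k γ (ζ * ε) ε (Function.update v z s) u ≤ B + ENNReal.ofReal (12 * ε) := by
      rw [hB, total, h1]
      calc _ ≤ energy k ε v + ENNReal.ofReal (12 * ε) + _ :=
            add_le_add (energy_update_le hε.le hk v z s) le_rfl
        _ = _ := by ring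
    have hBt : B ≠ ∞ := ne_top_of_le_ne_top hfin (h5 ▸ le_self_add)
    have h7 := h4.trans h6
    rw [h5] at h7
    have h8 := (ENNReal.add_le_add_iff_left hBt).1 h7
    rw [ENNReal.ofReal_le_ofReal_iff (by positivity)] at h8
    linarith
  rcases lt_trichotomy (surf v).ncard (surf u).ncard with h | h | h
  · exfalso
    obtain ⟨z, hz⟩ : ∃ z, z ∉ plus v ∪ surf v := by
      by_contra hcon
      push Not at hcon
      exact (Set.infinite_univ (α := Site)) ((hP.union hv.1).subset fun p _ => hcon p)
    simp only [Set.mem_union, not_or, plus, surf, Set.mem_ofPred_eq] at hz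
    have hs : surf (Function.update v z 0) = insert z (surf v) := by
      ext p
      by_cases hp : p = z
      · subst hp; simp [surf]
      · simp [surf, hp]
    refine key z 0 ?_ (hs ▸ hv.1.insert z) ?_
    · ext p
      by_cases hp : p = z
      · subst hp; simp [plus, hz.1]
      · simp [plus, Function.update_of_ne hp]
    · rw [hs, Set.ncard_insert_of_notMem (by simpa [surf] using hz.2) hv.1]
      have h' : ((surf v).ncard : ℝ) + 1 ≤ (surf u).ncard := by exact_mod_cast h
      push_cast
      rw [abs_of_nonpos (by linarith), abs_of_nonpos (by linarith)]
      ring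
  · exact h
  · exfalso
    obtain ⟨z, hz⟩ : (surf v).Nonempty := Set.nonempty_of_ncard_ne_zero (by omega)
    have hz' : v z = 0 := hz
    have hs : surf (Function.update v z (-1)) = surf v \ {z} := by
      ext p
      by_cases hp : p = z
      · subst hp; simp [surf]
      · simp [surf, hp]
    refine key z (-1) ?_ (hs ▸ hv.1.sdiff) ?_
    · ext p
      by_cases hp : p = z
      · subst hp; simp [plus, hz']
      · simp [plus, Function.update_of_ne hp]
    · have h' : ((surf u).ncard : ℝ) + 1 ≤ (surf v).ncard := by exact_mod_cast h
      have h2 : ((surf v \ {z}).ncard : ℝ) + 1 = (surf v).ncard := by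
        exact_mod_cast Set.ncard_sdiff_singleton_add_one hz hv.1
      rw [hs, abs_of_nonneg (by linarith), abs_of_nonneg (by linarith)]
      linarith

theorem IsMinimizer.exists_ctx (hε : 0 < ε) (hζ : 0 < ζ) (hk0 : 0 < k) (hk : k < 1)
    (hsmall : 12 * ε < 1 / (ζ * ε) * ε ^ γ) {u v : Config} (hv : IsMinimizer k γ (ζ * ε) ε v u)
    (hadm : IsAdmissible u) (hu : plus u = oct A D) (hC : (surf u).ncard = C)
    (hsum : (C : ℤ) ≤ ∑ i, tS A D i) :
    ∃ P Z : Finset Site, plus v = P ∧ surf v = Z ∧ Ctx k (ε / ζ) A D C P Z := by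
  obtain ⟨Zu, hZu⟩ := hadm.exists_finset_coe
  have hZuC : Zu.card = C := by rw [← hC, ← hZu, Set.ncard_coe_finset]
  have hut := total_eq (γ := γ) hε hζ hk.le hu hC hu hZu.symm (subset_refl _) hZuC
  have hfin : total k γ (ζ * ε) ε v u ≠ ∞ :=
    ne_top_of_le_ne_top (hut.1 ▸ ENNReal.ofReal_ne_top) (hv.2 u hadm)
  -- Admissibility does not bound the plus phase. Its finiteness comes from comparison with `u`,
  -- whose total energy is finite.
  have hd : diss1 ε (plus v) (plus u) ≠ ∞ := by
    intro htop
    refine hfin ?_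
    have : ENNReal.ofReal (1 / (ζ * ε)) ≠ 0 := by
      rw [Ne, ENNReal.ofReal_eq_zero, not_le]; positivity
    rw [total, htop, top_add, ENNReal.mul_top this, add_top]
  have hPf : (plus v).Finite := finite_of_diss1 hε (hu ▸ Finset.finite_toSet _) hd
  have hcard := hv.ncard_surf hε hζ (by linarith) hsmall hPf hfin
  obtain ⟨P, hP⟩ := hPf.exists_finset_coe
  obtain ⟨Z, hZ⟩ := hv.1.exists_finset_coe
  have hZC : Z.card = C := by rw [← hC, ← hcard, ← hZ, Set.ncard_coe_finset]
  refine ⟨P, Z, hP.symm, hZ.symm, ?_, hZC, hsum, hk0, hk, by positivity, ?_⟩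
  · refine Finset.disjoint_left.2 fun p h1 h2 => ?_
    rw [← Finset.mem_coe, hP] at h1
    rw [← Finset.mem_coe, hZ] at h2
    have h1' : v p = 1 := h1
    have h2' : v p = 0 := h2
    rw [h1'] at h2'
    exact absurd h2' (by decide)
  · intro P' Z' hP' hdis hZ'
    have h1 := le_total (γ := γ) hε hζ hk.le hu hP.symm hZ.symm hZC
    have hadm' : IsAdmissible (ofPhases P' Z') := by
      unfold IsAdmissible; rw [surf_ofPhases hdis]; exact Finset.finite_toSet _
    obtain ⟨h2, h3⟩ := total_eq (γ := γ) hε hζ hk.le hu hC (plus_ofPhases P' Z') (surf_ofPhases hdis)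
      hP' hZ'
    have h4 := h1.trans ((hv.2 _ hadm').trans_eq h2)
    rw [ENNReal.ofReal_le_ofReal_iff h3] at h4
    have h5 := le_of_mul_le_mul_left h4 hε
    linarith

end

/-! ### The datum -/

theorem finite_of_ball {ε R : ℝ} (hε : 0 < ε) {I : Set Site} {z : Plane}
    (h : ∀ p ∈ I, point ε p ∈ Metric.ball z R) : I.Finite := by
  have hb : ∀ p ∈ I, ∀ a : Fin 2, |point ε p a - z a| ≤ R := fun p hp a => by
    have h1 := h p hp
    rw [mem_ball_iff_norm] at h1
    exact (PiLp.norm_apply_le (point ε p - z) a).trans h1.le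
  refine (((Set.finite_Icc ⌊(z 0 - R) / ε⌋ ⌈(z 0 + R) / ε⌉).prod
    (Set.finite_Icc ⌊(z 1 - R) / ε⌋ ⌈(z 1 + R) / ε⌉))).subset fun p hp => ?_
  have key : ∀ (x : ℤ) (y : ℝ), |ε * x - y| ≤ R → x ∈ Set.Icc ⌊(y - R) / ε⌋ ⌈(y + R) / ε⌉ := by
    intro x y hxy
    rw [abs_le] at hxy
    constructor
    · refine Int.floor_le_iff.2 ?_
      rw [div_lt_iff₀ hε]
      nlinarith
    · refine Int.le_ceil_iff.2 ?_
      rw [lt_div_iff₀ hε]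
      nlinarith
  have h0 := hb p hp 0
  have h1 := hb p hp 1
  simp only [point] at h0 h1
  exact ⟨key _ _ (by simpa using h0), key _ _ (by simpa using h1)⟩

/-- The real constraints may be tightened to the integral values attained on `S` without changing
the sites that they select. -/
theorem eq_oct_of_isOctagon {ε : ℝ} (hε : 0 < ε) {S : Finset Site} (h : IsOctagon ε (S : Set Site)) :
    S = oct (sA S) (sD S) := by
  obtain ⟨hne, W, ⟨-, a, d, hW⟩, hS⟩ := h
  have hmem : ∀ p : Site, p ∈ S ↔ ∀ i, ε * ax i p ≤ a i ∧ ε * dg i p ≤ d i := fun p => by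
    rw [← Finset.mem_coe, hS, hW]
    simp only [Set.mem_ofPred_eq, along_point]
  refine (subset_oct_sA S).antisymm fun p hp => (hmem p).2 fun i => ?_
  obtain ⟨h1, h2⟩ := mem_oct.1 hp
  obtain ⟨q, hq, hqe⟩ := exists_sA (Finset.coe_nonempty.1 hne) i
  obtain ⟨r, hr, hre⟩ := exists_sD (Finset.coe_nonempty.1 hne) i
  have h3 := h1 i
  have h4 := h2 i
  rw [← hqe] at h3
  rw [← hre] at h4
  have h3' : (ax i p : ℝ) ≤ ax i q := by exact_mod_cast h3
  have h4' : (dg i p : ℝ) ≤ dg i r := by exact_mod_cast h4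
  exact ⟨(mul_le_mul_of_nonneg_left h3' hε.le).trans ((hmem q).1 hq i).1,
    (mul_le_mul_of_nonneg_left h4' hε.le).trans ((hmem r).1 hr i).2⟩

theorem ncard_slice_le {S : Finset Site} (hS : S.Nonempty) (i : Fin 4) :
    (slice (S : Set Site) i).ncard ≤ (pS (sA S) (sD S) i).toNat := by
  have hsub : (slice (S : Set Site) i) ⊆
      ((Finset.Icc (sA S i - sD S (i + 3)) (sD S i - sA S i)).image (pt i (sA S i)) : Finset Site) := by
    intro p hp
    obtain ⟨hpS, hmax⟩ := mem_slice.1 hp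
    obtain ⟨q, hq, e⟩ := exists_sA hS i
    have h1 := hmax q hq
    have h2 := le_sA (Finset.mem_coe.1 hpS) i
    have h3 : ax i p = sA S i := by omega
    have h4 := le_sD (Finset.mem_coe.1 hpS) i
    have h5 := le_sD (Finset.mem_coe.1 hpS) (i + 3)
    rw [dg] at h4
    rw [dg, ax_add_three, show i + 3 + 1 = i by rw [add_assoc]; simp] at h5
    refine Finset.mem_coe.2 (Finset.mem_image.2 ⟨ax (i + 1) p, Finset.mem_Icc.2 ⟨?_, ?_⟩, ?_⟩)
    · omega
    · omega
    · rw [← h3, pt_ax]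
  refine (Set.ncard_le_ncard hsub (Finset.finite_toSet _)).trans ?_
  rw [Set.ncard_coe_finset]
  refine Finset.card_image_le.trans ?_
  rw [Int.card_Icc, pS]
  omega

/-! ### Support values -/

/-- A cell extends beyond its centre by `ε / 2` in an axis direction, at the midpoint of an edge,
and by `ε` in a diagonal one, at a vertex. With these shifts the side lengths are exactly multiples
of `pS` and `tS`. -/
theorem supp_eq {ε : ℝ} (hε : 0 < ε) {S : Finset Site} (hS : S.Nonempty) (i : Fin 4) :
    supp ε (S : Set Site) (axisDir i) = ε * (sA S i + 1 / 2) ∧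
      supp ε (S : Set Site) (diagDir i) = ε * (sD S i + 1) := by
  have hb : ∀ x ∈ cells ε (S : Set Site), ∃ p ∈ S, |x 0 - ε * p.1| ≤ ε / 2 ∧
      |x 1 - ε * p.2| ≤ ε / 2 := by
    rintro x ⟨p, hp, h⟩
    have h0 := h 0
    have h1 := h 1
    simp only [point] at h0 h1
    exact ⟨p, hp, by simpa using h0, by simpa using h1⟩
  have hc : ∀ p ∈ S, ∀ s t : ℝ, |s| ≤ 1 → |t| ≤ 1 →
      (!₂[ε * (p.1 : ℝ) + ε / 2 * s, ε * (p.2 : ℝ) + ε / 2 * t] : Plane) ∈ cells ε (S : Set Site) := by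
    intro p hp s t hs ht
    refine ⟨p, hp, ?_⟩
    have : ∀ r : ℝ, |r| ≤ 1 → |ε / 2 * r| ≤ ε / 2 := fun r hr => by
      rw [abs_mul, abs_of_pos (by positivity : 0 < ε / 2)]
      exact mul_le_of_le_one_right (by positivity) hr
    intro a
    fin_cases a
    · simpa [point] using this s hs
    · simpa [point] using this t ht
  have habs : ∀ i : Fin 4, |((axisDir i).1 : ℝ)| ≤ 1 ∧ |((axisDir i).2 : ℝ)| ≤ 1 ∧
      |((diagDir i).1 : ℝ)| ≤ 1 ∧ |((diagDir i).2 : ℝ)| ≤ 1 := by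
    rw [forall_fin4]
    simp [diagDir]
  have hsq : ∀ i : Fin 4, ((axisDir i).1 : ℝ) ^ 2 + ((axisDir i).2 : ℝ) ^ 2 = 1 ∧
      ((diagDir i).1 : ℝ) ^ 2 + ((diagDir i).2 : ℝ) ^ 2 = 2 := by
    rw [forall_fin4]
    simp [diagDir]
    norm_num
  have hup : ∀ x : Plane, ∀ p : Site, |x 0 - ε * p.1| ≤ ε / 2 → |x 1 - ε * p.2| ≤ ε / 2 →
      along (axisDir i) x ≤ ε * (ax i p + 1 / 2) ∧ along (diagDir i) x ≤ ε * (dg i p + 1) := by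
    intro x p h0 h1
    rw [abs_le] at h0 h1
    clear habs hsq
    revert i
    rw [forall_fin4]
    simp only [along, diagDir, axisDir_zero, axisDir_one, axisDir_two, axisDir_three, ax_zero, ax_one,
      ax_two, ax_three, dg_zero, dg_one, dg_two, dg_three, zero_add,
      show (1 + 1 : Fin 4) = 2 from rfl, show (2 + 1 : Fin 4) = 3 from rfl,
      show (3 + 1 : Fin 4) = 0 from rfl, Prod.fst_add, Prod.snd_add]
    push_cast
    refine ⟨⟨?_, ?_⟩, ⟨?_, ?_⟩, ⟨?_, ?_⟩, ⟨?_, ?_⟩⟩ <;> linarith [h0.1, h0.2, h1.1, h1.2]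
  have hat : ∀ p : Site, (along (axisDir i) (!₂[ε * (p.1 : ℝ) + ε / 2 * (axisDir i).1,
      ε * (p.2 : ℝ) + ε / 2 * (axisDir i).2] : Plane) = ε * (ax i p + 1 / 2)) ∧
      along (diagDir i) (!₂[ε * (p.1 : ℝ) + ε / 2 * (diagDir i).1,
      ε * (p.2 : ℝ) + ε / 2 * (diagDir i).2] : Plane) = ε * (dg i p + 1) := by
    intro p
    obtain ⟨e1, e2⟩ := hsq i
    obtain ⟨f1, f2⟩ := along_point ε i p
    simp only [along, point] at f1 f2 ⊢
    simp only [Matrix.cons_val_zero, Matrix.cons_val_one] at f1 f2 ⊢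
    constructor
    · linear_combination f1 + ε / 2 * e1
    · linear_combination f2 + ε / 2 * e2
  constructor
  · refine IsGreatest.csSup_eq ⟨?_, ?_⟩
    · obtain ⟨p, hp, e⟩ := exists_sA hS i
      rw [← e]
      exact ⟨_, hc p hp _ _ (habs i).1 (habs i).2.1, (hat p).1⟩
    · rintro _ ⟨x, hx, rfl⟩
      obtain ⟨p, hp, h0, h1⟩ := hb x hx
      refine (hup x p h0 h1).1.trans ?_
      have : (ax i p : ℝ) ≤ sA S i := by exact_mod_cast le_sA hp i
      gcongr
  · refine IsGreatest.csSup_eq ⟨?_, ?_⟩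
    · obtain ⟨p, hp, e⟩ := exists_sD hS i
      rw [← e]
      exact ⟨_, hc p hp _ _ (habs i).2.2.1 (habs i).2.2.2, (hat p).2⟩
    · rintro _ ⟨x, hx, rfl⟩
      obtain ⟨p, hp, h0, h1⟩ := hb x hx
      refine (hup x p h0 h1).2.trans ?_
      have : (dg i p : ℝ) ≤ sD S i := by exact_mod_cast le_sD hp i
      gcongr

theorem lenP_eq {ε : ℝ} (hε : 0 < ε) {S : Finset Site} (hS : S.Nonempty) (i : Fin 4) :
    lenP ε (S : Set Site) i = ε * pS (sA S) (sD S) i := by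
  rw [lenP, (supp_eq hε hS i).1, (supp_eq hε hS i).2, (supp_eq hε hS (i - 1)).2, pS,
    show i - 1 = i + 3 by rw [sub_eq_add_neg]; rfl]
  push_cast
  ring

theorem lenD_eq {ε : ℝ} (hε : 0 < ε) {S : Finset Site} (hS : S.Nonempty) (i : Fin 4) :
    lenD ε (S : Set Site) i = √2 * ε * tS (sA S) (sD S) i := by
  rw [lenD, (supp_eq hε hS i).1, (supp_eq hε hS i).2, (supp_eq hε hS (i + 1)).1, tS]
  push_cast
  ring

theorem dispP_eq {ε : ℝ} (hε : 0 < ε) {S T : Finset Site} (hS : S.Nonempty) (hT : T.Nonempty)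
    (i : Fin 4) : dispP ε (S : Set Site) (T : Set Site) i = ((|sA S i - sA T i| : ℤ) : ℝ) := by
  rw [dispP, (supp_eq hε hS i).1, (supp_eq hε hT i).1, ← mul_sub, abs_mul, abs_of_pos hε,
    mul_div_cancel_left₀ _ hε.ne']
  push_cast
  congr 1
  ring

theorem dispD_eq {ε : ℝ} (hε : 0 < ε) {S T : Finset Site} (hS : S.Nonempty) (hT : T.Nonempty)
    (i : Fin 4) : dispD ε (S : Set Site) (T : Set Site) i = ((|sD S i - sD T i| : ℤ) : ℝ) := by
  rw [dispD, (supp_eq hε hS i).2, (supp_eq hε hT i).2, ← mul_sub, abs_mul, abs_of_pos hε,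
    mul_div_cancel₀ _ (by positivity : (√2 : ℝ) ≠ 0), mul_div_cancel_left₀ _ hε.ne']
  push_cast
  congr 1
  ring

/-! ### Hausdorff distance of the boundaries -/

theorem dist_le_abs_add_abs (x y : Plane) : dist x y ≤ |x 0 - y 0| + |x 1 - y 1| := by
  rw [EuclideanSpace.dist_eq, Fin.sum_univ_two, Real.dist_eq, Real.dist_eq]
  refine Real.sqrt_le_iff.2 ⟨by positivity, ?_⟩
  nlinarith [abs_nonneg (x 0 - y 0), abs_nonneg (x 1 - y 1)]

theorem dist_point_le {ε : ℝ} (hε : 0 ≤ ε) (p q : Site) :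
    dist (point ε p) (point ε q) ≤ ε * ((|p.1 - q.1| + |p.2 - q.2| : ℤ) : ℝ) := by
  refine (dist_le_abs_add_abs _ _).trans (le_of_eq ?_)
  simp only [point, Matrix.cons_val_zero, Matrix.cons_val_one, ← mul_sub, abs_mul, abs_of_nonneg hε]
  push_cast
  ring

theorem mem_cells_point {ε : ℝ} (hε : 0 < ε) {I : Set Site} {p : Site} :
    point ε p ∈ cells ε I ↔ p ∈ I := by
  constructor
  · rintro ⟨q, hq, h⟩
    have key : ∀ x y : ℤ, |ε * (x : ℝ) - ε * y| ≤ ε / 2 → x = y := by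
      intro x y hxy
      rw [← mul_sub, abs_mul, abs_of_pos hε] at hxy
      have h1 : |(x : ℝ) - y| < 1 := by nlinarith
      have h2 : |x - y| < 1 := by exact_mod_cast h1
      have := Int.abs_lt_one_iff.1 h2
      omega
    have h0 := key p.1 q.1 (by simpa [point] using h 0)
    have h1 := key p.2 q.2 (by simpa [point] using h 1)
    rwa [Prod.ext h0 h1]
  · exact fun hp => ⟨p, hp, fun a => by simpa using (half_pos hε).le⟩

theorem exists_cell {ε : ℝ} (hε : 0 < ε) (x : Plane) :
    ∃ p : Site, ∀ a : Fin 2, |x a - point ε p a| ≤ ε / 2 := by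
  have key : ∀ t : ℝ, |t - ε * (round (t / ε) : ℤ)| ≤ ε / 2 := by
    intro t
    have h := abs_sub_round (t / ε)
    have e : t - ε * (round (t / ε) : ℤ) = ε * (t / ε - (round (t / ε) : ℤ)) := by
      field_simp
    rw [e, abs_mul, abs_of_pos hε]
    nlinarith
  refine ⟨(round (x 0 / ε), round (x 1 / ε)), fun a => ?_⟩
  fin_cases a
  · simpa [point] using key (x 0)
  · simpa [point] using key (x 1)

theorem dist_le_of_cell {ε : ℝ} {x : Plane} {p : Site}
    (h : ∀ a : Fin 2, |x a - point ε p a| ≤ ε / 2) : dist x (point ε p) ≤ ε :=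
  (dist_le_abs_add_abs _ _).trans (by linarith [h 0, h 1])

theorem exists_near_of_frontier {ε : ℝ} (hε : 0 < ε) {I : Set Site} {x : Plane}
    (hx : x ∈ frontier (cells ε I)) :
    (∃ p ∈ I, dist x (point ε p) ≤ 2 * ε) ∧ ∃ q ∉ I, dist x (point ε q) ≤ 2 * ε := by
  rw [frontier_eq_closure_inter_closure] at hx
  obtain ⟨y, ⟨p, hp, hyp⟩, hy⟩ := Metric.mem_closure_iff.1 hx.1 ε hε
  obtain ⟨z, hz, hxz⟩ := Metric.mem_closure_iff.1 hx.2 ε hε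
  obtain ⟨q, hzq⟩ := exists_cell hε z
  refine ⟨⟨p, hp, ?_⟩, q, fun hq => hz ⟨q, hq, hzq⟩, ?_⟩
  · linarith [dist_triangle x y (point ε p), dist_le_of_cell hyp]
  · linarith [dist_triangle x z (point ε q), dist_le_of_cell hzq]

/-- The closed ball is connected and contains a point of the union of cells and a point outside it,
so it meets the frontier. -/
theorem exists_frontier_near {ε : ℝ} (hε : 0 < ε) {I : Set Site} {x : Plane} {p q : Site} {r : ℝ}
    (hp : p ∈ I) (hq : q ∉ I) (hxp : dist x (point ε p) ≤ r) (hxq : dist x (point ε q) ≤ r) :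
    ∃ y ∈ frontier (cells ε I), dist x y ≤ r := by
  by_contra hcon
  push Not at hcon
  have hsub : Metric.closedBall x r ⊆ interior (cells ε I) ∪ interior (cells ε I)ᶜ := fun y hy => by
    rw [← compl_frontier_eq_union_interior]
    exact fun hyf => absurd (Metric.mem_closedBall'.1 hy) (hcon y hyf).not_ge
  have h1 := Metric.mem_closedBall'.2 hxp
  have h2 := Metric.mem_closedBall'.2 hxq
  obtain ⟨y, -, h3, h4⟩ := (convex_closedBall x r).isPreconnected _ _ isOpen_interior isOpen_interior
    hsub ⟨_, h1, (hsub h1).resolve_right fun h =>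
      interior_subset h ((mem_cells_point hε).2 hp)⟩
    ⟨_, h2, (hsub h2).resolve_left fun h => hq ((mem_cells_point hε).1 (interior_subset h))⟩
  exact interior_subset h4 (interior_subset h3)

/-- Every site of a large octagon is close to a site of given depth. -/
theorem Tight.exists_deep {n m : ℤ} {A D : Fin 4 → ℤ} (h : Tight n A D) (hm : 1 ≤ m)
    (hn : 8 * m ≤ n) {p : Site} (hp : p ∈ oct A D) :
    ∃ q, m ≤ dep A D q ∧ |p.1 - q.1| + |p.2 - q.2| ≤ 2 * m := by
  have e := h.expand
  rw [mem_oct'] at hp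
  obtain ⟨x, y⟩ := p
  simp only at hp
  -- Each coordinate moves by `m` away from the sides closer than `m`; a nearby diagonal side
  -- triggers both moves. The slices are too long for opposite moves to be required at once.
  obtain ⟨vx, hvx⟩ : ∃ vx : ℤ, (vx = m ∧ (A 1 + x < m ∨ D 0 + y + x < m ∨ D 1 + x - y < m)) ∨
      (vx = -m ∧ (A 3 - x < m ∨ D 2 - y - x < m ∨ D 3 - x + y < m)) ∨
      (vx = 0 ∧ m ≤ A 1 + x ∧ m ≤ D 0 + y + x ∧ m ≤ D 1 + x - y ∧ m ≤ A 3 - x ∧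
        m ≤ D 2 - y - x ∧ m ≤ D 3 - x + y) := by
    by_cases h1 : A 1 + x < m ∨ D 0 + y + x < m ∨ D 1 + x - y < m
    · exact ⟨m, Or.inl ⟨rfl, h1⟩⟩
    · by_cases h2 : A 3 - x < m ∨ D 2 - y - x < m ∨ D 3 - x + y < m
      · exact ⟨-m, Or.inr (Or.inl ⟨rfl, h2⟩)⟩
      · exact ⟨0, Or.inr (Or.inr ⟨rfl, by omega⟩)⟩
  obtain ⟨vy, hvy⟩ : ∃ vy : ℤ, (vy = m ∧ (A 0 + y < m ∨ D 0 + y + x < m ∨ D 3 - x + y < m)) ∨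
      (vy = -m ∧ (A 2 - y < m ∨ D 2 - y - x < m ∨ D 1 + x - y < m)) ∨
      (vy = 0 ∧ m ≤ A 0 + y ∧ m ≤ D 0 + y + x ∧ m ≤ D 3 - x + y ∧ m ≤ A 2 - y ∧
        m ≤ D 2 - y - x ∧ m ≤ D 1 + x - y) := by
    by_cases h1 : A 0 + y < m ∨ D 0 + y + x < m ∨ D 3 - x + y < m
    · exact ⟨m, Or.inl ⟨rfl, h1⟩⟩
    · by_cases h2 : A 2 - y < m ∨ D 2 - y - x < m ∨ D 1 + x - y < m
      · exact ⟨-m, Or.inr (Or.inl ⟨rfl, h2⟩)⟩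
      · exact ⟨0, Or.inr (Or.inr ⟨rfl, by omega⟩)⟩
  refine ⟨(x + vx, y + vy), ?_, ?_⟩
  · rw [le_dep, forall_fin4, forall_fin4]
    simp only [ax_zero, ax_one, ax_two, ax_three, dg_zero, dg_one, dg_two, dg_three]
    rcases hvx with ⟨rfl, hx⟩ | ⟨rfl, hx⟩ | ⟨rfl, hx⟩ <;>
      rcases hvy with ⟨rfl, hy⟩ | ⟨rfl, hy⟩ | ⟨rfl, hy⟩ <;>
      refine ⟨⟨?_, ?_, ?_, ?_⟩, ?_, ?_, ?_, ?_⟩ <;> omega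
  · simp only [sub_add_cancel_left, abs_neg]
    have h1 : |vx| ≤ m := abs_le.2 (by omega)
    have h2 : |vy| ≤ m := abs_le.2 (by omega)
    omega

/-- A frontier point is within `2 ε` of a site inside and of a site outside. One of these may have
to be replaced, at distance at most `2 m ε`, by a deep site of `P` or by a site outside the datum.
-/
theorem hausdorffDist_frontier_cells_le {ε : ℝ} (hε : 0 < ε) {n m : ℤ} {A D : Fin 4 → ℤ}
    (h : Tight n A D) (hm : 1 ≤ m) (hn : 8 * m ≤ n) {P : Finset Site} (hP : P ⊆ oct A D)
    (hdeep : ∀ p, m ≤ dep A D p → p ∈ P) :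
    Metric.hausdorffDist (frontier (cells ε (oct A D : Set Site))) (frontier (cells ε (P : Set Site)))
      ≤ (2 * m + 2) * ε := by
  have hm' : (1 : ℝ) ≤ m := by exact_mod_cast hm
  refine Metric.hausdorffDist_le_of_mem_dist (by positivity) (fun x hx => ?_) fun x hx => ?_
  · obtain ⟨⟨p, hp, hxp⟩, q, hq, hxq⟩ := exists_near_of_frontier hε hx
    obtain ⟨p', hd, hpp'⟩ := h.exists_deep hm hn (Finset.mem_coe.1 hp)
    refine exists_frontier_near hε (Finset.mem_coe.2 (hdeep p' hd))
      (fun h => hq (Finset.mem_coe.2 (hP (Finset.mem_coe.1 h)))) ?_ (hxq.trans (by nlinarith))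
    have h1 := dist_point_le hε.le p p'
    have h2 : ((|p.1 - p'.1| + |p.2 - p'.2| : ℤ) : ℝ) ≤ 2 * m := by exact_mod_cast hpp'
    have h3 := mul_le_mul_of_nonneg_left h2 hε.le
    linarith [dist_triangle x (point ε p) (point ε p')]
  · obtain ⟨⟨p, hp, hxp⟩, q, hq, hxq⟩ := exists_near_of_frontier hε hx
    have hr : ∃ r ∉ oct A D, |q.1 - r.1| + |q.2 - r.2| ≤ m := by
      by_cases hqO : q ∈ oct A D
      · obtain ⟨r, hr, hqr⟩ := exists_notMem_oct hqO
        have : ¬ m ≤ dep A D q := fun h => hq (Finset.mem_coe.2 (hdeep q h))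
        exact ⟨r, hr, by omega⟩
      · exact ⟨q, hqO, by simp; omega⟩
    obtain ⟨r, hr, hqr⟩ := hr
    refine exists_frontier_near hε (Finset.mem_coe.2 (hP (Finset.mem_coe.1 hp)))
      (fun h => hr (Finset.mem_coe.1 h)) (hxp.trans (by nlinarith)) ?_
    have h1 := dist_point_le hε.le q r
    have h2 : ((|q.1 - r.1| + |q.2 - r.2| : ℤ) : ℝ) ≤ m := by exact_mod_cast hqr
    have h3 := mul_le_mul_of_nonneg_left h2 hε.le
    nlinarith [dist_triangle x (point ε q) (point ε r)]

/-- The margin of two beyond the displacements puts the site inside the hull and off its four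
slices, which are the only places affected by trimming. -/
theorem Shape.mem_of_deep {k δ : ℝ} {A D : Fin 4 → ℤ} {C : ℕ} {P Z : Finset Site} {N M0 : ℤ}
    (h : Shape k δ A D C P Z N M0)
    (hlarge : ∑ i, tS (sA P) (sD P) i < C →
      ∃ lo hi, TrimOK (sA P) (sD P) lo hi ∧ P = trim (sA P) (sD P) lo hi)
    {m : ℤ} (hA : ∀ i, A i - sA P i + 2 ≤ m) (hD : ∀ i, D i - sD P i + 2 ≤ m) {p : Site}
    (hp : m ≤ dep A D p) : p ∈ P := by
  have hax : ∀ i, ax i p + 1 ≤ sA P i := fun i => by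
    have := dep_le_ax A D p i
    have := hA i
    omega
  have hmem : p ∈ oct (sA P) (sD P) := mem_oct.2 ⟨fun i => by have := hax i; omega, fun i => by
    have := dep_le_dg A D p i
    have := hD i
    omega⟩
  by_cases hC : (C : ℤ) ≤ ∑ i, tS (sA P) (sD P) i
  · rwa [(h.small hC).1]
  · obtain ⟨lo, hi, -, e⟩ := hlarge (by omega)
    rw [e, mem_trim]
    have hx := forall_fin4.1 hax
    simp only [ax_zero, ax_one, ax_two, ax_three] at hx
    refine ⟨hmem, ?_, ?_⟩
    · simp only [TrimH]; omega
    · simp only [TrimV]; omega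

/-! ### From lattice units back to lengths and displacements -/

/-- The situation of the theorem, in lattice units. -/
structure Setup (k ζ cbar ε : ℝ) (u v : Config) (O P Z : Finset Site) (n N M0 : ℤ) : Prop where
  hε : 0 < ε
  hu : plus u = O
  hv : plus v = P
  hZ : surf v = Z
  ne : O.Nonempty
  eq : O = oct (sA O) (sD O)
  tight : Tight n (sA O) (sD O)
  hn : cbar ≤ ε * n
  shape : Shape k (ε / ζ) (sA O) (sD O) (surf u).ncard P Z N M0
  large : ∑ i, tS (sA P) (sD P) i < (surf u).ncard → (∀ i, 2 ≤ tS (sA P) (sD P) i) ∧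
    ∃ lo hi, TrimOK (sA P) (sD P) lo hi ∧ P = trim (sA P) (sD P) lo hi

/-- The inequality reads `12 ζ ε ^ (2 - γ) < 1`, and the exponent is positive. -/
theorem exists_small_rpow {ζ γ : ℝ} (hζ : 0 < ζ) (hγ : γ < 2) :
    ∃ ε0 : ℝ, 0 < ε0 ∧ ∀ ε, 0 < ε → ε ≤ ε0 → 12 * ε < 1 / (ζ * ε) * ε ^ γ := by
  have hg : 0 < 2 - γ := by linarith
  refine ⟨(1 / (24 * ζ)) ^ (2 - γ)⁻¹, by positivity, fun ε hε h => ?_⟩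
  have h1 := Real.rpow_le_rpow hε.le h hg.le
  rw [← Real.rpow_mul (by positivity), inv_mul_cancel₀ hg.ne', Real.rpow_one,
    le_div_iff₀ (by positivity)] at h1
  have h2 : ε ^ (2 - γ) * ε ^ γ = ε ^ 2 := by
    rw [← Real.rpow_add hε, sub_add_cancel, Real.rpow_two]
  have h3 : 0 < ε ^ γ := Real.rpow_pos_of_pos hε γ
  rw [one_div_mul_eq_div, lt_div_iff₀ (by positivity)]
  nlinarith [mul_le_mul_of_nonneg_right h1 h3.le]

theorem exists_setup {k γ ζ cbar : ℝ} (hk0 : 0 < k) (hk : k < 1) (hγ : γ < 2) (hζ : 0 < ζ)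
    (hc : 0 < cbar) {M0 : ℤ} (hM0 : 1 ≤ M0) (hM : 64 ≤ cbar / ζ * M0) :
    ∃ ε0 : ℝ, 0 < ε0 ∧ ∀ (μ R ε : ℝ), 0 < ε → ε ≤ ε0 → ∀ u v : Config, IsDatum ζ cbar R μ ε u →
      IsMinimizer k γ (ζ * ε) ε v u → ∃ O P Z n N, Setup k ζ cbar ε u v O P Z n N M0 := by
  obtain ⟨ε1, hε1, h1⟩ := exists_small_rpow hζ hγ
  obtain ⟨δ0, hδ0, h2⟩ := exists_shape hk (by positivity : 0 < cbar / ζ) hM0 hM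
  refine ⟨min ε1 (δ0 * ζ), by positivity, fun μ R ε hε hle u v hu hv => ?_⟩
  obtain ⟨hadm, ⟨-, ⟨z, hball⟩, hsl⟩, hoct, -, hsum, -⟩ := hu
  obtain ⟨O, hO⟩ := (finite_of_ball hε hball).exists_finset_coe
  rw [← hO] at hsl hoct hsum
  have hne : O.Nonempty := Finset.coe_nonempty.1 hoct.1
  have heq := eq_oct_of_isOctagon hε hoct
  -- With this slice length `(ε / ζ) * n ≥ cbar / ζ`, a lower bound independent of `ε`; it plays the
  -- role of `lam`.
  have hT : Tight ⌈cbar / ε⌉ (sA O) (sD O) := by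
    refine ⟨tS_support_nonneg hne, fun i => Int.ceil_le.2 ?_⟩
    have h3 := hsl i
    have h4 := ncard_slice_le hne i
    have h5 : 0 < cbar / ε := by positivity
    have h6 : (0 : ℝ) < (slice (O : Set Site) i).ncard := h5.trans_le h3
    have h7 : 0 < (slice (O : Set Site) i).ncard := by exact_mod_cast h6
    have h8 : ((slice (O : Set Site) i).ncard : ℤ) ≤ pS (sA O) (sD O) i := by omega
    have h9 : ((slice (O : Set Site) i).ncard : ℝ) ≤ pS (sA O) (sD O) i := by exact_mod_cast h8
    linarith
  have hn : cbar ≤ ε * ⌈cbar / ε⌉ := by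
    have := Int.le_ceil (cbar / ε)
    rw [div_le_iff₀ hε] at this
    linarith
  have hC : ((surf u).ncard : ℤ) ≤ ∑ i, tS (sA O) (sD O) i := by
    have h3 : ∀ i, lenD ε (O : Set Site) i / (√2 * ε) = tS (sA O) (sD O) i := fun i => by
      rw [lenD_eq hε hne, mul_div_cancel_left₀ _ (by positivity)]
    simp only [h3] at hsum
    exact_mod_cast hsum
  obtain ⟨P, Z, hP, hZ, hctx⟩ := hv.exists_ctx hε hζ hk0 hk (h1 ε hε (hle.trans (min_le_left _ _))) hadm
    (by rw [← hO]; exact congrArg _ heq) rfl hC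
  obtain ⟨N, hS, hlarge⟩ := h2 (ε / ζ) _ _ _ P Z _
    ((div_le_iff₀ hζ).2 (hle.trans (min_le_right _ _))) hctx hT (by
      rw [div_mul_eq_mul_div]
      gcongr)
  exact ⟨O, P, Z, _, N, hε, hO.symm, hP, hZ, hne, heq, hT, hn, hS, hlarge⟩

theorem two_mul_sum_sub_le {a b : Fin 4 → ℤ} {c : ℤ} (h : ∀ i, a i - b i ≤ c - 1) :
    2 * ∑ i, (a i - b i) ≤ 8 * c - 8 := by
  rw [Fin.sum_univ_four]
  linarith [h 0, h 1, h 2, h 3]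

namespace Setup

variable {k ζ cbar ε : ℝ} {u v : Config} {O P Z : Finset Site} {n N M0 : ℤ}

theorem lenP_eq (h : Setup k ζ cbar ε u v O P Z n N M0) (i : Fin 4) :
    lenP ε (plus u) i = ε * pS (sA O) (sD O) i := by
  rw [h.hu, BEG.lenP_eq h.hε h.ne]

theorem lenD_eq (h : Setup k ζ cbar ε u v O P Z n N M0) (i : Fin 4) :
    lenD ε (plus u) i = √2 * ε * tS (sA O) (sD O) i := by
  rw [h.hu, BEG.lenD_eq h.hε h.ne]

theorem dispP_eq (h : Setup k ζ cbar ε u v O P Z n N M0) (i : Fin 4) :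
    dispP ε (plus u) (plus v) i = ((sA O i - sA P i : ℤ) : ℝ) := by
  rw [h.hu, h.hv, BEG.dispP_eq h.hε h.ne h.shape.comp.ne,
    abs_of_nonneg (sub_nonneg.2 (h.shape.sA_le i))]

theorem dispD_eq (h : Setup k ζ cbar ε u v O P Z n N M0) (i : Fin 4) :
    dispD ε (plus u) (plus v) i = ((sD O i - sD P i : ℤ) : ℝ) := by
  rw [h.hu, h.hv, BEG.dispD_eq h.hε h.ne h.shape.comp.ne,
    abs_of_nonneg (sub_nonneg.2 (h.shape.sD_le i))]

theorem le_lenP (h : Setup k ζ cbar ε u v O P Z n N M0) (i : Fin 4) :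
    cbar ≤ lenP ε (plus u) i := by
  rw [h.lenP_eq]
  have : (n : ℝ) ≤ pS (sA O) (sD O) i := by exact_mod_cast h.tight.2 i
  exact h.hn.trans (mul_le_mul_of_nonneg_left this h.hε.le)

theorem le_iInf_lenP (h : Setup k ζ cbar ε u v O P Z n N M0) : cbar ≤ ⨅ i, lenP ε (plus u) i :=
  le_ciInf h.le_lenP

theorem cAlpha_le (h : Setup k ζ cbar ε u v O P Z n N M0) (hζ : 0 < ζ) (hc : 0 < cbar) :
    cAlpha ζ ε (plus u) ≤ ⌊4 * ζ / cbar⌋₊ + 2 := by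
  unfold cAlpha
  have := h.le_iInf_lenP
  gcongr

/-- Upper bound of the displacements of the sides parallel to the axes. -/
theorem alpha_mul_le (h : Setup k ζ cbar ε u v O P Z n N M0) (hζ : 0 < ζ) (i : Fin 4) :
    ((sA O i - sA P i : ℤ) : ℝ) * lenP ε (plus u) i ≤
      4 * ζ + ε * (16 * M0 * (8 * M0 + 1) + 8 * M0 * (32 * M0) : ℤ) := by
  have h1 := h.shape.alpha_upper i
  rw [div_mul_eq_mul_div, div_mul_eq_mul_div, div_le_iff₀ hζ, add_mul, div_mul_cancel₀ _ hζ.ne'] at h1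
  rw [h.lenP_eq]
  calc _ = ε * ((sA O i - sA P i) * pS (sA O) (sD O) i : ℤ) := by push_cast; ring
    _ ≤ _ := h1

/-- The error is at most `cbar`, hence at most the shortest side, so it adds at most one to `4 ζ /
min P`. Integrality gives the bound `⌊4 ζ / min P⌋ + 1`. -/
theorem alpha_le_cAlpha (h : Setup k ζ cbar ε u v O P Z n N M0) (hζ : 0 < ζ) (hc : 0 < cbar)
    (hK : ε * (16 * M0 * (8 * M0 + 1) + 8 * M0 * (32 * M0) : ℤ) ≤ cbar) (i : Fin 4) :
    sA O i - sA P i ≤ cAlpha ζ ε (plus u) - 1 := by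
  have h1 := h.alpha_mul_le hζ i
  have h2 := h.le_iInf_lenP
  have h3 : ⨅ i, lenP ε (plus u) i ≤ lenP ε (plus u) i := ciInf_le (Set.finite_range _).bddBelow i
  set m := ⨅ i, lenP ε (plus u) i with hm
  have hm0 : 0 < m := hc.trans_le h2
  have h4 : (0 : ℝ) ≤ ((sA O i - sA P i : ℤ) : ℝ) := by
    exact_mod_cast sub_nonneg.2 (h.shape.sA_le i)
  have h5 : ((sA O i - sA P i : ℤ) : ℝ) ≤ 4 * ζ / m + 1 := by
    rw [div_add_one hm0.ne', le_div_iff₀ hm0]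
    nlinarith [mul_le_mul_of_nonneg_left h3 h4]
  have h6 := Nat.lt_floor_add_one (4 * ζ / m)
  have h7 : ((sA O i - sA P i : ℤ) : ℝ) < ((⌊4 * ζ / m⌋₊ + 2 : ℕ) : ℤ) := by
    push_cast at h5 ⊢; linarith
  have h8 := Int.cast_lt.1 h7
  rw [cAlpha, ← hm]
  omega

/-- A short diagonal side excludes quasi-octagons. -/
theorem isOctagon_of_short (h : Setup k ζ cbar ε u v O P Z n N M0) (hζ : 0 < ζ) (hk : 0 < k) {c : ℤ}
    (hc : 1 ≤ c) (hα : ∀ i, sA O i - sA P i ≤ c - 1) {i : Fin 4}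
    (hK : ε * (2 * ((8 * c + 1) * (8 * c + 1) + 16 * M0 * (8 * M0 + 1)) : ℤ) ≤ ζ)
    (hi : lenD ε (plus u) i ≤ 1 / 2 * (√2 * ζ * (1 + k) / (8 * (c : ℝ) + 1))) :
    ((surf u).ncard : ℤ) ≤ ∑ i, tS (sA P) (sD P) i := by
  by_contra hcon
  push Not at hcon
  have hc' : (1 : ℝ) ≤ c := by exact_mod_cast hc
  have h1 := h.shape.cut_cost' hcon i (B := 8 * c) (by linarith [two_mul_sum_sub_le hα])
  rw [h.lenD_eq] at hi
  have hs : (0 : ℝ) < √2 := by positivity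
  have h2 : ε * tS (sA O) (sD O) i * (8 * (c : ℝ) + 1) ≤ 1 / 2 * (ζ * (1 + k)) := by
    have h3 : √2 * (ε * tS (sA O) (sD O) i) ≤ √2 * (1 / 2 * (ζ * (1 + k) / (8 * (c : ℝ) + 1))) := by
      calc _ = √2 * ε * tS (sA O) (sD O) i := by ring
        _ ≤ _ := hi
        _ = _ := by ring
    have h4 := le_of_mul_le_mul_left h3 hs
    rw [← mul_div_assoc, le_div_iff₀ (by linarith)] at h4
    exact h4
  -- Cutting the short side would have to cost at least `ζ (1 + k)` after multiplication by `ζ`. Its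
  -- length accounts for at most half of this by `h2`, and the bounded terms for at most `ζ / 2` by
  -- `hK`, which is less than the other half.
  rw [div_mul_eq_mul_div, le_div_iff₀ hζ] at h1
  push_cast at h1 hK
  nlinarith

theorem isOctagon (h : Setup k ζ cbar ε u v O P Z n N M0)
    (hC : ((surf u).ncard : ℤ) ≤ ∑ i, tS (sA P) (sD P) i) :
    IsOctagon ε (plus v) ∧ surf v ⊆ corners (plus v) := by
  rw [h.hv, h.hZ]
  exact h.shape.isOctagon h.hε hC

/-- Lower bound of the displacements of the sides parallel to the axes. -/
theorem le_alpha_mul (h : Setup k ζ cbar ε u v O P Z n N M0) (hζ : 0 < ζ)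
    (hC : ((surf u).ncard : ℤ) ≤ ∑ i, tS (sA P) (sD P) i) {l : ℝ} (hl : ε ≤ l) {j : Fin 4}
    (hj : lenD ε (plus u) j ≤ l) (i : Fin 4) :
    4 * ζ ≤ lenP ε (plus u) i * (((sA O i - sA P i : ℤ) : ℝ) + 1) +
      l * (16 * M0 * (8 * M0 + 1) + (32 * M0 + 5) * (16 * M0 + 2) : ℤ) := by
  have hε := h.hε
  have hM0 : (1 : ℝ) ≤ M0 := by exact_mod_cast h.shape.hM0
  have hl0 : 0 ≤ l := hε.le.trans hl
  have h1 := h.shape.alpha_lower hC i j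
  rw [div_mul_eq_mul_div, le_div_iff₀ hζ] at h1
  rw [h.lenD_eq] at hj
  have hT : (0 : ℝ) ≤ tS (sA O) (sD O) j := by exact_mod_cast h.shape.tAD j
  have h2 : ε * tS (sA O) (sD O) j ≤ l := by
    refine le_trans ?_ hj
    have : (1 : ℝ) ≤ √2 := Real.one_le_sqrt.2 (by norm_num)
    have h3 : 0 ≤ ε * tS (sA O) (sD O) j := by positivity
    nlinarith
  have h4 : ((sA O i - sA P i : ℤ) : ℝ) ≤ 8 * M0 := by exact_mod_cast h.shape.alpha_le i
  rw [h.lenP_eq]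
  push_cast at h1 h4 ⊢
  have h5 : ε * (16 * M0 * ((sA O i : ℝ) - sA P i + 1)) ≤ l * (16 * M0 * (8 * M0 + 1)) := by
    have h0 : (0 : ℝ) ≤ sA O i - sA P i := by
      have := h.shape.sA_le i
      rw [sub_nonneg]; exact_mod_cast this
    gcongr
  have h6 : ε * ((2 * tS (sA O) (sD O) j + 32 * M0 + 3) * (16 * M0 + 2)) ≤
      l * ((32 * M0 + 5) * (16 * M0 + 2)) := by
    rw [← mul_assoc, ← mul_assoc]
    refine mul_le_mul_of_nonneg_right ?_ (by linarith)
    nlinarith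
  nlinarith

theorem beta_eq_zero (h : Setup k ζ cbar ε u v O P Z n N M0)
    (hC : ((surf u).ncard : ℤ) ≤ ∑ i, tS (sA P) (sD P) i) {c : ℤ} (hc : 2 ≤ c)
    (hα : ∀ i, sA O i - sA P i ≤ c - 1) {l : ℝ} (hl : √2 * (8 * (c : ℝ) + 2) * ε ≤ l) {i j : Fin 4}
    (hj : lenD ε (plus u) j ≤ l) (hi : 16 * (c : ℝ) * l ≤ lenD ε (plus u) i) : sD P i = sD O i := by
  have hε := h.hε
  have hc' : (2 : ℝ) ≤ c := by exact_mod_cast hc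
  have hl0 : 0 < l := lt_of_lt_of_le (by positivity) hl
  have hij : i ≠ j := by
    rintro rfl
    nlinarith
  rw [h.lenD_eq] at hi hj
  have hs : 0 < √2 * ε := by positivity
  -- In units of `√2 ε` the lengths are the integers `tS`, and the threshold `16 c τ` dominates the
  -- loss `(8 c - 7) (τ + 8 c - 7) + 2 c` because `τ ≥ 8 c + 2`.
  obtain ⟨τ, rfl⟩ : ∃ τ, l = √2 * ε * τ := ⟨l / (√2 * ε), by field_simp⟩
  have h1 : 8 * (c : ℝ) + 2 ≤ τ := le_of_mul_le_mul_left (by linarith) hs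
  have h2 : (tS (sA O) (sD O) j : ℝ) ≤ τ := le_of_mul_le_mul_left hj hs
  have h3 : 16 * c * τ ≤ (tS (sA O) (sD O) i : ℝ) := le_of_mul_le_mul_left (by linarith) hs
  refine h.shape.beta_eq_zero hC hij (by omega) hα ?_
  have h4 : ((8 * c - 7) * (tS (sA O) (sD O) j + 8 * c - 7) + 2 * c : ℝ) <
      tS (sA O) (sD O) i + 3 := by
    nlinarith [mul_le_mul_of_nonneg_left h2 (by linarith : (0 : ℝ) ≤ 8 * c - 7),
      mul_le_mul_of_nonneg_left h1 (by linarith : (0 : ℝ) ≤ 8 * c - 7)]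
  exact_mod_cast h4

end Setup

/-- An integer in an interval of length close to one. -/
theorem eq_floor_or_round {x a b : ℝ} {m : ℤ} (hx : 0 ≤ x) (hm : 0 ≤ m) (hab : a < b)
    (hb : 2 * b < 1) (h1 : (m : ℝ) ≤ x + a) (h2 : x ≤ m + 1 + a) :
    (b ≤ Metric.infDist x posNat → (m : ℝ) = ⌊x⌋) ∧
    (Metric.infDist x posNat < b → (m : ℝ) = round x ∨ (m : ℝ) = round x - 1) := by
  constructor
  · intro h
    have key : ∀ j : ℤ, 1 ≤ j → b ≤ |x - j| := fun j hj => by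
      refine h.trans (Metric.infDist_le_dist_of_mem (s := posNat) ⟨j.toNat, by omega, ?_⟩)
      have : ((j.toNat : ℤ) : ℝ) = j := by rw [Int.toNat_of_nonneg (by omega)]
      rw [← this]; rfl
    have hf : 0 ≤ ⌊x⌋ := Int.floor_nonneg.2 hx
    rw [Int.cast_inj]
    refine le_antisymm ?_ ?_
    -- Were `m` above `⌊x⌋`, it would be a positive integer at distance at most `a < b` from `x`. In
    -- the other case the same applies to `m + 1`.
    · by_contra hcon
      push Not at hcon
      have h3 := key m (by omega)
      have h4 := Int.floor_lt.1 hcon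
      rw [abs_of_neg (by linarith)] at h3
      linarith
    · by_contra hcon
      push Not at hcon
      have h3 := key (m + 1) (by omega)
      have h4 := Int.le_floor.1 (Int.add_one_le_of_lt hcon)
      push_cast at h3 h4
      rw [abs_of_nonneg (by linarith)] at h3
      linarith
  · intro h
    obtain ⟨_, ⟨j, hj, rfl⟩, hd⟩ := (Metric.infDist_lt_iff (s := posNat) ⟨_, 1, le_rfl, rfl⟩).1 h
    rw [Real.dist_eq, abs_lt] at hd
    have hr : round x = (j : ℤ) := by
      rw [round_eq, Int.floor_eq_iff]
      push_cast
      constructor <;> linarith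
    rw [hr]
    have h3 : (m : ℝ) < ((j + 1 : ℤ) : ℝ) := by push_cast; linarith
    have h4 : ((j - 2 : ℤ) : ℝ) < m := by push_cast; linarith
    have h5 := Int.cast_lt.1 h3
    have h6 := Int.cast_lt.1 h4
    rcases (by omega : m = j ∨ m = j - 1) with e | e
    · left; rw [e]
    · right; rw [e]; push_cast; rfl

/-- For small `ε` the parameters are small compared with all the constants. -/
theorem exists_setup_small {k γ ζ cbar : ℝ} (hk0 : 0 < k) (hk : k < 1) (hγ : γ < 2) (hζ : 0 < ζ)
    (hc : 0 < cbar) {M0 : ℤ} (hM0 : 1 ≤ M0) (hM : 64 ≤ cbar / ζ * M0) :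
    ∃ ε0 : ℝ, 0 < ε0 ∧ ∀ (μ R ε : ℝ), 0 < ε → ε ≤ ε0 → ∀ u v : Config, IsDatum ζ cbar R μ ε u →
      IsMinimizer k γ (ζ * ε) ε v u → ∃ O P Z n N, Setup k ζ cbar ε u v O P Z n N M0 ∧
        (∀ i, sA O i - sA P i ≤ cAlpha ζ ε (plus u) - 1) ∧
        ε * (2 * ((8 * (cAlpha ζ ε (plus u) : ℤ) + 1) * (8 * (cAlpha ζ ε (plus u) : ℤ) + 1) +
          16 * M0 * (8 * M0 + 1)) : ℤ) ≤ ζ ∧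
        8 * (8 * (cAlpha ζ ε (plus u) : ℤ) + 2) ≤ n := by
  obtain ⟨ε1, hε1, h1⟩ := exists_setup hk0 hk hγ hζ hc hM0 hM
  -- An upper bound for `cAlpha` over all data, so that the smallness of `ε` does not depend on the
  -- datum.
  set cm : ℕ := ⌊4 * ζ / cbar⌋₊ + 2 with hcm
  have hM0' : (1 : ℝ) ≤ M0 := by exact_mod_cast hM0
  set K1 : ℝ := 16 * M0 * (8 * M0 + 1) + 8 * M0 * (32 * M0) with hK1
  set K2 : ℝ := 2 * ((8 * cm + 1) * (8 * cm + 1) + 16 * M0 * (8 * M0 + 1)) with hK2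
  set K3 : ℝ := 8 * (8 * cm + 2) with hK3
  have p1 : 0 < K1 := by positivity
  have p2 : 0 < K2 := by positivity
  have p3 : 0 < K3 := by positivity
  refine ⟨min ε1 (min (cbar / K1) (min (ζ / K2) (cbar / K3))), by positivity, ?_⟩
  intro μ R ε hε hle u v hu hv
  rw [le_min_iff, le_min_iff, le_min_iff, le_div_iff₀ p1, le_div_iff₀ p2, le_div_iff₀ p3] at hle
  obtain ⟨l1, l2, l3, l4⟩ := hle
  obtain ⟨O, P, Z, n, N, h⟩ := h1 μ R ε hε l1 u v hu hv
  have hcα := h.cAlpha_le hζ hc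
  rw [← hcm] at hcα
  have hcα' : (cAlpha ζ ε (plus u) : ℝ) ≤ cm := by exact_mod_cast hcα
  refine ⟨O, P, Z, n, N, h, h.alpha_le_cAlpha hζ hc ?_, ?_, ?_⟩
  · push_cast; rw [hK1] at l2; exact l2
  · push_cast
    refine le_trans (mul_le_mul_of_nonneg_left ?_ hε.le) l3
    rw [hK2]
    gcongr
  · have h2 : K3 ≤ n := le_of_mul_le_mul_left (l4.trans h.hn) hε
    have h3 : ((8 * (8 * (cm : ℤ) + 2) : ℤ) : ℝ) ≤ n := by push_cast; exact h2
    have h4 := Int.cast_le.1 h3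
    omega

end BEG

/-! ### The theorem -/

theorem proposition3p12 :
    ∃ cH : ℕ → ℝ, ∀ ζ cbar : ℝ, 0 < ζ → 0 < cbar →
    ∃ c : ℝ, 0 < c ∧ ∀ k γ μ R : ℝ, 1 / 3 < k → k < 1 → 0 < γ → γ < 2 → μ < 1 / 4 →
    (∃ εbar : ℝ, 0 < εbar ∧ ∀ ε : ℝ, 0 < ε → ε ≤ εbar → ∀ u v : BEG.Config,
      BEG.IsDatum ζ cbar R μ ε u → BEG.IsMinimizer k γ (ζ * ε) ε v u →
        BEG.plus v ⊆ BEG.plus u ∧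
        BEG.IsQuasiOctagon ε (BEG.plus v) ∧
        (∀ i, BEG.dispD ε (BEG.plus u) (BEG.plus v) i
            ≤ 2 * ∑ j, BEG.dispP ε (BEG.plus u) (BEG.plus v) j) ∧
        2 * ∑ j, BEG.dispP ε (BEG.plus u) (BEG.plus v) j
            ≤ 8 * (BEG.cAlpha ζ ε (BEG.plus u) : ℝ) ∧
        Metric.hausdorffDist (frontier (BEG.cells ε (BEG.plus u)))
            (frontier (BEG.cells ε (BEG.plus v))) ≤ cH (BEG.cAlpha ζ ε (BEG.plus u)) * ε ∧
        ((∃ i, BEG.lenD ε (BEG.plus u) i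
            ≤ 1 / 2 * (√2 * ζ * (1 + k) / (8 * (BEG.cAlpha ζ ε (BEG.plus u) : ℝ) + 1))) →
          BEG.IsOctagon ε (BEG.plus v) ∧ BEG.surf v ⊆ BEG.corners (BEG.plus v))) ∧
    (∀ l : ℝ → ℝ, Tendsto l (𝓝[>] 0) (𝓝 0) →
      ∃ εbar : ℝ, 0 < εbar ∧ ∀ ε : ℝ, 0 < ε → ε ≤ εbar → ∀ u v : BEG.Config,
      BEG.IsDatum ζ cbar R μ ε u → BEG.IsMinimizer k γ (ζ * ε) ε v u →
      √2 * (8 * (BEG.cAlpha ζ ε (BEG.plus u) : ℝ) + 2) * ε ≤ l ε →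
      (∃ i, BEG.lenD ε (BEG.plus u) i ≤ l ε) →
        BEG.IsOctagon ε (BEG.plus v) ∧ BEG.surf v ⊆ BEG.corners (BEG.plus v) ∧
        (∀ i, 16 * (BEG.cAlpha ζ ε (BEG.plus u) : ℝ) * l ε ≤ BEG.lenD ε (BEG.plus u) i →
          BEG.dispD ε (BEG.plus u) (BEG.plus v) i = 0) ∧
        (∀ i,
          (c * l ε ≤ Metric.infDist (4 * ζ / BEG.lenP ε (BEG.plus u) i) BEG.posNat →
            BEG.dispP ε (BEG.plus u) (BEG.plus v) i
              = (⌊4 * ζ / BEG.lenP ε (BEG.plus u) i⌋ : ℝ)) ∧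
          (Metric.infDist (4 * ζ / BEG.lenP ε (BEG.plus u) i) BEG.posNat < c * l ε →
            BEG.dispP ε (BEG.plus u) (BEG.plus v) i
                = (round (4 * ζ / BEG.lenP ε (BEG.plus u) i) : ℝ) ∨
            BEG.dispP ε (BEG.plus u) (BEG.plus v) i
                = (round (4 * ζ / BEG.lenP ε (BEG.plus u) i) : ℝ) - 1))) := by
  -- The Hausdorff estimate `(2 m + 2) ε` with depth `m = 8 c + 2`, which exceeds all displacements
  -- by at least two.
  refine ⟨fun c => 16 * c + 6, fun ζ cbar hζ hc => ?_⟩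
  obtain ⟨M0, hM0e⟩ : ∃ M0 : ℤ, M0 = ⌈64 * ζ / cbar⌉ := ⟨_, rfl⟩
  have hM0 : 1 ≤ M0 := hM0e ▸ Int.one_le_ceil_iff.2 (by positivity)
  have hM : 64 ≤ cbar / ζ * M0 := by
    have := Int.le_ceil (64 * ζ / cbar)
    rw [← hM0e, div_le_iff₀ hc] at this
    rw [div_mul_eq_mul_div, le_div_iff₀ hζ]
    linarith
  have hM0' : (1 : ℝ) ≤ M0 := by exact_mod_cast hM0
  set K : ℝ := 16 * M0 * (8 * M0 + 1) + 8 * M0 * (32 * M0) +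
    (16 * M0 * (8 * M0 + 1) + (32 * M0 + 5) * (16 * M0 + 2)) with hK
  have hK0 : 0 < K := by positivity
  -- Dividing the errors in the two estimates of `α P` by `P ≥ cbar` leaves at most `K / cbar * l
  -- ε`. The additional one makes the tolerance strictly larger than the error, as
  -- `eq_floor_or_round` requires.
  refine ⟨K / cbar + 1, by positivity, fun k γ μ R hk hk1 _ hγ _ => ?_⟩
  have hk0 : 0 < k := by linarith
  obtain ⟨ε0, hε0, H⟩ := BEG.exists_setup_small hk0 hk1 hγ hζ hc hM0 hM
  constructor
  · refine ⟨ε0, hε0, fun ε hε hle u v hu hv => ?_⟩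
    obtain ⟨O, P, Z, n, N, h, hα, hsm, hn⟩ := H μ R ε hε hle u v hu hv
    have hsum := BEG.two_mul_sum_sub_le hα
    have hO : BEG.plus u = ((BEG.oct (BEG.sA O) (BEG.sD O) : Finset BEG.Site) : Set BEG.Site) :=
      h.hu.trans (congrArg _ h.eq)
    refine ⟨?_, ?_, fun i => ?_, ?_, ?_, ?_⟩
    · rw [h.hv, hO]
      exact Finset.coe_subset.2 h.shape.sub
    · rw [h.hv]
      exact h.shape.isQuasiOctagon hε h.large
    · simp only [h.dispD_eq, h.dispP_eq]
      exact_mod_cast h.shape.beta_le i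
    · simp only [h.dispP_eq]
      have : 2 * ∑ i, (BEG.sA O i - BEG.sA P i) ≤ 8 * (BEG.cAlpha ζ ε (BEG.plus u) : ℤ) := by omega
      exact_mod_cast this
    · have h2 := BEG.hausdorffDist_frontier_cells_le hε h.tight
        (m := 8 * (BEG.cAlpha ζ ε (BEG.plus u) : ℤ) + 2) (by omega) hn h.shape.sub
        fun p hp => h.shape.mem_of_deep (fun hC => (h.large hC).2)
          (fun i => by have := hα i; omega)
          (fun i => by have := h.shape.beta_le i; omega) hp
      rw [← hO, ← h.hv] at h2
      refine h2.trans (le_of_eq ?_)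
      push_cast
      ring
    · rintro ⟨i, hi⟩
      exact h.isOctagon (h.isOctagon_of_short hζ hk0 (by unfold BEG.cAlpha; omega) hα hsm hi)
  · intro l hl
    set cm : ℕ := ⌊4 * ζ / cbar⌋₊ + 2 with hcm
    -- Below the first value a side of length at most `l ε` excludes surplus surfactant, for any
    -- datum; below the second the tolerance is under one quarter, so the nearest integer is
    -- unambiguous.
    have hη : (0 : ℝ) < min (1 / 2 * (√2 * ζ / (8 * cm + 1))) (1 / (4 * (K / cbar + 1))) := by
      positivity
    obtain ⟨ε1, hε1, H1⟩ := mem_nhdsGT_iff_exists_Ioc_subset.1 (hl.eventually (gt_mem_nhds hη))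
    refine ⟨min ε0 ε1, lt_min hε0 hε1, fun ε hε hle u v hu hv hlε => ?_⟩
    rintro ⟨j, hj⟩
    obtain ⟨O, P, Z, n, N, h, hα, hsm, hn⟩ := H μ R ε hε (hle.trans (min_le_left _ _)) u v hu hv
    have hsmall := H1 ⟨hε, hle.trans (min_le_right _ _)⟩
    rw [Set.mem_ofPred_eq, lt_min_iff] at hsmall
    obtain ⟨s1, s2⟩ := hsmall
    have hcα := h.cAlpha_le hζ hc
    rw [← hcm] at hcα
    have hc2 : 2 ≤ BEG.cAlpha ζ ε (BEG.plus u) := by unfold BEG.cAlpha; omega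
    set cα := BEG.cAlpha ζ ε (BEG.plus u) with hcαe
    have hcα' : (cα : ℝ) ≤ cm := by exact_mod_cast hcα
    have hs2 : (1 : ℝ) ≤ √2 := Real.one_le_sqrt.2 (by norm_num)
    have hεl : ε ≤ l ε := by
      refine le_trans ?_ hlε
      have h2 : (1 : ℝ) ≤ √2 * (8 * (cα : ℝ) + 2) := by
        have : (0 : ℝ) ≤ cα := by positivity
        nlinarith
      nlinarith
    have hl0 : 0 < l ε := hε.trans_le hεl
    have hC := h.isOctagon_of_short hζ hk0 (c := cα) (by omega) hα hsm (i := j) (by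
      refine hj.trans (s1.le.trans ?_)
      push_cast
      exact mul_le_mul_of_nonneg_left (div_le_div₀ (by positivity)
        (le_mul_of_one_le_right (by positivity) (by linarith)) (by positivity) (by linarith))
        (by norm_num))
    refine ⟨(h.isOctagon hC).1, (h.isOctagon hC).2, fun i hi => ?_, fun i => ?_⟩
    · rw [h.dispD_eq, h.beta_eq_zero hC (c := cα) (by omega) hα (by push_cast; exact hlε) hj
        (by push_cast; exact hi), sub_self, Int.cast_zero]
    · have hP := h.le_lenP i
      have hP0 : 0 < BEG.lenP ε (BEG.plus u) i := hc.trans_le hP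
      have h1 := h.alpha_mul_le hζ i
      have h2 := h.le_alpha_mul hζ hC hεl hj i
      rw [h.dispP_eq]
      set P0 := BEG.lenP ε (BEG.plus u) i
      have hKc : K * l ε ≤ P0 * (K / cbar * l ε) := by
        rw [div_mul_eq_mul_div, mul_div_assoc', le_div_iff₀ hc, mul_comm P0]
        exact mul_le_mul_of_nonneg_left hP (by positivity)
      have hb : 4 * ((K / cbar + 1) * l ε) < 1 := by
        rw [lt_div_iff₀ (by positivity)] at s2
        linarith
      have e1 : ε * ((16 * M0 * (8 * M0 + 1) + 8 * M0 * (32 * M0) : ℤ) : ℝ) ≤ K * l ε := by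
        push_cast
        rw [mul_comm]
        refine mul_le_mul ?_ hεl hε.le hK0.le
        rw [hK]
        exact le_add_of_nonneg_right (by positivity)
      have e2 : l ε * ((16 * M0 * (8 * M0 + 1) + (32 * M0 + 5) * (16 * M0 + 2) : ℤ) : ℝ) ≤
          K * l ε := by
        push_cast
        rw [mul_comm]
        refine mul_le_mul_of_nonneg_right ?_ hl0.le
        rw [hK]
        exact le_add_of_nonneg_left (by positivity)
      refine BEG.eq_floor_or_round (a := K / cbar * l ε) (by positivity)
        (sub_nonneg.2 (h.shape.sA_le i)) (by linarith) (by linarith) ?_ ?_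
      · rw [div_add' _ _ _ hP0.ne', le_div_iff₀ hP0]
        linarith
      · rw [div_le_iff₀ hP0]
        linarith
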